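/- Let $k$ be a field of characteristic different from $2$. Let $S$ be either the affine line $\operatorname{Spec} k[t]$, or $\operatorname{Spec}\mathcal O$ with $\mathcal O$ a discrete valuation ring essentially of finite type over $k$ and $t\in\mathcal O$ a uniformizer; let $\sigma=V(t)\subset S$. Let $f\colon X\to S$ be a flat, quasi-projective morphism with $X$ a regular scheme. Let $n\ge 0$, let $\underline a=(a_0,\dots,a_n)$ be pairwise coprime positive integers, and let $F\in k[T_0,\dots,T_n]$, with $\deg T_i=a_i$, be a nonzero weighted homogeneous polynomial of weighted degree $r\geq 1$ such that: each $a_i$ divides $r$; $r$ is prime to the exponential characteristic of $k$; with $G(y)=F(y_0^{a_0},\dots,y_n^{a_n})$, the hypersurfaces $V(G)\subset\mathbb P^n_k$ and $V(F)\subset\mathbb P_k(\underline a)=\operatorname{Proj}k[T_0,\dots,T_n]$ are smooth over $k$; and $F(v_i)\ne 0$ whenever $a_i>1$, where $v_i$ has $i$-th coordinate $1$ and all others $0$. Suppose that the special fiber $X_\sigma$ has exactly one singular (i.e. non-regular) point $o$, and that in the local ring $(\mathcal O_{X,o},m)$ $$f^*(t)=F(x_0,\dots,x_n)+h,$$ where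 $(x_0,\dots,x_n)$ is a regular sequence generating $m$, and $h\in m\cdot m_{\underline a}^{(r)}$, with $m_{\underline a}^{(r)}$ the ideal generated by the monomials in $x_0,\dots,x_n$ of $\underline a$-weighted degree $r$. Let $\kappa$ be the residue field of $o$; it is a $k$-algebra. Let $S'=S[t^{1/r}]$ with parameter $t^{1/r}$, $X_r=X\times_S S'$, and let $f_r\colon X_r\to S'$ be the base change of $f$. Then $f$ admits a semistable reduction over $S'$: there are a scheme $Y$ and a proper morphism $\pi\colon Y\to X_r$, which is an isomorphism over the locus $t^{1/r}\neq 0$, such that $g=f_r\circ\pi\colon Y\to S'$ is semistable, i.e. $Y$ is regular, $g$ is flat of finite type, and the special fiber $Y_\sigma=V(g^*t^{1/r})$ is a reduced simple normal crossing divisor in $Y$ (at each of its points it is cut out by a product of distinct members of a regular system of parameters of the local ring of $Y$). Moreover there are closed subschemes $D,D'\subset Y$ such that $Y_\sigma=D\cup D'$ (scheme-theoretically), both $D$ and $C:=D\cap D'$ are mapped by $Y\to X$ to $X$ through the closed point $\operatorname{Spec}\kappa\to X$ given by $o$, and there are isomorphisms of $\kappa$-schemes $$D\cong V_{\mathbb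 P_\kappa(\underline a,1)}\bigl(F-T_{n+1}^r\bigr),\qquad C=D\cap D'\cong V_{\mathbb P_\kappa(\underline a)}(F).$$ In particular, when $o$ is a $k$-rational point, $D\cong V_{\mathbb P(\underline a,1)}(F-T_{n+1}^r)$ and $C\cong V_{\mathbb P(\underline a)}(F)$ over $k$. -/

import Mathlib

open AlgebraicGeometry CategoryTheory CategoryTheory.Limits

universe u

noncomputable section

namespace QuasiHom

/-! ### Quotients of graded algebras -/

section Quotient

variable {R A : Type u} [CommRing R] [CommRing A] [Algebra R A]
  (𝒜 : ℕ → Submodule R A) [GradedAlgebra 𝒜] (I : Ideal A)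

/-- The grading induced on `A ⧸ I` by a grading of `A`: the images of the graded pieces. -/
def quotientGrading (i : ℕ) : Submodule R (A ⧸ I) :=
  (𝒜 i).map (Ideal.Quotient.mkₐ R I).toLinearMap

/-- The projection of `𝒜 i` onto the `i`-th graded piece of the quotient. -/
def quotientPiece (i : ℕ) : 𝒜 i →ₗ[R] quotientGrading 𝒜 I i :=
  ((Ideal.Quotient.mkₐ R I).toLinearMap.restrict
    (fun _ hx => Submodule.mem_map_of_mem hx))

instance quotientGradedMonoid : SetLike.GradedMonoid (quotientGrading 𝒜 I) where
  one_mem := ⟨1, SetLike.GradedOne.one_mem, map_one (Ideal.Quotient.mkₐ R I)⟩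
  mul_mem := by
    rintro i j _ _ ⟨x, hx, rfl⟩ ⟨y, hy, rfl⟩
    exact ⟨x * y, SetLike.GradedMul.mul_mem hx hy, map_mul (Ideal.Quotient.mkₐ R I) x y⟩

theorem quotient_isInternal (hI : I.IsHomogeneous 𝒜) :
    DirectSum.IsInternal (quotientGrading 𝒜 I) := by
  classical
  have hcomm : ∀ z : DirectSum ℕ (fun i => 𝒜 i),
      DirectSum.coeLinearMap (quotientGrading 𝒜 I)
        (DirectSum.lmap (quotientPiece 𝒜 I) z) =
      Ideal.Quotient.mk I (DirectSum.coeLinearMap 𝒜 z) := by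
    intro z
    induction z using DirectSum.induction_on with
    | zero => simp
    | of i x =>
      have h1 : DirectSum.of (fun i => 𝒜 i) i x = DirectSum.lof R ℕ (fun i => 𝒜 i) i x := rfl
      rw [h1, DirectSum.lmap_lof, DirectSum.coeLinearMap_lof, DirectSum.coeLinearMap_lof]
      rfl
    | add x y hx hy => simp only [map_add, hx, hy]
  have hsurj : Function.Surjective
      (DirectSum.lmap (quotientPiece 𝒜 I)) := by
    intro w
    induction w using DirectSum.induction_on with
    | zero => exact ⟨0, map_zero _⟩
    | of i x =>
      obtain ⟨_, ⟨y, hy, rfl⟩⟩ := x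
      refine ⟨DirectSum.lof R ℕ (fun i => 𝒜 i) i ⟨y, hy⟩, ?_⟩
      rw [DirectSum.lmap_lof]
      rfl
    | add x y hx hy =>
      obtain ⟨x', rfl⟩ := hx
      obtain ⟨y', rfl⟩ := hy
      exact ⟨x' + y', map_add _ _ _⟩
  constructor
  · rw [injective_iff_map_eq_zero]
    intro w hw
    obtain ⟨z, rfl⟩ := hsurj w
    have h0 : DirectSum.coeLinearMap 𝒜 z ∈ I := by
      rw [← Ideal.Quotient.eq_zero_iff_mem, ← hcomm]
      exact hw
    ext i
    have h1 := hI i h0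
    have h2 : DirectSum.decompose 𝒜 (DirectSum.coeLinearMap 𝒜 z) = z :=
      (DirectSum.decompose 𝒜).apply_symm_apply z
    rw [h2] at h1
    rw [DirectSum.lmap_apply]
    exact Ideal.Quotient.eq_zero_iff_mem.mpr h1
  · intro x
    obtain ⟨y, rfl⟩ := Ideal.Quotient.mk_surjective x
    refine ⟨DirectSum.lmap (quotientPiece 𝒜 I) (DirectSum.decompose 𝒜 y), ?_⟩
    have h3 : DirectSum.coeLinearMap 𝒜 (DirectSum.decompose 𝒜 y) = y :=
      (DirectSum.decompose 𝒜).symm_apply_apply y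
    exact (hcomm _).trans (by rw [h3])

/-- The quotient of a graded algebra by a homogeneous ideal is a graded algebra. -/
@[reducible]
def quotientGradedAlgebra (hI : I.IsHomogeneous 𝒜) : GradedAlgebra (quotientGrading 𝒜 I) where
  toDecomposition := (quotient_isInternal 𝒜 I hI).chooseDecomposition
  toGradedMonoid := quotientGradedMonoid 𝒜 I

end Quotient

/-! ### Weighted projective spaces and their hypersurfaces -/

section Weighted

open MvPolynomial

attribute [local instance] MvPolynomial.weightedGradedAlgebra

variable (K : Type u) [CommRing K] {m : ℕ} (w : Fin m → ℕ)

/-- `Proj` of an `ℕ`-graded `K`-algebra, as a scheme over `Spec K`: the structure morphism. -/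
def projToSpec {A : Type u} [CommRing A] [Algebra K A] (𝒜 : ℕ → Submodule K A)
    [GradedAlgebra 𝒜] : Proj 𝒜 ⟶ Spec (.of K) :=
  Proj.toSpecZero 𝒜 ≫ Spec.map (CommRingCat.ofHom (algebraMap K (𝒜 0)))

/-- The weighted projective space `ℙ(w) = Proj K[T_i]` with `T_i` in degree `w i`. -/
def WeightedProj : Scheme.{u} := Proj (weightedHomogeneousSubmodule K w)

/-- The structure morphism of the weighted projective space. -/
def WeightedProj.toSpec : WeightedProj K w ⟶ Spec (.of K) :=
  projToSpec K (weightedHomogeneousSubmodule K w)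

variable {K w} {d : ℕ}

theorem isHomogeneous_span {F : MvPolynomial (Fin m) K} (hF : IsWeightedHomogeneous w F d) :
    (Ideal.span {F}).IsHomogeneous (weightedHomogeneousSubmodule K w) :=
  Ideal.homogeneous_span _ _ (by rintro x rfl; exact ⟨d, hF⟩)

/-- The hypersurface `V(F) = Proj (K[T_i] / (F))` in the weighted projective space `ℙ(w)` over
`K`, for a weighted homogeneous polynomial `F`. -/
def Hypersurface {F : MvPolynomial (Fin m) K} (hF : IsWeightedHomogeneous w F d) : Scheme.{u} :=
  letI := quotientGradedAlgebra (weightedHomogeneousSubmodule K w) _ (isHomogeneous_span hF)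
  Proj (quotientGrading (weightedHomogeneousSubmodule K w) (Ideal.span {F}))

/-- The structure morphism of a hypersurface in weighted projective space. -/
def Hypersurface.toSpec {F : MvPolynomial (Fin m) K} (hF : IsWeightedHomogeneous w F d) :
    Hypersurface hF ⟶ Spec (.of K) :=
  letI := quotientGradedAlgebra (weightedHomogeneousSubmodule K w) _ (isHomogeneous_span hF)
  projToSpec K (quotientGrading (weightedHomogeneousSubmodule K w) (Ideal.span {F}))

theorem isWeightedHomogeneous_map {L : Type u} [CommRing L] (φ : K →+* L)
    {F : MvPolynomial (Fin m) K} (hF : IsWeightedHomogeneous w F d) :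
    IsWeightedHomogeneous w (map φ F) d := by
  intro b hb
  refine hF (fun h => hb ?_)
  rw [coeff_map, h, map_zero]

/-- The polynomial `G(y) = F(y_0^{w_0}, …, y_n^{w_n})`. -/
def unweight (w : Fin m → ℕ) (F : MvPolynomial (Fin m) K) : MvPolynomial (Fin m) K :=
  aeval (fun i => X i ^ w i) F

theorem isHomogeneous_unweight {F : MvPolynomial (Fin m) K}
    (hF : IsWeightedHomogeneous w F d) :
    IsWeightedHomogeneous (1 : Fin m → ℕ) (unweight w F) d := by
  classical
  rw [unweight, aeval_def, eval₂_eq]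
  refine IsWeightedHomogeneous.sum _ _ _ fun b hb => ?_
  refine IsWeightedHomogeneous.C_mul ?_ _
  have h := IsWeightedHomogeneous.prod (R := K) (w := (1 : Fin m → ℕ)) b.support
    (fun i => (X i ^ w i) ^ b i) (fun i => b i • (w i • (1 : Fin m → ℕ) i))
    (fun i _ => ((isWeightedHomogeneous_X K _ i).pow _).pow _)
  have hd : ∑ i ∈ b.support, b i • (w i • (1 : Fin m → ℕ) i) = d := by
    rw [← hF (mem_support_iff.mp hb), Finsupp.weight_apply, Finsupp.sum]
    simp
  rwa [hd] at h

/-- The polynomial `F - T_{n+1}^d` in one variable more. -/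
def suspend (d : ℕ) (F : MvPolynomial (Fin m) K) : MvPolynomial (Fin (m + 1)) K :=
  rename Fin.castSucc F - X (Fin.last m) ^ d

/-- `F - T_{n+1}^d` is homogeneous of degree `d` for the weights `(w, 1)`. -/
theorem isWeightedHomogeneous_suspend {F : MvPolynomial (Fin m) K}
    (hF : IsWeightedHomogeneous w F d) :
    IsWeightedHomogeneous (Fin.snoc w 1 : Fin (m + 1) → ℕ) (suspend d F) d := by
  refine IsWeightedHomogeneous.sub ?_ ?_
  · intro b hb
    obtain ⟨c, rfl, hc⟩ := coeff_rename_ne_zero _ _ _ hb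
    rw [← hF hc, Finsupp.weight_apply, Finsupp.weight_apply,
      Finsupp.sum_mapDomain_index (by simp) (by intros; simp [add_mul])]
    simp
  · simpa using (isWeightedHomogeneous_X K (Fin.snoc w 1 : Fin (m + 1) → ℕ) (Fin.last m)).pow d

end Weighted

/-! ### Families over the affine line or a trait -/

/-- `(R, t)` is the coordinate ring with parameter of a base `S` over `k`: either the affine line
`Spec k[t]`, or a trait, the spectrum of a discrete valuation ring essentially of finite type
over `k` with a uniformizer `t`. -/
def IsParameterRing (k R : Type u) [Field k] [CommRing R] [Algebra k R] (t : R) : Prop :=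
  (∃ e : R ≃ₐ[k] Polynomial k, e t = Polynomial.X) ∨
  (∃ _ : IsDomain R, IsDiscreteValuationRing R ∧ Algebra.EssFiniteType k R ∧ Irreducible t)

/-- A scheme is regular if all its local rings are regular. -/
def IsRegularScheme (X : Scheme.{u}) : Prop :=
  ∀ x : X, IsRegularLocalRing (X.presheaf.stalk x)

/-- A sequence generating the maximal ideal of a local ring and regular on it. -/
def IsRegularParameters {A : Type u} [CommRing A] [IsLocalRing A] {d : ℕ} (x : Fin d → A) : Prop :=
  Ideal.span (Set.range x) = IsLocalRing.maximalIdeal A ∧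
  RingTheory.Sequence.IsRegular A (List.ofFn x)

section Family

variable {R : Type u} [CommRing R] {X : Scheme.{u}} (f : X ⟶ Spec (.of R))

/-- The standing assumption on a family: a flat morphism of finite type with regular source. -/
structure IsRegularFamily : Prop where
  regular : IsRegularScheme X
  flat : Flat f
  locallyOfFiniteType : LocallyOfFiniteType f
  quasiCompact : QuasiCompact f

/-- `f : X ⟶ Spec R` is quasi-projective: `X` is a locally closed subscheme of some `ℙ^N_R`. -/
def IsQuasiProjective : Prop :=
  ∃ (N : ℕ) (i : X ⟶ WeightedProj R (1 : Fin (N + 1) → ℕ)),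
    IsImmersion i ∧ i ≫ WeightedProj.toSpec R (1 : Fin (N + 1) → ℕ) = f

/-- The pullback `f^*` of functions on the base into the local ring of `X` at `x`. -/
def pullbackGerm (x : X) : R →+* X.presheaf.stalk x :=
  (X.presheaf.germ ⊤ x trivial).hom.comp
    (f.appTop.hom.comp (Scheme.ΓSpecIso (.of R)).inv.hom)

/-- The closed point or origin `σ = V(t)` of the base. -/
def closedPointι (t : R) : Spec (.of (R ⧸ Ideal.span {t})) ⟶ Spec (.of R) :=
  Spec.map (CommRingCat.ofHom (Ideal.Quotient.mk (Ideal.span {t})))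

/-- The special fibre `X_σ`. -/
def specialFiber (t : R) : Scheme.{u} := pullback f (closedPointι t)

/-- The inclusion `X_σ ⟶ X`. -/
def specialFiberι (t : R) : specialFiber f t ⟶ X := pullback.fst f (closedPointι t)

/-- `f` is semistable: a regular family whose special fibre is a (reduced) simple normal crossing
divisor, that is, at each of its points `y` some regular system of parameters `x` of the local
ring of `X` is such that the special fibre is cut out there by a product of distinct `x j`. -/
structure IsSemistable (t : R) : Prop where
  family : IsRegularFamily f
  snc : ∀ y : X, pullbackGerm f y t ∈ IsLocalRing.maximalIdeal (X.presheaf.stalk y) →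
    ∃ (d : ℕ) (x : Fin d → X.presheaf.stalk y) (J : Finset (Fin d)),
      IsRegularParameters x ∧
      Ideal.span {pullbackGerm f y t} = Ideal.span {∏ j ∈ J, x j}

/-- The ring `R[t^{1/r}]`. -/
abbrev RootRing (t : R) (r : ℕ) : Type u :=
  AdjoinRoot (Polynomial.X ^ r - Polynomial.C t : Polynomial R)

/-- The parameter `t^{1/r}` of `R[t^{1/r}]`. -/
abbrev rootParam (t : R) (r : ℕ) : RootRing t r := AdjoinRoot.root _

/-- The base change `S' = S[t^{1/r}] ⟶ S`. -/
def rootCover (t : R) (r : ℕ) : Spec (.of (RootRing t r)) ⟶ Spec (.of R) :=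
  Spec.map (CommRingCat.ofHom (AdjoinRoot.of _))

/-- `X_r = X ×_S S'`. -/
def rootFamily (t : R) (r : ℕ) : Scheme.{u} := pullback f (rootCover t r)

/-- The projection `X_r ⟶ X`. -/
def rootFamilyToSource (t : R) (r : ℕ) : rootFamily f t r ⟶ X := pullback.fst f (rootCover t r)

/-- The `r`-th power base change `f_r : X_r ⟶ S'`. -/
def rootFamilyMap (t : R) (r : ℕ) : rootFamily f t r ⟶ Spec (.of (RootRing t r)) :=
  pullback.snd f (rootCover t r)

/-- `π : Y ⟶ X_r` exhibits `g = f_r ∘ π` as a semistable reduction of `f`: `π` is proper, an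
isomorphism over the generic fibre (the locus `t^{1/r} ≠ 0`), and `g` is semistable. -/
structure IsSemistableReduction (t : R) (r : ℕ) {Y : Scheme.{u}} (π : Y ⟶ rootFamily f t r) :
    Prop where
  proper : IsProper π
  isIso_generic : IsIso (π ∣_ (rootFamilyMap f t r ⁻¹ᵁ
    (PrimeSpectrum.basicOpen (rootParam t r) : (Spec (.of (RootRing t r))).Opens)))
  semistable : IsSemistable (π ≫ rootFamilyMap f t r) (rootParam t r)

end Family

/-! ### Quasi-homogeneous singularities -/

section Singularity

open MvPolynomial

variable {k : Type u} [Field k] {n : ℕ}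

/-- The conditions on an `a`-weighted homogeneous polynomial `F` of degree `r` that is allowed to
define a quasi-homogeneous singularity. -/
structure IsAdmissiblePolynomial (a : Fin (n + 1) → ℕ) (r : ℕ)
    (F : MvPolynomial (Fin (n + 1)) k) : Prop where
  homogeneous : IsWeightedHomogeneous a F r
  ne_zero : F ≠ 0
  weight_pos : ∀ i, 0 < a i
  degree_pos : 0 < r
  coprime : Pairwise fun i j => Nat.Coprime (a i) (a j)
  dvd : ∀ i, a i ∣ r
  coprime_char : Nat.Coprime r (ringExpChar k)
  smooth_unweight : Smooth (Hypersurface.toSpec (isHomogeneous_unweight homogeneous))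
  smooth : Smooth (Hypersurface.toSpec homogeneous)
  vertex : ∀ i, 1 < a i → eval (Pi.single i 1) F ≠ 0

/-- The ideal `m_a^{(r)}` generated by the monomials of `a`-weighted degree `r` in `x`. -/
def weightedIdeal {A : Type u} [CommRing A] (a : Fin (n + 1) → ℕ) (r : ℕ) (x : Fin (n + 1) → A) :
    Ideal A :=
  Ideal.span {y | ∃ b : Fin (n + 1) → ℕ, ∑ i, a i * b i = r ∧ y = ∏ i, x i ^ b i}

variable {R : Type u} [CommRing R] [Algebra k R] {X : Scheme.{u}} (f : X ⟶ Spec (.of R))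

/-- A point of a scheme is singular if the local ring there is not regular. -/
def IsSingularPoint {Z : Scheme.{u}} (z : Z) : Prop :=
  ¬ IsRegularLocalRing (Z.presheaf.stalk z)

/-- The `k`-algebra structure of the local ring of `X` at `x`. -/
def stalkStructure (k : Type u) [Field k] [Algebra k R] (x : X) : k →+* X.presheaf.stalk x :=
  (pullbackGerm f x).comp (algebraMap k R)

/-- The `k`-algebra structure of the residue field of `X` at `x`. -/
def residueStructure (k : Type u) [Field k] [Algebra k R] (x : X) : k →+* X.residueField x :=
  (X.residue x).hom.comp (stalkStructure f k x)

/-- The point `o` of the special fibre is an `a`-weighted homogeneous singularity defined by `F`,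
of weighted degree `r`: it is a singular point of `X_σ`, and in the local ring of `X` one has
`f^*(t) = F(x) + h` with `x` a regular sequence generating the maximal ideal `m`, and `h` in
`m * m_a^{(r)}`. -/
structure IsQuasiHomogeneousSingularity (t : R) (a : Fin (n + 1) → ℕ) (r : ℕ)
    (F : MvPolynomial (Fin (n + 1)) k) (o : specialFiber f t) : Prop where
  admissible : IsAdmissiblePolynomial a r F
  singular : IsSingularPoint o
  equation : ∃ (x : Fin (n + 1) → X.presheaf.stalk (specialFiberι f t o))
    (h : X.presheaf.stalk (specialFiberι f t o)),
    IsRegularParameters x ∧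
    h ∈ IsLocalRing.maximalIdeal (X.presheaf.stalk (specialFiberι f t o)) *
      weightedIdeal a r x ∧
    pullbackGerm f (specialFiberι f t o) t =
      eval₂ (stalkStructure f k (specialFiberι f t o)) x F + h

end Singularity

end QuasiHom

end

noncomputable section

namespace QuasiHom

/-! ### Regular local rings -/

section RegularLocal

open IsLocalRing

/-! Let `A` be the coordinate ring of a small affine neighbourhood of `o`. The error term `h` can be
absorbed into coefficients, so that `t = Φ(y)` with `y` generating the ideal of `o` and `Φ` weighted
homogeneous of degree `r` over `A`, reducing to `F` over `κ`. Over this neighbourhood `X_r` is the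
spectrum of `A' = A[τ] / (τ ^ r - Φ(y))`, and `Y` is its weighted blowup at `(y, τ)` with weights
`(a, 1)`: the `Proj` of the Rees algebra `⨁ I_j u ^ j`, where `I_j` consists of the values at `(y,
τ)` of polynomials of weighted order at least `j`. Off the centre the blowup is an isomorphism, so
it glues to `X_r` minus the fibre over `o`.

The associated graded ring of this filtration is `κ[T_0, …, T_{n+1}] / (F - T_{n+1} ^ r)`
(`isInitialSystem_suspend`, `IsInitialSystem.initialForm_eq_zero_iff`). The reason is weighted
quasi-regularity: the monomials in a regular sequence are independent, weighted degree by weighted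
degree, modulo the ideal of the sequence. Hence the exceptional divisor `D` is the hypersurface `F =
T_{n+1} ^ r`, and the initial form `T_{n+1}` of `τ` cuts it in `C = V(F)`.

Weighted blowups tend to have cyclic quotient singularities. None occur here because every point of
`D` lies in a chart `D_+(uv)` with `u`, `v` homogeneous of degrees `e + 1` and `e`. Where `T_{n+1} ≠
0` one takes `u = τ`, `v = 1`. Where `T_{n+1} = 0`, the vertex condition provides either a nonzero
coordinate of weight one or two nonzero coordinates of coprime weights, and suitable powers of these
serve (`IsInitialSystem.exists_pow_notMem`). On such a chart `s = u² / (uv)` defines `D`, `T = τv² /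
(uv)` defines the strict transform of `τ = 0`, and `s * T = τ`.

The quotient by `s`, respectively by `s, T`, is a chart of `D`, respectively of `C`. The first is
regular where `T_{n+1} ≠ 0` by the Euler relation, since `r ≠ 0` in `κ` (`exists_mul_mem_suspend`);
the second is regular by smoothness of `V(F)` over `k` (`exists_mul_mem_of_formallySmooth`). Since
`s, T` is a regular sequence, regularity lifts to `Y`, and `s, T` belong to a regular system of
parameters. This is normal crossing along `D`.

Away from `o`, the divisor `τ = 0` of `X_r` is `X_σ`, which is regular there, and where `τ` is
invertible `X_r` is flat and unramified over the regular scheme `X`. Finally `D'` is the residual of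
`D` in the special fibre, an ideal quotient; on the charts it is `(T)`, so that `D ∩ D' = C`
(`exists_semistable_of_glued`). -/

theorem spanFinrank_quotient_add_one_le {A : Type*} [CommRing A] [IsLocalRing A]
    [IsNoetherianRing A] {f : A} (hf : f ∈ maximalIdeal A) (hf2 : f ∉ maximalIdeal A ^ 2)
    [IsLocalRing (A ⧸ Ideal.span {f})] :
    (maximalIdeal (A ⧸ Ideal.span {f})).spanFinrank + 1 ≤ (maximalIdeal A).spanFinrank := by
  classical
  obtain ⟨S, hcard, hS⟩ := Submodule.FG.exists_span_finset_card_eq_spanFinrank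
    (maximalIdeal A).fg_of_isNoetherianRing
  have hfS : f ∈ Submodule.span A (S : Set A) := hS ▸ hf
  obtain ⟨c, hc⟩ := Submodule.mem_span_finset'.mp hfS
  have hSm : ∀ s : S, (s : A) ∈ maximalIdeal A := fun s => by
    rw [← hS]
    exact Submodule.subset_span s.2
  -- As `f` is not in the square of the maximal ideal, one of its coefficients on the minimal
  -- generating set `S` is a unit; that generator becomes redundant modulo `f`.
  obtain ⟨s, hs⟩ : ∃ s : S, c s ∉ maximalIdeal A := by
    by_contra! h
    refine hf2 (hc ▸ Ideal.sum_mem _ fun s _ => ?_)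
    rw [pow_two, smul_eq_mul]
    exact Ideal.mul_mem_mul (h s) (hSm s)
  have hu : IsUnit (c s) := by simpa using hs
  have hmax : maximalIdeal (A ⧸ Ideal.span {f}) =
      (maximalIdeal A).map (Ideal.Quotient.mk (Ideal.span {f})) :=
    (map_maximalIdeal_of_surjective _ Ideal.Quotient.mk_surjective).symm
  have hspan : maximalIdeal (A ⧸ Ideal.span {f}) =
      Ideal.span (((S.erase s.1).image (Ideal.Quotient.mk (Ideal.span {f})) : Finset _) :
        Set (A ⧸ Ideal.span {f})) := by
    rw [hmax, ← hS]
    change Ideal.map _ (Ideal.span _) = _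
    rw [Ideal.map_span]
    refine le_antisymm (Ideal.span_le.mpr ?_) (Ideal.span_mono ?_)
    · rintro _ ⟨x, hx, rfl⟩
      by_cases hxs : x = s.1
      · have h0 : Ideal.Quotient.mk (Ideal.span {f}) (∑ a, c a • (a : A)) = 0 :=
          Ideal.Quotient.eq_zero_iff_mem.mpr (hc ▸ Ideal.mem_span_singleton_self f)
        rw [map_sum, ← Finset.add_sum_erase _ _ (Finset.mem_univ s), add_eq_zero_iff_eq_neg,
          smul_eq_mul, map_mul] at h0
        have hu' := hu.map (Ideal.Quotient.mk (Ideal.span {f}))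
        subst hxs
        rw [SetLike.mem_coe, ← Ideal.unit_mul_mem_iff_mem _ hu', h0]
        refine neg_mem (Ideal.sum_mem _ fun y hy => ?_)
        rw [smul_eq_mul, map_mul]
        refine Ideal.mul_mem_left _ _ (Ideal.subset_span ?_)
        refine Finset.mem_coe.mpr (Finset.mem_image_of_mem _ (Finset.mem_erase.mpr ⟨?_, y.2⟩))
        exact fun h => (Finset.mem_erase.mp hy).1 (Subtype.ext h)
      · exact Ideal.subset_span (Finset.mem_coe.mpr
          (Finset.mem_image_of_mem _ (Finset.mem_erase.mpr ⟨hxs, hx⟩)))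
    · rw [Finset.coe_image]
      exact Set.image_mono (Finset.coe_subset.mpr (Finset.erase_subset _ _))
  have h1 : (maximalIdeal (A ⧸ Ideal.span {f})).spanFinrank ≤ (S.erase s.1).card := by
    rw [hspan]
    refine (Submodule.spanFinrank_span_le_ncard_of_finite (Finset.finite_toSet _)).trans ?_
    rw [Set.ncard_coe_finset]
    exact Finset.card_image_le
  have h2 := Finset.card_erase_add_one s.2
  omega

theorem isLocalRing_quotient_span_singleton_of_mem {A : Type*} [CommRing A] [IsLocalRing A]
    {f : A} (hf : f ∈ maximalIdeal A) : IsLocalRing (A ⧸ Ideal.span {f}) := by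
  have : Nontrivial (A ⧸ Ideal.span {f}) := Ideal.Quotient.nontrivial_iff.mpr fun h => by
    rw [Ideal.span_singleton_eq_top] at h
    exact hf h
  exact IsLocalRing.of_surjective' _ Ideal.Quotient.mk_surjective

/-- The embedding dimension drops by at least one and the Krull dimension by at most one, so the
inequality between them that characterizes regularity is inherited. -/
theorem isRegularLocalRing_quotient {A : Type*} [CommRing A] [IsRegularLocalRing A] {f : A}
    (hf : f ∈ maximalIdeal A) (hf2 : f ∉ maximalIdeal A ^ 2) :
    IsRegularLocalRing (A ⧸ Ideal.span {f}) := by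
  have := isLocalRing_quotient_span_singleton_of_mem hf
  refine IsRegularLocalRing.of_spanFinrank_maximalIdeal_le _ ?_
  have h1 := spanFinrank_quotient_add_one_le hf hf2
  have h2 := ringKrullDim_le_ringKrullDim_quotient_add_card ({f} : Finset A)
    (by simpa [ringJacobson_eq_maximalIdeal A] using hf)
  rw [← IsRegularLocalRing.spanFinrank_maximalIdeal] at h2
  rw [Finset.coe_singleton, Finset.card_singleton] at h2
  have h3 : (((maximalIdeal (A ⧸ Ideal.span {f})).spanFinrank + 1 : ℕ) : WithBot ℕ∞) ≤
      ringKrullDim (A ⧸ Ideal.span {f}) + (1 : ℕ) := le_trans (by exact_mod_cast h1) h2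
  rw [Nat.cast_add] at h3
  exact ENat.WithBot.add_le_add_natCast_right_iff.mp h3

/-- Induction on the embedding dimension. Prime avoidance gives `x` in the maximal ideal, outside
its square and outside all minimal primes. By induction `(x)` is prime, and it contains a minimal
prime `p`; as `x ∉ p`, one has `p = x p`, so `p = 0` by Nakayama. -/
theorem isDomain_of_isRegularLocalRing {A : Type*} [CommRing A] [IsRegularLocalRing A] :
    IsDomain A := by
  classical
  obtain ⟨n, hn⟩ : ∃ n, (maximalIdeal A).spanFinrank = n := ⟨_, rfl⟩
  induction n using Nat.strong_induction_on generalizing A with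
  | _ n ih =>
  by_cases h0 : maximalIdeal A = ⊥
  · have : IsField A := isField_iff_maximalIdeal_eq.mpr h0
    exact this.isDomain
  have hfg := (maximalIdeal A).fg_of_isNoetherianRing
  obtain ⟨x, hx, hx2⟩ : ∃ x ∈ maximalIdeal A, x ∉ (maximalIdeal A ^ 2 : Ideal A) ∧
      ∀ p ∈ minimalPrimes A, x ∉ p := by
    by_contra! h
    have hfin : (minimalPrimes A).Finite := minimalPrimes.finite_of_isNoetherianRing A
    have hsub : ((maximalIdeal A : Ideal A) : Set A) ⊆
        ⋃ i ∈ (↑(insert (maximalIdeal A ^ 2) hfin.toFinset) : Set (Ideal A)),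
          ((id i : Ideal A) : Set A) := by
      intro x hx
      by_cases hx2 : x ∈ (maximalIdeal A ^ 2 : Ideal A)
      · exact Set.mem_biUnion (by simp) hx2
      · obtain ⟨p, hp, hxp⟩ := h x hx hx2
        exact Set.mem_biUnion (by simpa using Or.inr hp) hxp
    -- Prime avoidance tolerates two ideals that are not prime; both places are taken by the square
    -- of the maximal ideal.
    rw [Ideal.subset_union_prime (maximalIdeal A ^ 2) (maximalIdeal A ^ 2) (fun i hi hi2 _ => by
      have : i ∈ minimalPrimes A := by simpa [hi2] using hi
      exact this.1.1)] at hsub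
    have hsq : ¬ maximalIdeal A ≤ maximalIdeal A ^ 2 := fun hle => h0
      (Submodule.eq_bot_of_le_smul_of_le_jacobson_bot (maximalIdeal A) _ hfg
        (by rwa [smul_eq_mul, ← pow_two]) (by rw [jacobson_eq_maximalIdeal _ bot_ne_top]))
    obtain ⟨p, hp, hle⟩ := hsub
    rcases Finset.mem_insert.mp hp with rfl | hp
    · exact hsq hle
    · have hp' : p ∈ minimalPrimes A := by simpa using hp
      have hpm : p = maximalIdeal A := le_antisymm (le_maximalIdeal hp'.1.1.ne_top) hle
      have hh : (maximalIdeal A).height = 0 := by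
        rw [← hpm]
        have := hp'.1.1
        exact Ideal.height_eq_zero_iff.mpr hp'
      have hd := IsRegularLocalRing.spanFinrank_maximalIdeal (R := A)
      rw [← maximalIdeal_height_eq_ringKrullDim, hh] at hd
      have hd' : (maximalIdeal A).spanFinrank = 0 := by exact_mod_cast hd
      exact h0 ((Submodule.spanFinrank_eq_zero_iff_eq_bot hfg).mp hd')
  have := isRegularLocalRing_quotient hx hx2.1
  have hdom : IsDomain (A ⧸ Ideal.span {x}) :=
    ih _ (by have := spanFinrank_quotient_add_one_le hx hx2.1; omega) rfl
  have hprime : (Ideal.span {x}).IsPrime := (Ideal.Quotient.isDomain_iff_prime _).mp hdom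
  obtain ⟨p, hp, hpx⟩ := Ideal.exists_minimalPrimes_le (bot_le : (⊥ : Ideal A) ≤ Ideal.span {x})
  have hpp : p.IsPrime := hp.1.1
  have hxp : x ∉ p := hx2.2 p hp
  have hle : p ≤ maximalIdeal A • p := by
    intro y hy
    obtain ⟨a, rfl⟩ := Ideal.mem_span_singleton'.mp (hpx hy)
    rw [smul_eq_mul, mul_comm a x]
    exact Ideal.mul_mem_mul hx ((hpp.mem_or_mem hy).resolve_right hxp)
  have hbot : p = ⊥ := Submodule.eq_bot_of_le_smul_of_le_jacobson_bot (maximalIdeal A) _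
    p.fg_of_isNoetherianRing hle (by rw [jacobson_eq_maximalIdeal _ bot_ne_top])
  have : (⊥ : Ideal A).IsPrime := hbot ▸ hpp
  exact IsDomain.of_bot_isPrime A

end RegularLocal

/-! ### Regular systems of parameters and criteria for regularity -/

section RegularLocalParameters

open IsLocalRing

open scoped Pointwise in
theorem isRegular_cons_iff_quotient {A : Type u} [CommRing A] (f : A) (l : List A) :
    RingTheory.Sequence.IsRegular A (f :: l) ↔ IsSMulRegular A f ∧
      RingTheory.Sequence.IsRegular (A ⧸ Ideal.span {f})
        (l.map (Ideal.Quotient.mk (Ideal.span {f}))) := by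
  rw [RingTheory.Sequence.isRegular_cons_iff']
  refine and_congr_right' ?_
  have h : (f • ⊤ : Submodule A A) = Ideal.span {f} := by
    rw [← Submodule.ideal_span_singleton_smul]
    simp
  let e : QuotSMulTop f A ≃+ A ⧸ Ideal.span {f} := (Submodule.quotEquivOfEq _ _ h).toAddEquiv
  refine AddEquiv.isRegular_congr (e := e) ?_
  rw [List.forall₂_same]
  intro r _ x
  obtain ⟨r, rfl⟩ := Ideal.Quotient.mk_surjective r
  exact (Submodule.quotEquivOfEq _ _ h).map_smul r x

/-- Allows regular systems of parameters to be built one element at a time, by lifting them from the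
quotient by a regular element. -/
theorem IsRegularParameters.cons {A : Type u} [CommRing A] [IsLocalRing A] {f : A}
    [IsLocalRing (A ⧸ Ideal.span {f})] (hf : IsSMulRegular A f) {d : ℕ} {z : Fin d → A}
    (hz : IsRegularParameters fun i => Ideal.Quotient.mk (Ideal.span {f}) (z i)) :
    IsRegularParameters (Fin.cons f z : Fin (d + 1) → A) := by
  have hmax : (maximalIdeal (A ⧸ Ideal.span {f})).comap (Ideal.Quotient.mk (Ideal.span {f})) =
      maximalIdeal A :=
    eq_maximalIdeal (Ideal.comap_isMaximal_of_surjective _ Ideal.Quotient.mk_surjective)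
  constructor
  · rw [← hmax, ← hz.1, Fin.range_cons, Set.range_comp' (Ideal.Quotient.mk (Ideal.span {f})),
      ← Ideal.map_span, Ideal.comap_map_of_surjective _ Ideal.Quotient.mk_surjective,
      ← RingHom.ker_eq_comap_bot, Ideal.mk_ker, Ideal.span_insert, sup_comm]
  · rw [List.ofFn_succ, isRegular_cons_iff_quotient]
    refine ⟨by simpa using hf, ?_⟩
    simp only [Fin.cons_succ, List.map_ofFn]
    exact hz.2

theorem IsRegularParameters.of_ringEquiv {A B : Type u} [CommRing A] [IsLocalRing A] [CommRing B]
    [IsLocalRing B] (e : A ≃+* B) {d : ℕ} {x : Fin d → A} (hx : IsRegularParameters x) :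
    IsRegularParameters fun i => e (x i) := by
  constructor
  · rw [← map_ringEquiv_maximalIdeal e, ← hx.1, Ideal.map_span, ← Set.range_comp']
  · refine (AddEquiv.isRegular_congr (e := e.toAddEquiv) ?_).mp hx.2
    rw [List.ofFn_comp' x e, List.forall₂_map_right_iff, List.forall₂_same]
    intro r _ x
    exact map_mul e r x

/-- A regular sequence of length `d` forces the dimension to be at least `d`, while `d` generators
bound the embedding dimension by `d`. -/
theorem IsRegularParameters.isRegularLocalRing {A : Type u} [CommRing A] [IsLocalRing A]
    [IsNoetherianRing A] {d : ℕ} {x : Fin d → A} (hx : IsRegularParameters x) :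
    IsRegularLocalRing A := by
  classical
  refine IsRegularLocalRing.of_spanFinrank_maximalIdeal_le _ ?_
  rw [← ringKrullDim_add_length_eq_ringKrullDim_of_isRegular _ hx.2, List.length_ofFn]
  have h1 : (maximalIdeal A).spanFinrank ≤ d := by
    rw [← hx.1]
    refine (Submodule.spanFinrank_span_le_ncard_of_finite (Set.finite_range _)).trans ?_
    simpa using Set.ncard_image_le (f := x) (Set.finite_univ)
  have h2 : (0 : WithBot ℕ∞) ≤ ringKrullDim (A ⧸ Ideal.ofList (List.ofFn x)) := by
    have : Nontrivial (A ⧸ Ideal.ofList (List.ofFn x)) := by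
      refine Ideal.Quotient.nontrivial_iff.mpr ?_
      have h3 := hx.2.top_ne_smul
      rw [smul_eq_mul, Ideal.mul_top] at h3
      exact h3.symm
    exact ringKrullDim_nonneg_of_nontrivial
  calc (((maximalIdeal A).spanFinrank : ℕ) : WithBot ℕ∞) ≤ (d : ℕ) := by exact_mod_cast h1
    _ = 0 + (d : ℕ) := (zero_add _).symm
    _ ≤ _ := by gcongr

theorem isSMulRegular_of_ne_zero {A : Type*} [CommRing A] [IsDomain A] {f : A} (hf : f ≠ 0) :
    IsSMulRegular A f := fun _ _ h => mul_left_cancel₀ hf h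

theorem exists_isRegularParameters (A : Type u) [CommRing A] [IsRegularLocalRing A] :
    ∃ (d : ℕ) (x : Fin d → A), IsRegularParameters x := by
  obtain ⟨n, hn⟩ : ∃ n, (maximalIdeal A).spanFinrank = n := ⟨_, rfl⟩
  induction n using Nat.strong_induction_on generalizing A with
  | _ n ih =>
  have hfg := (maximalIdeal A).fg_of_isNoetherianRing
  by_cases h0 : maximalIdeal A = ⊥
  · refine ⟨0, Fin.elim0, ?_, ?_⟩
    · rw [h0, Set.range_eq_empty, Ideal.span_empty]
    · exact RingTheory.Sequence.IsRegular.nil A A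
  obtain ⟨x, hx, hx2⟩ : ∃ x ∈ maximalIdeal A, x ∉ maximalIdeal A ^ 2 := by
    by_contra! hle
    exact h0 (Submodule.eq_bot_of_le_smul_of_le_jacobson_bot (maximalIdeal A) _ hfg
        (by rwa [smul_eq_mul, ← pow_two]) (by rw [jacobson_eq_maximalIdeal _ bot_ne_top]))
  have := isDomain_of_isRegularLocalRing (A := A)
  have := isRegularLocalRing_quotient hx hx2
  obtain ⟨d, z, hz⟩ := ih _ (by have := spanFinrank_quotient_add_one_le hx hx2; omega)
    (A ⧸ Ideal.span {x}) rfl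
  choose y hy using fun i => Ideal.Quotient.mk_surjective (z i)
  refine ⟨d + 1, Fin.cons x y, IsRegularParameters.cons
    (isSMulRegular_of_ne_zero fun h => hx2 (by rw [h]; exact zero_mem _)) ?_⟩
  simpa only [hy] using hz

/-- Regularity of `A` is not assumed: for noetherian `A` it follows from the conclusion. This is how
regularity is lifted from a divisor to the ambient scheme. -/
theorem exists_isRegularParameters_cons {A : Type u} [CommRing A] [IsLocalRing A] {f : A}
    (hf : IsSMulRegular A f) [h : IsRegularLocalRing (A ⧸ Ideal.span {f})] :
    ∃ (d : ℕ) (x : Fin (d + 1) → A), IsRegularParameters x ∧ x 0 = f := by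
  obtain ⟨d, z, hz⟩ := exists_isRegularParameters (A ⧸ Ideal.span {f})
  choose y hy using fun i => Ideal.Quotient.mk_surjective (z i)
  exact ⟨d + 1 - 1, Fin.cons f y, IsRegularParameters.cons hf (by simpa only [hy] using hz), rfl⟩

/-- A member of a regular system of parameters avoids the square of the maximal ideal of a regular
local ring; conversely a nonzero element of the square cuts out a non-regular ring. -/
theorem not_isRegularLocalRing_quotient {A : Type u} [CommRing A] [IsRegularLocalRing A] {f : A}
    (hf : f ∈ maximalIdeal A ^ 2) (hf0 : f ≠ 0) : ¬ IsRegularLocalRing (A ⧸ Ideal.span {f}) := by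
  intro h
  have hfm : f ∈ maximalIdeal A := Ideal.pow_le_self two_ne_zero hf
  have hdom := isDomain_of_isRegularLocalRing (A := A)
  have h1 := ringKrullDim_quotient_span_singleton_succ_eq_ringKrullDim
    (isSMulRegular_of_ne_zero hf0) hfm
  rw [← IsRegularLocalRing.spanFinrank_maximalIdeal (R := A),
    ← IsRegularLocalRing.spanFinrank_maximalIdeal (R := A ⧸ Ideal.span {f})] at h1
  have h2 : (maximalIdeal (A ⧸ Ideal.span {f})).spanFinrank + 1 =
    (maximalIdeal A).spanFinrank := by exact_mod_cast h1
  have hmax := map_maximalIdeal_of_surjective (Ideal.Quotient.mk (Ideal.span {f}))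
    Ideal.Quotient.mk_surjective
  obtain ⟨S, hcard, hS⟩ := Submodule.FG.exists_span_finset_card_eq_spanFinrank
    (maximalIdeal (A ⧸ Ideal.span {f})).fg_of_isNoetherianRing
  classical
  choose y hy using Ideal.Quotient.mk_surjective (I := Ideal.span {f})
  let S' : Finset A := S.image y
  have hS' : (Ideal.span (S' : Set A)).map (Ideal.Quotient.mk (Ideal.span {f})) =
      maximalIdeal (A ⧸ Ideal.span {f}) := by
    rw [Ideal.map_span, ← hS, Finset.coe_image, ← Set.image_comp]
    congr 1
    ext z
    simp [hy]
  -- Lifts of generators of the maximal ideal of the quotient generate that of `A` modulo `f`, which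
  -- lies in the square; by Nakayama they generate it outright. So the embedding dimension stays
  -- while the dimension drops by one.
  have hle : maximalIdeal A ≤ Ideal.span (S' : Set A) ⊔ maximalIdeal A • maximalIdeal A := by
    intro z hz
    have hz' : Ideal.Quotient.mk (Ideal.span {f}) z ∈
        (Ideal.span (S' : Set A)).map (Ideal.Quotient.mk (Ideal.span {f})) := by
      rw [hS', ← hmax]
      exact Ideal.mem_map_of_mem _ hz
    rw [← Ideal.mem_comap, Ideal.comap_map_of_surjective _ Ideal.Quotient.mk_surjective,
      ← RingHom.ker_eq_comap_bot, Ideal.mk_ker] at hz'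
    have hle : Ideal.span {f} ≤ maximalIdeal A • maximalIdeal A := by
      rw [smul_eq_mul, ← pow_two, Ideal.span_singleton_le_iff_mem]
      exact hf
    exact sup_le_sup_left hle (Ideal.span (S' : Set A)) hz'
  have hle2 : maximalIdeal A ≤ Ideal.span (S' : Set A) :=
    Submodule.le_of_le_smul_of_le_jacobson_bot (maximalIdeal A).fg_of_isNoetherianRing
      (by rw [jacobson_eq_maximalIdeal _ bot_ne_top]) hle
  have hne : Ideal.span (S' : Set A) ≤ maximalIdeal A := by
    refine le_maximalIdeal fun htop => ?_
    rw [htop, Ideal.map_top] at hS'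
    exact (maximalIdeal.isMaximal _).ne_top hS'.symm
  have h3 : (maximalIdeal A).spanFinrank ≤ S'.card := by
    rw [le_antisymm hle2 hne]
    refine (Submodule.spanFinrank_span_le_ncard_of_finite (Finset.finite_toSet _)).trans ?_
    rw [Set.ncard_coe_finset]
  have h4 : S'.card ≤ S.card := Finset.card_image_le
  omega

/-- Faithful flatness keeps a regular system of parameters of `A` a regular sequence, and by
hypothesis it generates the maximal ideal of `B`. -/
theorem isRegularLocalRing_of_flat_of_map_maximalIdeal {A B : Type u} [CommRing A] [CommRing B]
    [IsRegularLocalRing A] [IsLocalRing B] [IsNoetherianRing B] [Algebra A B] [Module.Flat A B]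
    (h : (maximalIdeal A).map (algebraMap A B) = maximalIdeal B) : IsRegularLocalRing B := by
  obtain ⟨d, x, hx⟩ := exists_isRegularParameters A
  have hloc : IsLocalHom (algebraMap A B) :=
    ((local_hom_TFAE (algebraMap A B)).out 0 2 rfl rfl).mpr h.le
  have : Module.FaithfullyFlat A B := Module.FaithfullyFlat.of_flat_of_isLocalHom
  have : IsRegularParameters fun i => algebraMap A B (x i) := by
    constructor
    · rw [← h, ← hx.1, Ideal.map_span, ← Set.range_comp']
    · rw [List.ofFn_comp' x (algebraMap A B)]
      exact hx.2.of_faithfullyFlat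
  exact this.isRegularLocalRing

/-- Over a local ring with maximal ideal generated by one regular element, multiplication by this
element detects flatness. -/
theorem flat_of_isSMulRegular {A : Type u} [CommRing A] [IsLocalRing A] [IsNoetherianRing A]
    {τ : A} (hτ : maximalIdeal A = Ideal.span {τ}) (hτ0 : IsSMulRegular A τ)
    {M : Type u} [AddCommGroup M] [Module A M] (hM : IsSMulRegular M τ) : Module.Flat A M := by
  have hp : IsRegularParameters (fun _ : Fin 1 => τ) := by
    constructor
    · rw [hτ, Set.range_const]
    · refine (RingTheory.Sequence.isRegular_cons_iff A τ []).mpr ⟨hτ0, ?_⟩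
      have : Nontrivial (QuotSMulTop τ A) :=
        by
        refine nontrivial_quotSMulTop_of_mem_maximalIdeal (R := A) (L := A) (x := τ) ?_
        rw [hτ]
        exact Ideal.mem_span_singleton_self τ
      exact RingTheory.Sequence.IsRegular.nil A (QuotSMulTop τ A)
  have := hp.isRegularLocalRing
  have hdom := isDomain_of_isRegularLocalRing (A := A)
  have hne : τ ≠ 0 := by
    rintro rfl
    exact one_ne_zero (hτ0 (by simp : (0 : A) • (1 : A) = (0 : A) • (0 : A)))
  have hdvr : IsDiscreteValuationRing A := by
    have hnf : ¬ IsField A := by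
      rw [isField_iff_maximalIdeal_eq, hτ, Ideal.span_singleton_eq_bot]
      exact hne
    have h : IsDiscreteValuationRing A ↔ (maximalIdeal A).IsPrincipal :=
      (IsDiscreteValuationRing.TFAE A hnf).out 0 4
    exact h.mpr ⟨⟨τ, hτ⟩⟩
  -- `A` is now a discrete valuation ring with uniformizer `τ`. A nonzero scalar is a unit times a
  -- power of `τ`, so regularity of `τ` on `M` gives torsion-freeness, which amounts to flatness.
  have : Module.IsTorsionFree A M := by
    refine ⟨fun a ha => ?_⟩
    have ha0 : a ≠ 0 := ha.ne_zero
    have hirr : Irreducible τ := (IsDiscreteValuationRing.irreducible_iff_uniformizer τ).mpr hτ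
    obtain ⟨n, hn⟩ := IsDiscreteValuationRing.associated_pow_irreducible ha0 hirr
    obtain ⟨v, hv⟩ := hn.symm
    rw [← hv]
    exact (hM.pow n).mul ((v.isUnit.isSMulRegular M) )
  infer_instance
-- The hypothesis says that `J / mJ` injects into `m / m²`: minimal generators of `J` are part of a
-- minimal system of generators of `m`. They are divided out one at a time, since an element of `J`
-- outside `mJ` lies outside `m²` and the hypothesis passes to the quotient.
theorem isRegularLocalRing_quotient_of_inf_sq_le {A : Type u} [CommRing A] [IsRegularLocalRing A]
    {J : Ideal A} (hJ : J ≤ maximalIdeal A) (h : J ⊓ maximalIdeal A ^ 2 ≤ maximalIdeal A * J) :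
    IsRegularLocalRing (A ⧸ J) := by
  obtain ⟨n, hn⟩ : ∃ n, (maximalIdeal A).spanFinrank = n := ⟨_, rfl⟩
  induction n using Nat.strong_induction_on generalizing A with
  | _ n ih =>
  by_cases h0 : J = ⊥
  · subst h0
    exact IsRegularLocalRing.of_ringEquiv (RingEquiv.quotientBot A).symm
  obtain ⟨f, hf, hf1⟩ : ∃ f ∈ J, f ∉ maximalIdeal A * J := by
    by_contra! hle
    exact h0 (Submodule.eq_bot_of_le_smul_of_le_jacobson_bot (maximalIdeal A) _
      J.fg_of_isNoetherianRing hle (by rw [jacobson_eq_maximalIdeal _ bot_ne_top]))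
  have hfm := hJ hf
  have hf2 : f ∉ maximalIdeal A ^ 2 := fun h' => hf1 (h ⟨hf, h'⟩)
  have hreg := isRegularLocalRing_quotient hfm hf2
  have hlt := spanFinrank_quotient_add_one_le hfm hf2
  have hmax := map_maximalIdeal_of_surjective (Ideal.Quotient.mk (Ideal.span {f}))
    Ideal.Quotient.mk_surjective
  have hle : Ideal.span {f} ≤ J := by rwa [Ideal.span_singleton_le_iff_mem]
  have := ih _ (by omega) (A := A ⧸ Ideal.span {f})
    (J := J.map (Ideal.Quotient.mk (Ideal.span {f}))) (hmax ▸ Ideal.map_mono hJ) (by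
      rintro x ⟨hx, hx2⟩
      obtain ⟨x, hxJ, rfl⟩ :=
        (Ideal.mem_map_iff_of_surjective _ Ideal.Quotient.mk_surjective).mp hx
      rw [← hmax, ← Ideal.map_pow] at hx2
      obtain ⟨y, hy, hyx⟩ :=
        (Ideal.mem_map_iff_of_surjective _ Ideal.Quotient.mk_surjective).mp hx2
      have hyJ : y ∈ J := by
        have h1 := hle (Ideal.Quotient.eq.mp hyx)
        simpa using J.add_mem h1 hxJ
      rw [← hyx, ← hmax, ← Ideal.map_mul]
      exact Ideal.mem_map_of_mem _ (h ⟨hyJ, hy⟩)) rfl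
  exact IsRegularLocalRing.of_ringEquiv
    ((DoubleQuot.quotQuotEquivQuotSup (Ideal.span {f}) J).trans
      (Ideal.quotEquivOfEq (sup_eq_right.mpr hle)))

/-- The preceding criterion with denominators cleared, so that it can be checked on elements of `A`,
which will be a polynomial ring. -/
theorem isRegularLocalRing_localization_quotient {A : Type u} [CommRing A] {q : Ideal A}
    [q.IsPrime] [IsRegularLocalRing (Localization.AtPrime q)] {I : Ideal A} (hI : I ≤ q)
    (h : ∀ f ∈ I, f ∈ q ^ 2 → ∃ v ∉ q, v * f ∈ q * I) :
    IsRegularLocalRing (Localization.AtPrime q ⧸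
      I.map (algebraMap A (Localization.AtPrime q))) := by
  have hq := Localization.AtPrime.map_eq_maximalIdeal (I := q)
  refine isRegularLocalRing_quotient_of_inf_sq_le (hq ▸ Ideal.map_mono hI) ?_
  rintro x ⟨hx, hx2⟩
  rw [← hq, ← Ideal.map_pow] at hx2
  rw [← hq, ← Ideal.map_mul]
  obtain ⟨⟨⟨f, hf⟩, s⟩, hs⟩ := (IsLocalization.mem_map_algebraMap_iff q.primeCompl _).mp hx
  obtain ⟨⟨⟨g, hg⟩, s'⟩, hs'⟩ := (IsLocalization.mem_map_algebraMap_iff q.primeCompl _).mp hx2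
  have heq : algebraMap A (Localization.AtPrime q) (s' * f) =
      algebraMap A (Localization.AtPrime q) (s * g) := by
    rw [map_mul, map_mul, ← hs, ← hs']
    ring
  obtain ⟨c, hc⟩ := (IsLocalization.eq_iff_exists q.primeCompl _).mp heq
  obtain ⟨v, hv, hvf⟩ := h (c * (s' * f)) (I.mul_mem_left _ (I.mul_mem_left _ hf))
    (by rw [hc]; exact Ideal.mul_mem_left _ _ (Ideal.mul_mem_left _ _ hg))
  refine (IsLocalization.mem_map_algebraMap_iff q.primeCompl _).mpr
    ⟨⟨⟨_, hvf⟩, ⟨v, hv⟩ * c * s' * s⟩, ?_⟩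
  simp only [map_mul, Submonoid.coe_mul] at hs ⊢
  rw [← hs]
  ring

/-- A comparison of the local ring of `E` at `p` with a quotient of the local ring of `A` at the
prime below `p`, for a homomorphism `A → E` that is surjective with kernel `I` up to elements
outside `p`. -/
theorem nonempty_localization_quotient_ringEquiv {A E : Type u} [CommRing A] [CommRing E]
    (φ : A →+* E) (I : Ideal A) (p : Ideal E) [p.IsPrime]
    (hsurj : ∀ e, ∃ a c, φ c ∉ p ∧ e * φ c = φ a)
    (hker : ∀ a, φ a = 0 → ∃ c, φ c ∉ p ∧ c * a ∈ I) (hI : I ≤ RingHom.ker φ) :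
    Nonempty ((Localization.AtPrime (p.comap φ) ⧸
      I.map (algebraMap A (Localization.AtPrime (p.comap φ)))) ≃+* Localization.AtPrime p) := by
  let ψ := Localization.localRingHom (p.comap φ) p φ rfl
  have hψ : Function.Surjective ψ := by
    intro y
    obtain ⟨e, s, rfl⟩ := IsLocalization.exists_mk'_eq p.primeCompl y
    obtain ⟨a, c, hc, ha⟩ := hsurj e
    obtain ⟨a', c', hc', ha'⟩ := hsurj s
    have hs : a' ∉ p.comap φ := by
      rw [Ideal.mem_comap, ← ha']
      exact fun h => (Ideal.IsPrime.mem_or_mem ‹_› h).elim s.2 hc'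
    have hs' : c * a' ∉ p.comap φ := fun h => (Ideal.IsPrime.mem_or_mem inferInstance h).elim hc hs
    refine ⟨IsLocalization.mk' _ (a * c') (⟨c * a', hs'⟩ : (p.comap φ).primeCompl), ?_⟩
    rw [Localization.localRingHom_mk', IsLocalization.mk'_eq_iff_eq]
    congr 1
    simp only [map_mul, ← ha, ← ha']
    ring
  have hkerψ : RingHom.ker ψ = I.map (algebraMap A (Localization.AtPrime (p.comap φ))) := by
    refine le_antisymm ?_ (Ideal.map_le_iff_le_comap.mpr fun a ha => ?_)
    · intro x hx
      obtain ⟨a, s, rfl⟩ := IsLocalization.exists_mk'_eq (p.comap φ).primeCompl x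
      rw [RingHom.mem_ker, Localization.localRingHom_mk', IsLocalization.mk'_eq_zero_iff] at hx
      obtain ⟨v, hv⟩ := hx
      obtain ⟨a', c, hc, ha'⟩ := hsurj v
      have h0 : φ (a' * a) = 0 := by
        rw [map_mul, ← ha', mul_right_comm, hv, zero_mul]
      obtain ⟨c', hc', hI'⟩ := hker _ h0
      have hs : a' ∉ p.comap φ := by
        rw [Ideal.mem_comap, ← ha']
        exact fun h => (Ideal.IsPrime.mem_or_mem ‹_› h).elim v.2 hc
      have hs' : c' * a' ∉ p.comap φ :=
        fun h => (Ideal.IsPrime.mem_or_mem inferInstance h).elim hc' hs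
      rw [← mul_assoc] at hI'
      rw [IsLocalization.mk'_mem_map_algebraMap_iff]
      exact ⟨_, hs', hI'⟩
    · rw [Ideal.mem_comap, RingHom.mem_ker, Localization.localRingHom_to_map,
        show φ a = 0 from hI ha, map_zero]
  exact ⟨(Ideal.quotEquivOfEq hkerψ.symm).trans (RingHom.quotientKerEquivOfSurjective hψ)⟩

end RegularLocalParameters

/-! ### Dehomogenization -/

section Dehomogenize

open HomogeneousLocalization

variable {R A : Type u} [CommRing R] [CommRing A] [Algebra R A]
  (𝒜 : ℕ → Submodule R A) [GradedAlgebra 𝒜]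

theorem Away.mk_eq_mk_iff {f : A} {d : ℕ} (hf : f ∈ 𝒜 d) {n n' : ℕ} {a a' : A}
    (ha : a ∈ 𝒜 (n • d)) (ha' : a' ∈ 𝒜 (n' • d)) :
    Away.mk 𝒜 hf n a ha = Away.mk 𝒜 hf n' a' ha' ↔
      ∃ l, f ^ l * (f ^ n' * a) = f ^ l * (f ^ n * a') := by
  rw [← (val_injective (𝒜 := 𝒜) (Submonoid.powers f)).eq_iff, Away.val_mk, Away.val_mk,
    Localization.mk_eq_mk_iff, Localization.r_iff_exists]
  constructor
  · rintro ⟨⟨_, l, rfl⟩, h⟩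
    exact ⟨l, h⟩
  · rintro ⟨l, h⟩
    exact ⟨⟨_, l, rfl⟩, h⟩

theorem Away.mk_eq_zero_iff {f : A} {d : ℕ} (hf : f ∈ 𝒜 d) {n : ℕ} {a : A}
    (ha : a ∈ 𝒜 (n • d)) :
    Away.mk 𝒜 hf n a ha = 0 ↔ ∃ l, f ^ l * a = 0 := by
  rw [← (val_injective (𝒜 := 𝒜) (Submonoid.powers f)).eq_iff, Away.val_mk, val_zero,
    Localization.mk_eq_mk', IsLocalization.mk'_eq_zero_iff]
  constructor
  · rintro ⟨⟨_, l, rfl⟩, h⟩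
    exact ⟨l, h⟩
  · rintro ⟨l, h⟩
    exact ⟨⟨_, l, rfl⟩, h⟩

theorem Away.mk_mul_mk {f : A} {d : ℕ} (hf : f ∈ 𝒜 d) {n n' : ℕ} {a a' : A}
    (ha : a ∈ 𝒜 (n • d)) (ha' : a' ∈ 𝒜 (n' • d)) (h : a * a' ∈ 𝒜 ((n + n') • d)) :
    Away.mk 𝒜 hf n a ha * Away.mk 𝒜 hf n' a' ha' = Away.mk 𝒜 hf (n + n') (a * a') h := by
  apply val_injective
  rw [val_mul, Away.val_mk, Away.val_mk, Away.val_mk, Localization.mk_mul]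
  congr 1
  exact Subtype.ext (pow_add f n n').symm

variable {𝒜} {m : ℕ} {U V : A} (hU : U ∈ 𝒜 (m + 1)) (hV : V ∈ 𝒜 m)

include hU hV in
theorem mul_mem_add_one_add : U * V ∈ 𝒜 (m + 1 + m) := SetLike.mul_mem_graded hU hV

include hV in
theorem mul_pow_mem_smul {j : ℕ} {a : A} (ha : a ∈ 𝒜 j) :
    a * V ^ (2 * j) ∈ 𝒜 (j • (m + 1 + m)) := by
  have h := SetLike.mul_mem_graded ha (SetLike.pow_mem_graded (2 * j) hV)
  convert h using 2
  simp only [smul_eq_mul]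
  ring

/-- The homomorphism `a ↦ a * (V ^ 2 / (U * V)) ^ deg a`, for `U` of degree one more than `V`. -/
def dehomogenize : A →+* Away 𝒜 (U * V) :=
  (DirectSum.toSemiring (fun j =>
    { toFun := fun a : 𝒜 j => Away.mk 𝒜 (mul_mem_add_one_add hU hV) j (a.1 * V ^ (2 * j))
        (mul_pow_mem_smul hV a.2)
      map_zero' := (Away.mk_eq_zero_iff 𝒜 _ _).mpr ⟨0, by simp⟩
      map_add' := fun a b => by
        apply val_injective
        rw [val_add, Away.val_mk, Away.val_mk, Away.val_mk, Localization.add_mk_self]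
        simp [add_mul] : 𝒜 j →+ Away 𝒜 (U * V) })
    (by
      apply val_injective
      rw [val_one]
      change (Away.mk 𝒜 (mul_mem_add_one_add hU hV) 0 ((1 : A) * V ^ (2 * 0)) _).val = 1
      rw [Away.val_mk, ← Localization.mk_one]
      congr 1
      · simp
      · exact Subtype.ext (pow_zero _))
    (by
      intro i j a b
      have hg := mul_mem_add_one_add hU hV
      change Away.mk 𝒜 hg _ _ _ = Away.mk 𝒜 hg _ _ _ * Away.mk 𝒜 hg _ _ _
      have he : (a.1 * b.1 * V ^ (2 * (i + j))) =
        (a.1 * V ^ (2 * i)) * (b.1 * V ^ (2 * j)) := by ring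
      rw [Away.mk_mul_mk]
      · congr 1
      · rw [← he]
        exact mul_pow_mem_smul hV (SetLike.mul_mem_graded a.2 b.2))).comp
    (DirectSum.decomposeRingEquiv 𝒜).toRingHom

theorem dehomogenize_of_mem {j : ℕ} {a : A} (ha : a ∈ 𝒜 j) :
    dehomogenize hU hV a = Away.mk 𝒜 (mul_mem_add_one_add hU hV) j (a * V ^ (2 * j))
      (mul_pow_mem_smul hV ha) := by
  have h : (DirectSum.decomposeRingEquiv 𝒜).toRingHom a =
    DirectSum.of (fun i => 𝒜 i) j ⟨a, ha⟩ := DirectSum.decompose_of_mem 𝒜 ha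
  rw [dehomogenize, RingHom.comp_apply, h]
  exact DirectSum.toSemiring_of _ _ _ _ _

theorem dehomogenize_eq : dehomogenize hU hV U = dehomogenize hU hV V := by
  rw [dehomogenize_of_mem hU hV hU, dehomogenize_of_mem hU hV hV, Away.mk_eq_mk_iff]
  exact ⟨0, by ring⟩

theorem isUnit_dehomogenize : IsUnit (dehomogenize hU hV (U * V)) := by
  have h1 : (U * V) ^ (2 * m) * U ^ (2 * (m + 1 + m)) ∈
      𝒜 ((2 * (m + 1 + m)) • (m + 1 + m)) := by
    have h := SetLike.mul_mem_graded
      (SetLike.pow_mem_graded (2 * m) (mul_mem_add_one_add hU hV))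
      (SetLike.pow_mem_graded (2 * (m + 1 + m)) hU)
    convert h using 2
    simp only [smul_eq_mul]
    ring
  refine IsUnit.of_mul_eq_one (Away.mk 𝒜 (mul_mem_add_one_add hU hV) _ _ h1) ?_
  rw [dehomogenize_of_mem hU hV (mul_mem_add_one_add hU hV), Away.mk_mul_mk]
  · apply val_injective
    rw [val_one, Away.val_mk, ← Localization.mk_one, Localization.mk_eq_mk_iff,
      Localization.r_iff_exists]
    refine ⟨1, ?_⟩
    simp only [Submonoid.coe_one, one_mul, mul_one]
    ring
  · have h := SetLike.mul_mem_graded (mul_pow_mem_smul hV (mul_mem_add_one_add hU hV)) h1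
    rwa [← add_smul] at h

theorem exists_dehomogenize_mul (e : Away 𝒜 (U * V)) :
    ∃ (a : A) (l : ℕ), e * dehomogenize hU hV ((U * V) ^ l) = dehomogenize hU hV a := by
  obtain ⟨l, b, hb, rfl⟩ := Away.mk_surjective 𝒜 (mul_mem_add_one_add hU hV) e
  refine ⟨b, l, ?_⟩
  have hg := SetLike.pow_mem_graded l (mul_mem_add_one_add hU hV)
  rw [dehomogenize_of_mem hU hV hb, dehomogenize_of_mem hU hV hg, Away.mk_mul_mk]
  · rw [Away.mk_eq_mk_iff]
    exact ⟨0, by ring⟩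
  · have h := SetLike.mul_mem_graded hb (mul_pow_mem_smul hV hg)
    rwa [← add_smul] at h

/-- With `dehomogenize_eq` and `isUnit_dehomogenize`, this makes the chart away from `U * V` behave
as `A / (U - V)` with `U * V` inverted. The homomorphism `ψ` sends `a / (UV) ^ n` to `χ a / χ (UV) ^
n`; when `χ U = χ V` it sends `V² / (UV)` to `1`, hence undoes the dehomogenization. -/
theorem exists_lift_dehomogenize {S : Type*} [CommRing S] (χ : A →+* S) (hχ : χ U = χ V)
    (hu : IsUnit (χ (U * V))) :
    ∃ ψ : Away 𝒜 (U * V) →+* S, (∀ a, ψ (dehomogenize hU hV a) = χ a) ∧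
      ∀ a, ψ (fromZeroRingHom 𝒜 _ a) = χ a := by
  let ψ : Away 𝒜 (U * V) →+* S := (IsLocalization.Away.lift (S := Localization.Away (U * V))
    (U * V) hu).comp (algebraMap (Away 𝒜 (U * V)) (Localization.Away (U * V)))
  refine ⟨ψ, fun a => ?_, fun a => ?_⟩
  · induction a using DirectSum.Decomposition.inductionOn 𝒜 with
    | zero => simp
    | @homogeneous j a =>
      rw [dehomogenize_of_mem hU hV a.2]
      change IsLocalization.Away.lift _ hu (Away.mk 𝒜 (mul_mem_add_one_add hU hV) j _ _).val = _
      rw [Away.val_mk, Localization.mk_eq_mk', IsLocalization.Away.lift,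
        IsLocalization.lift_mk'_spec]
      simp only [map_mul, map_pow, hχ]
      ring
    | add a b ha hb => simp only [map_add, ha, hb]
  · change IsLocalization.Away.lift _ hu (Localization.mk (a : A) 1) = _
    rw [Localization.mk_one_eq_algebraMap, IsLocalization.Away.lift_eq]

/-- The factorization applied to the canonical map from `A` to `A / (U - V)` with `U * V` inverted,
whose kernel is visible. -/
theorem exists_pow_mul_mem_of_dehomogenize_eq_zero {a : A} (ha : dehomogenize hU hV a = 0) :
    ∃ l, (U * V) ^ l * a ∈ Ideal.span {U - V} := by
  let χ : A →+* Localization.Away (Ideal.Quotient.mk (Ideal.span {U - V}) (U * V)) :=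
    (algebraMap (A ⧸ Ideal.span {U - V}) _).comp (Ideal.Quotient.mk (Ideal.span {U - V}))
  obtain ⟨ψ, hψ, -⟩ := exists_lift_dehomogenize hU hV χ
    (congrArg (algebraMap (A ⧸ Ideal.span {U - V}) _)
      (Ideal.Quotient.eq.mpr (Ideal.mem_span_singleton_self _)))
    (IsLocalization.Away.algebraMap_isUnit (Ideal.Quotient.mk (Ideal.span {U - V}) (U * V)))
  have h0 := hψ a
  rw [ha, map_zero] at h0
  obtain ⟨⟨_, l, rfl⟩, hl⟩ := (IsLocalization.map_eq_zero_iff (Submonoid.powers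
    (Ideal.Quotient.mk (Ideal.span {U - V}) (U * V))) _ _).mp h0.symm
  refine ⟨l, ?_⟩
  rw [← Ideal.Quotient.eq_zero_iff_mem, map_mul, map_pow]
  exact hl

end Dehomogenize

/-! ### Regularity of charts of weighted hypersurfaces -/

section ChartRegularity

open MvPolynomial HomogeneousLocalization IsLocalRing

/-- A coordinate-free Jacobian criterion. Let `J` be the extension of `I` to the local ring. The map
`φ` and the canonical map to the quotient by `J ^ 2` agree modulo `J`, so their difference obeys a
Leibniz rule and carries `q ^ 2` into `m J`. As `φ` kills `I`, an element of `I ∩ q ^ 2` itself lies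
in `m J`. -/
theorem exists_mul_mem_of_ringHom {P : Type u} [CommRing P] {q : Ideal P} [q.IsPrime]
    {I : Ideal P} (hI : I ≤ q)
    (φ : P →+* Localization.AtPrime q ⧸ (I.map (algebraMap P (Localization.AtPrime q))) ^ 2)
    (hφ : ∀ x, φ x - Ideal.Quotient.mk _ (algebraMap P _ x) ∈
      (I.map (algebraMap P (Localization.AtPrime q))).map (Ideal.Quotient.mk _))
    (hφI : ∀ x ∈ I, φ x = 0) (f : P) (hf : f ∈ I) (hf2 : f ∈ q ^ 2) :
    ∃ v ∉ q, v * f ∈ q * I := by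
  let J := I.map (algebraMap P (Localization.AtPrime q))
  let m := q.map (algebraMap P (Localization.AtPrime q))
  let π := Ideal.Quotient.mk (J ^ 2)
  have hJm : J ≤ m := Ideal.map_mono hI
  have key : ∀ x ∈ q ^ 2, φ x - π (algebraMap P _ x) ∈ (m * J).map π := by
    intro x hx
    rw [pow_two] at hx
    rw [Ideal.map_mul]
    refine Submodule.mul_induction_on hx (fun a ha b hb => ?_) (fun x y hx hy => ?_)
    · have e : φ (a * b) - π (algebraMap P _ (a * b)) = φ b * (φ a - π (algebraMap P _ a)) +
          π (algebraMap P _ a) * (φ b - π (algebraMap P _ b)) := by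
        simp only [map_mul]
        ring
      have hm : ∀ c ∈ q, π (algebraMap P _ c) ∈ m.map π := fun c hc =>
        Ideal.mem_map_of_mem _ (Ideal.mem_map_of_mem _ hc)
      have hb' : φ b ∈ m.map π := by
        have := add_mem (Ideal.map_mono hJm (hφ b)) (hm b hb)
        rwa [sub_add_cancel] at this
      rw [e]
      exact add_mem (Ideal.mul_mem_mul hb' (hφ a)) (Ideal.mul_mem_mul (hm a ha) (hφ b))
    · have e : φ (x + y) - π (algebraMap P _ (x + y)) = (φ x - π (algebraMap P _ x)) +
          (φ y - π (algebraMap P _ y)) := by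
        simp only [map_add]
        ring
      rw [e]
      exact add_mem hx hy
  have h1 := key f hf2
  rw [hφI f hf, zero_sub, neg_mem_iff, ← Ideal.mem_comap,
    Ideal.comap_map_of_surjective _ Ideal.Quotient.mk_surjective, ← RingHom.ker_eq_comap_bot,
    Ideal.mk_ker, sup_eq_left.mpr (by rw [pow_two]; exact Ideal.mul_mono_left hJm),
    ← Ideal.map_mul] at h1
  obtain ⟨⟨⟨g, hg⟩, s⟩, hs⟩ := (IsLocalization.mem_map_algebraMap_iff q.primeCompl _).mp h1
  rw [← map_mul] at hs
  obtain ⟨c, hc⟩ := (IsLocalization.eq_iff_exists q.primeCompl _).mp hs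
  refine ⟨c * s, (c * s).2, ?_⟩
  have e : (c : P) * s * f = c * g := by rw [← hc]; ring
  rw [e]
  exact Ideal.mul_mem_left _ _ hg

/-- Because the degrees of `U` and `V` differ by one, dehomogenizing presents the chart as the
quotient of `P` by `ker χ` and `U - V`, localized at `U * V`, with no finite group of invariants to
account for. The conormal criterion is then applied to this ideal of `P`. -/
theorem isRegularLocalRing_away_of_surjective {R P A : Type u} [CommRing R] [CommRing P]
    [CommRing A] [Algebra R A] [IsRegularRing P] (𝒜 : ℕ → Submodule R A) [GradedAlgebra 𝒜]
    (χ : P →+* A) (hχ : Function.Surjective χ) {U V : P} {m : ℕ} (hU : χ U ∈ 𝒜 (m + 1))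
    (hV : χ V ∈ 𝒜 m)
    (hcrit : ∀ (q : Ideal P) [q.IsPrime], U * V ∉ q → RingHom.ker χ ⊔ Ideal.span {U - V} ≤ q →
      ∀ f ∈ RingHom.ker χ ⊔ Ideal.span {U - V}, f ∈ q ^ 2 →
        ∃ v ∉ q, v * f ∈ q * (RingHom.ker χ ⊔ Ideal.span {U - V}))
    (p : Ideal (Away 𝒜 (χ U * χ V))) [p.IsPrime] :
    IsRegularLocalRing (Localization.AtPrime p) := by
  let φ := (dehomogenize hU hV).comp χ
  have hunit : IsUnit (φ (U * V)) := by
    simpa [φ] using isUnit_dehomogenize hU hV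
  have hnot : ∀ l, φ ((U * V) ^ l) ∉ p := fun l h =>
    Ideal.IsPrime.ne_top ‹_› (Ideal.eq_top_of_isUnit_mem _ h (by
      rw [map_pow]
      exact hunit.pow l))
  have hI : RingHom.ker χ ⊔ Ideal.span {U - V} ≤ RingHom.ker φ := by
    refine sup_le (fun x hx => ?_) ?_
    · rw [RingHom.mem_ker] at hx ⊢
      rw [RingHom.comp_apply, hx, map_zero]
    · rw [Ideal.span_singleton_le_iff_mem, RingHom.mem_ker, map_sub, sub_eq_zero]
      exact dehomogenize_eq hU hV
  have hIq : RingHom.ker χ ⊔ Ideal.span {U - V} ≤ p.comap φ := fun x hx => by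
    rw [Ideal.mem_comap, (RingHom.mem_ker).mp (hI hx)]
    exact zero_mem p
  obtain ⟨e⟩ := nonempty_localization_quotient_ringEquiv φ
    (RingHom.ker χ ⊔ Ideal.span {U - V}) p (fun e => by
      obtain ⟨a, l, h⟩ := exists_dehomogenize_mul hU hV e
      obtain ⟨a, rfl⟩ := hχ a
      refine ⟨a, (U * V) ^ l, hnot l, ?_⟩
      simpa [φ] using h) (fun a ha => by
      obtain ⟨l, hl⟩ := exists_pow_mul_mem_of_dehomogenize_eq_zero hU hV ha
      refine ⟨(U * V) ^ l, hnot l, ?_⟩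
      rw [← map_mul, ← map_pow, ← map_mul, ← map_sub, ← Set.image_singleton, ← Ideal.map_span,
        ← Ideal.mem_comap, Ideal.comap_map_of_surjective _ hχ, ← RingHom.ker_eq_comap_bot,
        sup_comm] at hl
      exact hl) hI
  have := isRegularLocalRing_localization_quotient hIq
    (hcrit _ (by simpa using hnot 1) hIq)
  exact IsRegularLocalRing.of_ringEquiv e

/-- Formal smoothness over `k` lifts `ψ` across the square-zero thickening. Only the lifted images
of the variables are kept, while scalars from `κ` act through `ι`. Smoothness over `k` thus has
consequences over `κ` without forming `E ⊗ κ` and without any separability of `κ` over `k`. -/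
theorem exists_ringHom_of_formallySmooth {k κ E O : Type u} [Field k] [Field κ] [Algebra k κ]
    [CommRing E] [Algebra k E] [Algebra.FormallySmooth k E] [CommRing O] {m : ℕ}
    (θ : MvPolynomial (Fin m) k →ₐ[k] E) (J : Ideal O) (ι : MvPolynomial (Fin m) κ →+* O)
    (ψ : E →+* O ⧸ J)
    (hψ : ∀ f, ψ (θ f) = Ideal.Quotient.mk J (ι (map (algebraMap k κ) f))) :
    ∃ φ : MvPolynomial (Fin m) κ →+* O ⧸ J ^ 2,
      (∀ x, φ x - Ideal.Quotient.mk (J ^ 2) (ι x) ∈ J.map (Ideal.Quotient.mk (J ^ 2))) ∧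
      ∀ f, θ f = 0 → φ (map (algebraMap k κ) f) = 0 := by
  have hJ : J ^ 2 ≤ J := Ideal.pow_le_self two_ne_zero
  let _ : Algebra k O := (ι.comp (C.comp (algebraMap k κ))).toAlgebra
  let g : (O ⧸ J ^ 2) →ₐ[k] (O ⧸ J) :=
    { Ideal.Quotient.factor hJ with commutes' := fun _ => rfl }
  have hg : Function.Surjective g := Ideal.Quotient.factor_surjective hJ
  have hker : RingHom.ker (g : (O ⧸ J ^ 2) →+* O ⧸ J) = J.map (Ideal.Quotient.mk (J ^ 2)) :=
    Ideal.Quotient.factor_ker hJ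
  have hnil : IsNilpotent (RingHom.ker (g : (O ⧸ J ^ 2) →+* O ⧸ J)) := by
    refine ⟨2, ?_⟩
    rw [hker, ← Ideal.map_pow, Ideal.map_quotient_self, Ideal.zero_eq_bot]
  let ψ' : E →ₐ[k] (O ⧸ J) :=
    AlgHom.mk ψ fun x => by
      have h := hψ (C x)
      rw [map_C, ← MvPolynomial.algebraMap_eq, AlgHom.commutes] at h
      exact h
  let l := Algebra.FormallySmooth.liftOfSurjective ψ' g hg hnil
  let φ : MvPolynomial (Fin m) κ →+* O ⧸ J ^ 2 :=
    eval₂Hom ((Ideal.Quotient.mk (J ^ 2)).comp (ι.comp C)) (fun i => l (θ (X i)))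
  have h1 : φ.comp (map (algebraMap k κ)) = (l.comp θ : _ →ₐ[k] _).toRingHom := by
    refine MvPolynomial.ringHom_ext (fun x => ?_) (fun i => ?_)
    · have h := (l.comp θ).commutes x
      rw [MvPolynomial.algebraMap_eq] at h
      simp only [RingHom.comp_apply, map_C, φ, coe_eval₂Hom, eval₂_C]
      exact h.symm
    · simp [φ]
  have h2 : (g : (O ⧸ J ^ 2) →+* O ⧸ J).comp φ = (Ideal.Quotient.mk J).comp ι := by
    refine MvPolynomial.ringHom_ext (fun x => ?_) (fun i => ?_)
    · simp only [RingHom.comp_apply, φ, coe_eval₂Hom, eval₂_C]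
      rfl
    · simp only [RingHom.comp_apply, φ, coe_eval₂Hom, eval₂_X]
      refine (Algebra.FormallySmooth.liftOfSurjective_apply ψ' g hg hnil _).trans ?_
      refine (hψ (X i)).trans ?_
      rw [map_X]
  refine ⟨φ, fun x => ?_, fun f hf => ?_⟩
  · rw [← hker, RingHom.mem_ker, map_sub, sub_eq_zero]
    exact congrArg (fun h => h x) h2
  · have := congrArg (fun h => h f) h1
    refine this.trans ?_
    change l (θ f) = 0
    rw [hf, map_zero]

theorem exists_mul_mem_of_formallySmooth {k κ E : Type u} [Field k] [Field κ] [Algebra k κ]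
    [CommRing E] [Algebra k E] [Algebra.FormallySmooth k E] {m : ℕ}
    (θ : MvPolynomial (Fin m) k →ₐ[k] E) {S : Set (MvPolynomial (Fin m) k)}
    (hS : ∀ f ∈ S, θ f = 0) {q : Ideal (MvPolynomial (Fin m) κ)} [q.IsPrime]
    {I : Ideal (MvPolynomial (Fin m) κ)} (hI : I ≤ q)
    (hIS : I = Ideal.span (map (algebraMap k κ) '' S))
    (ψ : E →+* Localization.AtPrime q ⧸ I.map
      (algebraMap (MvPolynomial (Fin m) κ) (Localization.AtPrime q)))
    (hψ : ∀ f, ψ (θ f) = Ideal.Quotient.mk _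
      (algebraMap (MvPolynomial (Fin m) κ) _ (map (algebraMap k κ) f)))
    (f : MvPolynomial (Fin m) κ) (hf : f ∈ I) (hf2 : f ∈ q ^ 2) :
    ∃ v ∉ q, v * f ∈ q * I := by
  obtain ⟨φ, h1, h2⟩ := exists_ringHom_of_formallySmooth θ _ _ ψ hψ
  refine exists_mul_mem_of_ringHom hI φ h1 (fun x hx => ?_) f hf hf2
  have : I ≤ RingHom.ker φ := by
    refine hIS.le.trans (Ideal.span_le.mpr ?_)
    rintro _ ⟨s, hs, rfl⟩
    exact RingHom.mem_ker.mpr (h2 s (hS s hs))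
  exact this hx

/-- Write `f = a (F - T ^ r) + b (T - 1)` with `f ∈ q ^ 2`; every derivation sends `f` into `q`. The
Euler derivation multiplies `F - T ^ r` by `r` and sends `T - 1` to `T`, which is outside `q`, so `b
∈ q`. Then `∂/∂T`, which sends `F - T ^ r` to `- r T ^ (r - 1)`, gives `a ∈ q` because `r ≠ 0` in
`κ`. -/
theorem exists_mul_mem_suspend {κ : Type u} [Field κ] {m r : ℕ} {w : Fin m → ℕ}
    {F : MvPolynomial (Fin m) κ} (hF : IsWeightedHomogeneous w F r) (hr : (r : κ) ≠ 0)
    {q : Ideal (MvPolynomial (Fin (m + 1)) κ)} [q.IsPrime] {I : Ideal (MvPolynomial (Fin (m + 1)) κ)}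
    (hI : I ≤ q) (hIS : I = Ideal.span {suspend r F, X (Fin.last m) - 1})
    (f : MvPolynomial (Fin (m + 1)) κ) (hf : f ∈ I) (hf2 : f ∈ q ^ 2) :
    ∃ v ∉ q, v * f ∈ q * I := by
  refine ⟨1, fun h => Ideal.IsPrime.ne_top ‹_› ((Ideal.eq_top_iff_one _).mpr h), ?_⟩
  have hmem1 : suspend r F ∈ I := hIS ▸ Ideal.subset_span (by simp)
  have hmem2 : X (Fin.last m) - 1 ∈ I := hIS ▸ Ideal.subset_span (by simp)
  have hder : ∀ δ : Derivation κ (MvPolynomial (Fin (m + 1)) κ) (MvPolynomial (Fin (m + 1)) κ),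
      ∀ x ∈ q ^ 2, δ x ∈ q := by
    intro δ x hx
    rw [pow_two] at hx
    refine Submodule.mul_induction_on hx (fun a ha b hb => ?_) (fun x y hx hy => ?_)
    · rw [Derivation.leibniz]
      exact add_mem (q.mul_mem_right _ ha) (q.mul_mem_right _ hb)
    · rw [map_add]
      exact add_mem hx hy
  have hT : X (Fin.last m) ∉ q := fun h =>
    Ideal.IsPrime.ne_top ‹_› ((Ideal.eq_top_iff_one _).mpr (by
      have := sub_mem h (hI hmem2)
      simpa using this))
  have hr' : C (r : κ) ∉ q := fun h =>
    Ideal.IsPrime.ne_top ‹_› (Ideal.eq_top_of_isUnit_mem _ h ((IsUnit.mk0 _ hr).map C))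
  rw [hIS, Ideal.mem_span_pair] at hf
  obtain ⟨a, b, rfl⟩ := hf
  let w' : Fin (m + 1) → ℕ := Fin.snoc w 1
  let δ : Derivation κ (MvPolynomial (Fin (m + 1)) κ) (MvPolynomial (Fin (m + 1)) κ) :=
    ∑ i, (w' i) • (X i : MvPolynomial (Fin (m + 1)) κ) • pderiv i
  have hδ : ∀ x, δ x = ∑ i, w' i • (X i * pderiv i x) := fun x => by
    have h : ⇑δ = ∑ i, ⇑(w' i • (X i : MvPolynomial (Fin (m + 1)) κ) • pderiv (R := κ) i) :=
      map_sum Derivation.coeFnAddMonoidHom _ _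
    rw [h, Finset.sum_apply]
    rfl
  have hδ1 : δ (suspend r F) = r • suspend r F := by
    rw [hδ]
    exact (isWeightedHomogeneous_suspend hF).sum_weight_X_mul_pderiv
  have hδ2 : δ (X (Fin.last m) - 1) = X (Fin.last m) := by
    have := (isWeightedHomogeneous_X κ w' (Fin.last m)).sum_weight_X_mul_pderiv
    rw [map_sub, Derivation.map_one_eq_zero, sub_zero, hδ, this]
    simp [w']
  have h1 := hder δ _ hf2
  rw [map_add, Derivation.leibniz, Derivation.leibniz, hδ1, hδ2] at h1
  simp only [smul_eq_mul, nsmul_eq_mul] at h1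
  have hb : b ∈ q := by
    have h2 : b * X (Fin.last m) ∈ q := by
      have e : b * X (Fin.last m) = (a * ((r : MvPolynomial (Fin (m + 1)) κ) * suspend r F) + suspend r F * δ a +
        (b * X (Fin.last m) + (X (Fin.last m) - 1) * δ b)) -
          (a * (r : MvPolynomial (Fin (m + 1)) κ) + δ a) * suspend r F - δ b * (X (Fin.last m) - 1) := by
        ring
      rw [e]
      exact sub_mem (sub_mem h1 (q.mul_mem_left _ (hI hmem1))) (q.mul_mem_left _ (hI hmem2))
    exact (Ideal.IsPrime.mem_or_mem ‹_› h2).resolve_right hT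
  have hp1 : pderiv (Fin.last m) (suspend r F) = - (C (r : κ) * X (Fin.last m) ^ (r - 1)) := by
    have h0 : pderiv (Fin.last m) (rename Fin.castSucc F) = 0 := by
      refine pderiv_eq_zero_of_notMem_vars fun h => ?_
      obtain ⟨i, -, hi⟩ := Finset.mem_image.mp (vars_rename _ _ h)
      exact (Fin.castSucc_lt_last i).ne hi
    rw [suspend, map_sub, h0, zero_sub, pderiv_pow, pderiv_X_self, mul_one]
    simp
  have h3 := hder (pderiv (Fin.last m)) _ hf2
  rw [map_add, Derivation.leibniz, Derivation.leibniz, hp1, map_sub, pderiv_X_self,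
    Derivation.map_one_eq_zero, sub_zero] at h3
  simp only [smul_eq_mul] at h3
  have ha : a ∈ q := by
    have h2 : a * (C (r : κ) * X (Fin.last m) ^ (r - 1)) ∈ q := by
      have e : a * (C (r : κ) * X (Fin.last m) ^ (r - 1)) =
        b + pderiv (Fin.last m) a * suspend r F + pderiv (Fin.last m) b * (X (Fin.last m) - 1) -
        (a * -(C (r : κ) * X (Fin.last m) ^ (r - 1)) + suspend r F * pderiv (Fin.last m) a +
          (b * 1 + (X (Fin.last m) - 1) * pderiv (Fin.last m) b)) := by
        ring
      rw [e]
      exact sub_mem (add_mem (add_mem hb (q.mul_mem_left _ (hI hmem1)))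
        (q.mul_mem_left _ (hI hmem2))) h3
    rcases Ideal.IsPrime.mem_or_mem ‹_› h2 with h | h
    · exact h
    · rcases Ideal.IsPrime.mem_or_mem ‹_› h with h | h
      · exact absurd h hr'
      · exact absurd (Ideal.IsPrime.mem_of_pow_mem ‹_› _ h) hT
  rw [one_mul]
  exact add_mem (Ideal.mul_mem_mul ha hmem1) (Ideal.mul_mem_mul hb hmem2)

theorem mk_mem_quotientGrading {R A : Type u} [CommRing R] [CommRing A] [Algebra R A]
    {𝒜 : ℕ → Submodule R A} (I : Ideal A) {i : ℕ} {x : A} (hx : x ∈ 𝒜 i) :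
    Ideal.Quotient.mk I x ∈ quotientGrading 𝒜 I i :=
  ⟨x, hx, rfl⟩

attribute [local instance] MvPolynomial.weightedGradedAlgebra

theorem awayι_projToSpec {R A : Type u} [CommRing R] [CommRing A] [Algebra R A]
    (𝒜 : ℕ → Submodule R A) [GradedAlgebra 𝒜] {g : A} {d : ℕ} (hg : g ∈ 𝒜 d) (hd : 0 < d) :
    Proj.awayι 𝒜 g hg hd ≫ projToSpec R 𝒜 = Spec.map (CommRingCat.ofHom
      ((fromZeroRingHom 𝒜 (Submonoid.powers g)).comp (algebraMap R (𝒜 0)))) := by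
  rw [projToSpec, Proj.awayι_toSpecZero_assoc, ← Spec.map_comp, ← CommRingCat.ofHom_comp]

theorem formallySmooth_away {R A : Type u} [CommRing R] [CommRing A] [Algebra R A]
    (𝒜 : ℕ → Submodule R A) [GradedAlgebra 𝒜] [Smooth (projToSpec R 𝒜)] {g : A} {d : ℕ}
    (hg : g ∈ 𝒜 d) (hd : 0 < d) :
    ((fromZeroRingHom 𝒜 (Submonoid.powers g)).comp (algebraMap R (𝒜 0))).FormallySmooth := by
  have h : Smooth (Proj.awayι 𝒜 g hg hd ≫ projToSpec R 𝒜) := inferInstance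
  rw [awayι_projToSpec, HasRingHomProperty.Spec_iff (P := @Smooth)] at h
  exact h.formallySmooth

/-- The formally smooth algebra is the chart of `V(F)` over `k` itself: dehomogenization gives `θ`,
which kills `F` and `U - V`, and the factorization property of the chart gives `ψ` into the local
ring over `κ` modulo `I`. -/
theorem exists_mul_mem_of_formallySmooth_away {k κ Q : Type u} [Field k] [Field κ] [Algebra k κ]
    [CommRing Q] [Algebra k Q] (𝒬 : ℕ → Submodule k Q) [GradedAlgebra 𝒬] {m : ℕ}
    (χ : MvPolynomial (Fin m) k →ₐ[k] Q) (hχ : Function.Surjective χ)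
    {F U V : MvPolynomial (Fin m) k} (hker : RingHom.ker χ = Ideal.span {F}) {e : ℕ}
    (hU : χ U ∈ 𝒬 (e + 1)) (hV : χ V ∈ 𝒬 e)
    (hfs : ((fromZeroRingHom 𝒬 (Submonoid.powers (χ U * χ V))).comp
      (algebraMap k (𝒬 0))).FormallySmooth)
    {q : Ideal (MvPolynomial (Fin m) κ)} [q.IsPrime]
    (hUV : map (algebraMap k κ) U * map (algebraMap k κ) V ∉ q)
    {I : Ideal (MvPolynomial (Fin m) κ)} (hI : I = Ideal.span {map (algebraMap k κ) F} ⊔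
      Ideal.span {map (algebraMap k κ) U - map (algebraMap k κ) V}) (hle : I ≤ q)
    (f : MvPolynomial (Fin m) κ) (hf : f ∈ I) (hf2 : f ∈ q ^ 2) :
    ∃ v ∉ q, v * f ∈ q * I := by
  let _ := ((fromZeroRingHom 𝒬 (Submonoid.powers (χ U * χ V))).comp
    (algebraMap k (𝒬 0))).toAlgebra
  have : Algebra.FormallySmooth k (Away 𝒬 (χ U * χ V)) := hfs
  let θ : MvPolynomial (Fin m) k →ₐ[k] Away 𝒬 (χ U * χ V) :=
    AlgHom.mk ((dehomogenize hU hV).comp χ.toRingHom) fun x => by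
      have hx : χ (algebraMap k (MvPolynomial (Fin m) k) x) ∈ 𝒬 0 := by
        rw [AlgHom.commutes]
        exact SetLike.algebraMap_mem_graded 𝒬 x
      change dehomogenize hU hV (χ _) = _
      rw [dehomogenize_of_mem hU hV hx]
      apply val_injective
      rw [Away.val_mk]
      change _ = Localization.mk (algebraMap k Q x) 1
      congr 1
      · rw [mul_zero, pow_zero, mul_one, AlgHom.commutes]
      · exact Subtype.ext (pow_zero _)
  let ρ : MvPolynomial (Fin m) k →+* Localization.AtPrime q ⧸
      I.map (algebraMap (MvPolynomial (Fin m) κ) (Localization.AtPrime q)) :=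
    ((Ideal.Quotient.mk _).comp (algebraMap _ (Localization.AtPrime q))).comp
      (map (algebraMap k κ))
  have hρI : ∀ x, map (algebraMap k κ) x ∈ I → ρ x = 0 := fun x hx =>
    Ideal.Quotient.eq_zero_iff_mem.mpr (Ideal.mem_map_of_mem _ hx)
  have hρF : RingHom.ker χ.toRingHom ≤ RingHom.ker ρ := by
    refine hker.le.trans ?_
    rw [Ideal.span_singleton_le_iff_mem]
    exact hρI F (hI ▸ Ideal.mem_sup_left (Ideal.mem_span_singleton_self _))
  let ρ' : Q →+* Localization.AtPrime q ⧸
      I.map (algebraMap (MvPolynomial (Fin m) κ) (Localization.AtPrime q)) :=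
    RingHom.liftOfSurjective χ.toRingHom hχ ⟨ρ, hρF⟩
  have hρ' : ∀ x, ρ' (χ x) = ρ x := fun x =>
    RingHom.liftOfRightInverse_comp_apply χ.toRingHom _ _ ⟨ρ, hρF⟩ x
  have hρ1 : ρ' (χ U) = ρ' (χ V) := by
    rw [hρ', hρ', ← sub_eq_zero, ← map_sub ρ]
    refine hρI _ ?_
    rw [map_sub, hI]
    exact Ideal.mem_sup_right (Ideal.mem_span_singleton_self _)
  have hρ2 : IsUnit (ρ' (χ U * χ V)) := by
    rw [← map_mul, hρ']
    have hu : map (algebraMap k κ) (U * V) ∉ q := by rwa [map_mul]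
    exact (IsLocalization.map_units (Localization.AtPrime q)
      (⟨_, hu⟩ : q.primeCompl)).map (Ideal.Quotient.mk _)
  obtain ⟨ψ, hψ, -⟩ := exists_lift_dehomogenize (S := Localization.AtPrime q ⧸
    I.map (algebraMap (MvPolynomial (Fin m) κ) (Localization.AtPrime q))) hU hV ρ' hρ1 hρ2
  refine exists_mul_mem_of_formallySmooth (k := k) θ (S := {F, U - V}) ?_ hle ?_ ψ ?_ f hf hf2
  · rintro f (rfl | rfl)
    · have h0 : χ f = 0 := by
        have : f ∈ RingHom.ker χ := hker ▸ Ideal.mem_span_singleton_self _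
        exact this
      change dehomogenize hU hV (χ _) = 0
      rw [h0, map_zero]
    · change dehomogenize hU hV (χ _) = 0
      rw [map_sub, map_sub, sub_eq_zero]
      exact dehomogenize_eq hU hV
  · rw [hI, Set.image_pair, Ideal.span_insert, map_sub]
  · exact fun f => (hψ _).trans (hρ' f)

theorem isRegularLocalRing_away_hypersurface {k κ : Type u} [Field k] [Field κ] [Algebra k κ]
    {m r : ℕ} {w : Fin m → ℕ} {F : MvPolynomial (Fin m) k} (hF : IsWeightedHomogeneous w F r)
    (hsm : Smooth (Hypersurface.toSpec hF)) {U V : MvPolynomial (Fin m) k} {e : ℕ}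
    (hU : IsWeightedHomogeneous w U (e + 1)) (hV : IsWeightedHomogeneous w V e) :
    letI := quotientGradedAlgebra (weightedHomogeneousSubmodule κ w) _
      (isHomogeneous_span (isWeightedHomogeneous_map (algebraMap k κ) hF))
    ∀ (p : Ideal (Away (quotientGrading (weightedHomogeneousSubmodule κ w)
      (Ideal.span {map (algebraMap k κ) F}))
      (Ideal.Quotient.mk (Ideal.span {map (algebraMap k κ) F}) (map (algebraMap k κ) U) *
        Ideal.Quotient.mk (Ideal.span {map (algebraMap k κ) F}) (map (algebraMap k κ) V))))
      [p.IsPrime], IsRegularLocalRing (Localization.AtPrime p) := by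
  let _ := quotientGradedAlgebra (weightedHomogeneousSubmodule κ w) _
      (isHomogeneous_span (isWeightedHomogeneous_map (algebraMap k κ) hF))
  let _ := quotientGradedAlgebra (weightedHomogeneousSubmodule k w) _ (isHomogeneous_span hF)
  have hU' := mk_mem_quotientGrading (𝒜 := weightedHomogeneousSubmodule k w) (Ideal.span {F}) hU
  have hV' := mk_mem_quotientGrading (𝒜 := weightedHomogeneousSubmodule k w) (Ideal.span {F}) hV
  intro p hp
  refine isRegularLocalRing_away_of_surjective _ (Ideal.Quotient.mk _)
    Ideal.Quotient.mk_surjective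
    (mk_mem_quotientGrading (𝒜 := weightedHomogeneousSubmodule κ w) _
      (isWeightedHomogeneous_map (algebraMap k κ) hU))
    (mk_mem_quotientGrading (𝒜 := weightedHomogeneousSubmodule κ w) _
      (isWeightedHomogeneous_map (algebraMap k κ) hV)) ?_ p
  intro q hq hUV hle f hf hf2
  rw [Ideal.mk_ker] at hle hf ⊢
  have : Smooth (projToSpec k (quotientGrading (weightedHomogeneousSubmodule k w)
    (Ideal.span {F}))) := hsm
  exact exists_mul_mem_of_formallySmooth_away
    (quotientGrading (weightedHomogeneousSubmodule k w) (Ideal.span {F}))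
    (Ideal.Quotient.mkₐ k (Ideal.span {F})) (Ideal.Quotient.mkₐ_surjective _ _)
    (Ideal.Quotient.mkₐ_ker k (Ideal.span {F})) hU' hV'
    (formallySmooth_away _ (mul_mem_add_one_add hU' hV') (by omega)) hUV rfl hle f hf hf2

/-- Here `U = T` and `V = 1`, of degrees one and zero, so the chart is the affine hypersurface `F =
1`. -/
theorem isRegularLocalRing_away_suspend {κ : Type u} [Field κ] {m r : ℕ} {w : Fin m → ℕ}
    {F : MvPolynomial (Fin m) κ} (hF : IsWeightedHomogeneous w F r) (hr : (r : κ) ≠ 0) :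
    letI := quotientGradedAlgebra (weightedHomogeneousSubmodule κ (Fin.snoc w 1 : Fin (m + 1) → ℕ))
      _ (isHomogeneous_span (isWeightedHomogeneous_suspend hF))
    ∀ (p : Ideal (Away (quotientGrading (weightedHomogeneousSubmodule κ
        (Fin.snoc w 1 : Fin (m + 1) → ℕ)) (Ideal.span {suspend r F}))
      (Ideal.Quotient.mk (Ideal.span {suspend r F}) (X (Fin.last m)) *
        Ideal.Quotient.mk (Ideal.span {suspend r F}) 1))) [p.IsPrime],
      IsRegularLocalRing (Localization.AtPrime p) := by
  let _ := quotientGradedAlgebra (weightedHomogeneousSubmodule κ (Fin.snoc w 1 : Fin (m + 1) → ℕ))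
      _ (isHomogeneous_span (isWeightedHomogeneous_suspend hF))
  intro p hp
  have hX : IsWeightedHomogeneous (Fin.snoc w 1 : Fin (m + 1) → ℕ)
      (X (Fin.last m) : MvPolynomial (Fin (m + 1)) κ) (0 + 1) := by
    simpa using isWeightedHomogeneous_X κ (Fin.snoc w 1 : Fin (m + 1) → ℕ) (Fin.last m)
  refine isRegularLocalRing_away_of_surjective _ (Ideal.Quotient.mk _)
    Ideal.Quotient.mk_surjective (m := 0) (mk_mem_quotientGrading _ hX)
    (mk_mem_quotientGrading _ (isWeightedHomogeneous_one κ _)) ?_ p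
  intro q hq hUV hle f hf hf2
  rw [Ideal.mk_ker] at hle hf ⊢
  refine exists_mul_mem_suspend hF hr hle ?_ f hf hf2
  rw [Ideal.span_insert]

end ChartRegularity

/-! ### Initial forms for weighted filtrations -/

section InitialForms

open MvPolynomial

/-- All monomials of `p` have weighted degree at least `j`. -/
def HasWeightedOrder {σ A : Type*} [CommSemiring A] (w : σ → ℕ) (j : ℕ) (p : MvPolynomial σ A) :
    Prop :=
  ∀ b, p.coeff b ≠ 0 → j ≤ Finsupp.weight w b

namespace HasWeightedOrder

variable {σ A : Type*} [CommRing A] {w : σ → ℕ} {i j : ℕ} {p q : MvPolynomial σ A}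

theorem coeff_eq_zero (hp : HasWeightedOrder w j p) {b : σ →₀ ℕ} (hb : Finsupp.weight w b < j) :
    p.coeff b = 0 := by
  by_contra h
  exact (hp b h).not_gt hb

theorem zero : HasWeightedOrder w j (0 : MvPolynomial σ A) := fun b hb => absurd (coeff_zero b) hb

theorem bot (p : MvPolynomial σ A) : HasWeightedOrder w 0 p := fun _ _ => Nat.zero_le _

theorem mono (hp : HasWeightedOrder w j p) (h : i ≤ j) : HasWeightedOrder w i p :=
  fun b hb => h.trans (hp b hb)

theorem add (hp : HasWeightedOrder w j p) (hq : HasWeightedOrder w j q) :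
    HasWeightedOrder w j (p + q) := fun b hb => by
  by_cases h : p.coeff b = 0
  · refine hq b fun h' => hb ?_
    rw [coeff_add, h, h', add_zero]
  · exact hp b h

theorem neg (hp : HasWeightedOrder w j p) : HasWeightedOrder w j (-p) := fun b hb =>
  hp b fun h => hb (by rw [coeff_neg, h, neg_zero])

theorem sub (hp : HasWeightedOrder w j p) (hq : HasWeightedOrder w j q) :
    HasWeightedOrder w j (p - q) := by
  rw [sub_eq_add_neg]
  exact hp.add hq.neg

theorem sum {ι : Type*} {s : Finset ι} {f : ι → MvPolynomial σ A}
    (h : ∀ i ∈ s, HasWeightedOrder w j (f i)) : HasWeightedOrder w j (∑ i ∈ s, f i) := by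
  classical
  induction s using Finset.induction_on with
  | empty => exact zero
  | insert a s ha ih =>
    rw [Finset.sum_insert ha]
    exact (h a (Finset.mem_insert_self a s)).add
      (ih fun i hi => h i (Finset.mem_insert_of_mem hi))

theorem mul (hp : HasWeightedOrder w i p) (hq : HasWeightedOrder w j q) :
    HasWeightedOrder w (i + j) (p * q) := fun b hb => by
  classical
  rw [coeff_mul] at hb
  obtain ⟨⟨c, d⟩, hcd, h⟩ := Finset.exists_ne_zero_of_sum_ne_zero hb
  rw [← Finset.HasAntidiagonal.mem_antidiagonal.mp hcd, map_add]
  exact add_le_add (hp c (left_ne_zero_of_mul h)) (hq d (right_ne_zero_of_mul h))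

theorem of_isWeightedHomogeneous (hp : IsWeightedHomogeneous w p j) : HasWeightedOrder w j p :=
  fun _ hb => (hp hb).ge

theorem monomial {b : σ →₀ ℕ} (c : A) (hb : j ≤ Finsupp.weight w b) :
    HasWeightedOrder w j (MvPolynomial.monomial b c) := fun b' hb' => by
  classical
  rw [coeff_monomial] at hb'
  split_ifs at hb' with h
  · exact h ▸ hb
  · exact absurd rfl hb'

theorem map {B : Type*} [CommRing B] (φ : A →+* B) (hp : HasWeightedOrder w j p) :
    HasWeightedOrder w j (MvPolynomial.map φ p) := fun b hb =>
  hp b fun h => hb (by rw [coeff_map, h, map_zero])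

theorem sub_weightedHomogeneousComponent (hp : HasWeightedOrder w j p) :
    HasWeightedOrder w (j + 1) (p - weightedHomogeneousComponent w j p) := fun b hb => by
  classical
  rw [coeff_sub, coeff_weightedHomogeneousComponent] at hb
  split_ifs at hb with h
  · exact absurd (sub_self _) hb
  · rw [sub_zero] at hb
    exact lt_of_le_of_ne (hp b hb) (Ne.symm h)

theorem weightedHomogeneousComponent_mul (hp : HasWeightedOrder w i p)
    (hq : HasWeightedOrder w j q) :
    weightedHomogeneousComponent w (i + j) (p * q) =
      weightedHomogeneousComponent w i p * weightedHomogeneousComponent w j q := by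
  have h1 : weightedHomogeneousComponent w (i + j) (p * q -
      weightedHomogeneousComponent w i p * weightedHomogeneousComponent w j q) = 0 := by
    refine weightedHomogeneousComponent_eq_zero' _ _ fun b hb h => ?_
    have h2 : HasWeightedOrder w (i + j + 1) (p * q -
        weightedHomogeneousComponent w i p * weightedHomogeneousComponent w j q) := by
      have e : p * q - weightedHomogeneousComponent w i p * weightedHomogeneousComponent w j q =
          (p - weightedHomogeneousComponent w i p) * q +
          weightedHomogeneousComponent w i p * (q - weightedHomogeneousComponent w j q) := by ring
      rw [e]
      refine add ?_ ?_
      · have := hp.sub_weightedHomogeneousComponent.mul hq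
        rwa [add_right_comm] at this
      · have := (of_isWeightedHomogeneous
          (weightedHomogeneousComponent_isWeightedHomogeneous (w := w) i p)).mul
          hq.sub_weightedHomogeneousComponent
        rwa [← add_assoc] at this
    have := h2 b (mem_support_iff.mp hb)
    omega
  rw [map_sub, sub_eq_zero] at h1
  rw [h1]
  exact ((weightedHomogeneousComponent_isWeightedHomogeneous i p).mul
    (weightedHomogeneousComponent_isWeightedHomogeneous j q)).weightedHomogeneousComponent_same

theorem weightedHomogeneousComponent_eq_zero (hp : HasWeightedOrder w j p) (h : i < j) :
    weightedHomogeneousComponent w i p = 0 :=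
  weightedHomogeneousComponent_eq_zero' _ _ fun b hb hb' =>
    (hp b (mem_support_iff.mp hb)).not_gt (hb'.trans_lt h)

end HasWeightedOrder

/-- The ideal of values at `x` of the polynomials of weighted order at least `j`. -/
def orderIdeal {σ A : Type*} [CommRing A] (w : σ → ℕ) (x : σ → A) (j : ℕ) : Ideal A where
  carrier := {y | ∃ p : MvPolynomial σ A, HasWeightedOrder w j p ∧ eval x p = y}
  add_mem' := by
    rintro _ _ ⟨p, hp, rfl⟩ ⟨q, hq, rfl⟩
    exact ⟨p + q, hp.add hq, map_add _ _ _⟩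
  zero_mem' := ⟨0, HasWeightedOrder.zero, map_zero _⟩
  smul_mem' := by
    rintro c _ ⟨p, hp, rfl⟩
    refine ⟨C c * p, ?_, ?_⟩
    · simpa using (HasWeightedOrder.bot (C c)).mul hp
    · rw [map_mul, eval_C, smul_eq_mul]

/-- Weighted quasi-regularity: a relation between monomials in `x` of weighted degree at least `j`
has its coefficients in degree `j` in the ideal `(x)`. -/
def IsQuasiRegular {σ A : Type*} [CommRing A] (w : σ → ℕ) (x : σ → A) : Prop :=
  ∀ (j : ℕ) (p : MvPolynomial σ A), HasWeightedOrder w j p → eval x p = 0 →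
    ∀ b, Finsupp.weight w b = j → p.coeff b ∈ Ideal.span (Set.range x)

/-- A coefficient in `(x)` can be traded for one more variable: writing it as a combination of the
`x i` turns a monomial of weight `j` into monomials of weight at least `j + 1`, the weights being
positive. -/
theorem eval_mem_orderIdeal_succ {σ A : Type*} [CommRing A] {w : σ → ℕ} (hw : ∀ i, 0 < w i)
    {x : σ → A} {j : ℕ} {p : MvPolynomial σ A} (hp : HasWeightedOrder w j p)
    (h : ∀ b, Finsupp.weight w b = j → p.coeff b ∈ Ideal.span (Set.range x)) :
    eval x p ∈ orderIdeal w x (j + 1) := by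
  have key : ∀ b, eval x (monomial b (p.coeff b)) ∈ orderIdeal w x (j + 1) := by
    intro b
    by_cases hb : Finsupp.weight w b = j
    · have h1 : ∀ c ∈ Ideal.span (Set.range x),
          eval x (monomial b c) ∈ orderIdeal w x (j + 1) := by
        intro c hc
        refine Submodule.span_induction (p := fun c _ =>
          eval x (monomial b c) ∈ orderIdeal w x (j + 1)) ?_ ?_ ?_ ?_ hc
        · rintro _ ⟨i, rfl⟩
          refine ⟨monomial b 1 * X i, ?_, ?_⟩
          · refine (HasWeightedOrder.monomial _ hb.ge).mul
              ((HasWeightedOrder.of_isWeightedHomogeneous (isWeightedHomogeneous_X A w i)).mono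
                (hw i))
          · simp only [map_mul, eval_X, eval_monomial]
            ring
        · simp
        · intro a b _ _ ha hb
          rw [map_add, map_add]
          exact add_mem ha hb
        · intro a c _ hc
          rw [smul_eq_mul, ← C_mul_monomial, map_mul]
          exact Ideal.mul_mem_left _ _ hc
      exact h1 _ (h b hb)
    · by_cases h0 : p.coeff b = 0
      · simp [h0]
      · exact ⟨_, HasWeightedOrder.monomial _ (lt_of_le_of_ne (hp b h0) (Ne.symm hb)), rfl⟩
  rw [as_sum p, map_sum]
  exact sum_mem fun b _ => key b

/-- The order of `c` is raised step by step. If `c = q(x)` has order `l < j`, then `y q` minus a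
polynomial of order `j` representing `y * c` is a relation of order `l`, with degree-`l`
coefficients `y` times those of `q`. These lie in `(x)`, hence so do those of `q`, since `y` is
regular modulo `(x)`. -/
theorem IsQuasiRegular.mem_of_mul_mem {σ A : Type*} [CommRing A] {w : σ → ℕ}
    (hw : ∀ i, 0 < w i) {x : σ → A} (hx : IsQuasiRegular w x) {y : A}
    (hy : ∀ c, y * c ∈ Ideal.span (Set.range x) → c ∈ Ideal.span (Set.range x)) {j : ℕ} {c : A}
    (hc : y * c ∈ orderIdeal w x j) : c ∈ orderIdeal w x j := by
  have key : ∀ l ≤ j, c ∈ orderIdeal w x l := by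
    intro l
    induction l with
    | zero => exact fun _ => ⟨C c, HasWeightedOrder.bot _, eval_C _⟩
    | succ l ih =>
      intro hl
      obtain ⟨q, hq, rfl⟩ := ih (by omega)
      obtain ⟨z, hz, hzc⟩ := hc
      refine eval_mem_orderIdeal_succ hw hq fun b hb => hy _ ?_
      have h1 := hx l (C y * q - z) (by
        refine HasWeightedOrder.sub ?_ (hz.mono (by omega))
        simpa using (HasWeightedOrder.bot (C y)).mul hq) (by
        rw [map_sub, map_mul, eval_C, hzc, sub_self]) b hb
      rwa [coeff_sub, coeff_C_mul, hz.coeff_eq_zero (by omega), sub_zero] at h1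
  exact key j le_rfl

/-- A relation in `y` and `x` is expanded in powers of `y`, and the induction is on the number `E`
of powers. Moving `Q 0` to the other side shows that `y S` has order `j`, where `S` is the sum of
the remaining terms divided by `y`. By `IsQuasiRegular.mem_of_mul_mem`, `S` has order `j` too, say
`S = Z(x)`. The relation `Q 0 + y Z` settles the constant term; the others are shifted down. -/
theorem IsQuasiRegular.cons_aux {A : Type*} [CommRing A] {n : ℕ} {w : Fin n → ℕ}
    (hw : ∀ i, 0 < w i) {x : Fin n → A} (hx : IsQuasiRegular w x) {v : ℕ} (hv : 0 < v) {y : A}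
    (hy : ∀ c, y * c ∈ Ideal.span (Set.range x) → c ∈ Ideal.span (Set.range x)) (E : ℕ) :
    ∀ (j : ℕ) (Q : ℕ → MvPolynomial (Fin n) A), (∀ e, HasWeightedOrder w (j - e * v) (Q e)) →
      ∑ e ∈ Finset.range E, y ^ e * eval x (Q e) = 0 →
      ∀ e < E, ∀ b, Finsupp.weight w b + e * v = j →
        (Q e).coeff b ∈ Ideal.span (insert y (Set.range x)) := by
  have hle : Ideal.span (Set.range x) ≤ Ideal.span (insert y (Set.range x)) :=
    Ideal.span_mono (Set.subset_insert _ _)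
  have hymem : y ∈ Ideal.span (insert y (Set.range x)) :=
    Ideal.subset_span (Set.mem_insert _ _)
  induction E with
  | zero => exact fun _ _ _ _ e he => absurd he (Nat.not_lt_zero e)
  | succ E ih =>
    intro j Q hQ hsum
    have hQ0 : HasWeightedOrder w j (Q 0) := by simpa using hQ 0
    rw [Finset.sum_range_succ'] at hsum
    set S := ∑ e ∈ Finset.range E, y ^ e * eval x (Q (e + 1)) with hS
    have hsum' : y * S + eval x (Q 0) = 0 := by
      rw [← hsum, hS, Finset.mul_sum]
      simp only [pow_zero, one_mul, add_left_inj]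
      exact Finset.sum_congr rfl fun e _ => by ring
    have hmem : S ∈ orderIdeal w x j := by
      refine hx.mem_of_mul_mem hw hy ⟨-Q 0, hQ0.neg, ?_⟩
      rw [map_neg, ← add_eq_zero_iff_neg_eq', ← hsum', add_comm]
    obtain ⟨Z, hZ, hZS⟩ := hmem
    have h0 := hx j (Q 0 + C y * Z) (hQ0.add (by
      simpa using (HasWeightedOrder.bot (C y)).mul hZ)) (by
      rw [map_add, map_mul, eval_C, hZS, add_comm, hsum'])
    intro e he b hb
    rcases Nat.eq_zero_or_pos e with rfl | hpos
    · have h1 := h0 b (by simpa using hb)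
      rw [coeff_add, coeff_C_mul] at h1
      have h2 := sub_mem (hle h1) (Ideal.mul_mem_right (Z.coeff b) _ hymem)
      rwa [add_sub_cancel_right] at h2
    · obtain ⟨e, rfl⟩ := Nat.exists_eq_succ_of_ne_zero hpos.ne'
      have hvj : v ≤ j := by
        rw [← hb, Nat.succ_mul]
        omega
      -- The relation `S - Z(x) = 0` has one power of `y` fewer and order `j - v`. Since `Z` has
      -- order `j > j - v`, subtracting it does not affect the coefficients in question.
      let Q' : ℕ → MvPolynomial (Fin n) A := fun i => if i = 0 then Q 1 - Z else Q (i + 1)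
      have hb' : Finsupp.weight w b + e * v = j - v := by
        rw [← hb, Nat.succ_mul]
        omega
      have h3 := ih (j - v) Q' (fun i => by
        by_cases hi : i = 0
        · subst hi
          simp only [Q', if_true, zero_mul, Nat.sub_zero]
          refine HasWeightedOrder.sub ?_ (hZ.mono (Nat.sub_le _ _))
          simpa using hQ 1
        · simp only [Q', hi, if_false]
          have := hQ (i + 1)
          rwa [Nat.succ_mul, add_comm, ← Nat.sub_sub] at this) (by
        rcases Nat.eq_zero_or_pos E with rfl | hE
        · simp
        · obtain ⟨E, rfl⟩ := Nat.exists_eq_succ_of_ne_zero hE.ne'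
          rw [hS, Finset.sum_range_succ'] at hZS
          rw [Finset.sum_range_succ']
          simp only [Q', if_true, Nat.succ_ne_zero, if_false, map_sub, hZS]
          ring) e (by omega) b hb'
      by_cases he0 : e = 0
      · subst he0
        simp only [Q', if_true, coeff_sub] at h3
        rwa [hZ.coeff_eq_zero (by omega), sub_zero] at h3
      · simpa only [Q', he0, if_false] using h3

theorem IsQuasiRegular.cons {A : Type*} [CommRing A] {n : ℕ} {w : Fin n → ℕ}
    (hw : ∀ i, 0 < w i) {x : Fin n → A} (hx : IsQuasiRegular w x) {v : ℕ} (hv : 0 < v) {y : A}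
    (hy : ∀ c, y * c ∈ Ideal.span (Set.range x) → c ∈ Ideal.span (Set.range x)) :
    IsQuasiRegular (Fin.cons v w : Fin (n + 1) → ℕ) (Fin.cons y x : Fin (n + 1) → A) := by
  intro j p hp hpx b hb
  have hweight : ∀ c : Fin (n + 1) →₀ ℕ, Finsupp.weight (Fin.cons v w : Fin (n + 1) → ℕ) c =
      Finsupp.weight w (Finsupp.tail c) + c 0 * v := by
    intro c
    simp [Finsupp.weight_apply, Finsupp.sum_fintype, Fin.sum_univ_succ, Finsupp.tail_apply,
      add_comm]
  have h := IsQuasiRegular.cons_aux hw hx hv hy ((finSuccEquiv A n p).natDegree + 1) j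
    (fun e => (finSuccEquiv A n p).coeff e) (fun e c hc => by
      rw [finSuccEquiv_coeff_coeff] at hc
      have := hp _ hc
      rw [hweight] at this
      simp only [Finsupp.tail_cons, Finsupp.cons_zero] at this
      omega) (by
      rw [← hpx, eval_eq_eval_mv_eval', Polynomial.eval_eq_sum_range'
        (n := (finSuccEquiv A n p).natDegree + 1)
        (lt_of_le_of_lt Polynomial.natDegree_map_le (Nat.lt_succ_self _))]
      simp [mul_comm])
  rw [Fin.range_cons]
  by_cases hb0 : b 0 < (finSuccEquiv A n p).natDegree + 1
  · have := h (b 0) hb0 (Finsupp.tail b) (by rw [← hb, hweight])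
    rwa [finSuccEquiv_coeff_coeff, Finsupp.cons_tail] at this
  · have : (finSuccEquiv A n p).coeff (b 0) = 0 :=
      Polynomial.coeff_eq_zero_of_natDegree_lt (by omega)
    have h2 : p.coeff b = 0 := by
      rw [← Finsupp.cons_tail b, ← finSuccEquiv_coeff_coeff, this, coeff_zero]
    rw [h2]
    exact zero_mem _

end InitialForms

/-! ### Quasi-regularity of regular sequences, and division of initial forms -/

section QuasiRegular

open MvPolynomial

theorem IsQuasiRegular.comp_equiv {σ σ' A : Type*} [CommRing A] {w : σ → ℕ} {x : σ → A}
    (hx : IsQuasiRegular w x) (e : σ' ≃ σ) : IsQuasiRegular (w ∘ e) (x ∘ e) := by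
  have hweight : ∀ b : σ' →₀ ℕ,
      Finsupp.weight w (Finsupp.mapDomain e b) = Finsupp.weight (w ∘ e) b := by
    intro b
    simp [Finsupp.weight_apply, Finsupp.sum_mapDomain_index, add_mul]
  intro j p hp hpx b hb
  have h := hx j (rename e p) (fun c hc => by
    obtain ⟨c, rfl, hc⟩ := coeff_rename_ne_zero _ _ _ hc
    rw [hweight]
    exact hp c fun h => hc (by rw [coeff_rename_mapDomain _ e.injective, h])) (by rw [eval_rename, hpx])
      (Finsupp.mapDomain e b) (by rw [hweight, hb])
  rwa [coeff_rename_mapDomain _ e.injective, ← e.surjective.range_comp x] at h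

/-- Quasi-regularity is extended by an element regular modulo all the previous ones, so the first
member of the sequence must come last; over a noetherian local ring a regular sequence may be
permuted. -/
theorem isQuasiRegular_of_isWeaklyRegular {A : Type*} [CommRing A] [IsLocalRing A]
    [IsNoetherianRing A] {n : ℕ} {w : Fin n → ℕ} (hw : ∀ i, 0 < w i) {x : Fin n → A}
    (hxm : ∀ i, x i ∈ IsLocalRing.maximalIdeal A)
    (hx : RingTheory.Sequence.IsWeaklyRegular A (List.ofFn x)) : IsQuasiRegular w x := by
  induction n with
  | zero =>
    intro j p _ hpx b _
    obtain rfl : b = 0 := Subsingleton.elim _ _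
    rw [eq_C_of_isEmpty p, eval_C] at hpx
    rw [hpx]
    exact zero_mem _
  | succ n ih =>
    rw [List.ofFn_succ] at hx
    have hperm : RingTheory.Sequence.IsWeaklyRegular A
        (List.ofFn (fun i => x (Fin.succ i)) ++ [x 0]) := by
      refine IsLocalRing.isWeaklyRegular_of_perm_of_subset_maximalIdeal hx
        (List.perm_append_singleton _ _).symm ?_
      intro r hr
      rcases List.mem_cons.mp hr with rfl | hr
      · exact hxm 0
      · obtain ⟨i, rfl⟩ := List.mem_ofFn.mp hr
        exact hxm _
    rw [RingTheory.Sequence.isWeaklyRegular_append_iff,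
      RingTheory.Sequence.isWeaklyRegular_singleton_iff] at hperm
    have hlist : Ideal.ofList (List.ofFn fun i => x (Fin.succ i)) =
        Ideal.span (Set.range fun i => x (Fin.succ i)) := by
      rw [Ideal.ofList]
      congr 1
      ext y
      simp [List.mem_ofFn]
    have := IsQuasiRegular.cons (fun i => hw (Fin.succ i))
      (ih (w := fun i => w (Fin.succ i)) (fun i => hw (Fin.succ i)) (fun i => hxm _) hperm.1)
      (hw 0) (y := x 0) (fun c hc => by
        have h0 : x 0 • (Submodule.Quotient.mk c : A ⧸
            (Ideal.ofList (List.ofFn fun i => x (Fin.succ i)) • ⊤ : Submodule A A)) = 0 := by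
          rw [← Submodule.Quotient.mk_smul, Submodule.Quotient.mk_eq_zero, hlist, smul_eq_mul,
            smul_eq_mul, Ideal.mul_top]
          exact hc
        have h1 := hperm.2 (h0.trans (smul_zero _).symm)
        rwa [Submodule.Quotient.mk_eq_zero, hlist, smul_eq_mul, Ideal.mul_top] at h1)
    have e1 : (Fin.cons (w 0) fun i => w (Fin.succ i) : Fin (n + 1) → ℕ) = w := Fin.cons_self_tail w
    have e2 : (Fin.cons (x 0) fun i => x (Fin.succ i) : Fin (n + 1) → A) = x := Fin.cons_self_tail x
    rwa [e1, e2] at this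

/-- The coefficients of `X ^ e` in a relation over `A[X]` form a relation over `A`, because the
elements substituted are constants. -/
theorem IsQuasiRegular.polynomial {σ A : Type*} [CommRing A] {w : σ → ℕ} {x : σ → A}
    (hx : IsQuasiRegular w x) : IsQuasiRegular w fun i => Polynomial.C (x i) := by
  intro j p hp hpx b hb
  rw [Set.range_comp' Polynomial.C, ← Ideal.map_span, Ideal.mem_map_C_iff]
  intro e
  let pe : MvPolynomial σ A := ∑ b ∈ p.support, monomial b ((p.coeff b).coeff e)
  have hpe : ∀ b, pe.coeff b = (p.coeff b).coeff e := by
    classical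
    intro b
    simp only [pe, coeff_sum, coeff_monomial, Finset.sum_ite_eq']
    split_ifs with h
    · rfl
    · rw [notMem_support_iff.mp h, Polynomial.coeff_zero]
  have h := hx j pe (fun b hb => hp b fun h => hb (by rw [hpe, h, Polynomial.coeff_zero])) (by
    have h0 := congrArg (Polynomial.coeff · e) hpx
    simp only [Polynomial.coeff_zero] at h0
    conv_rhs => rw [← h0, as_sum p]
    rw [map_sum, map_sum, Polynomial.finsetSum_coeff]
    refine Finset.sum_congr rfl fun b _ => ?_
    rw [eval_monomial, eval_monomial, Finsupp.prod, Finsupp.prod]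
    simp only [← Polynomial.C_pow, ← map_prod, Polynomial.coeff_mul_C]) b hb
  rwa [hpe] at h

theorem IsQuasiRegular.snoc_X {A : Type*} [CommRing A] {n : ℕ} {w : Fin n → ℕ}
    (hw : ∀ i, 0 < w i) {x : Fin n → A} (hx : IsQuasiRegular w x) :
    IsQuasiRegular (Fin.snoc w 1 : Fin (n + 1) → ℕ)
      (Fin.snoc (fun i => Polynomial.C (x i)) Polynomial.X : Fin (n + 1) → Polynomial A) := by
  have h := (IsQuasiRegular.cons hw hx.polynomial one_pos (y := Polynomial.X) (fun c hc => by
    rw [Set.range_comp' (⇑Polynomial.C), ← Ideal.map_span, Ideal.mem_map_C_iff] at hc ⊢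
    intro e
    have := hc (e + 1)
    rwa [Polynomial.coeff_X_mul] at this)).comp_equiv
      (finSuccEquivLast.trans (finSuccEquiv n).symm)
  convert h using 1
  · funext i
    refine Fin.lastCases ?_ (fun i => ?_) i <;> simp
  · funext i
    refine Fin.lastCases ?_ (fun i => ?_) i <;> simp

theorem weightedHomogeneous_map {σ A B : Type*} [CommRing A] [CommRing B] {w : σ → ℕ} {r : ℕ}
    {p : MvPolynomial σ A} (φ : A →+* B) (hp : IsWeightedHomogeneous w p r) :
    IsWeightedHomogeneous w (map φ p) r := fun _ hb =>
  hp fun h => hb (by rw [coeff_map, h, map_zero])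

/-- The initial forms of the polynomials of weighted order at least `j` in `T` that vanish at `z`
modulo the value of `Ψ` are the multiples of the initial form of `Ψ`. -/
theorem IsQuasiRegular.dvd_weightedHomogeneousComponent {σ B κ : Type*} [CommRing B] [Field κ]
    {w : σ → ℕ} (hw : ∀ i, 0 < w i) {z : σ → B} (hz : IsQuasiRegular w z) (ρ : B →+* κ)
    (hρ : RingHom.ker ρ = Ideal.span (Set.range z)) {r : ℕ} {Ψ : MvPolynomial σ B}
    (hΨ : IsWeightedHomogeneous w Ψ r) (hΨ0 : map ρ Ψ ≠ 0) {j : ℕ} {p : MvPolynomial σ B}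
    (hp : HasWeightedOrder w j p) {c : B} (hpc : eval z p = c * eval z Ψ) :
    map ρ Ψ ∣ weightedHomogeneousComponent w j (map ρ p) := by
  have hinit : ∀ {l : ℕ} {q : MvPolynomial σ B}, HasWeightedOrder w l q → eval z q = 0 →
      weightedHomogeneousComponent w l (map ρ q) = 0 := by
    classical
    intro l q hq hqz
    ext b
    rw [coeff_weightedHomogeneousComponent, coeff_zero]
    split_ifs with h
    · rw [coeff_map, ← RingHom.mem_ker, hρ]
      exact hz l q hq hqz b h
    · rfl
  have hΨ' := weightedHomogeneous_map ρ hΨ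
  -- The order of `c` is at least `j - r`: as long as it is smaller, the product of the forms of `c`
  -- and `Ψ` vanishes in a polynomial ring over a field, where the form of `Ψ` is nonzero, so the
  -- form of `c` vanishes and its order goes up.
  have key : ∀ l, l + r ≤ j → c ∈ orderIdeal w z l := by
    intro l
    induction l with
    | zero => exact fun _ => ⟨C c, HasWeightedOrder.bot _, eval_C _⟩
    | succ l ih =>
      intro hl
      obtain ⟨q, hq, rfl⟩ := ih (by omega)
      refine eval_mem_orderIdeal_succ hw hq fun b hb => ?_
      have h1 := hinit (l := l + r) (q := q * Ψ - p)
        ((hq.mul (HasWeightedOrder.of_isWeightedHomogeneous hΨ)).sub (hp.mono (by omega)))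
        (by rw [map_sub, map_mul, hpc, sub_self])
      rw [map_sub, map_sub, map_mul, (hp.map ρ).weightedHomogeneousComponent_eq_zero (by omega),
        sub_zero, (hq.map ρ).weightedHomogeneousComponent_mul
          (HasWeightedOrder.of_isWeightedHomogeneous hΨ'),
        hΨ'.weightedHomogeneousComponent_same, mul_eq_zero] at h1
      have h2 := congrArg (coeff b) (h1.resolve_right hΨ0)
      classical
      rw [coeff_weightedHomogeneousComponent, if_pos hb, coeff_map, coeff_zero,
        ← RingHom.mem_ker, hρ] at h2
      exact h2
  by_cases hrj : r ≤ j
  · obtain ⟨q, hq, hqc⟩ := key (j - r) (by omega)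
    have h1 := hinit (l := j) (q := p - q * Ψ)
        (hp.sub ((hq.mul (HasWeightedOrder.of_isWeightedHomogeneous hΨ)).mono (by omega)))
        (by rw [map_sub, map_mul, hpc, hqc, sub_self])
    have h2 := (hq.map ρ).weightedHomogeneousComponent_mul
          (HasWeightedOrder.of_isWeightedHomogeneous hΨ')
    rw [Nat.sub_add_cancel hrj] at h2
    rw [map_sub, map_sub, map_mul, sub_eq_zero, h2, hΨ'.weightedHomogeneousComponent_same] at h1
    exact h1 ▸ dvd_mul_left _ _
  -- For `j < r` the product `c * Ψ` has no component in degree `j`, so the component of `p`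
  -- vanishes.
  · have h1 := hinit (l := j) (q := p - C c * Ψ) (hp.sub (by
      refine HasWeightedOrder.mono (j := 0 + r) ?_ (by omega)
      exact (HasWeightedOrder.bot (C c)).mul (HasWeightedOrder.of_isWeightedHomogeneous hΨ)))
      (by rw [map_sub, map_mul, eval_C, hpc, sub_self])
    have h2 : HasWeightedOrder w r (map ρ (C c * Ψ)) := by
      have := ((HasWeightedOrder.bot (w := w) (C c)).mul
        (HasWeightedOrder.of_isWeightedHomogeneous hΨ)).map ρ
      rwa [zero_add] at this
    rw [map_sub, map_sub, h2.weightedHomogeneousComponent_eq_zero (by omega), sub_zero] at h1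
    rw [h1]
    exact dvd_zero _

end QuasiRegular

/-! ### The Rees algebra of a weighted filtration -/

section Rees

open MvPolynomial

section Basic

variable {A : Type u} [CommRing A] {N : ℕ} (w : Fin N → ℕ) (z : Fin N → A)

theorem mul_mem_orderIdeal {i j : ℕ} {a b : A} (ha : a ∈ orderIdeal w z i)
    (hb : b ∈ orderIdeal w z j) : a * b ∈ orderIdeal w z (i + j) := by
  obtain ⟨p, hp, rfl⟩ := ha
  obtain ⟨q, hq, rfl⟩ := hb
  exact ⟨p * q, hp.mul hq, map_mul _ _ _⟩

theorem pow_mem_orderIdeal {i : ℕ} {a : A} (ha : a ∈ orderIdeal w z i) (n : ℕ) :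
    a ^ n ∈ orderIdeal w z (n * i) := by
  obtain ⟨p, hp, rfl⟩ := ha
  refine ⟨p ^ n, ?_, map_pow _ _ _⟩
  induction n with
  | zero => simpa using HasWeightedOrder.bot _
  | succ n ih =>
    rw [pow_succ, Nat.succ_mul]
    exact ih.mul hp

theorem mem_orderIdeal_zero (a : A) : a ∈ orderIdeal w z 0 :=
  ⟨C a, HasWeightedOrder.bot _, eval_C a⟩

theorem orderIdeal_anti {i j : ℕ} (h : i ≤ j) : orderIdeal w z j ≤ orderIdeal w z i := by
  rintro _ ⟨p, hp, rfl⟩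
  exact ⟨p, hp.mono h, rfl⟩

theorem mem_orderIdeal_self (i : Fin N) : z i ∈ orderIdeal w z (w i) :=
  ⟨X i, HasWeightedOrder.of_isWeightedHomogeneous (isWeightedHomogeneous_X A w i), eval_X i⟩

/-- The Rees algebra `⨁ I_j u ^ j` of the filtration by weighted order. -/
def weightedRees : Subalgebra A (Polynomial A) where
  carrier := {p | ∀ j, p.coeff j ∈ orderIdeal w z j}
  mul_mem' := fun {p q} hp hq j => by
    rw [Polynomial.coeff_mul]
    refine sum_mem fun c hc => ?_
    rw [← Finset.HasAntidiagonal.mem_antidiagonal.mp hc]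
    exact mul_mem_orderIdeal w z (hp _) (hq _)
  add_mem' := fun {p q} hp hq j => by
    rw [Polynomial.coeff_add]
    exact add_mem (hp j) (hq j)
  algebraMap_mem' := fun a j => by
    rw [Polynomial.algebraMap_apply, Polynomial.coeff_C]
    split_ifs with h
    · subst h
      exact mem_orderIdeal_zero w z _
    · exact zero_mem _

/-- The element `a u ^ j` of the Rees algebra. -/
def reesMonomial {j : ℕ} {a : A} (ha : a ∈ orderIdeal w z j) : weightedRees w z :=
  ⟨Polynomial.monomial j a, fun i => by
    rw [Polynomial.coeff_monomial]
    split_ifs with h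
    · exact h ▸ ha
    · exact zero_mem _⟩

/-- The grading of the Rees algebra. -/
def reesGrading (j : ℕ) : Submodule A (weightedRees w z) where
  carrier := {p | ∀ i, i ≠ j → p.1.coeff i = 0}
  add_mem' := fun {p q} hp hq i hi => by
    change (p.1 + q.1).coeff i = 0
    rw [Polynomial.coeff_add, hp i hi, hq i hi, add_zero]
  zero_mem' := fun i _ => Polynomial.coeff_zero i
  smul_mem' := fun c p hp i hi => by
    change (c • p.1).coeff i = 0
    rw [Polynomial.coeff_smul, hp i hi, smul_zero]

variable {w z}

theorem reesMonomial_mem {j : ℕ} {a : A} (ha : a ∈ orderIdeal w z j) :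
    reesMonomial w z ha ∈ reesGrading w z j := fun i hi => by
  change (Polynomial.monomial j a).coeff i = 0
  rw [Polynomial.coeff_monomial, if_neg hi.symm]

theorem eq_reesMonomial {j : ℕ} {p : weightedRees w z} (hp : p ∈ reesGrading w z j) :
    p = reesMonomial w z (p.2 j) := by
  refine Subtype.ext (Polynomial.ext fun i => ?_)
  change _ = (Polynomial.monomial j (p.1.coeff j)).coeff i
  rw [Polynomial.coeff_monomial]
  split_ifs with h
  · rw [h]
  · exact hp i (Ne.symm h)

theorem reesMonomial_mul {i j : ℕ} {a b : A} (ha : a ∈ orderIdeal w z i)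
    (hb : b ∈ orderIdeal w z j) : reesMonomial w z ha * reesMonomial w z hb =
      reesMonomial w z (mul_mem_orderIdeal w z ha hb) :=
  Subtype.ext (Polynomial.monomial_mul_monomial i j a b)

theorem reesMonomial_pow {i : ℕ} {a : A} (ha : a ∈ orderIdeal w z i) (n : ℕ) :
    reesMonomial w z ha ^ n = reesMonomial w z (pow_mem_orderIdeal w z ha n) :=
  Subtype.ext ((Polynomial.monomial_pow i a n).trans (by
    change _ = Polynomial.monomial (n * i) (a ^ n)
    rw [mul_comm]))

theorem reesMonomial_add {j : ℕ} {a b : A} (ha : a ∈ orderIdeal w z j)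
    (hb : b ∈ orderIdeal w z j) : reesMonomial w z ha + reesMonomial w z hb =
      reesMonomial w z (add_mem ha hb) :=
  Subtype.ext (map_add (Polynomial.monomial j) a b).symm

theorem reesMonomial_eq_zero {j : ℕ} {a : A} (ha : a ∈ orderIdeal w z j) :
    reesMonomial w z ha = 0 ↔ a = 0 :=
  Subtype.ext_iff.trans (Polynomial.monomial_eq_zero_iff a j)

theorem reesMonomial_congr {i j : ℕ} {a b : A} (ha : a ∈ orderIdeal w z i)
    (hb : b ∈ orderIdeal w z j) (hij : i = j) (hab : a = b) :
    reesMonomial w z ha = reesMonomial w z hb := by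
  subst hij hab
  rfl

theorem algebraMap_eq_reesMonomial (a : A) : algebraMap A (weightedRees w z) a =
    reesMonomial w z (mem_orderIdeal_zero w z a) :=
  Subtype.ext (by
    change Polynomial.C a = Polynomial.monomial 0 a
    rw [Polynomial.monomial_zero_left])

instance reesGradedMonoid : SetLike.GradedMonoid (reesGrading w z) where
  one_mem := by
    have h := reesMonomial_mem (mem_orderIdeal_zero w z 1)
    rwa [← algebraMap_eq_reesMonomial, map_one] at h
  mul_mem := by
    intro i j p q hp hq
    rw [eq_reesMonomial hp, eq_reesMonomial hq, reesMonomial_mul]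
    exact reesMonomial_mem _

variable (w z)

theorem reesGrading_isInternal : DirectSum.IsInternal (reesGrading w z) := by
  classical
  have hcoeff : ∀ (x : DirectSum ℕ fun i => reesGrading w z i) (j : ℕ),
      (DirectSum.coeAddMonoidHom (reesGrading w z) x).1.coeff j = (x j).1.1.coeff j := by
    intro x j
    induction x using DirectSum.induction_on with
    | zero => simp
    | of i x =>
      rw [DirectSum.coeAddMonoidHom_of]
      by_cases h : i = j
      · subst h
        rw [DirectSum.of_eq_same]
      · rw [DirectSum.of_eq_of_ne _ _ _ (Ne.symm h), x.2 j (Ne.symm h)]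
        simp
    | add x y hx hy =>
      rw [map_add, DirectSum.add_apply]
      change (_ + _ : Polynomial A).coeff j = (_ + _ : Polynomial A).coeff j
      rw [Polynomial.coeff_add, Polynomial.coeff_add, hx, hy]
  constructor
  · intro x y hxy
    refine DirectSum.ext fun j => Subtype.ext ?_
    rw [eq_reesMonomial (x j).2, eq_reesMonomial (y j).2]
    refine reesMonomial_congr _ _ rfl ?_
    rw [← hcoeff, ← hcoeff, hxy]
  · intro p
    refine ⟨∑ j ∈ p.1.support, DirectSum.of (fun i => reesGrading w z i) j
      ⟨_, reesMonomial_mem (p.2 j)⟩, ?_⟩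
    simp only [map_sum, DirectSum.coeAddMonoidHom_of]
    refine Subtype.ext ?_
    rw [AddSubmonoidClass.coe_finsetSum]
    exact p.1.as_sum_support.symm

instance reesGradedAlgebra : GradedAlgebra (reesGrading w z) where
  toDecomposition := (reesGrading_isInternal w z).chooseDecomposition
  toGradedMonoid := reesGradedMonoid

end Basic

attribute [local instance] MvPolynomial.weightedGradedAlgebra

theorem map_weightedHomogeneousComponent {σ A B : Type*} [CommRing A] [CommRing B] (w : σ → ℕ)
    (φ : A →+* B) (j : ℕ) (p : MvPolynomial σ A) : map φ (weightedHomogeneousComponent w j p) =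
      weightedHomogeneousComponent w j (map φ p) := by
  classical
  ext b
  simp only [coeff_map, coeff_weightedHomogeneousComponent]
  split_ifs <;> simp

theorem weightedHomogeneousComponent_mul_of_le {σ A : Type*} [CommRing A] {w : σ → ℕ} {i j : ℕ}
    {p : MvPolynomial σ A} (hp : IsWeightedHomogeneous w p i) (q : MvPolynomial σ A)
    (hij : i ≤ j) : weightedHomogeneousComponent w j (p * q) =
      p * weightedHomogeneousComponent w (j - i) q := by
  classical
  have h := DirectSum.coe_decompose_mul_of_left_mem_of_le (weightedHomogeneousSubmodule A w)
    (b := q) hp hij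
  have h1 : ∀ (l : ℕ) (f : MvPolynomial σ A), (DirectSum.decompose
      (weightedHomogeneousSubmodule A w) f l : MvPolynomial σ A) =
      weightedHomogeneousComponent w l f := fun l f => decompose'_apply A w f l
  rw [h1, h1] at h
  exact h

/-- A system of elements `z` of weights `w`, together with a weighted homogeneous
polynomial `G` that lifts to a relation between them, such that the
associated graded ring of the filtration by weighted order is the weighted polynomial
ring over the residue field modulo `G`. -/
structure IsInitialSystem {A κ : Type u} [CommRing A] [Field κ] {N : ℕ} (w : Fin N → ℕ)
    (z : Fin N → A) (ρ : A →+* κ) (r : ℕ) (G : MvPolynomial (Fin N) κ) : Prop where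
  weight_pos : ∀ i, 0 < w i
  surjective : Function.Surjective ρ
  ker_eq : RingHom.ker ρ = Ideal.span (Set.range z)
  exists_relation : ∃ Ψ : MvPolynomial (Fin N) A,
    IsWeightedHomogeneous w Ψ r ∧ eval z Ψ = 0 ∧ map ρ Ψ = G
  dvd : ∀ (j : ℕ) (p : MvPolynomial (Fin N) A), HasWeightedOrder w j p → eval z p = 0 →
    G ∣ weightedHomogeneousComponent w j (map ρ p)

namespace IsInitialSystem

variable {A κ : Type u} [CommRing A] [Field κ] {N : ℕ} {w : Fin N → ℕ} {z : Fin N → A}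
  {ρ : A →+* κ} {r : ℕ} {G : MvPolynomial (Fin N) κ} (h : IsInitialSystem w z ρ r G)

/-- The initial form of an element of weighted order at least `j`. -/
def form (_ : IsInitialSystem w z ρ r G) (j : ℕ) (a : orderIdeal w z j) :
    MvPolynomial (Fin N) κ ⧸ Ideal.span {G} :=
  Ideal.Quotient.mk _ (weightedHomogeneousComponent w j (map ρ a.2.choose))

-- The definition of `form` chooses a polynomial; divisibility of the initial forms of relations by
-- `G` makes the class independent of that choice.
include h in
theorem form_eq {j : ℕ} {p : MvPolynomial (Fin N) A} (hp : HasWeightedOrder w j p)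
    (a : orderIdeal w z j) (ha : eval z p = a) :
    h.form j a = Ideal.Quotient.mk _ (weightedHomogeneousComponent w j (map ρ p)) := by
  have hc := a.2.choose_spec
  rw [form, Ideal.Quotient.eq, Ideal.mem_span_singleton, ← map_sub, ← map_sub]
  exact h.dvd j _ (hc.1.sub hp) (by rw [map_sub, hc.2, ha, sub_self])

/-- The homomorphism from the Rees algebra to the associated graded ring. -/
def initialForm : weightedRees w z →+* MvPolynomial (Fin N) κ ⧸ Ideal.span {G} :=
  (DirectSum.toSemiring (fun j =>
    { toFun := fun p : reesGrading w z j => h.form j ⟨p.1.1.coeff j, p.1.2 j⟩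
      map_zero' := by
        rw [h.form_eq HasWeightedOrder.zero _ (map_zero _), map_zero, map_zero, map_zero]
      map_add' := fun p q => by
        obtain ⟨p', hp, hp'⟩ := p.1.2 j
        obtain ⟨q', hq, hq'⟩ := q.1.2 j
        rw [h.form_eq hp ⟨_, p.1.2 j⟩ hp', h.form_eq hq ⟨_, q.1.2 j⟩ hq',
          h.form_eq (hp.add hq) _ (by
          rw [map_add, hp', hq']
          exact (Polynomial.coeff_add p.1.1 q.1.1 j).symm), map_add, map_add, map_add] :
      reesGrading w z j →+ MvPolynomial (Fin N) κ ⧸ Ideal.span {G}})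
    (by
      change h.form 0 _ = 1
      rw [h.form_eq (HasWeightedOrder.bot 1) _ (by
        rw [map_one]
        exact Polynomial.coeff_one_zero.symm), map_one,
        (isWeightedHomogeneous_one κ w).weightedHomogeneousComponent_same, map_one])
    (by
      intro i j p q
      obtain ⟨p', hp, hp'⟩ := p.1.2 i
      obtain ⟨q', hq, hq'⟩ := q.1.2 j
      change h.form (i + j) _ = h.form i _ * h.form j _
      rw [h.form_eq hp _ hp', h.form_eq hq _ hq', h.form_eq (hp.mul hq) _ (by
          rw [map_mul, hp', hq']
          change _ = (p.1 * q.1).1.coeff (i + j)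
          rw [eq_reesMonomial p.2, eq_reesMonomial q.2, reesMonomial_mul]
          change _ = (Polynomial.monomial (i + j) _).coeff (i + j)
          rw [Polynomial.coeff_monomial, if_pos rfl]
          change (Polynomial.monomial i (p.1.1.coeff i)).coeff i *
            (Polynomial.monomial j (q.1.1.coeff j)).coeff j = _
          rw [Polynomial.coeff_monomial, if_pos rfl, Polynomial.coeff_monomial, if_pos rfl]),
        map_mul, (hp.map ρ).weightedHomogeneousComponent_mul (hq.map ρ), map_mul])).comp
    (DirectSum.decomposeRingEquiv (reesGrading w z)).toRingHom

theorem initialForm_reesMonomial {j : ℕ} {a : A} (ha : a ∈ orderIdeal w z j) :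
    h.initialForm (reesMonomial w z ha) = h.form j ⟨a, ha⟩ := by
  have h1 : (DirectSum.decomposeRingEquiv (reesGrading w z)).toRingHom (reesMonomial w z ha) =
    DirectSum.of (fun i => reesGrading w z i) j ⟨_, reesMonomial_mem ha⟩ :=
    DirectSum.decompose_of_mem _ (reesMonomial_mem ha)
  rw [initialForm, RingHom.comp_apply, h1, DirectSum.toSemiring_of]
  change h.form j _ = h.form j _
  congr 2
  change (Polynomial.monomial j a).coeff j = a
  rw [Polynomial.coeff_monomial, if_pos rfl]

theorem initialForm_eval {j : ℕ} {p : MvPolynomial (Fin N) A} (hp : HasWeightedOrder w j p)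
    (ha : eval z p ∈ orderIdeal w z j) : h.initialForm (reesMonomial w z ha) =
      Ideal.Quotient.mk _ (weightedHomogeneousComponent w j (map ρ p)) := by
  rw [initialForm_reesMonomial, h.form_eq hp _ rfl]

theorem initialForm_self (i : Fin N) :
    h.initialForm (reesMonomial w z (mem_orderIdeal_self w z i)) =
      Ideal.Quotient.mk _ (X i) := by
  rw [initialForm_reesMonomial, h.form_eq (HasWeightedOrder.of_isWeightedHomogeneous
    (isWeightedHomogeneous_X A w i)) _ (eval_X i), map_X,
    (isWeightedHomogeneous_X κ w i).weightedHomogeneousComponent_same]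

/-- This identifies the associated graded ring: the kernel of the initial form in degree `j` is
`I_{j+1}`. If the form of `p` is a multiple of `G`, subtracting a multiple of `Ψ`, which vanishes at
`z`, leaves degree-`j` coefficients in `ker ρ = (z)`, and this raises the order. -/
theorem initialForm_eq_zero_iff {j : ℕ} {a : A} (ha : a ∈ orderIdeal w z j) :
    h.initialForm (reesMonomial w z ha) = 0 ↔ a ∈ orderIdeal w z (j + 1) := by
  classical
  obtain ⟨p, hp, rfl⟩ := id ha
  obtain ⟨Ψ, hΨ, hΨ0, hG⟩ := h.exists_relation
  rw [h.initialForm_eval hp]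
  constructor
  · intro h0
    rw [Ideal.Quotient.eq_zero_iff_mem, Ideal.mem_span_singleton] at h0
    obtain ⟨q, hq⟩ := h0
    rw [← hG] at hq
    obtain ⟨q, rfl⟩ := map_surjective ρ h.surjective q
    -- Only the component of degree `j - r` of the cofactor matters; for `j < r` the form is zero
    -- and the cofactor may be taken to be `0`.
    obtain ⟨q', hq', hq0⟩ : ∃ q', HasWeightedOrder w j (Ψ * q') ∧
        weightedHomogeneousComponent w j (map ρ p) = map ρ (Ψ * q') := by
      have hΨ'' := weightedHomogeneous_map ρ hΨ
      rw [← (weightedHomogeneousComponent_isWeightedHomogeneous j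
        (map ρ p)).weightedHomogeneousComponent_same, hq]
      by_cases hrj : r ≤ j
      · refine ⟨weightedHomogeneousComponent w (j - r) q, ?_, ?_⟩
        · have := (HasWeightedOrder.of_isWeightedHomogeneous hΨ).mul
            (HasWeightedOrder.of_isWeightedHomogeneous
              (weightedHomogeneousComponent_isWeightedHomogeneous (w := w) (j - r) q))
          rwa [Nat.add_sub_cancel' hrj] at this
        · rw [weightedHomogeneousComponent_mul_of_le hΨ'' _ hrj, map_mul,
            map_weightedHomogeneousComponent]
      · refine ⟨0, by simpa using HasWeightedOrder.zero, ?_⟩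
        rw [mul_zero, map_zero]
        refine HasWeightedOrder.weightedHomogeneousComponent_eq_zero (j := r + 0) ?_ (by omega)
        exact (HasWeightedOrder.of_isWeightedHomogeneous hΨ'').mul (HasWeightedOrder.bot _)
    have e : eval z p = eval z (p - Ψ * q') := by
      rw [map_sub, map_mul, hΨ0, zero_mul, sub_zero]
    rw [e]
    refine eval_mem_orderIdeal_succ h.weight_pos (hp.sub hq') fun b hb => ?_
    have h1 := congrArg (coeff b) hq0
    rw [coeff_weightedHomogeneousComponent, if_pos hb] at h1
    rw [← h.ker_eq, RingHom.mem_ker, ← coeff_map, map_sub, coeff_sub, h1, sub_self]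
  · rintro ⟨q, hq, hqp⟩
    have h1 := h.form_eq hp ⟨_, ha⟩ rfl
    have h2 := h.form_eq (hq.mono (Nat.le_succ j)) ⟨_, ha⟩ hqp
    rw [← h1, h2, (hq.map ρ).weightedHomogeneousComponent_eq_zero (Nat.lt_succ_self j), map_zero]

end IsInitialSystem

end Rees

/-! ### Charts of the blowup -/

section Charts

open HomogeneousLocalization

theorem exists_frac_of_surjective {R S A B : Type u} [CommRing R] [CommRing S] [CommRing A]
    [CommRing B] [Algebra R A] [Algebra S B] {𝒜 : ℕ → Submodule R A} [GradedAlgebra 𝒜]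
    {ℬ : ℕ → Submodule S B} [GradedAlgebra ℬ] (f : 𝒜 →+*ᵍ ℬ)
    (hf : ∀ j, ∀ b ∈ ℬ j, ∃ a ∈ 𝒜 j, f a = b) {d : ℕ} {g : A} (hg : g ∈ 𝒜 d) :
    Function.Surjective (Away.map f g) := by
  intro y
  obtain ⟨n, b, hb, rfl⟩ := Away.mk_surjective ℬ (f.map_mem hg) y
  obtain ⟨a, ha, rfl⟩ := hf _ b hb
  exact ⟨Away.mk 𝒜 hg n a ha, Away.map_mk _ _ _ _ _ _⟩

theorem isSMulRegular_of_mul_eq_zero {C : Type*} [CommRing C] {s : C}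
    (h : ∀ c, s * c = 0 → c = 0) : IsSMulRegular C s :=
  isSMulRegular_iff_right_eq_zero_of_smul.mpr h

variable {A : Type u} [CommRing A] {N : ℕ} {w : Fin N → ℕ} {z : Fin N → A}

theorem reesMonomial_eq_iff {i j : ℕ} {a b : A} (ha : a ∈ orderIdeal w z i)
    (hb : b ∈ orderIdeal w z j) (hij : i = j) :
    reesMonomial w z ha = reesMonomial w z hb ↔ a = b := by
  subst hij
  exact Subtype.ext_iff.trans (Polynomial.monomial_injective i).eq_iff

/-! ### Fractions of degree zero in the Rees algebra -/

section Frac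

variable {d : ℕ} {γ : A} (hγ : γ ∈ orderIdeal w z d)

/-- The element `(a u ^ (n d)) / (γ u ^ d) ^ n` of the homogeneous localization of the Rees algebra
away from `γ u ^ d`. -/
def reesFrac (n : ℕ) {a : A} (ha : a ∈ orderIdeal w z (n * d)) :
    Away (reesGrading w z) (reesMonomial w z hγ) :=
  Away.mk _ (reesMonomial_mem hγ) n (reesMonomial w z ha) (reesMonomial_mem ha)

theorem exists_eq_reesFrac (c : Away (reesGrading w z) (reesMonomial w z hγ)) :
    ∃ (n : ℕ) (a : A) (ha : a ∈ orderIdeal w z (n * d)), c = reesFrac hγ n ha := by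
  obtain ⟨n, b, hb, rfl⟩ := Away.mk_surjective _ (reesMonomial_mem hγ) c
  refine ⟨n, b.1.coeff (n * d), b.2 _, ?_⟩
  rw [reesFrac, Away.mk_eq_mk_iff]
  exact ⟨0, by rw [← eq_reesMonomial hb]⟩

theorem reesFrac_eq_iff {n n' : ℕ} {a a' : A} (ha : a ∈ orderIdeal w z (n * d))
    (ha' : a' ∈ orderIdeal w z (n' * d)) : reesFrac hγ n ha = reesFrac hγ n' ha' ↔
      ∃ l, γ ^ l * (γ ^ n' * a) = γ ^ l * (γ ^ n * a') := by
  rw [reesFrac, reesFrac, Away.mk_eq_mk_iff]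
  refine exists_congr fun l => ?_
  simp only [reesMonomial_pow, reesMonomial_mul]
  exact reesMonomial_eq_iff _ _ (by ring)

theorem reesFrac_eq_zero_iff {n : ℕ} {a : A} (ha : a ∈ orderIdeal w z (n * d)) :
    reesFrac hγ n ha = 0 ↔ ∃ l, γ ^ l * a = 0 := by
  rw [reesFrac, Away.mk_eq_zero_iff]
  refine exists_congr fun l => ?_
  simp only [reesMonomial_pow, reesMonomial_mul]
  exact reesMonomial_eq_zero _

theorem reesFrac_mul {n n' : ℕ} {a a' : A} (ha : a ∈ orderIdeal w z (n * d))
    (ha' : a' ∈ orderIdeal w z (n' * d)) : reesFrac hγ n ha * reesFrac hγ n' ha' =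
      reesFrac hγ (n + n') (a := a * a') (by
        rw [add_mul]
        exact mul_mem_orderIdeal w z ha ha') := by
  have e : reesMonomial w z ha * reesMonomial w z ha' = reesMonomial w z (a := a * a')
      (j := (n + n') * d) (by
        rw [add_mul]
        exact mul_mem_orderIdeal w z ha ha') := by
    rw [reesMonomial_mul]
    exact reesMonomial_congr _ _ (add_mul _ _ _).symm rfl
  rw [reesFrac, reesFrac, Away.mk_mul_mk]
  · congr 1
  · rw [e]
    exact reesMonomial_mem _

theorem reesFrac_one : reesFrac hγ 0 (a := 1) (by simpa using mem_orderIdeal_zero w z 1) = 1 := by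
  apply val_injective
  rw [reesFrac, Away.val_mk, val_one, ← Localization.mk_one]
  congr 1
  exact (algebraMap_eq_reesMonomial (1 : A)).symm.trans (map_one _) |>.symm ▸
    reesMonomial_congr _ _ (zero_mul d) rfl

/-- The structure map of the homogeneous localization as an algebra over the base. -/
def reesFracMap : A →+* Away (reesGrading w z) (reesMonomial w z hγ) :=
  (fromZeroRingHom (reesGrading w z) _).comp (algebraMap A (reesGrading w z 0))

theorem reesFracMap_apply (a : A) : reesFracMap hγ a =
    reesFrac hγ 0 (a := a) (by simpa using mem_orderIdeal_zero w z a) := by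
  apply val_injective
  rw [reesFrac, Away.val_mk]
  change Localization.mk (algebraMap A (weightedRees w z) a) 1 = _
  rw [algebraMap_eq_reesMonomial]
  congr 1
  · exact reesMonomial_congr _ _ (zero_mul d).symm rfl

/-- The chart away from `z_i ^ 2 u ^ (w i)` is the localization of the base at `z_i`. -/
theorem isLocalization_reesFracMap {i : Fin N} (hγ : z i * z i ∈ orderIdeal w z (w i)) :
    letI := (reesFracMap hγ).toAlgebra
    IsLocalization.Away (z i) (Away (reesGrading w z) (reesMonomial w z hγ)) := by
  let _ := (reesFracMap hγ).toAlgebra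
  have hz : z i ∈ orderIdeal w z (1 * w i) := by
    rw [one_mul]
    exact mem_orderIdeal_self w z i
  refine IsLocalization.Away.mk (z i) ?_ ?_ ?_
  -- The inverse of `z i` is the fraction `z i / (z i * z i)`, with numerator and denominator both
  -- placed in degree `w i`.
  · have h : reesFracMap hγ (z i) * reesFrac hγ 1 hz = 1 := by
      rw [reesFracMap_apply, reesFrac_mul, ← reesFrac_one hγ, reesFrac_eq_iff]
      exact ⟨0, by ring⟩
    have h' : reesFrac hγ 1 hz * reesFracMap hγ (z i) = 1 := by
      rw [reesFracMap_apply, reesFrac_mul, ← reesFrac_one hγ, reesFrac_eq_iff]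
      exact ⟨0, by ring⟩
    exact ⟨⟨_, _, h, h'⟩, rfl⟩
  · intro c
    obtain ⟨n, a, ha, rfl⟩ := exists_eq_reesFrac hγ c
    refine ⟨2 * n, a, ?_⟩
    change _ * reesFracMap hγ (z i) ^ (2 * n) = reesFracMap hγ a
    rw [← RingHom.map_pow (reesFracMap hγ), reesFracMap_apply, reesFracMap_apply, reesFrac_mul, reesFrac_eq_iff]
    exact ⟨0, by ring⟩
  · intro a b hab
    change reesFracMap hγ a = reesFracMap hγ b at hab
    rw [reesFracMap_apply, reesFracMap_apply, reesFrac_eq_iff] at hab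
    obtain ⟨l, hl⟩ := hab
    refine ⟨2 * l, ?_⟩
    rw [pow_mul, pow_two]
    simpa using hl

end Frac

/-! ### The chart of two elements of consecutive degrees -/

section Chart

variable {e : ℕ} {u v τ : A} (hu : u ∈ orderIdeal w z (e + 1)) (hv : v ∈ orderIdeal w z e)
  (hτ : τ ∈ orderIdeal w z 1)

theorem chart_sq_mem_left (hu : u ∈ orderIdeal w z (e + 1)) :
    u * u ∈ orderIdeal w z (1 * (e + 1 + e)) :=
  orderIdeal_anti w z (by omega) (mul_mem_orderIdeal w z hu hu)

theorem chart_sq_mem_right (hv : v ∈ orderIdeal w z e) (hτ : τ ∈ orderIdeal w z 1) :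
    τ * (v * v) ∈ orderIdeal w z (1 * (e + 1 + e)) := by
  have h := mul_mem_orderIdeal w z hτ (mul_mem_orderIdeal w z hv hv)
  rwa [show 1 + (e + e) = 1 * (e + 1 + e) by ring] at h

/-- The equation of the exceptional divisor on a chart. -/
def chartS : Away (reesGrading w z) (reesMonomial w z (mul_mem_orderIdeal w z hu hv)) :=
  reesFrac _ 1 (chart_sq_mem_left hu)

/-- The equation of the strict transform of the divisor of `τ` on a chart. -/
def chartT : Away (reesGrading w z) (reesMonomial w z (mul_mem_orderIdeal w z hu hv)) :=
  reesFrac _ 1 (chart_sq_mem_right hv hτ)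

theorem chartS_mul_chartT : chartS hu hv * chartT hu hv hτ = reesFracMap _ τ := by
  rw [chartS, chartT, reesFrac_mul, reesFracMap_apply, reesFrac_eq_iff]
  exact ⟨0, by ring⟩

theorem chartT_eq_one (hγ : τ ∈ orderIdeal w z (0 + 1)) (h1 : (1 : A) ∈ orderIdeal w z 0) :
    chartT hγ h1 hτ = 1 := by
  rw [chartT, ← reesFrac_one, reesFrac_eq_iff]
  exact ⟨0, by ring⟩

/-- A relation `s * c = 0` says that a power of `u * v` kills `u² a`; multiplying by `v²` gives a
larger power that kills the numerator `a`. No regularity of elements of `A` is needed. -/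
theorem isSMulRegular_chartS : IsSMulRegular
    (Away (reesGrading w z) (reesMonomial w z (mul_mem_orderIdeal w z hu hv)))
    (chartS hu hv) := by
  refine isSMulRegular_of_mul_eq_zero (C := Away (reesGrading w z)
    (reesMonomial w z (mul_mem_orderIdeal w z hu hv))) fun c hc => ?_
  obtain ⟨n, a, ha, rfl⟩ := exists_eq_reesFrac _ c
  rw [chartS, reesFrac_mul, reesFrac_eq_zero_iff] at hc
  obtain ⟨l, hl⟩ := hc
  rw [reesFrac_eq_zero_iff]
  refine ⟨l + 2, ?_⟩
  calc (u * v) ^ (l + 2) * a = v * v * ((u * v) ^ l * (u * u * a)) := by ring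
    _ = 0 := by rw [hl, mul_zero]

/-- `s ^ (e + 1)` is `u` times the fraction `u ^ (2e + 1) / (uv) ^ (e + 1)`. Thus points of the
chart over the zero locus of `u`, in particular those over the centre, lie on the exceptional
divisor. -/
theorem chartS_mem_of_mem {p : Ideal (Away (reesGrading w z)
    (reesMonomial w z (mul_mem_orderIdeal w z hu hv)))} [p.IsPrime]
    (h : reesFracMap _ u ∈ p) : chartS hu hv ∈ p := by
  have hS : ∀ n, ∃ ha, chartS hu hv ^ n = reesFrac _ n (a := (u * u) ^ n) ha := by
    intro n
    induction n with
    | zero =>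
      have h : (u * u) ^ 0 ∈ orderIdeal w z (0 * (e + 1 + e)) := by
        simpa using mem_orderIdeal_zero w z 1
      refine ⟨h, ?_⟩
      rw [pow_zero (chartS hu hv), ← reesFrac_one, reesFrac_eq_iff]
      exact ⟨0, by ring⟩
    | succ n ih =>
      obtain ⟨ha, ih⟩ := ih
      have h : (u * u) ^ (n + 1) ∈ orderIdeal w z ((n + 1) * (e + 1 + e)) := by
        rw [add_mul, pow_succ]
        exact mul_mem_orderIdeal w z ha (chart_sq_mem_left hu)
      refine ⟨h, ?_⟩
      rw [pow_succ (chartS hu hv), ih, chartS, reesFrac_mul, reesFrac_eq_iff]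
      exact ⟨0, by ring⟩
  have hu' : u ^ (2 * e + 1) ∈ orderIdeal w z ((e + 1) * (e + 1 + e)) := by
    have := pow_mem_orderIdeal w z hu (2 * e + 1)
    rwa [show (2 * e + 1) * (e + 1) = (e + 1) * (e + 1 + e) by ring] at this
  obtain ⟨ha, h1⟩ := hS (e + 1)
  have h2 : chartS hu hv ^ (e + 1) = reesFracMap _ u * reesFrac _ (e + 1) hu' := by
    rw [h1, reesFracMap_apply, reesFrac_mul, reesFrac_eq_iff]
    exact ⟨0, by ring⟩
  exact Ideal.IsPrime.mem_of_pow_mem ‹_› (e + 1) (h2 ▸ Ideal.mul_mem_right _ _ h)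

variable {S Q : Type u} [CommRing S] [CommRing Q] [Algebra S Q] {𝒬 : ℕ → Submodule S Q}
  [GradedAlgebra 𝒬] (θ : reesGrading w z →+*ᵍ 𝒬)

/-- One unit of excess order is one factor `s`: `a / (uv) ^ n` equals `s` times `v² a / (uv) ^ (n +
1)`, whose numerator has the required order exactly because of that excess. -/
theorem reesFrac_mem_of_mem_succ {n : ℕ} {a : A} (ha : a ∈ orderIdeal w z (n * (e + 1 + e)))
    (ha' : a ∈ orderIdeal w z (n * (e + 1 + e) + 1)) :
    reesFrac (mul_mem_orderIdeal w z hu hv) n ha ∈ Ideal.span {chartS hu hv} := by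
  have h : v * v * a ∈ orderIdeal w z ((n + 1) * (e + 1 + e)) := by
    have := mul_mem_orderIdeal w z (mul_mem_orderIdeal w z hv hv) ha'
    rwa [show e + e + (n * (e + 1 + e) + 1) = (n + 1) * (e + 1 + e) by ring] at this
  rw [Ideal.mem_span_singleton]
  refine ⟨reesFrac _ (n + 1) h, ?_⟩
  rw [chartS, reesFrac_mul, reesFrac_eq_iff]
  exact ⟨0, by ring⟩

theorem reesFrac_eq_pow_mul (n l : ℕ) {a : A} (ha : a ∈ orderIdeal w z (n * (e + 1 + e))) :
    ∃ ha', reesFrac (mul_mem_orderIdeal w z hu hv) n ha =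
      reesFrac _ (l + n) (a := (u * v) ^ l * a) ha' := by
  refine ⟨?_, ?_⟩
  · rw [add_mul]
    exact mul_mem_orderIdeal w z (pow_mem_orderIdeal w z (mul_mem_orderIdeal w z hu hv) l) ha
  · rw [reesFrac_eq_iff]
    exact ⟨0, by ring⟩

theorem awayMap_reesFrac_eq_zero_iff {d : ℕ} {γ : A} (hγ : γ ∈ orderIdeal w z d) {n : ℕ} {a : A}
    (ha : a ∈ orderIdeal w z (n * d)) :
    Away.map θ (reesMonomial w z hγ) (reesFrac hγ n ha) = 0 ↔
      ∃ l, ∃ h : γ ^ l * a ∈ orderIdeal w z ((l + n) * d), θ (reesMonomial w z h) = 0 := by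
  rw [reesFrac, Away.map_mk, Away.mk_eq_zero_iff]
  refine exists_congr fun l => ?_
  have h : γ ^ l * a ∈ orderIdeal w z ((l + n) * d) := by
    rw [add_mul]
    exact mul_mem_orderIdeal w z (pow_mem_orderIdeal w z hγ l) ha
  rw [← map_pow, ← map_mul, reesMonomial_pow, reesMonomial_mul, exists_prop_of_true h]
  rw [reesMonomial_congr _ h (by ring) rfl]

section

variable (hθ : ∀ (j : ℕ) (a : A) (ha : a ∈ orderIdeal w z j),
  θ (reesMonomial w z ha) = 0 ↔ a ∈ orderIdeal w z (j + 1))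
include hθ

/-- A fraction is killed when its numerator, after multiplication by a power of `u * v`, has order
exceeding its degree, and such an excess is a factor `s`. -/
theorem ker_awayMap_eq_span_chartS :
    RingHom.ker (Away.map θ (reesMonomial w z (mul_mem_orderIdeal w z hu hv))) =
      Ideal.span {chartS hu hv} := by
  apply le_antisymm
  · intro c hc
    obtain ⟨n, a, ha, rfl⟩ := exists_eq_reesFrac _ c
    rw [RingHom.mem_ker, awayMap_reesFrac_eq_zero_iff] at hc
    obtain ⟨l, h, hl⟩ := hc
    rw [hθ] at hl
    obtain ⟨ha', e⟩ := reesFrac_eq_pow_mul hu hv n l ha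
    rw [e]
    exact reesFrac_mem_of_mem_succ hu hv _ hl
  · rw [Ideal.span_singleton_le_iff_mem, RingHom.mem_ker, chartS, awayMap_reesFrac_eq_zero_iff]
    have h : (u * v) ^ 0 * (u * u) ∈ orderIdeal w z ((0 + 1) * (e + 1 + e)) := by
      rw [pow_zero, one_mul, zero_add]
      exact chart_sq_mem_left hu
    refine ⟨0, h, (hθ _ _ h).mpr ?_⟩
    rw [pow_zero, one_mul]
    refine orderIdeal_anti w z (le_of_eq ?_) (mul_mem_orderIdeal w z hu hu)
    ring

/-- As `(s)` is the kernel of reduction to the associated graded ring, regularity of `T` modulo `s`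
is a question there; `hτ'` says that multiplication by the initial form of `τ` is injective. -/
theorem mem_span_chartS_of_chartT_mul_mem
    (hτ' : ∀ (j : ℕ) (a : A), a ∈ orderIdeal w z j → τ * a ∈ orderIdeal w z (j + 2) →
      a ∈ orderIdeal w z (j + 1))
    (c : Away (reesGrading w z) (reesMonomial w z (mul_mem_orderIdeal w z hu hv)))
    (hc : chartT hu hv hτ * c ∈ Ideal.span {chartS hu hv}) : c ∈ Ideal.span {chartS hu hv} := by
  rw [← ker_awayMap_eq_span_chartS hu hv θ hθ, RingHom.mem_ker] at hc ⊢
  obtain ⟨n, a, ha, rfl⟩ := exists_eq_reesFrac _ c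
  rw [chartT, reesFrac_mul, awayMap_reesFrac_eq_zero_iff] at hc
  obtain ⟨l, h, hl⟩ := hc
  rw [hθ] at hl
  have h' : (u * v) ^ (l + 2) * a ∈ orderIdeal w z ((l + 2 + n) * (e + 1 + e)) := by
    rw [add_mul]
    exact mul_mem_orderIdeal w z (pow_mem_orderIdeal w z (mul_mem_orderIdeal w z hu hv) _) ha
  rw [awayMap_reesFrac_eq_zero_iff]
  refine ⟨l + 2, h', (hθ _ _ h').mpr (hτ' _ _ h' ?_)⟩
  have h2 := mul_mem_orderIdeal w z (mul_mem_orderIdeal w z hu hu) hl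
  have e1 : τ * ((u * v) ^ (l + 2) * a) = u * u * ((u * v) ^ l * (τ * (v * v) * a)) := by ring
  rw [e1]
  exact orderIdeal_anti w z (le_of_eq (by ring)) h2

end

/-- The numerator of a fraction in the kernel is, up to a power of `u * v`, a multiple of `τ` plus a
term of higher order; the first contributes a multiple of `T`, the second a multiple of `s`. -/
theorem ker_awayMap_eq_span_pair
    (hθ : ∀ (j : ℕ) (a : A) (ha : a ∈ orderIdeal w z (j + 1)), θ (reesMonomial w z ha) = 0 →
      ∃ b ∈ orderIdeal w z j, a - τ * b ∈ orderIdeal w z (j + 2))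
    (hθ0 : ∀ (j : ℕ) (a : A) (ha : a ∈ orderIdeal w z j), a ∈ orderIdeal w z (j + 1) →
      θ (reesMonomial w z ha) = 0)
    (hθτ : θ (reesMonomial w z hτ) = 0) :
    RingHom.ker (Away.map θ (reesMonomial w z (mul_mem_orderIdeal w z hu hv))) =
      Ideal.span {chartS hu hv, chartT hu hv hτ} := by
  apply le_antisymm
  · intro c hc
    obtain ⟨n, a, ha, rfl⟩ := exists_eq_reesFrac _ c
    rw [RingHom.mem_ker, awayMap_reesFrac_eq_zero_iff] at hc
    obtain ⟨l, h, hl⟩ := hc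
    have hγ := mul_mem_orderIdeal w z hu hv
    -- The extra factor `u * v` makes the degree positive, as needed to take a factor of degree one
    -- out of it.
    have h1 : (u * v) ^ (l + 1) * a ∈ orderIdeal w z ((l + n) * (e + 1 + e) + (e + e) + 1) := by
      have := mul_mem_orderIdeal w z hγ h
      rw [← mul_assoc, ← pow_succ'] at this
      exact orderIdeal_anti w z (le_of_eq (by ring)) this
    have h2 : θ (reesMonomial w z h1) = 0 := by
      have := congrArg (θ (reesMonomial w z hγ) * ·) hl
      simp only [mul_zero] at this
      rw [← map_mul, reesMonomial_mul] at this
      rw [← this]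
      exact congrArg θ (reesMonomial_congr _ _ (by ring) (by ring))
    obtain ⟨b, hb, hab⟩ := hθ _ _ h1 h2
    obtain ⟨ha', e1⟩ := reesFrac_eq_pow_mul hu hv n (l + 1) ha
    have hb' : u * u * b ∈ orderIdeal w z ((l + n + 1 + 1) * (e + 1 + e)) := by
      have := mul_mem_orderIdeal w z (mul_mem_orderIdeal w z hu hu) hb
      exact orderIdeal_anti w z (by nlinarith) this
    have hτb : τ * b ∈ orderIdeal w z ((l + 1 + n) * (e + 1 + e)) :=
      orderIdeal_anti w z (by nlinarith) (mul_mem_orderIdeal w z hτ hb)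
    have hsub : (u * v) ^ (l + 1) * a - τ * b ∈ orderIdeal w z ((l + 1 + n) * (e + 1 + e)) :=
      sub_mem ha' hτb
    have e2 : reesFrac hγ (l + 1 + n) ha' = reesFrac hγ (l + 1 + n) hsub +
        chartT hu hv hτ * reesFrac hγ _ hb' := by
      have e3 : chartT hu hv hτ * reesFrac hγ _ hb' = reesFrac hγ _ hτb := by
        rw [chartT, reesFrac_mul, reesFrac_eq_iff]
        exact ⟨0, by ring⟩
      rw [e3]
      apply val_injective
      rw [val_add, reesFrac, reesFrac, reesFrac, Away.val_mk, Away.val_mk, Away.val_mk,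
        Localization.add_mk_self, reesMonomial_add]
      congr 1
      exact reesMonomial_congr _ _ rfl (by ring)
    rw [e1, e2]
    refine add_mem (Ideal.span_mono (Set.singleton_subset_iff.mpr (Set.mem_insert _ _))
      (reesFrac_mem_of_mem_succ hu hv _ ?_))
      (Ideal.mul_mem_right _ _ (Ideal.subset_span (Set.mem_insert_of_mem _ rfl)))
    exact orderIdeal_anti w z (le_of_eq (by ring)) hab
  · rw [Ideal.span_le, Set.insert_subset_iff, Set.singleton_subset_iff]
    constructor
    · rw [SetLike.mem_coe, RingHom.mem_ker, chartS, awayMap_reesFrac_eq_zero_iff]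
      have h : (u * v) ^ 0 * (u * u) ∈ orderIdeal w z ((0 + 1) * (e + 1 + e)) := by
        rw [pow_zero, one_mul, zero_add]
        exact chart_sq_mem_left hu
      refine ⟨0, h, hθ0 _ _ h ?_⟩
      rw [pow_zero, one_mul]
      refine orderIdeal_anti w z (le_of_eq ?_) (mul_mem_orderIdeal w z hu hu)
      ring
    · rw [SetLike.mem_coe, RingHom.mem_ker, chartT, awayMap_reesFrac_eq_zero_iff]
      have h : (u * v) ^ 0 * (τ * (v * v)) ∈ orderIdeal w z ((0 + 1) * (e + 1 + e)) := by
        rw [pow_zero, one_mul, zero_add]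
        exact chart_sq_mem_right hv hτ
      refine ⟨0, h, ?_⟩
      have e1 : reesMonomial w z h = reesMonomial w z hτ *
          reesMonomial w z (mul_mem_orderIdeal w z hv hv) := by
        rw [reesMonomial_mul]
        exact reesMonomial_congr _ _ (by ring) (by ring)
      rw [e1, map_mul, hθτ, zero_mul]

end Chart

/-! ### Lifting regularity from the quotient by one or two elements -/

section Parameters

variable {C E : Type u} [CommRing C] [CommRing E]

theorem isSMulRegular_localization {p : Ideal C} [p.IsPrime] {s : C} (hs : IsSMulRegular C s) :
    IsSMulRegular (Localization.AtPrime p) (algebraMap C (Localization.AtPrime p) s) :=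
  hs.of_flat

theorem isRegularLocalRing_localization_quotient_ker {φ : C →+* E} (hφ : Function.Surjective φ)
    (hE : ∀ (q : Ideal E) [q.IsPrime], IsRegularLocalRing (Localization.AtPrime q))
    (p : Ideal C) [p.IsPrime] (hle : RingHom.ker φ ≤ p) : IsRegularLocalRing
      (Localization.AtPrime p ⧸ (RingHom.ker φ).map (algebraMap C (Localization.AtPrime p))) := by
  have hq : (p.map φ).IsPrime := Ideal.map_isPrime_of_surjective hφ hle
  have hcomap : (p.map φ).comap φ = p := by
    rw [Ideal.comap_map_of_surjective' φ hφ, sup_eq_left.mpr hle]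
  have key : ∀ (q : Ideal E) [q.IsPrime], q.comap φ = p → IsRegularLocalRing
      (Localization.AtPrime p ⧸
        (RingHom.ker φ).map (algebraMap C (Localization.AtPrime p))) := by
    rintro q hq' rfl
    have h1 : φ 1 ∉ q := by
      rw [map_one]
      exact hq'.one_notMem
    obtain ⟨ε⟩ := nonempty_localization_quotient_ringEquiv φ (RingHom.ker φ) q
      (fun e => by
        obtain ⟨a, rfl⟩ := hφ e
        exact ⟨a, 1, h1, by simp⟩)
      (fun a ha => ⟨1, h1, by rwa [one_mul]⟩) le_rfl
    have := hE q
    exact IsRegularLocalRing.of_ringEquiv ε.symm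
  exact key _ hcomap

theorem exists_isRegularParameters_of_ker_span {φ : C →+* E} (hφ : Function.Surjective φ)
    {s : C} (hker : RingHom.ker φ = Ideal.span {s}) (hs : IsSMulRegular C s)
    (hE : ∀ (q : Ideal E) [q.IsPrime], IsRegularLocalRing (Localization.AtPrime q))
    (p : Ideal C) [p.IsPrime] (hp : s ∈ p) :
    ∃ (d : ℕ) (x : Fin (d + 1) → Localization.AtPrime p), IsRegularParameters x ∧
      x 0 = algebraMap C _ s := by
  have hle : RingHom.ker φ ≤ p := by rwa [hker, Ideal.span_singleton_le_iff_mem]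
  have := isRegularLocalRing_localization_quotient_ker hφ hE p hle
  rw [hker, Ideal.map_span, Set.image_singleton] at this
  exact exists_isRegularParameters_cons (isSMulRegular_localization hs)

theorem exists_isRegularParameters_cons_cons {B : Type u} [CommRing B] [IsLocalRing B] {s t : B}
    (hs : IsSMulRegular B s) (hsm : s ∈ IsLocalRing.maximalIdeal B)
    (ht : ∀ c, t * c ∈ Ideal.span {s} → c ∈ Ideal.span {s})
    [IsRegularLocalRing (B ⧸ Ideal.span {s, t})] :
    ∃ (d : ℕ) (x : Fin (d + 2) → B), IsRegularParameters x ∧ x 0 = s ∧ x 1 = t := by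
  have hloc := isLocalRing_quotient_span_singleton_of_mem hsm
  have ht' : IsSMulRegular (B ⧸ Ideal.span {s}) (Ideal.Quotient.mk (Ideal.span {s}) t) := by
    refine isSMulRegular_iff_right_eq_zero_of_smul.mpr fun x hx => ?_
    obtain ⟨x, rfl⟩ := Ideal.Quotient.mk_surjective x
    rw [smul_eq_mul, ← map_mul, Ideal.Quotient.eq_zero_iff_mem] at hx
    exact Ideal.Quotient.eq_zero_iff_mem.mpr (ht x hx)
  have e1 : (Ideal.span {t}).map (Ideal.Quotient.mk (Ideal.span {s})) =
      Ideal.span {Ideal.Quotient.mk (Ideal.span {s}) t} := by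
    rw [Ideal.map_span, Set.image_singleton]
  have e2 : Ideal.span {s} ⊔ Ideal.span {t} = Ideal.span {s, t} := by
    rw [← Ideal.span_union, Set.singleton_union]
  have : IsRegularLocalRing ((B ⧸ Ideal.span {s}) ⧸
      Ideal.span {Ideal.Quotient.mk (Ideal.span {s}) t}) :=
    IsRegularLocalRing.of_ringEquiv (((Ideal.quotEquivOfEq e1.symm).trans
      (DoubleQuot.quotQuotEquivQuotSup (Ideal.span {s}) (Ideal.span {t}))).trans
      (Ideal.quotEquivOfEq e2)).symm
  obtain ⟨d, x, hx, hx0⟩ := exists_isRegularParameters_cons ht'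
  choose y hy using fun i : Fin d => Ideal.Quotient.mk_surjective (x i.succ)
  refine ⟨d, Fin.cons s (Fin.cons t y), IsRegularParameters.cons hs (d := d + 1) ?_, rfl, rfl⟩
  convert hx using 1
  funext i
  refine Fin.cases ?_ (fun i => ?_) i
  · exact hx0.symm
  · exact hy i

theorem exists_isRegularParameters_of_ker_span_pair {φ : C →+* E} (hφ : Function.Surjective φ)
    {s t : C} (hker : RingHom.ker φ = Ideal.span {s, t}) (hs : IsSMulRegular C s)
    (ht : ∀ c, t * c ∈ Ideal.span {s} → c ∈ Ideal.span {s})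
    (hE : ∀ (q : Ideal E) [q.IsPrime], IsRegularLocalRing (Localization.AtPrime q))
    (p : Ideal C) [p.IsPrime] (hp : s ∈ p) (hp' : t ∈ p) :
    ∃ (d : ℕ) (x : Fin (d + 2) → Localization.AtPrime p), IsRegularParameters x ∧
      x 0 = algebraMap C _ s ∧ x 1 = algebraMap C _ t := by
  have hle : RingHom.ker φ ≤ p := by
    rw [hker, Ideal.span_le, Set.insert_subset_iff, Set.singleton_subset_iff]
    exact ⟨hp, hp'⟩
  have := isRegularLocalRing_localization_quotient_ker hφ hE p hle
  rw [hker, Ideal.map_span, Set.image_pair] at this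
  refine exists_isRegularParameters_cons_cons (isSMulRegular_localization hs) ?_ ?_
  · exact (IsLocalization.AtPrime.to_map_mem_maximal_iff _ p s).mpr hp
  · intro c hc
    obtain ⟨c, b, rfl⟩ := IsLocalization.exists_mk'_eq p.primeCompl c
    rw [IsLocalization.mul_mk'_eq_mk'_of_mul,
      ← Set.image_singleton, ← Ideal.map_span, IsLocalization.mk'_mem_map_algebraMap_iff] at hc
    obtain ⟨v, hv, hvc⟩ := hc
    rw [← Set.image_singleton, ← Ideal.map_span, IsLocalization.mk'_mem_map_algebraMap_iff]
    exact ⟨v, hv, ht _ (by rwa [mul_left_comm])⟩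

end Parameters

end Charts

/-! ### The exceptional divisor in the associated graded ring -/

section Exceptional

open MvPolynomial

attribute [local instance] MvPolynomial.weightedGradedAlgebra

theorem irrelevant_le_map {R S A B : Type u} [CommRing R] [CommRing S] [CommRing A]
    [CommRing B] [Algebra R A] [Algebra S B] {𝒜 : ℕ → Submodule R A} [GradedAlgebra 𝒜]
    {ℬ : ℕ → Submodule S B} [GradedAlgebra ℬ] (f : 𝒜 →+*ᵍ ℬ)
    (hf : ∀ j, ∀ b ∈ ℬ j, ∃ a ∈ 𝒜 j, f a = b) :
    HomogeneousIdeal.irrelevant ℬ ≤ (HomogeneousIdeal.irrelevant 𝒜).map f := by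
  rw [HomogeneousIdeal.irrelevant_le]
  intro i hi b hb
  obtain ⟨a, ha, rfl⟩ := hf i b hb
  exact Ideal.mem_map_of_mem _ (HomogeneousIdeal.mem_irrelevant_of_mem 𝒜 hi ha)

namespace IsInitialSystem

variable {A κ : Type u} [CommRing A] [Field κ]

section

variable {N : ℕ} {w : Fin N → ℕ} {z : Fin N → A}
  {ρ : A →+* κ} {r : ℕ} {G : MvPolynomial (Fin N) κ} (h : IsInitialSystem w z ρ r G)

theorem exists_initialForm_eq (j : ℕ) (P : MvPolynomial (Fin N) κ) :
    ∃ (b : A) (hb : b ∈ orderIdeal w z j), h.initialForm (reesMonomial w z hb) =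
      Ideal.Quotient.mk _ (weightedHomogeneousComponent w j P) := by
  classical
  obtain ⟨q, rfl⟩ := map_surjective ρ h.surjective P
  have hq := weightedHomogeneousComponent_isWeightedHomogeneous (w := w) j q
  have hq' := HasWeightedOrder.of_isWeightedHomogeneous hq
  have hm : eval z (weightedHomogeneousComponent w j q) ∈ orderIdeal w z j := ⟨_, hq', rfl⟩
  refine ⟨_, hm, ?_⟩
  rw [h.initialForm_eval hq', map_weightedHomogeneousComponent,
    (weightedHomogeneousComponent_isWeightedHomogeneous j
      (map ρ q)).weightedHomogeneousComponent_same]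

/-- The graded homomorphism from the Rees algebra to the associated graded ring. -/
def initialFormHom : reesGrading w z →+*ᵍ
    quotientGrading (weightedHomogeneousSubmodule κ w) (Ideal.span {G}) where
  toRingHom := h.initialForm
  map_mem := by
    intro j p hp
    obtain ⟨q, hq, hqp⟩ := id (p.2 j)
    have e : p = reesMonomial w z (p.2 j) := eq_reesMonomial hp
    have e2 : h.initialForm p = Ideal.Quotient.mk _ (weightedHomogeneousComponent w j (map ρ q)) := by
      rw [e, initialForm_reesMonomial, h.form_eq hq _ hqp]
    change h.initialForm p ∈ _
    rw [e2]
    exact mk_mem_quotientGrading _ (weightedHomogeneousComponent_isWeightedHomogeneous j _)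

theorem initialFormHom_surjective (j : ℕ) :
    ∀ b ∈ quotientGrading (weightedHomogeneousSubmodule κ w) (Ideal.span {G}) j,
      ∃ a ∈ reesGrading w z j, h.initialFormHom a = b := by
  rintro _ ⟨P, hP, rfl⟩
  obtain ⟨b, hb, e⟩ := h.exists_initialForm_eq j P
  refine ⟨_, reesMonomial_mem hb, e.trans ?_⟩
  rw [IsWeightedHomogeneous.weightedHomogeneousComponent_same hP]
  rfl

end

section KillLast

variable {m : ℕ}

/-- The substitution of zero for the last variable. -/
def killLast (K : Type*) [CommRing K] (m : ℕ) :
    MvPolynomial (Fin (m + 1)) K →ₐ[K] MvPolynomial (Fin m) K :=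
  aeval (Fin.snoc (α := fun _ => MvPolynomial (Fin m) K) X 0)

theorem killLast_X_last : killLast κ m (X (Fin.last m)) = 0 := by simp [killLast]

theorem killLast_X_castSucc (i : Fin m) : killLast κ m (X i.castSucc) = X i := by simp [killLast]

theorem killLast_rename (p : MvPolynomial (Fin m) κ) :
    killLast κ m (rename Fin.castSucc p) = p := by
  have : (killLast κ m).comp (rename Fin.castSucc) = AlgHom.id κ _ :=
    algHom_ext fun i => by simp [killLast_X_castSucc]
  exact DFunLike.congr_fun this p

theorem X_last_dvd_sub (p : MvPolynomial (Fin (m + 1)) κ) :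
    X (Fin.last m) ∣ p - rename Fin.castSucc (killLast κ m p) := by
  rw [← Ideal.mem_span_singleton, ← Ideal.Quotient.eq]
  have : (Ideal.Quotient.mkₐ κ (Ideal.span {X (Fin.last m)})) =
      ((Ideal.Quotient.mkₐ κ (Ideal.span {X (Fin.last m)})).comp
        (rename Fin.castSucc)).comp (killLast κ m) := by
    refine algHom_ext fun i => ?_
    refine Fin.lastCases ?_ (fun i => ?_) i
    · rw [AlgHom.comp_apply, killLast_X_last, map_zero]
      exact Ideal.Quotient.eq_zero_iff_mem.mpr (Ideal.mem_span_singleton_self _)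
    · rw [AlgHom.comp_apply, killLast_X_castSucc, AlgHom.comp_apply, rename_X]
  exact DFunLike.congr_fun this p

theorem X_last_dvd_of_killLast_eq_zero {p : MvPolynomial (Fin (m + 1)) κ}
    (hp : killLast κ m p = 0) : X (Fin.last m) ∣ p := by
  simpa [hp] using X_last_dvd_sub p

theorem killLast_suspend {r : ℕ} (hr : 0 < r) (F : MvPolynomial (Fin m) κ) :
    killLast κ m (suspend r F) = F := by
  rw [suspend, map_sub, killLast_rename, map_pow, killLast_X_last, zero_pow hr.ne', sub_zero]

theorem isWeightedHomogeneous_killLast {a : Fin m → ℕ} {p : MvPolynomial (Fin (m + 1)) κ} {j : ℕ}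
    (hp : IsWeightedHomogeneous (Fin.snoc a 1 : Fin (m + 1) → ℕ) p j) :
    IsWeightedHomogeneous a (killLast κ m p) j := by
  rw [as_sum p, map_sum]
  refine IsWeightedHomogeneous.sum _ _ _ fun b hb => ?_
  have hbj := hp (mem_support_iff.mp hb)
  rw [killLast, aeval_monomial, algebraMap_eq]
  refine IsWeightedHomogeneous.C_mul ?_ _
  have h := IsWeightedHomogeneous.prod (R := κ) (w := a) b.support
    (fun i => (Fin.snoc (α := fun _ => MvPolynomial (Fin m) κ) X 0 : Fin (m + 1) → _) i ^ b i)
    (fun i => b i • (Fin.snoc a 1 : Fin (m + 1) → ℕ) i) (fun i _ => IsWeightedHomogeneous.pow (by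
      refine Fin.lastCases ?_ (fun i => ?_) i
      · rw [Fin.snoc_last]
        exact isWeightedHomogeneous_zero _ _ _
      · rw [Fin.snoc_castSucc, Fin.snoc_castSucc]
        exact isWeightedHomogeneous_X _ _ _) _)
  have e : ∑ i ∈ b.support, b i • (Fin.snoc a 1 : Fin (m + 1) → ℕ) i = j := by
    rw [← hbj, Finsupp.weight_apply, Finsupp.sum]
  rwa [e] at h

end KillLast

variable {m : ℕ} {a : Fin m → ℕ} {x : Fin m → A} {τ : A} {ρ : A →+* κ} {r : ℕ}
  {F : MvPolynomial (Fin m) κ}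
  (h : IsInitialSystem (Fin.snoc a 1 : Fin (m + 1) → ℕ) (Fin.snoc x τ : Fin (m + 1) → A) ρ r
    (suspend r F))

/-- The projection from the homogeneous coordinate ring of the hypersurface of `F - T ^ r` to that
of its hyperplane section `T = 0`. -/
def quotientKillLast (hr : 0 < r) (F : MvPolynomial (Fin m) κ) :
    MvPolynomial (Fin (m + 1)) κ ⧸ Ideal.span {suspend r F} →+*
      MvPolynomial (Fin m) κ ⧸ Ideal.span {F} :=
  Ideal.quotientMap _ (killLast κ m).toRingHom (by
    rw [Ideal.span_singleton_le_iff_mem, Ideal.mem_comap]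
    refine Ideal.mem_span_singleton.mpr ?_
    exact (killLast_suspend hr F).symm ▸ dvd_rfl)

theorem quotientKillLast_mk (hr : 0 < r) (p : MvPolynomial (Fin (m + 1)) κ) :
    quotientKillLast hr F (Ideal.Quotient.mk _ p) = Ideal.Quotient.mk _ (killLast κ m p) := rfl

/-- The graded homomorphism from the Rees algebra to the homogeneous coordinate ring of the
hypersurface of `F`. -/
def initialFormKillLast (hr : 0 < r) :
    reesGrading (Fin.snoc a 1 : Fin (m + 1) → ℕ) (Fin.snoc x τ : Fin (m + 1) → A) →+*ᵍ
      quotientGrading (weightedHomogeneousSubmodule κ a) (Ideal.span {F}) where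
  toRingHom := (quotientKillLast hr F).comp h.initialForm
  map_mem := by
    intro j p hp
    obtain ⟨P, hP, e⟩ := h.initialFormHom.map_mem hp
    change quotientKillLast hr F (h.initialForm p) ∈ _
    have e' : h.initialForm p = Ideal.Quotient.mk _ P := e.symm
    rw [e', quotientKillLast_mk]
    exact mk_mem_quotientGrading _ (isWeightedHomogeneous_killLast hP)

theorem initialFormKillLast_apply (hr : 0 < r) (p) :
    h.initialFormKillLast hr p = quotientKillLast hr F (h.initialForm p) := rfl

theorem isWeightedHomogeneous_rename_castSucc {P : MvPolynomial (Fin m) κ} {j : ℕ}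
    (hP : IsWeightedHomogeneous a P j) : IsWeightedHomogeneous (Fin.snoc a 1 : Fin (m + 1) → ℕ)
      (rename Fin.castSucc P) j := by
  intro b hb
  obtain ⟨c, rfl, hc⟩ := coeff_rename_ne_zero _ _ _ hb
  rw [← hP hc, Finsupp.weight_apply, Finsupp.weight_apply,
    Finsupp.sum_mapDomain_index (by simp) (by intros; simp [add_mul])]
  simp

theorem initialFormKillLast_surjective (hr : 0 < r) (j : ℕ) :
    ∀ b ∈ quotientGrading (weightedHomogeneousSubmodule κ a) (Ideal.span {F}) j,
      ∃ c ∈ reesGrading (Fin.snoc a 1 : Fin (m + 1) → ℕ) (Fin.snoc x τ : Fin (m + 1) → A) j,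
        h.initialFormKillLast hr c = b := by
  rintro _ ⟨P, hP, rfl⟩
  obtain ⟨c, hc, e⟩ := h.initialFormHom_surjective j _
    (mk_mem_quotientGrading (Ideal.span {suspend r F}) (isWeightedHomogeneous_rename_castSucc hP))
  refine ⟨c, hc, ?_⟩
  have e' : h.initialForm c = Ideal.Quotient.mk _ (rename Fin.castSucc P) := e
  rw [initialFormKillLast_apply, e', quotientKillLast_mk, killLast_rename]
  rfl

theorem mem_orderIdeal_one : τ ∈ orderIdeal (Fin.snoc a 1 : Fin (m + 1) → ℕ)
    (Fin.snoc x τ : Fin (m + 1) → A) 1 := by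
  have := mem_orderIdeal_self (Fin.snoc a 1 : Fin (m + 1) → ℕ)
    (Fin.snoc x τ : Fin (m + 1) → A) (Fin.last m)
  rwa [Fin.snoc_last, Fin.snoc_last] at this

theorem initialForm_last : h.initialForm (reesMonomial _ _ mem_orderIdeal_one) =
    Ideal.Quotient.mk _ (X (Fin.last m)) := by
  rw [← h.initialForm_self (Fin.last m)]
  exact congrArg _ (reesMonomial_congr _ _ (by simp) (by simp))

-- `T` is a nonzerodivisor modulo `F - T ^ r`: from `T P = (F - T ^ r) c`, setting `T = 0` gives `F`
-- times the restriction of `c` equal to zero. As `F ≠ 0`, `T` divides `c` and can be cancelled.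
include h in
theorem mem_orderIdeal_of_mul_last_mem (hr : 0 < r) (hF : F ≠ 0) (j : ℕ) (b : A)
    (hb : b ∈ orderIdeal (Fin.snoc a 1 : Fin (m + 1) → ℕ) (Fin.snoc x τ : Fin (m + 1) → A) j)
    (hτ : τ * b ∈ orderIdeal (Fin.snoc a 1 : Fin (m + 1) → ℕ)
      (Fin.snoc x τ : Fin (m + 1) → A) (j + 2)) :
    b ∈ orderIdeal (Fin.snoc a 1 : Fin (m + 1) → ℕ) (Fin.snoc x τ : Fin (m + 1) → A) (j + 1) := by
  rw [← h.initialForm_eq_zero_iff hb]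
  have hm := mul_mem_orderIdeal _ _ (mem_orderIdeal_one (a := a) (x := x) (τ := τ)) hb
  have h1 : h.initialForm (reesMonomial _ _ hm) = 0 :=
    (h.initialForm_eq_zero_iff hm).mpr (orderIdeal_anti _ _ (by omega) hτ)
  rw [← reesMonomial_mul mem_orderIdeal_one hb, map_mul, initialForm_last] at h1
  obtain ⟨P, hP⟩ := Ideal.Quotient.mk_surjective (h.initialForm (reesMonomial _ _ hb))
  rw [← hP] at h1 ⊢
  rw [← map_mul, Ideal.Quotient.eq_zero_iff_mem, Ideal.mem_span_singleton] at h1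
  rw [Ideal.Quotient.eq_zero_iff_mem, Ideal.mem_span_singleton]
  obtain ⟨c, hc⟩ := h1
  have h2 := congrArg (killLast κ m) hc
  rw [map_mul, killLast_X_last, zero_mul, map_mul, killLast_suspend hr, eq_comm,
    mul_eq_zero] at h2
  obtain ⟨c', rfl⟩ := X_last_dvd_of_killLast_eq_zero (h2.resolve_left hF)
  refine ⟨c', mul_left_cancel₀ (X_ne_zero (Fin.last m)) ?_⟩
  rw [hc]
  ring

/-- If the initial form `P` of `c` restricts to a multiple of `F` at `T = 0`, then `P` is a multiple
of `F - T ^ r` plus `T * b0`. An element `b` with the degree-`j` component of `b0` as its form then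
has `c - τ b` with zero form in degree `j + 1`. -/
theorem exists_sub_mem_of_initialFormKillLast_eq_zero (hr : 0 < r)
    (hF : IsWeightedHomogeneous a F r) (j : ℕ) (c : A)
    (hc : c ∈ orderIdeal (Fin.snoc a 1 : Fin (m + 1) → ℕ) (Fin.snoc x τ : Fin (m + 1) → A) (j + 1))
    (h0 : h.initialFormKillLast hr (reesMonomial _ _ hc) = 0) :
    ∃ b ∈ orderIdeal (Fin.snoc a 1 : Fin (m + 1) → ℕ) (Fin.snoc x τ : Fin (m + 1) → A) j,
      c - τ * b ∈ orderIdeal (Fin.snoc a 1 : Fin (m + 1) → ℕ)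
        (Fin.snoc x τ : Fin (m + 1) → A) (j + 2) := by
  classical
  obtain ⟨P, hP, hPc⟩ := h.initialFormHom.map_mem (reesMonomial_mem hc)
  have e : h.initialForm (reesMonomial _ _ hc) = Ideal.Quotient.mk _ P := hPc.symm
  rw [initialFormKillLast_apply, e, quotientKillLast_mk, Ideal.Quotient.eq_zero_iff_mem,
    Ideal.mem_span_singleton] at h0
  obtain ⟨c0, hc0⟩ := h0
  obtain ⟨b0, hb0⟩ := X_last_dvd_of_killLast_eq_zero
    (p := P - suspend r F * rename Fin.castSucc c0) (by
      rw [map_sub, map_mul, killLast_suspend hr, killLast_rename, hc0, sub_self])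
  obtain ⟨b, hb, hbe⟩ := h.exists_initialForm_eq j b0
  refine ⟨b, hb, ?_⟩
  have hX : IsWeightedHomogeneous (Fin.snoc a 1 : Fin (m + 1) → ℕ)
      (X (Fin.last m) : MvPolynomial (Fin (m + 1)) κ) 1 := by
    simpa using isWeightedHomogeneous_X κ (Fin.snoc a 1 : Fin (m + 1) → ℕ) (Fin.last m)
  have h1 := congrArg (weightedHomogeneousComponent (Fin.snoc a 1 : Fin (m + 1) → ℕ) (j + 1)) hb0
  rw [map_sub, IsWeightedHomogeneous.weightedHomogeneousComponent_same hP,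
    weightedHomogeneousComponent_mul_of_le hX _ (by omega), Nat.add_sub_cancel] at h1
  have h2 := weightedHomogeneousComponent_mem_of_mem κ (Fin.snoc a 1 : Fin (m + 1) → ℕ)
    (isHomogeneous_span (isWeightedHomogeneous_suspend hF))
    (Ideal.mul_mem_right (rename Fin.castSucc c0) _ (Ideal.mem_span_singleton_self (suspend r F)))
    (j + 1)
  have hτb : τ * b ∈ orderIdeal (Fin.snoc a 1 : Fin (m + 1) → ℕ)
      (Fin.snoc x τ : Fin (m + 1) → A) (j + 1) :=
    orderIdeal_anti _ _ (by omega) (mul_mem_orderIdeal _ _ mem_orderIdeal_one hb)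
  rw [← h.initialForm_eq_zero_iff (sub_mem hc hτb)]
  have h3 : reesMonomial _ _ (sub_mem hc hτb) = reesMonomial _ _ hc -
      reesMonomial _ _ (mem_orderIdeal_one (a := a) (x := x) (τ := τ)) * reesMonomial _ _ hb := by
    rw [eq_sub_iff_add_eq, reesMonomial_mul, reesMonomial_congr
      (mul_mem_orderIdeal _ _ mem_orderIdeal_one hb) hτb (add_comm _ _) rfl, reesMonomial_add]
    exact reesMonomial_congr _ _ rfl (by ring)
  rw [h3, map_sub, map_mul, e, initialForm_last, hbe, ← map_mul, ← map_sub,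
    Ideal.Quotient.eq_zero_iff_mem, ← h1, sub_sub_cancel]
  exact h2

end IsInitialSystem

end Exceptional

/-! ### Generators of the Rees algebra -/

section Generators

open MvPolynomial

variable {A : Type u} [CommRing A] {N : ℕ} (w : Fin N → ℕ) (z : Fin N → A)

/-- The generators `z_i u ^ l`, for `l ≤ w i`, of the Rees algebra. -/
def reesGenerator (p : Σ i : Fin N, Fin (w i + 1)) : weightedRees w z :=
  reesMonomial w z (orderIdeal_anti w z (Nat.le_of_lt_succ p.2.2) (mem_orderIdeal_self w z p.1))

variable {w z}

theorem exists_reesMonomial_mem_adjoin_mul {S : Subalgebra A (weightedRees w z)} {a b : A}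
    {i j l : ℕ}
    (ha : ∀ l ≤ i, ∃ h : a ∈ orderIdeal w z l, reesMonomial w z h ∈ S)
    (hb : ∀ l ≤ j, ∃ h : b ∈ orderIdeal w z l, reesMonomial w z h ∈ S) (hl : l ≤ i + j) :
    ∃ h : a * b ∈ orderIdeal w z l, reesMonomial w z h ∈ S := by
  obtain ⟨h1, h1'⟩ := ha (min l i) (min_le_right _ _)
  obtain ⟨h2, h2'⟩ := hb (l - min l i) (by omega)
  have h3 : a * b ∈ orderIdeal w z l :=
    orderIdeal_anti w z (by omega) (mul_mem_orderIdeal w z h1 h2)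
  refine ⟨h3, ?_⟩
  have := S.mul_mem h1' h2'
  rw [reesMonomial_mul] at this
  convert this using 1
  exact reesMonomial_congr _ _ (by omega) rfl

/-- A monomial in `z` of weight `W` occurs in the Rees algebra in every degree up to `W`, not only
in degree `W`. This is why the generators include `z_i u ^ l` for all `l ≤ w i`. -/
theorem exists_reesMonomial_mem_adjoin (b : Fin N →₀ ℕ) : ∀ j ≤ Finsupp.weight w b,
    ∃ h : eval z (monomial b 1) ∈ orderIdeal w z j,
      reesMonomial w z h ∈ Algebra.adjoin A (Set.range (reesGenerator w z)) := by
  have hone : ∃ h : (1 : A) ∈ orderIdeal w z 0,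
      reesMonomial w z h ∈ Algebra.adjoin A (Set.range (reesGenerator w z)) := by
    refine ⟨mem_orderIdeal_zero w z 1, ?_⟩
    rw [← algebraMap_eq_reesMonomial]
    exact Subalgebra.algebraMap_mem _ _
  induction b using Finsupp.induction_linear with
  | zero =>
    intro j hj
    rw [map_zero] at hj
    obtain rfl : j = 0 := by omega
    simpa using hone
  | add b c hb hc =>
    intro j hj
    rw [map_add] at hj
    have e : eval z (monomial (b + c) 1) = eval z (monomial b 1) * eval z (monomial c 1) := by
      rw [← map_mul, monomial_mul, one_mul]
    rw [e]
    exact exists_reesMonomial_mem_adjoin_mul hb hc hj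
  | single i n =>
    induction n with
    | zero =>
      intro j hj
      rw [Finsupp.single_zero, map_zero] at hj
      obtain rfl : j = 0 := by omega
      simpa using hone
    | succ n ih =>
      intro j hj
      have e : eval z (monomial (Finsupp.single i (n + 1)) 1) =
          eval z (monomial (Finsupp.single i n) 1) * z i := by
        rw [eval_monomial, eval_monomial, one_mul, one_mul, Finsupp.prod_single_index (by simp),
          Finsupp.prod_single_index (by simp), pow_succ]
      rw [e]
      refine exists_reesMonomial_mem_adjoin_mul (j := w i) ih (fun l hl => ?_) ?_
      · exact ⟨orderIdeal_anti w z hl (mem_orderIdeal_self w z i),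
          Algebra.subset_adjoin ⟨⟨i, l, Nat.lt_succ_of_le hl⟩, rfl⟩⟩
      · rw [Finsupp.single_add, map_add] at hj
        simpa [Finsupp.weight_apply] using hj

variable (w z)

theorem adjoin_reesGenerator : Algebra.adjoin A (Set.range (reesGenerator w z)) = ⊤ := by
  rw [eq_top_iff]
  rintro p -
  induction p using DirectSum.Decomposition.inductionOn (reesGrading w z) with
  | zero => exact zero_mem _
  | @homogeneous j p =>
    obtain ⟨q, hq, hqp⟩ := id (p.1.2 j)
    have key : ∀ s ⊆ q.support, ∃ h : ∑ b ∈ s, q.coeff b * eval z (monomial b 1) ∈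
        orderIdeal w z j,
        reesMonomial w z h ∈ Algebra.adjoin A (Set.range (reesGenerator w z)) := by
      classical
      intro s
      induction s using Finset.induction_on with
      | empty =>
        intro _
        simp only [Finset.sum_empty]
        refine ⟨zero_mem _, ?_⟩
        rw [(reesMonomial_eq_zero _).mpr rfl]
        exact zero_mem _
      | insert b s hb ih =>
        intro hs
        obtain ⟨h1, h1'⟩ := ih fun c hc => hs (Finset.mem_insert_of_mem hc)
        obtain ⟨h2, h2'⟩ := exists_reesMonomial_mem_adjoin (w := w) (z := z) b j
          (hq b (mem_support_iff.mp (hs (Finset.mem_insert_self b s))))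
        rw [Finset.sum_insert hb]
        have h3 := Ideal.mul_mem_left _ (q.coeff b) h2
        refine ⟨add_mem h3 h1, ?_⟩
        rw [← reesMonomial_add h3 h1]
        refine add_mem ?_ h1'
        have := Subalgebra.smul_mem _ h2' (q.coeff b)
        rwa [Algebra.smul_def, algebraMap_eq_reesMonomial, reesMonomial_mul,
          reesMonomial_congr _ h3 (zero_add j) rfl] at this
    obtain ⟨h, h'⟩ := key q.support subset_rfl
    rw [eq_reesMonomial p.2]
    convert h' using 1
    refine reesMonomial_congr _ _ rfl ?_
    rw [← hqp]
    conv_lhs => rw [as_sum q, map_sum]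
    refine Finset.sum_congr rfl fun b _ => ?_
    rw [eval_monomial, eval_monomial, one_mul]
  | add p q hp hq => exact add_mem hp hq

instance finiteType_weightedRees : Algebra.FiniteType A (weightedRees w z) :=
  ⟨by
    rw [← adjoin_reesGenerator w z]
    exact Subalgebra.fg_def.mpr ⟨_, Set.finite_range _, rfl⟩⟩

instance finiteType_reesGrading_zero :
    Algebra.FiniteType (reesGrading w z 0) (weightedRees w z) :=
  have : IsScalarTower A (reesGrading w z 0) (weightedRees w z) := 
    ⟨fun a x y => smul_mul_assoc a (x : weightedRees w z) y⟩
  Algebra.FiniteType.of_restrictScalars_finiteType A _ _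

theorem algebraMap_reesGrading_zero_bijective :
    Function.Bijective (algebraMap A (reesGrading w z 0)) := by
  constructor
  · intro a b hab
    have h1 : algebraMap A (weightedRees w z) a = algebraMap A (weightedRees w z) b :=
      congrArg (fun p : reesGrading w z 0 => (p : weightedRees w z)) hab
    rw [algebraMap_eq_reesMonomial, algebraMap_eq_reesMonomial, reesMonomial_eq_iff _ _ rfl] at h1
    exact h1
  · intro p
    refine ⟨p.1.1.coeff 0, Subtype.ext ?_⟩
    change algebraMap A (weightedRees w z) (p.1.1.coeff 0) = p.1
    rw [algebraMap_eq_reesMonomial, eq_reesMonomial p.2]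
    refine reesMonomial_congr _ _ rfl ?_
    change (Polynomial.monomial 0 (p.1.1.coeff 0)).coeff 0 = _
    rw [Polynomial.coeff_monomial, if_pos rfl]

/-- Turns a weighted homogeneous relation between the `z i` into a relation between the elements
`z_i u ^ (w i)` of the Rees algebra, which can then be read at a point of `Proj`. -/
theorem aeval_reesMonomial {p : MvPolynomial (Fin N) A} {r : ℕ} (hp : IsWeightedHomogeneous w p r)
    (h : eval z p ∈ orderIdeal w z r) :
    aeval (fun i => reesMonomial w z (mem_orderIdeal_self w z i)) p = reesMonomial w z h := by
  have hprod : ∀ b : Fin N →₀ ℕ, ((b.prod fun i n =>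
      reesMonomial w z (mem_orderIdeal_self w z i) ^ n : weightedRees w z) : Polynomial A) =
      Polynomial.monomial (Finsupp.weight w b) (eval z (monomial b 1)) := by
    intro b
    induction b using Finsupp.induction_linear with
    | zero => simp
    | add b c hb hc =>
      rw [Finsupp.prod_add_index' (by simp) (by simp [pow_add]), map_add, ← one_mul (1 : A),
        ← monomial_mul, map_mul, ← Polynomial.monomial_mul_monomial, ← hb, ← hc]
      rfl
    | single i n =>
      rw [Finsupp.prod_single_index (h := fun i n =>
        reesMonomial w z (mem_orderIdeal_self w z i) ^ n) (by simp), eval_monomial, one_mul,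
        Finsupp.prod_single_index (by simp), Finsupp.weight_apply,
        Finsupp.sum_single_index (by simp)]
      change (Polynomial.monomial (w i) (z i)) ^ n = _
      rw [Polynomial.monomial_pow, mul_comm, smul_eq_mul]
  refine Subtype.ext ?_
  change _ = Polynomial.monomial r (eval z p)
  rw [aeval_def, eval₂_eq, AddSubmonoidClass.coe_finsetSum]
  conv_rhs => rw [as_sum p, map_sum, map_sum]
  refine Finset.sum_congr rfl fun b hb => ?_
  have h1 := hprod b
  rw [hp (mem_support_iff.mp hb)] at h1
  have h2 : ((algebraMap A (weightedRees w z) (p.coeff b) * (b.prod fun i n =>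
      reesMonomial w z (mem_orderIdeal_self w z i) ^ n) : weightedRees w z) : Polynomial A) =
      Polynomial.C (p.coeff b) * Polynomial.monomial r (eval z (monomial b 1)) := by
    rw [← h1]
    rfl
  refine Eq.trans ?_ (h2.trans ?_)
  · rfl
  · rw [Polynomial.C_mul_monomial, eval_monomial, eval_monomial, one_mul]

/-- A homogeneous prime containing all the generators of the Rees algebra contains its irrelevant
ideal. -/
theorem exists_reesGenerator_notMem (y : ProjectiveSpectrum (reesGrading w z)) :
    ∃ p, reesGenerator w z p ∉ y.asHomogeneousIdeal := by
  by_contra! hcon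
  refine y.not_irrelevant_le ?_
  rw [HomogeneousIdeal.irrelevant_le]
  intro j hj p hp
  replace hp : p ∈ reesGrading w z j := hp
  -- Modulo an ideal containing all the generators every element is congruent to a constant, and
  -- passing to a component of positive degree removes the constant.
  have h1 : ∀ q : weightedRees w z, ∃ a : A,
      q - algebraMap A _ a ∈ y.asHomogeneousIdeal.toIdeal := by
    intro q
    have hq : q ∈ Algebra.adjoin A (Set.range (reesGenerator w z)) :=
      adjoin_reesGenerator w z ▸ Algebra.mem_top
    induction hq using Algebra.adjoin_induction with
    | mem q hq =>
      obtain ⟨i, rfl⟩ := hq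
      exact ⟨0, by simpa using hcon i⟩
    | algebraMap a => exact ⟨a, by simp⟩
    | add q q' _ _ hq hq' =>
      obtain ⟨a, ha⟩ := hq
      obtain ⟨b, hb⟩ := hq'
      refine ⟨a + b, ?_⟩
      rw [map_add, add_sub_add_comm]
      exact add_mem ha hb
    | mul q q' _ _ hq hq' =>
      obtain ⟨a, ha⟩ := hq
      obtain ⟨b, hb⟩ := hq'
      refine ⟨a * b, ?_⟩
      rw [map_mul, show q * q' - algebraMap A _ a * algebraMap A _ b =
        q * (q' - algebraMap A _ b) + algebraMap A _ b * (q - algebraMap A _ a) by ring]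
      exact add_mem (Ideal.mul_mem_left _ _ hb) (Ideal.mul_mem_left _ _ ha)
  obtain ⟨a, ha⟩ := h1 p
  have h2 : GradedRing.proj (reesGrading w z) j (p - algebraMap A _ a) ∈
    y.asHomogeneousIdeal.toIdeal := y.asHomogeneousIdeal.isHomogeneous j ha
  rw [map_sub, GradedRing.proj_apply, GradedRing.proj_apply,
    DirectSum.decompose_of_mem_same _ hp, DirectSum.decompose_of_mem_ne (i := 0) (j := j) _
      (by
        rw [algebraMap_eq_reesMonomial]
        exact reesMonomial_mem _) hj.ne, sub_zero] at h2
  exact h2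

/-- The identity `(z_i u ^ l) ^ (w i) = (z_i u ^ (w i)) ^ l * z_i ^ (w i - l)` shows that, over the
centre, the vanishing of all the top-degree generators forces that of all generators. -/
theorem exists_self_notMem (hw : ∀ i, 0 < w i) (y : ProjectiveSpectrum (reesGrading w z))
    (hy : ∀ i, algebraMap A (weightedRees w z) (z i) ∈ y.asHomogeneousIdeal) :
    ∃ i, reesMonomial w z (mem_orderIdeal_self w z i) ∉ y.asHomogeneousIdeal := by
  by_contra! hcon
  obtain ⟨⟨i, l, hl⟩, hi⟩ := exists_reesGenerator_notMem w z y
  refine hi ?_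
  have hle := Nat.le_of_lt_succ hl
  have h0 : reesGenerator w z ⟨i, l, hl⟩ ^ (w i) = reesMonomial w z
      (mem_orderIdeal_self w z i) ^ l * algebraMap A (weightedRees w z) (z i) ^ (w i - l) := by
    rw [reesGenerator, algebraMap_eq_reesMonomial, reesMonomial_pow, reesMonomial_pow,
      reesMonomial_pow, reesMonomial_mul]
    refine reesMonomial_congr _ _ ?_ ?_
    · rw [mul_zero, add_zero, mul_comm]
    · rw [← pow_add, Nat.add_sub_cancel' hle]
  have h1 : reesGenerator w z ⟨i, l, hl⟩ ^ (w i) ∈ y.asHomogeneousIdeal := by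
    rw [h0]
    by_cases hl0 : l = 0
    · exact Ideal.mul_mem_left _ _ (Ideal.pow_mem_of_mem _ (hy i) _ (by have := hw i; omega))
    · exact Ideal.mul_mem_right _ _ (Ideal.pow_mem_of_mem _ (hcon i) _ (by omega))
  exact y.isPrime.mem_of_pow_mem _ h1

/-- On a coordinate axis only pure powers of one variable survive, and homogeneity fixes the
exponent. -/
theorem eval₂_single {K L : Type*} [CommRing K] [CommRing L] (φ : K →+* L)
    {P : MvPolynomial (Fin N) K} {r : ℕ} (hP : IsWeightedHomogeneous w P r) {i : Fin N}
    (hw : 0 < w i) (g : L) : eval₂ φ (Pi.single i g) P =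
      φ (P.coeff (Finsupp.single i (r / w i))) * g ^ (r / w i) := by
  classical
  rw [eval₂_eq, Finset.sum_eq_single (Finsupp.single i (r / w i))]
  · congr 1
    by_cases h : r / w i = 0
    · simp [h]
    · rw [Finsupp.support_single _ h, Finset.prod_singleton, Pi.single_eq_same,
        Finsupp.single_eq_same]
  · intro b hb hne
    by_cases h : ∃ j ≠ i, b j ≠ 0
    · obtain ⟨j, hj, hbj⟩ := h
      rw [Finset.prod_eq_zero (Finsupp.mem_support_iff.mpr hbj)
        (by rw [Pi.single_eq_of_ne hj, zero_pow hbj]), mul_zero]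
    · push Not at h
      have hbs : b = Finsupp.single i (b i) := by
        ext j
        by_cases hj : j = i
        · rw [hj, Finsupp.single_eq_same]
        · rw [h j hj, Finsupp.single_eq_of_ne hj]
      refine absurd ?_ hne
      have hwt := hP (mem_support_iff.mp hb)
      rw [hbs, Finsupp.weight_apply, Finsupp.sum_single_index (by simp), smul_eq_mul] at hwt
      rw [hbs, ← hwt, Nat.mul_div_cancel _ hw]
  · intro h
    rw [notMem_support_iff.mp h, map_zero, zero_mul]

end Generators

/-! ### The initial system of a quasi-homogeneous singularity -/

section RootSystem

open MvPolynomial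

theorem exists_hasWeightedOrder_map_eq {σ A B : Type*} [CommRing A] [CommRing B] {φ : A →+* B}
    (hφ : Function.Surjective φ) {w : σ → ℕ} {j : ℕ} {p : MvPolynomial σ B}
    (hp : HasWeightedOrder w j p) :
    ∃ q : MvPolynomial σ A, HasWeightedOrder w j q ∧ map φ q = p := by
  classical
  choose ψ hψ using hφ
  refine ⟨∑ b ∈ p.support, monomial b (ψ (p.coeff b)), ?_, ?_⟩
  · exact HasWeightedOrder.sum fun b hb => HasWeightedOrder.monomial _ (hp b (mem_support_iff.mp hb))
  · rw [map_sum]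
    conv_rhs => rw [as_sum p]
    exact Finset.sum_congr rfl fun b _ => by rw [map_monomial, hψ]

/-- The elements `x` together with the variable are quasi-regular in the polynomial ring over `A₀`.
A relation between their images in `A` lifts to a polynomial whose value is a multiple of that of `Φ
- T ^ r`, so its initial form is a multiple of the reduction of `Φ - T ^ r`. -/
theorem isInitialSystem_suspend {A₀ A κ : Type u} [CommRing A₀] [CommRing A] [Field κ] {m r : ℕ}
    {a : Fin m → ℕ} (ha : ∀ i, 0 < a i) (hr : 0 < r) {x : Fin m → A₀} (hx : IsQuasiRegular a x)
    {Φ : MvPolynomial (Fin m) A₀} (hΦ : IsWeightedHomogeneous a Φ r) {ρ₀ : A₀ →+* κ}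
    (hρ₀ : Function.Surjective ρ₀) (hker : RingHom.ker ρ₀ = Ideal.span (Set.range x))
    {π : Polynomial A₀ →+* A} (hπ : Function.Surjective π)
    (hkerπ : RingHom.ker π = Ideal.span {Polynomial.X ^ r - Polynomial.C (eval x Φ)})
    {ρ : A →+* κ} (hρ : ∀ b, ρ (π (Polynomial.C b)) = ρ₀ b) (hρX : ρ (π Polynomial.X) = 0) :
    IsInitialSystem (Fin.snoc a 1 : Fin (m + 1) → ℕ)
      (Fin.snoc (fun i => π (Polynomial.C (x i))) (π Polynomial.X) : Fin (m + 1) → A) ρ r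
      (suspend r (map ρ₀ Φ)) := by
  have hw : ∀ i, 0 < (Fin.snoc a 1 : Fin (m + 1) → ℕ) i := fun i => by
    refine Fin.lastCases ?_ (fun i => ?_) i
    · simp
    · simpa using ha i
  let z : Fin (m + 1) → Polynomial A₀ :=
    Fin.snoc (fun i => Polynomial.C (x i)) Polynomial.X
  have hz : (fun i => π (z i)) =
      (Fin.snoc (fun i => π (Polynomial.C (x i))) (π Polynomial.X) : Fin (m + 1) → A) := by
    funext i
    refine Fin.lastCases ?_ (fun i => ?_) i <;> simp [z]
  let Ψ : MvPolynomial (Fin (m + 1)) (Polynomial A₀) := suspend r (map Polynomial.C Φ)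
  have hΨ : IsWeightedHomogeneous (Fin.snoc a 1 : Fin (m + 1) → ℕ) Ψ r :=
    isWeightedHomogeneous_suspend (weightedHomogeneous_map _ hΦ)
  have hmap : ∀ {B : Type u} [CommRing B] (φ : Polynomial A₀ →+* B),
      map φ Ψ = suspend r (map (φ.comp Polynomial.C) Φ) := by
    intro B _ φ
    simp only [Ψ, suspend, map_sub, map_pow, map_X, map_rename, MvPolynomial.map_map]
  have hevalΨ : eval z Ψ = Polynomial.C (eval x Φ) - Polynomial.X ^ r := by
    simp only [Ψ, suspend, map_sub, map_pow, eval_X, eval_rename, z, Fin.snoc_last]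
    congr 1
    have h1 : (Fin.snoc (fun i => Polynomial.C (x i)) Polynomial.X : Fin (m + 1) → Polynomial A₀) ∘
        Fin.castSucc = fun i => Polynomial.C (x i) := by
      funext i
      simp
    rw [h1, MvPolynomial.eval_map]
    exact (eval₂_comp_left Polynomial.C (RingHom.id A₀) x Φ).symm
  have hρπ : (ρ.comp π).comp Polynomial.C = ρ₀ := RingHom.ext hρ
  have hkerρπ : RingHom.ker (ρ.comp π) = Ideal.span (Set.range z) := by
    apply le_antisymm
    · intro p hp
      have h1 : p = Polynomial.C (p.coeff 0) + Polynomial.X * p.divX := by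
        rw [add_comm]
        exact (Polynomial.X_mul_divX_add p).symm
      have h2 : p.coeff 0 ∈ RingHom.ker ρ₀ := by
        rw [RingHom.mem_ker] at hp ⊢
        rw [h1, map_add, map_mul, RingHom.comp_apply, RingHom.comp_apply, hρX, zero_mul,
          add_zero, hρ] at hp
        exact hp
      rw [h1]
      refine add_mem ?_ (Ideal.mul_mem_right _ _ (Ideal.subset_span ⟨Fin.last m, by simp [z]⟩))
      rw [hker] at h2
      have h3 := Ideal.mem_map_of_mem Polynomial.C h2
      rw [Ideal.map_span] at h3
      refine Ideal.span_mono ?_ h3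
      rintro _ ⟨_, ⟨i, rfl⟩, rfl⟩
      exact ⟨i.castSucc, by simp [z]⟩
    · rw [Ideal.span_le]
      rintro _ ⟨i, rfl⟩
      refine Fin.lastCases ?_ (fun i => ?_) i
      · simpa [z] using hρX
      · have : x i ∈ RingHom.ker ρ₀ := hker ▸ Ideal.subset_span ⟨i, rfl⟩
        simpa [z, hρ] using this
  have hker' : RingHom.ker ρ = Ideal.span (Set.range fun i => π (z i)) := by
    have h1 : RingHom.ker ρ = (RingHom.ker (ρ.comp π)).map π := by
      rw [← RingHom.comap_ker, Ideal.map_comap_of_surjective π hπ]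
    rw [h1, hkerρπ, Ideal.map_span, ← Set.range_comp']
  have hsusp : suspend r (map ρ₀ Φ) ≠ 0 := fun h => by
    have h1 := congrArg (coeff (Finsupp.single (Fin.last m) r)) h
    have h2 : coeff (Finsupp.single (Fin.last m) r) (rename Fin.castSucc (map ρ₀ Φ)) = 0 := by
      refine coeff_rename_eq_zero _ _ _ fun b hb => ?_
      have h3 := DFunLike.congr_fun hb (Fin.last m)
      rw [Finsupp.single_eq_same, Finsupp.mapDomain_of_notMem_range _ _ (by simp)] at h3
      omega
    rw [suspend, coeff_sub, h2, coeff_X_pow, if_pos rfl, coeff_zero] at h1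
    simp at h1
  rw [← hz]
  refine ⟨hw, ?_, hker', ⟨map π Ψ, weightedHomogeneous_map _ hΨ, ?_, ?_⟩, ?_⟩
  · intro y
    obtain ⟨b, rfl⟩ := hρ₀ y
    exact ⟨_, hρ b⟩
  · rw [MvPolynomial.eval_map]
    have h1 := eval₂_comp_left π (RingHom.id _) z Ψ
    rw [RingHom.comp_id] at h1
    refine h1.symm.trans ?_
    change π (eval z Ψ) = 0
    rw [hevalΨ, ← RingHom.mem_ker, ← neg_sub, neg_mem_iff, hkerπ]
    exact Ideal.mem_span_singleton_self _
  · rw [MvPolynomial.map_map, hmap, hρπ]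
  · intro j p hp hp0
    obtain ⟨q, hq, rfl⟩ := exists_hasWeightedOrder_map_eq hπ hp
    rw [MvPolynomial.eval_map] at hp0
    have h1 := eval₂_comp_left π (RingHom.id _) z q
    rw [RingHom.comp_id] at h1
    have h2 : eval z q ∈ RingHom.ker π := h1.trans hp0
    rw [hkerπ, Ideal.mem_span_singleton'] at h2
    obtain ⟨c, hc⟩ := h2
    have h3 := IsQuasiRegular.dvd_weightedHomogeneousComponent hw (hx.snoc_X ha) (ρ.comp π)
      hkerρπ hΨ (by rwa [hmap, hρπ]) hq (c := -c) (by
        rw [hevalΨ, ← hc]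
        ring)
    rwa [hmap, hρπ, ← MvPolynomial.map_map] at h3

namespace IsInitialSystem

theorem exists_coprime_combination {p q : ℕ} (hp : 0 < p) (hq : 0 < q) (h : Nat.Coprime p q) :
    ∃ α β, 0 < α ∧ α * p = β * q + 1 := by
  by_cases hq1 : q = 1
  · subst hq1
    exact ⟨1, p - 1, one_pos, by omega⟩
  obtain ⟨α, -, hα⟩ := Nat.exists_mul_mod_eq_one_of_coprime h (by omega)
  have hd := Nat.div_add_mod (p * α) q
  rw [hα] at hd
  refine ⟨α, p * α / q, Nat.pos_of_ne_zero fun h0 => ?_, ?_⟩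
  · subst h0
    simp at hα
  · rw [mul_comm (p * α / q) q, hd, mul_comm]

variable {A κ : Type u} [CommRing A] [Field κ] {m : ℕ} {a : Fin m → ℕ} {x : Fin m → A} {τ : A}
  {ρ : A →+* κ} {r : ℕ} {F : MvPolynomial (Fin m) κ}
  (h : IsInitialSystem (Fin.snoc a 1 : Fin (m + 1) → ℕ) (Fin.snoc x τ : Fin (m + 1) → A) ρ r
    (suspend r F))

theorem mem_orderIdeal_castSucc (i : Fin m) :
    x i ∈ orderIdeal (Fin.snoc a 1 : Fin (m + 1) → ℕ) (Fin.snoc x τ : Fin (m + 1) → A) (a i) := by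
  have := mem_orderIdeal_self (Fin.snoc a 1 : Fin (m + 1) → ℕ)
    (Fin.snoc x τ : Fin (m + 1) → A) i.castSucc
  rwa [Fin.snoc_castSucc, Fin.snoc_castSucc] at this

include h in
/-- A point of the exceptional divisor that lies on the hyperplane `τ u = 0` is contained in a
chart defined by elements of coprime degrees. -/
theorem exists_pow_notMem (hr : 0 < r) (hF : IsWeightedHomogeneous a F r)
    (ha : ∀ i, 0 < a i) (hcop : Pairwise fun i j => Nat.Coprime (a i) (a j))
    (hvertex : ∀ i, 1 < a i → eval (Pi.single i 1) F ≠ 0)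
    (y : ProjectiveSpectrum (reesGrading (Fin.snoc a 1 : Fin (m + 1) → ℕ)
      (Fin.snoc x τ : Fin (m + 1) → A)))
    (hy : ∀ i, algebraMap A (weightedRees (Fin.snoc a 1 : Fin (m + 1) → ℕ)
      (Fin.snoc x τ : Fin (m + 1) → A)) ((Fin.snoc x τ : Fin (m + 1) → A) i) ∈
        y.asHomogeneousIdeal)
    (hτ : reesMonomial _ _ (mem_orderIdeal_one (a := a) (x := x) (τ := τ)) ∈
      y.asHomogeneousIdeal) :
    ∃ (i j : Fin m) (α β : ℕ), 0 < α ∧ α * a i = β * a j + 1 ∧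
      reesMonomial _ _ (mem_orderIdeal_castSucc (a := a) (x := x) (τ := τ) i) ^ α ∉
        y.asHomogeneousIdeal ∧
      reesMonomial _ _ (mem_orderIdeal_castSucc (a := a) (x := x) (τ := τ) j) ^ β ∉
        y.asHomogeneousIdeal := by
  classical
  have hself : ∀ i : Fin m, reesMonomial _ _ (mem_orderIdeal_self (Fin.snoc a 1 : Fin (m + 1) → ℕ)
      (Fin.snoc x τ : Fin (m + 1) → A) i.castSucc) =
      reesMonomial _ _ (mem_orderIdeal_castSucc (a := a) (x := x) (τ := τ) i) := fun i =>
    reesMonomial_congr _ _ (by simp) (by simp)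
  have hlast : reesMonomial _ _ (mem_orderIdeal_self (Fin.snoc a 1 : Fin (m + 1) → ℕ)
      (Fin.snoc x τ : Fin (m + 1) → A) (Fin.last m)) =
      reesMonomial _ _ (mem_orderIdeal_one (a := a) (x := x) (τ := τ)) :=
    reesMonomial_congr _ _ (by simp) (by simp)
  obtain ⟨i, hi⟩ := exists_self_notMem _ _ h.weight_pos y hy
  induction i using Fin.lastCases with
  | last => exact absurd (hlast ▸ hτ) hi
  | cast i =>
  have hpow : ∀ {q} (n : ℕ), q ∉ y.asHomogeneousIdeal → q ^ n ∉ y.asHomogeneousIdeal :=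
    fun n hq hq' => hq (y.isPrime.mem_of_pow_mem _ hq')
  rw [hself] at hi
  by_cases hai : a i = 1
  -- A coordinate of weight one suffices alone: the element of lower degree is `1`, with exponent `β
  -- = 0`.
  · refine ⟨i, i, 1, 0, one_pos, by omega, hpow _ hi, hpow _ hi⟩
  by_cases hj : ∃ j ≠ i, reesMonomial _ _ (mem_orderIdeal_castSucc (a := a) (x := x) (τ := τ) j) ∉
      y.asHomogeneousIdeal
  · obtain ⟨j, hji, hj⟩ := hj
    obtain ⟨α, β, hα, hαβ⟩ := exists_coprime_combination (ha i) (ha j) (hcop hji.symm)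
    exact ⟨i, j, α, β, hα, hαβ, hpow _ hi, hpow _ hj⟩
  -- The point would be a vertex, with `x i` the only surviving coordinate. Read modulo the point,
  -- the relation `Ψ` retains only its pure power of that coordinate, so the coefficient `c` lies in
  -- the prime. Then `ρ c = 0`, since over the centre the prime meets `A` in a proper ideal
  -- containing `ker ρ`; but `ρ c` is the value of `F` at the vertex.
  exfalso
  push Not at hj
  obtain ⟨Ψ, hΨ, hΨ0, hΨF⟩ := h.exists_relation
  let I := y.asHomogeneousIdeal.toIdeal
  have hIp : I.IsPrime := y.isPrime
  let ψ := Ideal.Quotient.mk I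
  have h1 := aeval_reesMonomial (Fin.snoc a 1 : Fin (m + 1) → ℕ) (Fin.snoc x τ : Fin (m + 1) → A)
    hΨ (hΨ0 ▸ zero_mem _)
  rw [(reesMonomial_eq_zero _).mpr hΨ0, aeval_def] at h1
  have h2 := congrArg ψ h1
  rw [map_zero, eval₂_comp_left] at h2
  have h3 : (ψ ∘ fun l => reesMonomial _ _ (mem_orderIdeal_self (Fin.snoc a 1 : Fin (m + 1) → ℕ)
      (Fin.snoc x τ : Fin (m + 1) → A) l)) = Pi.single i.castSucc (ψ (reesMonomial _ _
        (mem_orderIdeal_castSucc (a := a) (x := x) (τ := τ) i))) := by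
    funext l
    by_cases hl : l = i.castSucc
    · subst hl
      rw [Pi.single_eq_same, Function.comp_apply, hself]
    · rw [Pi.single_eq_of_ne hl, Function.comp_apply, Ideal.Quotient.eq_zero_iff_mem]
      induction l using Fin.lastCases with
      | last => exact hlast ▸ hτ
      | cast l => exact (hself l).symm ▸ hj l fun e => hl (e ▸ rfl)
  have hwi : 0 < (Fin.snoc a 1 : Fin (m + 1) → ℕ) i.castSucc := h.weight_pos _
  have h4 : ψ (reesMonomial _ _ (mem_orderIdeal_castSucc (a := a) (x := x) (τ := τ) i)) ≠ 0 :=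
    fun e => hi (Ideal.Quotient.eq_zero_iff_mem.mp e)
  have hvi := hvertex i (by have := ha i; omega)
  rw [h3, eval₂_single _ _ hΨ hwi, mul_eq_zero, or_iff_left (pow_ne_zero _ h4),
    RingHom.comp_apply, Ideal.Quotient.eq_zero_iff_mem] at h2
  set c := coeff (Finsupp.single i.castSucc (r / (Fin.snoc a 1 : Fin (m + 1) → ℕ) i.castSucc)) Ψ
    with hc
  have hker : RingHom.ker ρ ≤ I.comap (algebraMap A _) := by
    rw [h.ker_eq, Ideal.span_le]
    rintro _ ⟨l, rfl⟩
    exact hy l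
  have hρc : ρ c = 0 := by
    by_contra hne
    obtain ⟨b, hb⟩ := h.surjective (ρ c)⁻¹
    have h5 : b * c - 1 ∈ RingHom.ker ρ := by
      rw [RingHom.mem_ker, map_sub, map_mul, hb, inv_mul_cancel₀ hne, map_one, sub_self]
    have h6 : (1 : weightedRees (Fin.snoc a 1 : Fin (m + 1) → ℕ)
        (Fin.snoc x τ : Fin (m + 1) → A)) ∈ I := by
      have h7 := sub_mem (Ideal.mul_mem_left I (algebraMap A _ b) h2) (hker h5)
      rwa [← map_mul, ← map_sub, sub_sub_cancel, map_one] at h7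
    exact hIp.one_notMem h6
  have h8 := eval₂_single _ (RingHom.id κ) (isWeightedHomogeneous_suspend hF) hwi 1
  rw [one_pow, mul_one, RingHom.id_apply, ← hΨF, coeff_map, ← hc, hρc, hΨF] at h8
  refine hvi ?_
  rw [← h8]
  change _ = eval _ (suspend r F)
  rw [suspend, map_sub, eval_rename, map_pow, eval_X,
    Pi.single_eq_of_ne (Fin.castSucc_lt_last i).ne', zero_pow hr.ne', sub_zero]
  congr 1
  congr 1
  funext l
  by_cases hl : l = i
  · subst hl
    simp
  · rw [Pi.single_eq_of_ne hl, Function.comp_apply, Pi.single_eq_of_ne]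
    exact fun e => hl (Fin.castSucc_injective _ e)

end IsInitialSystem

end RootSystem

/-! ### Morphisms that are isomorphisms over an open subset -/

theorem isIso_morphismRestrict_of_isOpenImmersion {X Y Z : Scheme.{u}} (f : X ⟶ Y) (j : Z ⟶ X)
    [IsOpenImmersion j] [IsOpenImmersion (j ≫ f)] {V : Y.Opens} (h1 : f ⁻¹ᵁ V = j.opensRange)
    (h2 : (j ≫ f).opensRange = V) : IsIso (f ∣_ V) := by
  have e : Set.range (f ⁻¹ᵁ V).ι = Set.range j := by
    have := congrArg (fun U : X.Opens => (U : Set X)) h1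
    simpa using this
  have h3 : (f ∣_ V) ≫ V.ι = (IsOpenImmersion.isoOfRangeEq (f ⁻¹ᵁ V).ι j e).hom ≫ j ≫ f := by
    rw [morphismRestrict_ι, IsOpenImmersion.isoOfRangeEq_hom_fac_assoc]
  have h4 : IsOpenImmersion ((f ∣_ V) ≫ V.ι) := by
    rw [h3]
    infer_instance
  have h5 : IsOpenImmersion (f ∣_ V) := .of_comp _ V.ι
  rw [isIso_iff_isOpenImmersion_and_surjective]
  refine ⟨h5, ⟨fun y => ?_⟩⟩
  have hy : V.ι y ∈ (j ≫ f).opensRange := h2 ▸ y.2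
  obtain ⟨x, hx⟩ := hy
  refine ⟨(IsOpenImmersion.isoOfRangeEq (f ⁻¹ᵁ V).ι j e).inv x, V.ι.isOpenEmbedding.injective ?_⟩
  rw [← hx, ← Scheme.Hom.comp_apply, ← Scheme.Hom.comp_apply, h3,
    Iso.inv_hom_id_assoc]

theorem isIso_morphismRestrict_iSup {X Y : Scheme.{u}} (f : X ⟶ Y) {ι : Type*} (V : ι → Y.Opens)
    (h : ∀ i, IsIso (f ∣_ V i)) : IsIso (f ∣_ ⨆ i, V i) := by
  refine (IsZariskiLocalAtTarget.iff_of_openCover (P := .isomorphisms Scheme)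
    (Scheme.Opens.iSupOpenCover V)).mpr fun i => ?_
  refine ((MorphismProperty.isomorphisms Scheme).arrow_mk_iso_iff
    ((morphismRestrictOpensRange _ _).symm ≪≫ morphismRestrictRestrict _ _ _ ≪≫
      morphismRestrictEq f ?_)).mpr (h i)
  simp only [Scheme.Opens.iSupOpenCover, ← Scheme.Hom.opensRange_comp, Scheme.homOfLE_ι,
    Scheme.Opens.opensRange_ι]

/-! ### Morphisms of `Proj`, and the blowup off its centre -/

section ProjMorphisms

open HomogeneousLocalization

section

variable {K A : Type u} [CommRing K] [CommRing A] [Algebra K A] (𝒜 : ℕ → Submodule K A)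
  [GradedAlgebra 𝒜]

theorem exists_awayι_apply_eq (y : Proj 𝒜) : ∃ (d : ℕ) (hd : 0 < d) (g : A) (hg : g ∈ 𝒜 d)
    (q : Spec (.of (Away 𝒜 g))), Proj.awayι 𝒜 g hg hd q = y := by
  obtain ⟨q, hq⟩ := (Proj.affineOpenCover 𝒜).openCover.covers y
  exact ⟨_, _, _, _, q, hq⟩

theorem awayι_apply_mem_basicOpen_iff {d : ℕ} (hd : 0 < d) {g : A} (hg : g ∈ 𝒜 d)
    (q : Spec (.of (Away 𝒜 g))) (c : 𝒜 0) :
    Proj.awayι 𝒜 g hg hd q ∈ Proj.basicOpen 𝒜 (c : A) ↔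
      fromZeroRingHom 𝒜 (Submonoid.powers g) c ∉ q.asIdeal := by
  -- On the chart of `g`, the element `c` of degree zero cuts out the same open subset as `g * c`,
  -- which has positive degree.
  have hgc : g * c ∈ 𝒜 d := by simpa using SetLike.mul_mem_graded hg c.2
  have h1 := congrArg (fun U : (Spec (.of (Away 𝒜 g))).Opens => q ∈ U)
    (Proj.awayι_preimage_basicOpen 𝒜 hg hd hgc hd)
  have h2 : Proj.awayι 𝒜 g hg hd q ∈ Proj.basicOpen 𝒜 g := by
    rw [← Proj.opensRange_awayι 𝒜 g hg hd]
    exact ⟨q, rfl⟩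
  have h3 : Proj.awayι 𝒜 g hg hd q ∈ Proj.basicOpen 𝒜 (c : A) ↔
      Proj.awayι 𝒜 g hg hd q ∈ Proj.basicOpen 𝒜 (g * c) := by
    rw [Proj.basicOpen_mul]
    exact ⟨fun h => ⟨h2, h⟩, fun h => h.2⟩
  have h4 : Away.isLocalizationElem hg hgc = fromZeroRingHom 𝒜 (Submonoid.powers g) c ^ d := by
    apply val_injective
    rw [Away.isLocalizationElem, Away.val_mk, val_pow]
    change _ = (Localization.mk (c : A) 1) ^ d
    rw [Localization.mk_pow, Localization.mk_eq_mk_iff, Localization.r_iff_exists]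
    exact ⟨1, by simp; ring⟩
  rw [h3]
  refine (iff_of_eq h1).trans ?_
  rw [h4]
  exact not_congr (q.isPrime.pow_mem_iff_mem d hd)

theorem isProper_projToSpec [Algebra.FiniteType (𝒜 0) A]
    (h : Function.Bijective (algebraMap K (𝒜 0))) : IsProper (projToSpec K 𝒜) := by
  have : IsIso (Spec.map (CommRingCat.ofHom (algebraMap K (𝒜 0)))) := by
    have : IsIso (CommRingCat.ofHom (algebraMap K (𝒜 0))) :=
      (ConcreteCategory.isIso_iff_bijective _).mpr h
    infer_instance
  rw [projToSpec]
  infer_instance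

theorem mem_projToSpec_apply_iff (y : Proj 𝒜) (c : K) :
    c ∈ (projToSpec K 𝒜 y).asIdeal ↔ algebraMap K A c ∈ y.asHomogeneousIdeal := by
  obtain ⟨d, hd, g, hg, q, rfl⟩ := exists_awayι_apply_eq 𝒜 y
  rw [← not_iff_not]
  refine Iff.trans ?_ (awayι_apply_mem_basicOpen_iff 𝒜 hd hg q (algebraMap K (𝒜 0) c)).symm
  rw [← Scheme.Hom.comp_apply, awayι_projToSpec]
  rfl

end

section

variable {R S A B : Type u} [CommRing R] [CommRing S] [CommRing A]
  [CommRing B] [Algebra R A] [Algebra S B] {𝒜 : ℕ → Submodule R A} [GradedAlgebra 𝒜]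
  {ℬ : ℕ → Submodule S B} [GradedAlgebra ℬ] (f : 𝒜 →+*ᵍ ℬ)
  (hf : HomogeneousIdeal.irrelevant ℬ ≤ (HomogeneousIdeal.irrelevant 𝒜).map f)

theorem isPullback_awayι_map {d : ℕ} (hd : 0 < d) {g : A} (hg : g ∈ 𝒜 d) :
    IsPullback (Spec.map (CommRingCat.ofHom (Away.map f g))) (Proj.awayι ℬ (f g) (f.2 hg) hd)
      (Proj.awayι 𝒜 g hg hd) (Proj.map f hf) := by
  refine IsOpenImmersion.isPullback _ _ _ _ (Proj.awayι_comp_map f hf hd g hg) ?_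
  rw [Proj.opensRange_awayι, Proj.opensRange_awayι, Proj.map_preimage_basicOpen]

theorem isClosedImmersion_proj_map (h : ∀ j, ∀ b ∈ ℬ j, ∃ a ∈ 𝒜 j, f a = b) :
    IsClosedImmersion (Proj.map f hf) := by
  have key : ∀ (d : ℕ) (hd : 0 < d) (g : A) (hg : g ∈ 𝒜 d),
      IsClosedImmersion (pullback.snd (Proj.map f hf) (Proj.awayι 𝒜 g hg hd)) := by
    intro d hd g hg
    have : IsClosedImmersion (Spec.map (CommRingCat.ofHom (Away.map f g))) :=
      IsClosedImmersion.spec_of_surjective _ (exists_frac_of_surjective f h hg)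
    rw [← (isPullback_awayι_map f hf hd hg).flip.isoPullback_inv_snd]
    infer_instance
  exact (IsZariskiLocalAtTarget.iff_of_openCover (P := @IsClosedImmersion)
    (Proj.affineOpenCover 𝒜).openCover).mpr fun s => key _ s.1.2 _ s.2.2

theorem proj_map_comp_projToSpec {φ : R →+* S}
    (hφ : ∀ c, f (algebraMap R A c) = algebraMap S B (φ c)) :
    Proj.map f hf ≫ projToSpec R 𝒜 = projToSpec S ℬ ≫ Spec.map (CommRingCat.ofHom φ) := by
  have key : ∀ (d : ℕ) (hd : 0 < d) (g : A) (hg : g ∈ 𝒜 d),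
      Proj.awayι ℬ (f g) (f.2 hg) hd ≫ Proj.map f hf ≫ projToSpec R 𝒜 =
      Proj.awayι ℬ (f g) (f.2 hg) hd ≫ projToSpec S ℬ ≫ Spec.map (CommRingCat.ofHom φ) := by
    intro d hd g hg
    rw [Proj.awayι_comp_map_assoc f hf hd g hg, awayι_projToSpec,
      ← Category.assoc, awayι_projToSpec, ← Spec.map_comp, ← Spec.map_comp]
    congr 1
    ext c
    change (Away.map f g (HomogeneousLocalization.mk (𝒜 := 𝒜) (x := Submonoid.powers g)
      ⟨0, algebraMap R (𝒜 0) c, 1, one_mem _⟩)).val = _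
    rw [Away.map, HomogeneousLocalization.map_mk]
    change Localization.mk (f (algebraMap R A c)) _ = Localization.mk (algebraMap S B (φ c)) _
    rw [hφ]
    congr 1
    exact Subtype.ext (RingHom.map_one f.toRingHom)
  exact (Proj.mapAffineOpenCover f hf).openCover.hom_ext _ _ fun s => key _ s.1.2 _ s.2.2

end

section Rees

variable {A : Type u} [CommRing A] {N : ℕ} (w : Fin N → ℕ) (z : Fin N → A)

theorem isProper_projToSpec_rees : IsProper (projToSpec A (reesGrading w z)) :=
  isProper_projToSpec _ (algebraMap_reesGrading_zero_bijective w z)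

variable {w z}

/-- The factor `z_i u ^ (w i)` cannot vanish where `z_i` does not: for `b` of degree `j`, the
product `b ^ (w i) * z_i ^ j` is a multiple of `(z_i u ^ (w i)) ^ j`, so otherwise the prime would
contain the irrelevant ideal. -/
theorem reesMonomial_sq_notMem_iff (i : Fin N)
    (hγ : z i * z i ∈ orderIdeal w z (w i)) (y : ProjectiveSpectrum (reesGrading w z)) :
    reesMonomial w z hγ ∉ y.asHomogeneousIdeal ↔
      algebraMap A (weightedRees w z) (z i) ∉ y.asHomogeneousIdeal := by
  have := y.isPrime
  have e : reesMonomial w z hγ = algebraMap A (weightedRees w z) (z i) *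
      reesMonomial w z (mem_orderIdeal_self w z i) := by
    rw [algebraMap_eq_reesMonomial, reesMonomial_mul]
    exact reesMonomial_congr _ _ (zero_add _).symm rfl
  refine ⟨fun h h' => h (e ▸ Ideal.mul_mem_right _ y.asHomogeneousIdeal.toIdeal h'),
    fun h h' => ?_⟩
  have h1 : reesMonomial w z (mem_orderIdeal_self w z i) ∈ y.asHomogeneousIdeal.toIdeal := by
    rw [e] at h'
    exact (this.mem_or_mem h').resolve_left h
  refine y.not_irrelevant_le ?_
  rw [HomogeneousIdeal.irrelevant_le]
  intro j hj b hb
  have hb' : b = reesMonomial w z (b.2 j) := eq_reesMonomial hb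
  have e2 : b ^ w i * algebraMap A (weightedRees w z) (z i) ^ j =
      algebraMap A (weightedRees w z) (b.1.coeff j ^ w i) *
        reesMonomial w z (mem_orderIdeal_self w z i) ^ j := by
    conv_lhs => rw [hb']
    rw [algebraMap_eq_reesMonomial, algebraMap_eq_reesMonomial, reesMonomial_pow,
      reesMonomial_pow, reesMonomial_pow, reesMonomial_mul, reesMonomial_mul]
    exact reesMonomial_congr _ _ (by ring) rfl
  have h2 : b ^ w i * algebraMap A (weightedRees w z) (z i) ^ j ∈
      y.asHomogeneousIdeal.toIdeal := by
    rw [e2]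
    exact Ideal.mul_mem_left _ _ (Ideal.pow_mem_of_mem _ h1 j hj)
  exact (this.mem_or_mem h2).elim (this.mem_of_pow_mem _)
    fun h3 => absurd (this.mem_of_pow_mem _ h3) h

/-- The open subset of the spectrum where one of the `z i` is invertible. -/
def nonvanishing (z : Fin N → A) : (Spec (.of A)).Opens :=
  ⨆ i, (PrimeSpectrum.basicOpen (z i) : (Spec (.of A)).Opens)

/-- Over `z_i ≠ 0` the whole preimage is the chart of `z_i² u ^ (w i)`, and the ring of this chart
is the localization of `A` at `z_i`. -/
theorem isIso_projToSpec_rees (hw : ∀ i, 0 < w i) :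
    IsIso (projToSpec A (reesGrading w z) ∣_ nonvanishing z) := by
  refine isIso_morphismRestrict_iSup _ _ fun i => ?_
  have hγ : z i * z i ∈ orderIdeal w z (w i) := by
    have := mul_mem_orderIdeal w z (mem_orderIdeal_self w z i) (mem_orderIdeal_zero w z (z i))
    rwa [add_zero] at this
  have e := awayι_projToSpec (reesGrading w z) (reesMonomial_mem hγ) (hw i)
  let _ := (reesFracMap hγ).toAlgebra
  have hloc := isLocalization_reesFracMap hγ
  have e' : Proj.awayι (reesGrading w z) (reesMonomial w z hγ) (reesMonomial_mem hγ) (hw i) ≫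
      projToSpec A (reesGrading w z) = Spec.map (CommRingCat.ofHom (algebraMap A
        (Away (reesGrading w z) (reesMonomial w z hγ)))) := e
  have : IsOpenImmersion (Proj.awayι (reesGrading w z) (reesMonomial w z hγ)
      (reesMonomial_mem hγ) (hw i) ≫ projToSpec A (reesGrading w z)) := by
    rw [e']
    exact IsOpenImmersion.of_isLocalization (z i)
  refine isIso_morphismRestrict_of_isOpenImmersion _ (Proj.awayι (reesGrading w z)
    (reesMonomial w z hγ) (reesMonomial_mem hγ) (hw i)) ?_ ?_
  · rw [Proj.opensRange_awayι]
    ext y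
    exact (not_congr (mem_projToSpec_apply_iff _ y (z i))).trans
      (reesMonomial_sq_notMem_iff i hγ y).symm
  · ext q
    refine Iff.trans (b := q ∈ Set.range (Proj.awayι (reesGrading w z) (reesMonomial w z hγ)
      (reesMonomial_mem hγ) (hw i) ≫ projToSpec A (reesGrading w z))) Iff.rfl ?_
    rw [e']
    exact Set.ext_iff.mp (PrimeSpectrum.localization_away_comap_range
      (Away (reesGrading w z) (reesMonomial w z hγ)) (z i)) q

end Rees

end ProjMorphisms

/-! ### Normal crossings in charts along the exceptional divisor -/

section ExceptionalCharts

open MvPolynomial HomogeneousLocalization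

attribute [local instance] MvPolynomial.weightedGradedAlgebra

/-- An affine chart `Spec C` of a scheme `P`, in which two subschemes given by `i` and `i'` have
the ideals `(s)` and `(s, T)`, for a regular sequence `s, T` of `C`. -/
structure IsExceptionalChart {P H H' : Scheme.{u}} (i : H ⟶ P) (i' : H' ⟶ P) {C : Type u}
    [CommRing C] (j : Spec (.of C) ⟶ P) (s T : C) : Prop where
  isOpenImmersion : IsOpenImmersion j
  exists_isPullback : ∃ (E : Type u) (_ : CommRing E) (φ : C →+* E) (l : Spec (.of E) ⟶ H),
    Function.Surjective φ ∧ IsPullback (Spec.map (CommRingCat.ofHom φ)) l j i ∧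
      RingHom.ker φ = Ideal.span {s}
  exists_isPullback' : ∃ (E : Type u) (_ : CommRing E) (φ : C →+* E) (l : Spec (.of E) ⟶ H'),
    Function.Surjective φ ∧ IsPullback (Spec.map (CommRingCat.ofHom φ)) l j i' ∧
      RingHom.ker φ = Ideal.span {s, T}
  eq_zero_of_mul : ∀ c, s * c = 0 → c = 0
  mem_of_mul_mem : ∀ c, T * c ∈ Ideal.span {s} → c ∈ Ideal.span {s}

/-- At the prime `q` of `C`, the divisor of `c` has simple normal crossings. -/
def HasCrossingParameters {C : Type u} [CommRing C] (q : PrimeSpectrum C) (c : C) : Prop :=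
  ∃ (d : ℕ) (b : Fin d → Localization.AtPrime q.asIdeal) (J : Finset (Fin d)),
    IsRegularParameters b ∧
      Ideal.span {algebraMap C (Localization.AtPrime q.asIdeal) c} = Ideal.span {∏ l ∈ J, b l}

theorem hasCrossingParameters_of_ker_span {C E : Type u} [CommRing C] [CommRing E] {φ : C →+* E}
    (hφ : Function.Surjective φ) {s t : C} (hker : RingHom.ker φ = Ideal.span {s})
    (hs : ∀ c, s * c = 0 → c = 0)
    (hE : ∀ (q : Ideal E) [q.IsPrime], IsRegularLocalRing (Localization.AtPrime q))
    (q : PrimeSpectrum C) (hq : s ∈ q.asIdeal) (ht : t = 1) : HasCrossingParameters q (s * t) := by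
  obtain ⟨d, b, hb, hb0⟩ := exists_isRegularParameters_of_ker_span hφ hker
    (isSMulRegular_of_mul_eq_zero hs) hE q.asIdeal hq
  refine ⟨_, b, {0}, hb, ?_⟩
  rw [Finset.prod_singleton, hb0, ht, mul_one]

theorem hasCrossingParameters_of_ker_span_pair {C E : Type u} [CommRing C] [CommRing E]
    {φ : C →+* E} (hφ : Function.Surjective φ) {s t : C} (hker : RingHom.ker φ = Ideal.span {s, t})
    (hs : ∀ c, s * c = 0 → c = 0) (ht : ∀ c, t * c ∈ Ideal.span {s} → c ∈ Ideal.span {s})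
    (hE : ∀ (q : Ideal E) [q.IsPrime], IsRegularLocalRing (Localization.AtPrime q))
    (q : PrimeSpectrum C) (hq : s ∈ q.asIdeal) (hq' : t ∈ q.asIdeal) :
    HasCrossingParameters q (s * t) := by
  obtain ⟨d, b, hb, hb0, hb1⟩ := exists_isRegularParameters_of_ker_span_pair hφ hker
    (isSMulRegular_of_mul_eq_zero hs) ht hE q.asIdeal hq hq'
  refine ⟨_, b, {0, 1}, hb, ?_⟩
  rw [Finset.prod_pair (by simp), hb0, hb1, map_mul]

/-- The point `y` of `P` lies in an exceptional chart for `i` and `i'`, on which `s * T` is the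
pullback of `τ`, and in which the divisor of `τ` has normal crossings at `y`. -/
def HasExceptionalChart {P H H' : Scheme.{u}} (i : H ⟶ P) (i' : H' ⟶ P) {A : Type u} [CommRing A]
    (f : P ⟶ Spec (.of A)) (I : Ideal A) (τ : A) (y : P) : Prop :=
  ∃ (C : Type u) (_ : CommRing C) (j : Spec (.of C) ⟶ P) (s T : C) (ψ : A →+* C)
    (q : PrimeSpectrum C), IsExceptionalChart i i' j s T ∧ j q = y ∧
    j ≫ f = Spec.map (CommRingCat.ofHom ψ) ∧ ψ τ = s * T ∧
    (∀ p : Ideal C, p.IsPrime → I ≤ p.comap ψ → s ∈ p) ∧ HasCrossingParameters q (s * T)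

namespace IsInitialSystem

variable {A κ : Type u} [CommRing A] [Field κ] {m : ℕ} {a : Fin m → ℕ} {x : Fin m → A} {τ : A}
  {ρ : A →+* κ} {r : ℕ} {F : MvPolynomial (Fin m) κ}
  (h : IsInitialSystem (Fin.snoc a 1 : Fin (m + 1) → ℕ) (Fin.snoc x τ : Fin (m + 1) → A) ρ r
    (suspend r F))

/-- The inclusion of the exceptional divisor of the weighted blowing up. -/
def exceptionalι (hF : IsWeightedHomogeneous a F r) :
    Hypersurface (isWeightedHomogeneous_suspend hF) ⟶
      Proj (reesGrading (Fin.snoc a 1 : Fin (m + 1) → ℕ) (Fin.snoc x τ : Fin (m + 1) → A)) :=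
  letI := quotientGradedAlgebra (weightedHomogeneousSubmodule κ (Fin.snoc a 1 : Fin (m + 1) → ℕ))
    _ (isHomogeneous_span (isWeightedHomogeneous_suspend hF))
  Proj.map h.initialFormHom (irrelevant_le_map _ h.initialFormHom_surjective)

/-- The inclusion of the intersection of the exceptional divisor with the strict transform of the
divisor of `τ`. -/
def exceptionalSectionι (hF : IsWeightedHomogeneous a F r) (hr : 0 < r) :
    Hypersurface hF ⟶
      Proj (reesGrading (Fin.snoc a 1 : Fin (m + 1) → ℕ) (Fin.snoc x τ : Fin (m + 1) → A)) :=
  letI := quotientGradedAlgebra (weightedHomogeneousSubmodule κ a) _ (isHomogeneous_span hF)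
  Proj.map (h.initialFormKillLast hr) (irrelevant_le_map _ (h.initialFormKillLast_surjective hr))

theorem isClosedImmersion_exceptionalι (hF : IsWeightedHomogeneous a F r) :
    IsClosedImmersion (h.exceptionalι hF) :=
  letI := quotientGradedAlgebra (weightedHomogeneousSubmodule κ (Fin.snoc a 1 : Fin (m + 1) → ℕ))
    _ (isHomogeneous_span (isWeightedHomogeneous_suspend hF))
  isClosedImmersion_proj_map _ _ h.initialFormHom_surjective

theorem isClosedImmersion_exceptionalSectionι (hF : IsWeightedHomogeneous a F r) (hr : 0 < r) :
    IsClosedImmersion (h.exceptionalSectionι hF hr) :=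
  letI := quotientGradedAlgebra (weightedHomogeneousSubmodule κ a) _ (isHomogeneous_span hF)
  isClosedImmersion_proj_map _ _ (h.initialFormKillLast_surjective hr)

theorem initialForm_algebraMap (c : A) : h.initialForm (algebraMap A _ c) =
    Ideal.Quotient.mk _ (C (ρ c)) := by
  have hc : eval (Fin.snoc x τ : Fin (m + 1) → A) (C c) = c := eval_C c
  have hm : eval (Fin.snoc x τ : Fin (m + 1) → A) (C c) ∈
      orderIdeal (Fin.snoc a 1 : Fin (m + 1) → ℕ) (Fin.snoc x τ : Fin (m + 1) → A) 0 :=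
    mem_orderIdeal_zero _ _ _
  rw [algebraMap_eq_reesMonomial, reesMonomial_congr _ hm rfl hc.symm,
    h.initialForm_eval (HasWeightedOrder.of_isWeightedHomogeneous (isWeightedHomogeneous_C _ c)),
    map_C, (isWeightedHomogeneous_C _ (ρ c)).weightedHomogeneousComponent_same]

theorem exceptionalι_comp (hF : IsWeightedHomogeneous a F r) :
    h.exceptionalι hF ≫ projToSpec A (reesGrading _ _) =
      Hypersurface.toSpec (isWeightedHomogeneous_suspend hF) ≫
        Spec.map (CommRingCat.ofHom ρ) :=
  letI := quotientGradedAlgebra (weightedHomogeneousSubmodule κ (Fin.snoc a 1 : Fin (m + 1) → ℕ))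
    _ (isHomogeneous_span (isWeightedHomogeneous_suspend hF))
  proj_map_comp_projToSpec _ _ h.initialForm_algebraMap

theorem exceptionalSectionι_comp (hF : IsWeightedHomogeneous a F r) (hr : 0 < r) :
    h.exceptionalSectionι hF hr ≫ projToSpec A (reesGrading _ _) =
      Hypersurface.toSpec hF ≫ Spec.map (CommRingCat.ofHom ρ) :=
  letI := quotientGradedAlgebra (weightedHomogeneousSubmodule κ a) _ (isHomogeneous_span hF)
  proj_map_comp_projToSpec _ _ fun c => by
    rw [initialFormKillLast_apply, initialForm_algebraMap, quotientKillLast_mk]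
    exact congrArg _ ((killLast κ m).commutes (ρ c))

theorem ker_exceptional (hF : IsWeightedHomogeneous a F r) {e : ℕ} {u v : A}
    (hu : u ∈ orderIdeal (Fin.snoc a 1 : Fin (m + 1) → ℕ) (Fin.snoc x τ : Fin (m + 1) → A) (e + 1))
    (hv : v ∈ orderIdeal (Fin.snoc a 1 : Fin (m + 1) → ℕ) (Fin.snoc x τ : Fin (m + 1) → A) e) :
    letI := quotientGradedAlgebra
      (weightedHomogeneousSubmodule κ (Fin.snoc a 1 : Fin (m + 1) → ℕ))
      _ (isHomogeneous_span (isWeightedHomogeneous_suspend hF))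
    RingHom.ker (Away.map h.initialFormHom (reesMonomial _ _ (mul_mem_orderIdeal _ _ hu hv))) =
      Ideal.span {chartS hu hv} :=
  letI := quotientGradedAlgebra
    (weightedHomogeneousSubmodule κ (Fin.snoc a 1 : Fin (m + 1) → ℕ))
    _ (isHomogeneous_span (isWeightedHomogeneous_suspend hF))
  ker_awayMap_eq_span_chartS hu hv h.initialFormHom fun _ _ hb => h.initialForm_eq_zero_iff hb

theorem ker_exceptionalSection (hF : IsWeightedHomogeneous a F r) (hr : 0 < r) {e : ℕ} {u v : A}
    (hu : u ∈ orderIdeal (Fin.snoc a 1 : Fin (m + 1) → ℕ) (Fin.snoc x τ : Fin (m + 1) → A) (e + 1))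
    (hv : v ∈ orderIdeal (Fin.snoc a 1 : Fin (m + 1) → ℕ) (Fin.snoc x τ : Fin (m + 1) → A) e) :
    letI := quotientGradedAlgebra (weightedHomogeneousSubmodule κ a) _ (isHomogeneous_span hF)
    RingHom.ker (Away.map (h.initialFormKillLast hr)
      (reesMonomial _ _ (mul_mem_orderIdeal _ _ hu hv))) =
      Ideal.span {chartS hu hv, chartT hu hv mem_orderIdeal_one} := by
  let _ := quotientGradedAlgebra (weightedHomogeneousSubmodule κ a) _ (isHomogeneous_span hF)
  refine ker_awayMap_eq_span_pair hu hv mem_orderIdeal_one (h.initialFormKillLast hr)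
    (h.exists_sub_mem_of_initialFormKillLast_eq_zero hr hF) ?_ ?_
  · intro j b hb hb'
    rw [initialFormKillLast_apply, (h.initialForm_eq_zero_iff hb).mpr hb', map_zero]
  · rw [initialFormKillLast_apply, initialForm_last, quotientKillLast_mk, killLast_X_last,
      map_zero]

theorem isExceptionalChart (hF : IsWeightedHomogeneous a F r) (hr : 0 < r) (hF0 : F ≠ 0) {e : ℕ}
    {u v : A}
    (hu : u ∈ orderIdeal (Fin.snoc a 1 : Fin (m + 1) → ℕ) (Fin.snoc x τ : Fin (m + 1) → A) (e + 1))
    (hv : v ∈ orderIdeal (Fin.snoc a 1 : Fin (m + 1) → ℕ) (Fin.snoc x τ : Fin (m + 1) → A) e) :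
    IsExceptionalChart (h.exceptionalι hF) (h.exceptionalSectionι hF hr)
      (Proj.awayι _ _ (reesMonomial_mem (mul_mem_orderIdeal _ _ hu hv)) (by omega))
      (chartS hu hv) (chartT hu hv mem_orderIdeal_one) where
  isOpenImmersion := inferInstance
  exists_isPullback := by
    let _ := quotientGradedAlgebra
      (weightedHomogeneousSubmodule κ (Fin.snoc a 1 : Fin (m + 1) → ℕ))
      _ (isHomogeneous_span (isWeightedHomogeneous_suspend hF))
    exact ⟨_, _, Away.map h.initialFormHom _, _,
      exists_frac_of_surjective _ h.initialFormHom_surjective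
        (reesMonomial_mem (mul_mem_orderIdeal _ _ hu hv)),
      isPullback_awayι_map h.initialFormHom _ (by omega) _,
      h.ker_exceptional hF hu hv⟩
  exists_isPullback' := by
    let _ := quotientGradedAlgebra (weightedHomogeneousSubmodule κ a) _ (isHomogeneous_span hF)
    exact ⟨_, _, Away.map (h.initialFormKillLast hr) _, _,
      exists_frac_of_surjective _ (h.initialFormKillLast_surjective hr)
        (reesMonomial_mem (mul_mem_orderIdeal _ _ hu hv)),
      isPullback_awayι_map (h.initialFormKillLast hr) _ (by omega) _,
      h.ker_exceptionalSection hF hr hu hv⟩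
  eq_zero_of_mul := fun c hc =>
    isSMulRegular_iff_right_eq_zero_of_smul.mp (isSMulRegular_chartS hu hv) c hc
  mem_of_mul_mem := by
    let _ := quotientGradedAlgebra
      (weightedHomogeneousSubmodule κ (Fin.snoc a 1 : Fin (m + 1) → ℕ))
      _ (isHomogeneous_span (isWeightedHomogeneous_suspend hF))
    exact mem_span_chartS_of_chartT_mul_mem hu hv mem_orderIdeal_one h.initialFormHom
      (fun j b hb => h.initialForm_eq_zero_iff hb) (h.mem_orderIdeal_of_mul_last_mem hr hF0)

theorem reesMonomial_mul_notMem {N : ℕ} {w : Fin N → ℕ} {z : Fin N → A} {i j : ℕ} {u v : A}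
    (hu : u ∈ orderIdeal w z i) (hv : v ∈ orderIdeal w z j)
    (y : ProjectiveSpectrum (reesGrading w z)) (h1 : reesMonomial w z hu ∉ y.asHomogeneousIdeal)
    (h2 : reesMonomial w z hv ∉ y.asHomogeneousIdeal) :
    reesMonomial w z (mul_mem_orderIdeal w z hu hv) ∉ y.asHomogeneousIdeal := by
  intro h3
  rw [← reesMonomial_mul hu hv] at h3
  exact (y.isPrime.mem_or_mem h3).elim h1 h2

theorem chartT_mem {N : ℕ} {w : Fin N → ℕ} {z : Fin N → A} {e : ℕ} {u v : A}
    (hu : u ∈ orderIdeal w z (e + 1)) (hv : v ∈ orderIdeal w z e) (hτ : τ ∈ orderIdeal w z 1)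
    (q : PrimeSpectrum (Away (reesGrading w z) (reesMonomial w z (mul_mem_orderIdeal w z hu hv))))
    (hd : 0 < e + 1 + e)
    (hy : reesMonomial w z hτ ∈ ProjectiveSpectrum.asHomogeneousIdeal
      (Proj.awayι _ _ (reesMonomial_mem (mul_mem_orderIdeal w z hu hv)) hd q)) :
    chartT hu hv hτ ∈ q.asIdeal := by
  have hm : τ * (v * v) ∈ orderIdeal w z (e + 1 + e) := by
    simpa using chart_sq_mem_right hv hτ
  have h1 : Proj.awayι _ _ (reesMonomial_mem (mul_mem_orderIdeal w z hu hv)) hd q ∉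
      Proj.basicOpen (reesGrading w z) (reesMonomial w z hm) := by
    rw [Proj.mem_basicOpen, not_not]
    have e1 : reesMonomial w z hm = reesMonomial w z hτ *
        reesMonomial w z (mul_mem_orderIdeal w z hv hv) := by
      rw [reesMonomial_mul]
      exact reesMonomial_congr _ _ (by ring) rfl
    rw [e1]
    exact Ideal.mul_mem_right _ _ hy
  have h2 := congrArg (fun U : (Spec (.of (Away (reesGrading w z)
    (reesMonomial w z (mul_mem_orderIdeal w z hu hv))))).Opens => q ∈ U)
    (Proj.awayι_preimage_basicOpen (reesGrading w z)
      (reesMonomial_mem (mul_mem_orderIdeal w z hu hv)) hd (reesMonomial_mem hm) hd)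
  have h3 : Away.isLocalizationElem (reesMonomial_mem (mul_mem_orderIdeal w z hu hv))
      (reesMonomial_mem hm) = chartT hu hv hτ ^ (e + 1 + e) := by
    apply val_injective
    rw [Away.isLocalizationElem, chartT, reesFrac, Away.val_mk, val_pow, Away.val_mk,
      Localization.mk_pow, Localization.mk_eq_mk_iff, Localization.r_iff_exists]
    refine ⟨1, ?_⟩
    rw [reesMonomial_congr (chart_sq_mem_right hv hτ) hm (by ring) rfl]
    simp
  have h4 := not_iff_not.mpr (iff_of_eq h2)
  rw [h3] at h4
  have h5 := not_not.mp (h4.mp h1)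
  exact q.isPrime.mem_of_pow_mem _ h5

theorem hasExceptionalChart_awayι (hF : IsWeightedHomogeneous a F r) (hr : 0 < r) (hF0 : F ≠ 0)
    {e : ℕ} {u v : A}
    (hu : u ∈ orderIdeal (Fin.snoc a 1 : Fin (m + 1) → ℕ) (Fin.snoc x τ : Fin (m + 1) → A) (e + 1))
    (hv : v ∈ orderIdeal (Fin.snoc a 1 : Fin (m + 1) → ℕ) (Fin.snoc x τ : Fin (m + 1) → A) e)
    (hd : 0 < e + 1 + e) (hus : u ∈ RingHom.ker ρ)
    (q : PrimeSpectrum (Away (reesGrading _ _) (reesMonomial _ _ (mul_mem_orderIdeal _ _ hu hv))))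
    (hy : RingHom.ker ρ ≤ (projToSpec A (reesGrading _ _)
      (Proj.awayι _ _ (reesMonomial_mem (mul_mem_orderIdeal _ _ hu hv)) hd q)).asIdeal)
    (hb : chartS hu hv ∈ q.asIdeal →
      HasCrossingParameters q (chartS hu hv * chartT hu hv mem_orderIdeal_one)) :
    HasExceptionalChart (h.exceptionalι hF) (h.exceptionalSectionι hF hr)
      (projToSpec A (reesGrading _ _)) (RingHom.ker ρ) τ
      (Proj.awayι _ _ (reesMonomial_mem (mul_mem_orderIdeal _ _ hu hv)) hd q) := by
  have hcomp : Proj.awayι _ _ (reesMonomial_mem (mul_mem_orderIdeal _ _ hu hv)) hd ≫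
      projToSpec A (reesGrading _ _) =
        Spec.map (CommRingCat.ofHom (reesFracMap (mul_mem_orderIdeal _ _ hu hv))) :=
    awayι_projToSpec _ _ _
  refine ⟨_, _, Proj.awayι _ _ (reesMonomial_mem (mul_mem_orderIdeal _ _ hu hv)) hd,
    chartS hu hv, chartT hu hv mem_orderIdeal_one, reesFracMap _, q,
    h.isExceptionalChart hF hr hF0 hu hv, rfl, hcomp, (chartS_mul_chartT hu hv _).symm,
    fun p hp hz => chartS_mem_of_mem hu hv (hz hus), hb (chartS_mem_of_mem hu hv ?_)⟩
  have hy' : RingHom.ker ρ ≤ ((Proj.awayι _ _ (reesMonomial_mem (mul_mem_orderIdeal _ _ hu hv))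
    hd ≫ projToSpec A (reesGrading _ _)) q).asIdeal := hy
  rw [hcomp] at hy'
  exact hy' hus

-- Off the strict transform of `τ = 0`: with `u = τ` and `v = 1` one has `T = 1`, and `s` alone cuts
-- out a regular scheme, the chart `F = 1` of the exceptional divisor.
include h in
theorem hasCrossingParameters_last (hF : IsWeightedHomogeneous a F r) (hr : 0 < r) (hF0 : F ≠ 0)
    (hrκ : (r : κ) ≠ 0)
    (hone : (1 : A) ∈ orderIdeal (Fin.snoc a 1 : Fin (m + 1) → ℕ)
      (Fin.snoc x τ : Fin (m + 1) → A) 0)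
    (q : PrimeSpectrum (Away (reesGrading _ _) (reesMonomial _ _ (mul_mem_orderIdeal _ _
      (mem_orderIdeal_one : τ ∈ orderIdeal (Fin.snoc a 1 : Fin (m + 1) → ℕ)
        (Fin.snoc x τ : Fin (m + 1) → A) (0 + 1)) hone))))
    (hs : chartS mem_orderIdeal_one hone ∈ q.asIdeal) :
    HasCrossingParameters q (chartS mem_orderIdeal_one hone *
      chartT mem_orderIdeal_one hone mem_orderIdeal_one) := by
  let _ := quotientGradedAlgebra
    (weightedHomogeneousSubmodule κ (Fin.snoc a 1 : Fin (m + 1) → ℕ))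
    _ (isHomogeneous_span (isWeightedHomogeneous_suspend hF))
  have hθ : h.initialFormHom (reesMonomial _ _ (mul_mem_orderIdeal _ _
      (mem_orderIdeal_one : τ ∈ orderIdeal _ _ (0 + 1)) hone)) =
      Ideal.Quotient.mk (Ideal.span {suspend r F}) (X (Fin.last m)) *
      Ideal.Quotient.mk (Ideal.span {suspend r F}) 1 := by
    change h.initialForm _ = _
    rw [map_one]
    refine Eq.trans ?_ (mul_one _).symm
    rw [← h.initialForm_last]
    exact congrArg _ (reesMonomial_congr _ _ rfl (mul_one τ))
  have hE := isRegularLocalRing_away_suspend hF hrκ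
  rw [← hθ] at hE
  have hch := h.isExceptionalChart hF hr hF0 (mem_orderIdeal_one : τ ∈ orderIdeal _ _ (0 + 1)) hone
  exact hasCrossingParameters_of_ker_span
    (exists_frac_of_surjective _ h.initialFormHom_surjective (reesMonomial_mem _))
    (h.ker_exceptional hF _ hone) hch.eq_zero_of_mul hE q hs (chartT_eq_one _ _ _)

/-- At a point of both components the quotient by `(s, T)` is the chart of `V(F)` for the monomials
`T_i ^ α` and `T_j ^ β`, which is regular by smoothness over `k`. -/
theorem hasCrossingParameters_of_mul_eq {k : Type u} [Field k] [Algebra k κ]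
    {F : MvPolynomial (Fin m) k}
    (h : IsInitialSystem (Fin.snoc a 1 : Fin (m + 1) → ℕ) (Fin.snoc x τ : Fin (m + 1) → A) ρ r
      (suspend r (map (algebraMap k κ) F)))
    (hF : IsWeightedHomogeneous a F r) (hsm : Smooth (Hypersurface.toSpec hF)) (hr : 0 < r)
    (hF0 : F ≠ 0) {i j : Fin m} {α β : ℕ} (hαβ : α * a i = β * a j + 1)
    (hu : x i ^ α ∈ orderIdeal (Fin.snoc a 1 : Fin (m + 1) → ℕ)
        (Fin.snoc x τ : Fin (m + 1) → A) (β * a j + 1))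
    (hv : x j ^ β ∈ orderIdeal (Fin.snoc a 1 : Fin (m + 1) → ℕ)
        (Fin.snoc x τ : Fin (m + 1) → A) (β * a j))
    (q : PrimeSpectrum (Away (reesGrading _ _) (reesMonomial _ _ (mul_mem_orderIdeal _ _ hu hv))))
    (hs : chartS hu hv ∈ q.asIdeal) (hT : chartT hu hv mem_orderIdeal_one ∈ q.asIdeal) :
    HasCrossingParameters q (chartS hu hv * chartT hu hv mem_orderIdeal_one) := by
  have hFκ := isWeightedHomogeneous_map (algebraMap k κ) hF
  have hFκ0 : map (algebraMap k κ) F ≠ 0 := fun h0 =>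
    hF0 (map_injective _ (algebraMap k κ).injective (h0.trans (map_zero _).symm))
  let _ := quotientGradedAlgebra (weightedHomogeneousSubmodule κ a) _ (isHomogeneous_span hFκ)
  have hθ : h.initialFormKillLast hr (reesMonomial _ _ (mul_mem_orderIdeal _ _ hu hv)) =
      Ideal.Quotient.mk (Ideal.span {map (algebraMap k κ) F})
        (map (algebraMap k κ) (X i ^ α)) *
      Ideal.Quotient.mk (Ideal.span {map (algebraMap k κ) F})
        (map (algebraMap k κ) (X j ^ β)) := by
    have hX : ∀ i : Fin m, h.initialFormKillLast hr (reesMonomial _ _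
        (mem_orderIdeal_castSucc (a := a) (x := x) (τ := τ) i)) =
          Ideal.Quotient.mk _ (X i) := fun i => by
      rw [initialFormKillLast_apply, reesMonomial_congr _ (mem_orderIdeal_self _ _ i.castSucc)
        (by simp) (by simp), initialForm_self, quotientKillLast_mk, killLast_X_castSucc]
    rw [← reesMonomial_mul hu hv, ← reesMonomial_congr (pow_mem_orderIdeal _ _
      (mem_orderIdeal_castSucc i) α) hu hαβ rfl, ← reesMonomial_pow, ← reesMonomial_pow, map_mul,
      map_pow, map_pow, hX, hX]
    · simp
    · exact mem_orderIdeal_castSucc j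
    · exact mem_orderIdeal_castSucc i
  have hE := isRegularLocalRing_away_hypersurface (κ := κ) hF hsm
    (U := X i ^ α) (V := X j ^ β) (e := β * a j)
    (by simpa [hαβ] using (isWeightedHomogeneous_X k a i).pow α)
    (by simpa using (isWeightedHomogeneous_X k a j).pow β)
  rw [← hθ] at hE
  have hch := h.isExceptionalChart hFκ hr hFκ0 hu hv
  exact hasCrossingParameters_of_ker_span_pair
    (exists_frac_of_surjective _ (h.initialFormKillLast_surjective hr) (reesMonomial_mem _))
    (h.ker_exceptionalSection hFκ hr hu hv) hch.eq_zero_of_mul hch.mem_of_mul_mem hE q hs hT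

/-- Every point of the exceptional divisor lies in a chart in which the divisor of `τ` has normal
crossings at that point. -/
theorem hasExceptionalChart {k : Type u} [Field k] [Algebra k κ]
    {F : MvPolynomial (Fin m) k}
    (h : IsInitialSystem (Fin.snoc a 1 : Fin (m + 1) → ℕ) (Fin.snoc x τ : Fin (m + 1) → A) ρ r
      (suspend r (map (algebraMap k κ) F)))
    (hF : IsWeightedHomogeneous a F r) (hsm : Smooth (Hypersurface.toSpec hF)) (hr : 0 < r)
    (hrκ : (r : κ) ≠ 0) (hF0 : F ≠ 0) (ha : ∀ i, 0 < a i)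
    (hcop : Pairwise fun i j => Nat.Coprime (a i) (a j))
    (hvertex : ∀ i, 1 < a i → eval (Pi.single i 1) F ≠ 0)
    (y : Proj (reesGrading (Fin.snoc a 1 : Fin (m + 1) → ℕ) (Fin.snoc x τ : Fin (m + 1) → A)))
    (hy : RingHom.ker ρ ≤ (projToSpec A (reesGrading _ _) y).asIdeal) :
    HasExceptionalChart (h.exceptionalι (isWeightedHomogeneous_map (algebraMap k κ) hF))
      (h.exceptionalSectionι (isWeightedHomogeneous_map (algebraMap k κ) hF) hr)
      (projToSpec A (reesGrading _ _)) (RingHom.ker ρ) τ y := by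
  have hFκ := isWeightedHomogeneous_map (algebraMap k κ) hF
  have hFκ0 : map (algebraMap k κ) F ≠ 0 := fun h0 =>
    hF0 (map_injective _ (algebraMap k κ).injective (h0.trans (map_zero _).symm))
  have hz : ∀ i, (Fin.snoc x τ : Fin (m + 1) → A) i ∈ RingHom.ker ρ := fun i => by
    rw [h.ker_eq]
    exact Ideal.subset_span ⟨i, rfl⟩
  have hzx : ∀ i, x i ∈ RingHom.ker ρ := fun i => by simpa using hz i.castSucc
  have hzτ : τ ∈ RingHom.ker ρ := by simpa using hz (Fin.last m)
  have hy' : ∀ i, algebraMap A (weightedRees (Fin.snoc a 1 : Fin (m + 1) → ℕ)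
      (Fin.snoc x τ : Fin (m + 1) → A)) ((Fin.snoc x τ : Fin (m + 1) → A) i) ∈
        ProjectiveSpectrum.asHomogeneousIdeal y :=
    fun i => (mem_projToSpec_apply_iff _ y _).mp (hy (hz i))
  have hrange : ∀ {d : ℕ} {g : A} (hg : g ∈ orderIdeal (Fin.snoc a 1 : Fin (m + 1) → ℕ)
      (Fin.snoc x τ : Fin (m + 1) → A) d) (hd : 0 < d),
      reesMonomial _ _ hg ∉ ProjectiveSpectrum.asHomogeneousIdeal y →
      ∃ q : PrimeSpectrum (Away _ (reesMonomial _ _ hg)),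
        Proj.awayι _ _ (reesMonomial_mem hg) hd q = y := by
    intro d g hg hd hgy
    have : y ∈ (Proj.awayι _ _ (reesMonomial_mem hg) hd).opensRange := by
      rw [Proj.opensRange_awayι]
      exact hgy
    exact this
  -- On the strict transform of `τ = 0` the chart comes from powers of coordinates; elsewhere `u =
  -- τ`, `v = 1` will do.
  by_cases hτ : reesMonomial _ _ (mem_orderIdeal_one (a := a) (x := x) (τ := τ)) ∈
      ProjectiveSpectrum.asHomogeneousIdeal y
  · obtain ⟨i, j, α, β, hα, hαβ, hi, hj⟩ := h.exists_pow_notMem hr hFκ ha hcop (fun i hi => by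
      have : eval (Pi.single i 1) (map (algebraMap k κ) F) =
          algebraMap k κ (eval (Pi.single i 1) F) := by
        rw [MvPolynomial.eval_map, MvPolynomial.eval, MvPolynomial.coe_eval₂Hom,
          MvPolynomial.eval₂_comp_left]
        congr 1
        ext l
        by_cases hl : l = i
        · subst hl
          simp
        · simp [Pi.single_eq_of_ne hl]
      rw [this]
      exact fun h0 => hvertex i hi ((map_eq_zero _).mp h0)) y hy' hτ
    rw [reesMonomial_pow] at hi hj
    have hu : x i ^ α ∈ orderIdeal (Fin.snoc a 1 : Fin (m + 1) → ℕ)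
        (Fin.snoc x τ : Fin (m + 1) → A) (β * a j + 1) := by
      rw [← hαβ]
      exact pow_mem_orderIdeal _ _ (mem_orderIdeal_castSucc i) α
    have hv := pow_mem_orderIdeal (Fin.snoc a 1 : Fin (m + 1) → ℕ)
      (Fin.snoc x τ : Fin (m + 1) → A) (mem_orderIdeal_castSucc (a := a) (x := x) (τ := τ) j) β
    rw [reesMonomial_congr _ hu hαβ rfl] at hi
    obtain ⟨q, rfl⟩ := hrange (mul_mem_orderIdeal _ _ hu hv) (by omega)
      (reesMonomial_mul_notMem hu hv y hi hj)
    have hT := chartT_mem hu hv mem_orderIdeal_one q (by omega) hτ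
    refine h.hasExceptionalChart_awayι hFκ hr hFκ0 hu hv _ (Ideal.pow_mem_of_mem _ (hzx i) _ hα)
      q hy fun hs => ?_
    exact h.hasCrossingParameters_of_mul_eq hF hsm hr hF0 hαβ hu hv q hs hT
  · have hone : (1 : A) ∈ orderIdeal (Fin.snoc a 1 : Fin (m + 1) → ℕ)
      (Fin.snoc x τ : Fin (m + 1) → A) 0 := mem_orderIdeal_zero _ _ 1
    obtain ⟨q, rfl⟩ := hrange (mul_mem_orderIdeal _ _ (mem_orderIdeal_one : τ ∈ orderIdeal _ _ (0 + 1))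
      hone) (by omega) (reesMonomial_mul_notMem mem_orderIdeal_one hone y hτ (by
        intro h1
        rw [← algebraMap_eq_reesMonomial, map_one] at h1
        exact y.isPrime.ne_top ((Ideal.eq_top_iff_one _).mpr h1)))
    refine h.hasExceptionalChart_awayι hFκ hr hFκ0
      (mem_orderIdeal_one : τ ∈ orderIdeal _ _ (0 + 1)) hone _ hzτ q hy fun hs => ?_
    exact h.hasCrossingParameters_last hFκ hr hFκ0 hrκ hone q hs

end IsInitialSystem

end ExceptionalCharts

/-! ### Gluing a modification along an open subset -/

section Gluing

variable {U V X P : Scheme.{u}} (i : U ⟶ X) (j : V ⟶ X) [IsOpenImmersion i] [IsOpenImmersion j]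
  (p : P ⟶ U)

/-- A morphism to an open subscheme `U` that is an isomorphism over `U ∩ V` extends to a morphism
to `U ∪ V` that is an isomorphism over `V`. -/
theorem exists_glued (hp : IsIso (p ∣_ (i ⁻¹ᵁ j.opensRange))) :
    ∃ (Y : Scheme.{u}) (π : Y ⟶ X) (jP : P ⟶ Y) (jV : V ⟶ Y),
      IsOpenImmersion jP ∧ IsOpenImmersion jV ∧ IsPullback p jP i π ∧ IsPullback (𝟙 V) jV j π := by
  let W : P.Opens := p ⁻¹ᵁ i ⁻¹ᵁ j.opensRange
  have hW : W.ι ≫ p ≫ i = (p ∣_ (i ⁻¹ᵁ j.opensRange)) ≫ (i ⁻¹ᵁ j.opensRange).ι ≫ i := by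
    rw [morphismRestrict_ι_assoc]
  have hWopen : IsOpenImmersion (W.ι ≫ p ≫ i) := by
    rw [hW]
    infer_instance
  have hrange : Set.range (W.ι ≫ p ≫ i) ⊆ Set.range j := by
    rintro _ ⟨y, rfl⟩
    rw [Scheme.Hom.comp_apply, Scheme.Hom.comp_apply]
    exact y.2
  let g : W.toScheme ⟶ V := IsOpenImmersion.lift j (W.ι ≫ p ≫ i) hrange
  have hg : g ≫ j = W.ι ≫ p ≫ i := IsOpenImmersion.lift_fac _ _ _
  have hgopen : IsOpenImmersion g := by
    have : IsOpenImmersion (g ≫ j) := hg ▸ hWopen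
    exact .of_comp g j
  let jP : P ⟶ pushout W.ι g := pushout.inl _ _
  let jV : V ⟶ pushout W.ι g := pushout.inr _ _
  have : IsOpenImmersion jP := inferInstanceAs (IsOpenImmersion (colimit.ι (span W.ι g) .left))
  have : IsOpenImmersion jV := inferInstanceAs (IsOpenImmersion (colimit.ι (span W.ι g) .right))
  have hjoint : ∀ y : (pushout W.ι g : Scheme), (∃ q, jP q = y) ∨ ∃ q, jV q = y := by
    intro y
    obtain ⟨l, q, hq⟩ := Scheme.IsLocallyDirected.ι_jointly_surjective (span W.ι g) y
    rcases l with _ | _ | _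
    · refine Or.inl ⟨W.ι q, ?_⟩
      rw [← hq, ← colimit.w (span W.ι g) WalkingSpan.Hom.fst]
      rfl
    · exact Or.inl ⟨q, hq⟩
    · exact Or.inr ⟨q, hq⟩
  let π : pushout W.ι g ⟶ X := pushout.desc (p ≫ i) j (by rw [hg])
  have hπP : jP ≫ π = p ≫ i := pushout.inl_desc _ _ _
  have hπV : jV ≫ π = j := pushout.inr_desc _ _ _
  have hcond : W.ι ≫ jP = g ≫ jV := pushout.condition
  refine ⟨pushout W.ι g, π, jP, jV, inferInstance, inferInstance, ?_, ?_⟩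
  · refine IsOpenImmersion.isPullback _ _ _ _ hπP ?_
    ext y
    constructor
    · rintro ⟨u, hu⟩
      obtain ⟨q, rfl⟩ | ⟨v, rfl⟩ := hjoint y
      · exact ⟨q, rfl⟩
      rw [← Scheme.Hom.comp_apply, hπV] at hu
      obtain ⟨w, hw⟩ := (p ∣_ (i ⁻¹ᵁ j.opensRange)).surjective ⟨u, v, hu.symm⟩
      refine ⟨W.ι w, ?_⟩
      rw [← Scheme.Hom.comp_apply, hcond, Scheme.Hom.comp_apply]
      congr 1
      apply j.isOpenEmbedding.injective
      rw [← Scheme.Hom.comp_apply, hg, hW, ← hu, Scheme.Hom.comp_apply, hw]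
      rfl
    · rintro ⟨q, rfl⟩
      refine ⟨p q, ?_⟩
      rw [← Scheme.Hom.comp_apply, ← Scheme.Hom.comp_apply, hπP]
  · refine IsOpenImmersion.isPullback _ _ _ _ (by rw [hπV, Category.id_comp]) ?_
    ext y
    constructor
    · rintro ⟨v, hv⟩
      obtain ⟨q, rfl⟩ | ⟨v', rfl⟩ := hjoint y
      · rw [← Scheme.Hom.comp_apply, hπP] at hv
        let w : W.toScheme := ⟨q, v, hv⟩
        refine ⟨g w, ?_⟩
        rw [← Scheme.Hom.comp_apply, ← hcond]
        rfl
      · exact ⟨v', rfl⟩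
    · rintro ⟨v, rfl⟩
      refine ⟨v, ?_⟩
      rw [← Scheme.Hom.comp_apply, hπV]

variable {Y : Scheme.{u}} {i j p} {π : Y ⟶ X} {jP : P ⟶ Y} {jV : V ⟶ Y}

theorem isZariskiLocalAtTarget_of_isPullback (Q : MorphismProperty Scheme.{u})
    [IsZariskiLocalAtTarget Q] (hcover : i.opensRange ⊔ j.opensRange = ⊤)
    (hP : IsPullback p jP i π) (hV : IsPullback (𝟙 V) jV j π) (hp : Q p) (hid : Q (𝟙 V)) :
    Q π := by
  refine (IsZariskiLocalAtTarget.iff_of_iSup_eq_top (P := Q) (fun b : Bool => cond b i.opensRange j.opensRange)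
    ?_).mpr ?_
  · rw [iSup_bool_eq]
    exact hcover
  · rintro (_ | _)
    · refine (Q.arrow_mk_iso_iff (morphismRestrictOpensRange π j)).mpr ?_
      change Q (pullback.snd π j)
      rw [← hV.flip.isoPullback_inv_snd]
      exact (MorphismProperty.cancel_left_of_respectsIso Q _ _).mpr hid
    · refine (Q.arrow_mk_iso_iff (morphismRestrictOpensRange π i)).mpr ?_
      change Q (pullback.snd π i)
      rw [← hP.flip.isoPullback_inv_snd]
      exact (MorphismProperty.cancel_left_of_respectsIso Q _ _).mpr hp

theorem isIso_morphismRestrict_of_isPullback (hV : IsPullback (𝟙 V) jV j π) [IsOpenImmersion jV]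
    {O : X.Opens} (hO : O ≤ j.opensRange) : IsIso (π ∣_ O) := by
  have hj : jV ≫ π = j := by rw [← hV.w, Category.id_comp]
  have hj' : ((j ⁻¹ᵁ O).ι ≫ jV) ≫ π = (j ⁻¹ᵁ O).ι ≫ j := by rw [Category.assoc, hj]
  have : IsOpenImmersion (((j ⁻¹ᵁ O).ι ≫ jV) ≫ π) := by
    rw [hj']
    infer_instance
  have hr : ∀ v, π (jV v) = j v := fun v => by rw [← Scheme.Hom.comp_apply, hj]
  have hmem : ∀ y, π y ∈ O → ∃ v, jV v = y := fun y hy => by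
    obtain ⟨v, hv⟩ := hO hy
    obtain ⟨w, -, hw⟩ := Scheme.Pullback.exists_preimage_pullback v y hv
    exact ⟨hV.isoPullback.inv w, by rw [← Scheme.Hom.comp_apply, hV.isoPullback_inv_snd, hw]⟩
  refine isIso_morphismRestrict_of_isOpenImmersion π ((j ⁻¹ᵁ O).ι ≫ jV) ?_ ?_
  · ext y
    constructor
    · intro hy
      obtain ⟨v, rfl⟩ := hmem y hy
      exact ⟨⟨v, (hr v ▸ hy : j v ∈ O)⟩, rfl⟩
    · rintro ⟨v, rfl⟩
      have : π (jV v.1) ∈ O := (hr v.1).symm ▸ (v.2 : j v.1 ∈ O)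
      exact this
  · ext y
    constructor
    · rintro ⟨v, rfl⟩
      have : π (jV v.1) ∈ O := (hr v.1).symm ▸ (v.2 : j v.1 ∈ O)
      exact this
    · intro hy
      obtain ⟨v, rfl⟩ := hO hy
      exact ⟨⟨v, hy⟩, hr v⟩

end Gluing

/-! ### Ideal sheaves on affine charts, special fibres and residual ideals -/

section IdealSheaves

theorem isPushout_quotient {A B : Type u} [CommRing A] [CommRing B] (φ : A →+* B) (t : A) :
    IsPushout (CommRingCat.ofHom φ) (CommRingCat.ofHom (Ideal.Quotient.mk (Ideal.span {t})))
      (CommRingCat.ofHom (Ideal.Quotient.mk (Ideal.span {φ t})))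
      (CommRingCat.ofHom (Ideal.quotientMap (Ideal.span {φ t}) φ
        ((Ideal.span_singleton_le_iff_mem _).mpr (Ideal.mem_span_singleton_self (φ t))))) := by
  refine ⟨⟨by ext; rfl⟩, ⟨PushoutCocone.IsColimit.mk _
    (fun s => CommRingCat.ofHom (Ideal.Quotient.lift _ s.inl.hom ?_)) ?_ ?_ ?_⟩⟩
  · intro b hb
    have h1 : φ t ∈ RingHom.ker s.inl.hom := by
      have := congrArg (fun f => f.hom t) s.condition
      have h2 : s.inl.hom (φ t) = s.inr.hom (Ideal.Quotient.mk _ t) := this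
      rw [RingHom.mem_ker, h2, Ideal.Quotient.eq_zero_iff_mem.mpr (Ideal.mem_span_singleton_self t),
        map_zero]
    exact (Ideal.span_singleton_le_iff_mem _).mpr h1 hb
  · intro s
    ext b
    rfl
  · intro s
    ext b
    exact congrArg (fun f => f.hom b) s.condition
  · intro s m hm _
    ext b
    exact congrArg (fun f => f.hom b) hm

/-- Finite generation of `J` lets a single power of `f` clear the denominators for all its
generators at once. -/
theorem map_colon_of_isLocalization {A B : Type*} [CommRing A] [CommRing B] [Algebra A B] (f : A)
    [IsLocalization.Away f B] (I J : Ideal A) (hJ : J.FG) :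
    (Submodule.colon I (J : Set A)).map (algebraMap A B) =
      Submodule.colon (I.map (algebraMap A B)) (J.map (algebraMap A B) : Set B) := by
  apply le_antisymm
  · rw [Ideal.map_le_iff_le_comap]
    intro a ha
    rw [Submodule.mem_colon] at ha
    rw [Ideal.mem_comap, Submodule.mem_colon]
    have : J.map (algebraMap A B) ≤
        Submodule.colon (I.map (algebraMap A B)) {algebraMap A B a} := by
      rw [Ideal.map_le_iff_le_comap]
      intro b hb
      rw [Ideal.mem_comap, Submodule.mem_colon_singleton, smul_eq_mul, ← map_mul, mul_comm]
      exact Ideal.mem_map_of_mem _ (ha b hb)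
    intro b hb
    have := Submodule.mem_colon_singleton.mp (this hb)
    rwa [smul_eq_mul, mul_comm] at this
  · intro b hb
    rw [Submodule.mem_colon] at hb
    obtain ⟨⟨a, s⟩, hs⟩ := IsLocalization.surj (Submonoid.powers f) b
    have hu := IsLocalization.map_units B s
    have key : ∀ c ∈ J, ∃ n : ℕ, f ^ n * (a * c) ∈ I := by
      intro c hc
      have h1 := hb _ (Ideal.mem_map_of_mem (algebraMap A B) hc)
      have h2 : algebraMap A B (a * c) ∈ I.map (algebraMap A B) := by
        rw [map_mul, ← hs, mul_right_comm]
        exact Ideal.mul_mem_right _ _ h1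
      rw [IsLocalization.algebraMap_mem_map_algebraMap_iff (Submonoid.powers f)] at h2
      obtain ⟨_, ⟨n, rfl⟩, hn⟩ := h2
      exact ⟨n, hn⟩
    obtain ⟨G, rfl⟩ := hJ
    choose! n hn using key
    have h3 : f ^ (∑ c ∈ G, n c) * a ∈ Submodule.colon I (Ideal.span (G : Set A) : Set A) := by
      rw [Submodule.colon_span, Submodule.mem_colon]
      intro c hc
      obtain ⟨e, he⟩ := Nat.exists_eq_add_of_le
        (Finset.single_le_sum (f := n) (fun _ _ => Nat.zero_le _) hc)
      rw [he, pow_add, smul_eq_mul, show f ^ n c * f ^ e * a * c = f ^ e * (f ^ n c * (a * c)) by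
        ring]
      exact Ideal.mul_mem_left _ _ (hn c (Ideal.subset_span hc))
    have h4 := Ideal.mem_map_of_mem (algebraMap A B) h3
    rw [map_mul, map_pow, ← hs] at h4
    have hf := (IsLocalization.Away.algebraMap_isUnit (S := B) f).pow (∑ c ∈ G, n c)
    have h5 := (Ideal.unit_mul_mem_iff_mem _ hf).mp h4
    rw [mul_comm] at h5
    exact (Ideal.unit_mul_mem_iff_mem _ hu).mp h5

variable {Y : Scheme.{u}}

section Chart

variable {C : Type u} [CommRing C] (j : Spec (.of C) ⟶ Y) [IsOpenImmersion j]

/-- The affine open subset that is the image of a chart. -/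
def chartOpen : Y.affineOpens :=
  ⟨j ''ᵁ ⊤, (isAffineOpen_top (Spec (.of C))).image_of_isOpenImmersion j⟩

/-- The coordinate ring of a chart. -/
def chartEquiv : C ≃+* Γ(Y, chartOpen j) :=
  ((Scheme.ΓSpecIso (.of C)).symm ≪≫ (j.appIso ⊤).symm).commRingCatIsoToRingEquiv

/-- The ideal defined by an ideal sheaf on a chart. -/
def chartIdeal (I : Y.IdealSheafData) : Ideal C := (I.ideal (chartOpen j)).comap (chartEquiv j)

theorem chartIdeal_eq_comap (I : Y.IdealSheafData) : chartIdeal j I =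
    ((I.comap j).ideal ⟨⊤, isAffineOpen_top _⟩).comap (Scheme.ΓSpecIso (.of C)).inv.hom := by
  rw [Scheme.IdealSheafData.ideal_comap_of_isOpenImmersion, Ideal.comap_comap]
  rfl

theorem chartIdeal_inf (I J : Y.IdealSheafData) :
    chartIdeal j (I ⊓ J) = chartIdeal j I ⊓ chartIdeal j J := rfl

theorem chartIdeal_sup (I J : Y.IdealSheafData) :
    chartIdeal j (I ⊔ J) = chartIdeal j I ⊔ chartIdeal j J := by
  have h (K : Y.IdealSheafData) : chartIdeal j K =
      (K.ideal (chartOpen j)).map (chartEquiv j).symm := by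
    rw [Ideal.map_symm]
    rfl
  rw [h, h, h, ← Ideal.map_sup]
  rfl

/-- Equality of ideal sheaves can be checked near each point in a chart chosen for that point, with
no compatibility between the charts. -/
theorem ext_of_chartIdeal {I J : Y.IdealSheafData}
    (h : ∀ y : Y, ∃ (C : Type u) (_ : CommRing C) (j : Spec (.of C) ⟶ Y) (_ : IsOpenImmersion j)
      (q : Spec (.of C)), j q = y ∧ chartIdeal j I = chartIdeal j J) : I = J := by
  choose C _ j _ q hq h using h
  refine Scheme.IdealSheafData.ext_of_iSup_eq_top (fun y => chartOpen (j y)) ?_ fun y => ?_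
  · rw [eq_top_iff]
    intro y _
    exact TopologicalSpace.Opens.mem_iSup.mpr ⟨y, q y, trivial, hq y⟩
  · exact Ideal.comap_injective_of_surjective _ (chartEquiv (j y)).surjective (h y)

theorem chartIdeal_ker {Z : Scheme.{u}} (i : Z ⟶ Y) [IsClosedImmersion i] {E : Type u} [CommRing E]
    {φ : C →+* E} {l : Spec (.of E) ⟶ Z}
    (h : IsPullback (Spec.map (CommRingCat.ofHom φ)) l j i) :
    chartIdeal j i.ker = RingHom.ker φ := by
  rw [chartIdeal_eq_comap, ← Scheme.IdealSheafData.ker_fst_of_isClosedImmersion,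
    ← Scheme.Hom.ker_comp_of_isIso h.isoPullback.hom, h.isoPullback_hom_fst, Scheme.ker_of_isAffine]
  have h1 : (Scheme.IdealSheafData.ofIdealTop
      (RingHom.ker (Spec.map (CommRingCat.ofHom φ)).appTop.hom)).ideal ⟨⊤, isAffineOpen_top _⟩ =
      RingHom.ker (Spec.map (CommRingCat.ofHom φ)).appTop.hom := by
    rw [Scheme.IdealSheafData.ofIdealTop_ideal]
    change Ideal.map ((Spec (CommRingCat.of C)).presheaf.map (𝟙 _)).hom _ = _
    rw [CategoryTheory.Functor.map_id, CommRingCat.hom_id]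
    exact Ideal.map_id _
  rw [h1, RingHom.comap_ker, ← CommRingCat.hom_comp, ← Scheme.ΓSpecIso_inv_naturality,
    CommRingCat.hom_comp]
  ext c
  rw [RingHom.mem_ker, RingHom.mem_ker, RingHom.comp_apply]
  exact map_eq_zero_iff _
    (Scheme.ΓSpecIso (.of E)).symm.commRingCatIsoToRingEquiv.injective

theorem chartIdeal_ker_eq_top {Z : Scheme.{u}} (i : Z ⟶ Y) [IsClosedImmersion i]
    (h : Disjoint (Set.range j) (Set.range i)) : chartIdeal j i.ker = ⊤ := by
  rw [chartIdeal_eq_comap, ← Scheme.IdealSheafData.ker_fst_of_isClosedImmersion]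
  have := Scheme.isEmpty_pullback_iff.mpr h
  rw [Scheme.ker_eq_top_of_isEmpty]
  rfl

end Chart

section SpecialFiber

variable {R C : Type u} [CommRing R] [CommRing C] (f : Y ⟶ Spec (.of R)) (t : R)
  {j : Spec (.of C) ⟶ Y} {ψ : R →+* C} (hj : j ≫ f = Spec.map (CommRingCat.ofHom ψ))

instance isClosedImmersion_specialFiberι : IsClosedImmersion (specialFiberι f t) :=
  MorphismProperty.of_isPullback (IsPullback.of_hasPullback f (closedPointι t)).flip
    (IsClosedImmersion.spec_of_surjective _ Ideal.Quotient.mk_surjective)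

include hj in
/-- The special fibre on an affine chart. -/
theorem exists_isPullback_specialFiberι : ∃ l : Spec (.of (C ⧸ Ideal.span {ψ t})) ⟶
    specialFiber f t, IsPullback (Spec.map (CommRingCat.ofHom (Ideal.Quotient.mk
      (Ideal.span {ψ t})))) l j (specialFiberι f t) := by
  have h1 := isPullback_SpecMap_of_isPushout _ _ _ _ (isPushout_quotient ψ t)
  rw [← hj] at h1
  refine ⟨pullback.lift _ _ ((Category.assoc _ _ _).trans h1.w), (IsPullback.of_right
    (h₁₂ := pullback.snd f (closedPointι t)) (v₁₃ := closedPointι t) (h₂₂ := f) ?_ ?_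
    (IsPullback.of_hasPullback f (closedPointι t)).flip).flip⟩
  · rw [pullback.lift_snd]
    exact h1.flip
  · exact pullback.lift_fst _ _ _

include hj in
theorem chartIdeal_specialFiber [IsOpenImmersion j] :
    chartIdeal j (specialFiberι f t).ker = Ideal.span {ψ t} := by
  obtain ⟨l, hl⟩ := exists_isPullback_specialFiberι f t hj
  rw [chartIdeal_ker j _ hl, Ideal.mk_ker]

end SpecialFiber

section Colon

variable [IsLocallyNoetherian Y]

/-- The quotient of ideal sheaves on a locally noetherian scheme. -/
def colonIdealSheaf (S D : Y.IdealSheafData) : Y.IdealSheafData where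
  ideal U := Submodule.colon (S.ideal U) (D.ideal U)
  map_ideal_basicOpen U f := by
    have hloc := U.2.isLocalization_basicOpen f
    have hmap (K : Y.IdealSheafData) : (K.ideal U).map (algebraMap Γ(Y, U)
      Γ(Y, Y.basicOpen f)) = K.ideal (Y.affineBasicOpen f) := K.map_ideal_basicOpen U f
    change Ideal.map (algebraMap Γ(Y, U) Γ(Y, Y.basicOpen f)) _ =
      Submodule.colon (S.ideal (Y.affineBasicOpen f)) (D.ideal (Y.affineBasicOpen f))
    rw [← hmap, ← hmap]
    have := IsLocallyNoetherian.component_noetherian U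
    exact map_colon_of_isLocalization f _ _ (IsNoetherian.noetherian (D.ideal U))

theorem mem_chartIdeal_colon {C : Type u} [CommRing C] (j : Spec (.of C) ⟶ Y) [IsOpenImmersion j]
    (S D : Y.IdealSheafData) (c : C) : c ∈ chartIdeal j (colonIdealSheaf S D) ↔
      ∀ d ∈ chartIdeal j D, c * d ∈ chartIdeal j S := by
  change chartEquiv j c ∈ Submodule.colon (S.ideal (chartOpen j)) (D.ideal (chartOpen j)) ↔ _
  rw [Submodule.mem_colon]
  constructor
  · intro h d hd
    change chartEquiv j (c * d) ∈ S.ideal (chartOpen j)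
    rw [map_mul]
    exact h _ hd
  · intro h d hd
    obtain ⟨d, rfl⟩ := (chartEquiv j).surjective d
    have h1 : chartEquiv j (c * d) ∈ S.ideal (chartOpen j) := h d hd
    rw [map_mul] at h1
    exact h1

end Colon

end IdealSheaves

/-! ### Local rings and pullback of functions on charts -/

section LocalRings

variable {Y : Scheme.{u}} {B C : Type u} [CommRing B] [CommRing C]

theorem stalkMap_pullbackGerm {Z : Scheme.{u}} (j : Z ⟶ Y) (g : Y ⟶ Spec (.of B)) (z : Z) (b : B) :
    j.stalkMap z (pullbackGerm g (j z) b) = pullbackGerm (j ≫ g) z b := by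
  have h := Scheme.Hom.germ_stalkMap_apply j ⊤ z trivial
    (g.appTop.hom ((Scheme.ΓSpecIso (.of B)).inv.hom b))
  refine h.trans ?_
  rw [pullbackGerm, RingHom.comp_apply, RingHom.comp_apply, Scheme.Hom.comp_appTop]
  rfl

theorem pullbackGerm_SpecMap (ψ : B →+* C) (q : Spec (.of C)) (b : B) :
    pullbackGerm (Spec.map (CommRingCat.ofHom ψ)) q b =
      pullbackGerm (𝟙 (Spec (.of C))) q (ψ b) := by
  have h := congrArg (fun φ => φ.hom b)
    (Scheme.ΓSpecIso_inv_naturality (CommRingCat.ofHom ψ))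
  have h' : (Spec.map (CommRingCat.ofHom ψ)).appTop.hom ((Scheme.ΓSpecIso (.of B)).inv.hom b) =
    (Scheme.ΓSpecIso (.of C)).inv.hom (ψ b) := h.symm
  simp only [pullbackGerm, RingHom.comp_apply, h', Scheme.Hom.id_appTop]
  rfl

theorem isLocalization_stalk (q : PrimeSpectrum C) :
    letI := (pullbackGerm (𝟙 (Spec (.of C))) q).toAlgebra
    IsLocalization.AtPrime ((Spec (.of C)).presheaf.stalk q) q.asIdeal := by
  exact StructureSheaf.IsLocalization.to_stalk C q

/-- The local rings of a scheme on an affine chart. -/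
theorem exists_stalkChartEquiv (j : Spec (.of C) ⟶ Y) [IsOpenImmersion j] (q : PrimeSpectrum C) :
    ∃ e : Y.presheaf.stalk (j q) ≃+* Localization.AtPrime q.asIdeal,
      ∀ (B : Type u) [CommRing B] (g : Y ⟶ Spec (.of B)) (ψ : B →+* C),
        j ≫ g = Spec.map (CommRingCat.ofHom ψ) → ∀ b,
          e (pullbackGerm g (j q) b) = algebraMap C _ (ψ b) := by
  let q' : Spec (.of C) := q
  let _ := (pullbackGerm (𝟙 (Spec (.of C))) q').toAlgebra
  have : IsLocalization.AtPrime ((Spec (.of C)).presheaf.stalk q') q.asIdeal :=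
    isLocalization_stalk q
  refine ⟨(asIso (j.stalkMap q')).commRingCatIsoToRingEquiv.trans (IsLocalization.algEquiv
    q.asIdeal.primeCompl ((Spec (.of C)).presheaf.stalk q') _).toRingEquiv, ?_⟩
  intro B _ g ψ hψ b
  have h : j.stalkMap q' (pullbackGerm g (j q') b) = algebraMap C
      ((Spec (.of C)).presheaf.stalk q') (ψ b) := by
    rw [stalkMap_pullbackGerm, hψ, pullbackGerm_SpecMap]
    rfl
  exact (congrArg (IsLocalization.algEquiv q.asIdeal.primeCompl
    ((Spec (.of C)).presheaf.stalk q') _) h).trans (AlgEquiv.commutes _ _)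

/-- Over the point `b = 0` the local ring of the base has maximal ideal generated by the regular
element `b`, so flatness reduces to regularity of the pullback of `b`. -/
theorem flat_stalkMap_of_isSMulRegular [IsNoetherianRing B] {b : B}
    (hmax : (Ideal.span {b}).IsMaximal) (hb : IsSMulRegular B b) (g : Y ⟶ Spec (.of B)) {y : Y}
    (hy : pullbackGerm g y b ∈ IsLocalRing.maximalIdeal (Y.presheaf.stalk y))
    (hreg : IsSMulRegular (Y.presheaf.stalk y) (pullbackGerm g y b)) :
    (g.stalkMap y).hom.Flat := by
  obtain ⟨p, hp⟩ : ∃ p : PrimeSpectrum B, p = g y := ⟨_, rfl⟩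
  let O := (Spec (.of B)).presheaf.stalk (g y)
  let _ : Algebra B O := (pullbackGerm (𝟙 (Spec (.of B))) (g y)).toAlgebra
  have : IsLocalization.AtPrime O p.asIdeal := by
    subst hp
    exact isLocalization_stalk (g y)
  have hcomp (c : B) : g.stalkMap y (algebraMap B O c) = pullbackGerm g y c := by
    have h1 := stalkMap_pullbackGerm g (𝟙 (Spec (.of B))) y c
    rwa [Category.comp_id] at h1
  have hbp : b ∈ p.asIdeal := by
    by_contra hbp
    have hu := (IsLocalization.AtPrime.isUnit_to_map_iff O p.asIdeal b).mpr hbp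
    have := hu.map (g.stalkMap y).hom
    exact (IsLocalRing.mem_maximalIdeal _).mp hy (hcomp b ▸ this)
  have hp : p.asIdeal = Ideal.span {b} :=
    (hmax.eq_of_le p.isPrime.ne_top ((Ideal.span_singleton_le_iff_mem _).mpr hbp)).symm
  have hO : IsLocalRing.maximalIdeal O = Ideal.span {algebraMap B O b} := by
    rw [← IsLocalization.AtPrime.map_eq_maximalIdeal p.asIdeal O, hp, Ideal.map_span,
      Set.image_singleton]
  have : IsNoetherianRing O :=
    IsLocalization.isNoetherianRing p.asIdeal.primeCompl O inferInstance
  have hO0 : IsSMulRegular O (algebraMap B O b) :=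
    IsSMulRegular.of_isLocalization O p.asIdeal.primeCompl hb
  refine @flat_of_isSMulRegular O _ _ _ _ hO hO0 (Y.presheaf.stalk y) _
    (g.stalkMap y).hom.toModule ?_
  intro c c' h
  refine hreg ?_
  change pullbackGerm g y b * c = pullbackGerm g y b * c'
  rw [← hcomp]
  exact h

end LocalRings

/-! ### The blowup glued into the family, and its semistability -/

section GluedFamily

theorem isPullback_comp_mono {P X Z Y W : Scheme.{u}} {fst : P ⟶ X} {snd : P ⟶ Z} {f : X ⟶ Y}
    {g : Z ⟶ Y} (h : IsPullback fst snd f g) (i : Y ⟶ W) [Mono i] :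
    IsPullback fst snd (f ≫ i) (g ≫ i) :=
  ⟨⟨by rw [← Category.assoc, ← Category.assoc, h.w]⟩,
    ⟨PullbackCone.isLimitOfCompMono f g i _ h.isLimit⟩⟩

/-- Being a closed immersion is local on the target: over `V` the subscheme is empty, and over `P`
it is `i`. -/
theorem isClosedImmersion_comp_of_disjoint {H P V Y : Scheme.{u}} (i : H ⟶ P) [IsClosedImmersion i]
    (jP : P ⟶ Y) (jV : V ⟶ Y) [IsOpenImmersion jP] [IsOpenImmersion jV]
    (hcover : jP.opensRange ⊔ jV.opensRange = ⊤)
    (hdisj : Disjoint (Set.range jV) (Set.range (i ≫ jP))) : IsClosedImmersion (i ≫ jP) := by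
  refine (IsZariskiLocalAtTarget.iff_of_iSup_eq_top (P := @IsClosedImmersion)
    (fun b : Bool => cond b jP.opensRange jV.opensRange) ?_).mpr ?_
  · rw [iSup_bool_eq]
    exact hcover
  · rintro (_ | _)
    · refine (MorphismProperty.arrow_mk_iso_iff @IsClosedImmersion
        (morphismRestrictOpensRange _ jV)).mpr ?_
      change IsClosedImmersion (pullback.snd (i ≫ jP) jV)
      have := Scheme.isEmpty_pullback_iff.mpr hdisj.symm
      infer_instance
    · refine (MorphismProperty.arrow_mk_iso_iff @IsClosedImmersion
        (morphismRestrictOpensRange _ jP)).mpr ?_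
      change IsClosedImmersion (pullback.snd (i ≫ jP) jP)
      have h : IsPullback i (𝟙 H) (𝟙 P ≫ jP) (i ≫ jP) :=
        isPullback_comp_mono (IsPullback.of_vert_isIso ⟨by simp⟩) jP
      rw [Category.id_comp] at h
      rw [← h.flip.isoPullback_inv_snd]
      infer_instance

/-- The isomorphism of a closed subscheme with the subscheme of its ideal sheaf. -/
theorem exists_subscheme_iso {H Y : Scheme.{u}} (e : H ⟶ Y) [IsClosedImmersion e]
    {I : Y.IdealSheafData} (hI : e.ker = I) :
    ∃ i : I.subscheme ≅ H, i.hom ≫ e = I.subschemeι := by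
  subst hI
  refine ⟨(asIso e.toImage).symm, ?_⟩
  rw [Iso.symm_hom, asIso_inv, IsIso.inv_comp_eq]
  exact e.toImage_imageι.symm

theorem exists_isRegularParameters_of_ringEquiv {A B : Type u} [CommRing A] [IsLocalRing A]
    [CommRing B] [IsLocalRing B] (e : A ≃+* B) {c : A}
    (h : ∃ (d : ℕ) (x : Fin d → B) (J : Finset (Fin d)), IsRegularParameters x ∧
      Ideal.span {e c} = Ideal.span {∏ l ∈ J, x l}) :
    ∃ (d : ℕ) (x : Fin d → A) (J : Finset (Fin d)), IsRegularParameters x ∧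
      Ideal.span {c} = Ideal.span {∏ l ∈ J, x l} := by
  obtain ⟨d, x, J, hx, hJ⟩ := h
  refine ⟨d, fun l => e.symm (x l), J, hx.of_ringEquiv e.symm, ?_⟩
  have h1 := congrArg (Ideal.map e.symm) hJ
  rw [Ideal.map_span, Ideal.map_span, Set.image_singleton, Set.image_singleton, map_prod,
    e.symm_apply_apply] at h1
  exact h1

section Charts

variable {P H H' Y : Scheme.{u}} {i : H ⟶ P} {i' : H' ⟶ P} {A B : Type u} [CommRing A] [CommRing B]
  {p : P ⟶ Spec (.of A)} {I : Ideal A} {θ : B →+* A} {b : B} {jP : P ⟶ Y} [IsOpenImmersion jP]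
  {g : Y ⟶ Spec (.of B)}

/-- A chart of `Y` at the point `y` in which the ideal sheaves `D`, `E` and the divisor of `b`
are given by `(s)`, `(s, T)` and `(s * T)`. -/
def HasDivisorChart (g : Y ⟶ Spec (.of B)) (b : B) (D E : Y.IdealSheafData) (y : Y) : Prop :=
  ∃ (C : Type u) (_ : CommRing C) (j : Spec (.of C) ⟶ Y) (_ : IsOpenImmersion j) (s T : C)
    (ψ : B →+* C) (q : PrimeSpectrum C), j q = y ∧ chartIdeal j D = Ideal.span {s} ∧
    chartIdeal j E = Ideal.span {s, T} ∧ (∀ c, s * c = 0 → c = 0) ∧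
    (∀ c, T * c ∈ Ideal.span {s} → c ∈ Ideal.span {s}) ∧ s ∈ q.asIdeal ∧
    j ≫ g = Spec.map (CommRingCat.ofHom ψ) ∧ ψ b = s * T ∧ HasCrossingParameters q (ψ b)

theorem HasExceptionalChart.hasDivisorChart {y : P}
    (h : HasExceptionalChart i i' p I (θ b) y) (hy : I ≤ (p y).asIdeal)
    (hg : jP ≫ g = p ≫ Spec.map (CommRingCat.ofHom θ))
    [IsClosedImmersion (i ≫ jP)] [IsClosedImmersion (i' ≫ jP)] :
    HasDivisorChart g b (i ≫ jP).ker (i' ≫ jP).ker (jP y) := by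
  obtain ⟨C, _, j, s, T, ψ, q, hj, rfl, hψ, hb, hs, hc⟩ := h
  have := hj.isOpenImmersion
  obtain ⟨E, _, φ, l, hφ, hl, hker⟩ := hj.exists_isPullback
  obtain ⟨E', _, φ', l', hφ', hl', hker'⟩ := hj.exists_isPullback'
  refine ⟨C, _, j ≫ jP, inferInstance, s, T, ψ.comp θ, q, rfl, ?_, ?_, hj.eq_zero_of_mul,
    hj.mem_of_mul_mem, hs _ q.isPrime ?_, ?_, hb, ?_⟩
  · rw [chartIdeal_ker _ _ (isPullback_comp_mono hl jP), hker]
  · rw [chartIdeal_ker _ _ (isPullback_comp_mono hl' jP), hker']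
  · have h1 : I ≤ ((j ≫ p) q).asIdeal := hy
    rw [hψ] at h1
    exact h1
  · rw [Category.assoc, hg, ← Category.assoc, hψ, CommRingCat.ofHom_comp, Spec.map_comp]
  · rw [RingHom.comp_apply, hb]
    exact hc

theorem HasDivisorChart.exists_isRegularParameters {D E : Y.IdealSheafData} {y : Y}
    (h : HasDivisorChart g b D E y) : ∃ (d : ℕ) (x : Fin d → Y.presheaf.stalk y)
      (J : Finset (Fin d)), IsRegularParameters x ∧
      Ideal.span {pullbackGerm g y b} = Ideal.span {∏ l ∈ J, x l} := by
  obtain ⟨C, _, j, _, s, T, ψ, q, rfl, -, -, -, -, -, hψ, -, d, x, J, hx, hJ⟩ := h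
  obtain ⟨e, he⟩ := exists_stalkChartEquiv j q
  refine exists_isRegularParameters_of_ringEquiv e ⟨d, x, J, hx, ?_⟩
  rw [he B g ψ hψ b, hJ]

/-- The local ring is a domain, so only `s * T ≠ 0` is at stake. If some `v` outside `q` killed `s *
T`, regularity of `s` would give `T v = 0`, and regularity of `T` modulo `s` would put `v` in `(s)`,
which lies in `q`. -/
theorem HasDivisorChart.isSMulRegular [IsLocallyNoetherian Y] {D E : Y.IdealSheafData} {y : Y}
    (h : HasDivisorChart g b D E y) :
    pullbackGerm g y b ∈ IsLocalRing.maximalIdeal (Y.presheaf.stalk y) ∧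
    IsSMulRegular (Y.presheaf.stalk y) (pullbackGerm g y b) := by
  have hreg : IsRegularLocalRing (Y.presheaf.stalk y) := by
    obtain ⟨d, x, J, hx, -⟩ := h.exists_isRegularParameters
    exact hx.isRegularLocalRing
  obtain ⟨C, _, j, _, s, T, ψ, q, rfl, -, -, hs, hT, hsq, hψ, hb, -⟩ := h
  obtain ⟨e, he⟩ := exists_stalkChartEquiv j q
  have := isDomain_of_isRegularLocalRing (A := Y.presheaf.stalk (j q))
  have hes := he B g ψ hψ b
  constructor
  · rw [IsLocalRing.mem_maximalIdeal, mem_nonunits_iff, ← MulEquiv.isUnit_map e, hes,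
      IsLocalization.AtPrime.isUnit_to_map_iff _ q.asIdeal, hb]
    exact fun h => h (Ideal.mul_mem_right _ _ hsq)
  · refine isSMulRegular_of_ne_zero fun h0 => ?_
    rw [h0, map_zero, eq_comm, IsLocalization.map_eq_zero_iff q.asIdeal.primeCompl, hb] at hes
    obtain ⟨v, hv⟩ := hes
    have h1 : T * v = 0 := hs _ (by rw [← hv]; ring)
    refine v.2 ((Ideal.span_singleton_le_iff_mem _).mpr hsq (hT v ?_))
    rw [h1]
    exact Ideal.zero_mem _

/-- The quotient of `(s T)` by `(s)` is `(T)` because `s` is regular, and `(s) ∩ (T) = (s T)`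
because `T` is regular modulo `s`; the sum of the two ideals is `(s, T)`. -/
theorem HasDivisorChart.exists_chartIdeal_eq [IsLocallyNoetherian Y] {D E : Y.IdealSheafData}
    {y : Y} (h : HasDivisorChart g b D E y) :
    ∃ (C : Type u) (_ : CommRing C) (j : Spec (.of C) ⟶ Y) (_ : IsOpenImmersion j)
      (q : Spec (.of C)), j q = y ∧ chartIdeal j (specialFiberι g b).ker =
        chartIdeal j (D ⊓ colonIdealSheaf (specialFiberι g b).ker D) ∧
      chartIdeal j E = chartIdeal j (D ⊔ colonIdealSheaf (specialFiberι g b).ker D) := by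
  obtain ⟨C, _, j, _, s, T, ψ, q, rfl, hD, hE, hs, hT, -, hψ, hb, -⟩ := h
  have hS : chartIdeal j (specialFiberι g b).ker = Ideal.span {s * T} := by
    rw [chartIdeal_specialFiber g b hψ, hb]
  have hD' : chartIdeal j (colonIdealSheaf (specialFiberι g b).ker D) = Ideal.span {T} := by
    ext c
    rw [mem_chartIdeal_colon, hD, hS, Ideal.mem_span_singleton]
    constructor
    · intro h
      obtain ⟨e, he⟩ := Ideal.mem_span_singleton.mp (h s (Ideal.mem_span_singleton_self s))
      exact ⟨e, sub_eq_zero.mp (hs _ (by linear_combination he))⟩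
    · rintro ⟨e, rfl⟩ d hd
      obtain ⟨d, rfl⟩ := Ideal.mem_span_singleton.mp hd
      exact Ideal.mem_span_singleton.mpr ⟨e * d, by ring⟩
  refine ⟨C, _, j, inferInstance, q, rfl, ?_, ?_⟩
  · rw [chartIdeal_inf, hS, hD, hD']
    ext c
    rw [Ideal.mem_inf, Ideal.mem_span_singleton, Ideal.mem_span_singleton,
      Ideal.mem_span_singleton]
    constructor
    · rintro ⟨e, rfl⟩
      exact ⟨⟨T * e, by ring⟩, ⟨s * e, by ring⟩⟩
    · rintro ⟨h1, e, rfl⟩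
      obtain ⟨d, rfl⟩ := Ideal.mem_span_singleton.mp (hT e (Ideal.mem_span_singleton.mpr h1))
      exact ⟨d, by ring⟩
  · rw [chartIdeal_sup, hE, hD, hD', ← Ideal.span_union, Set.singleton_union]

end Charts

/-- Off the exceptional divisor both closed subschemes are empty, their ideals are the unit ideal,
and the residual ideal is `S` itself. -/
theorem exists_chartIdeal_colon_eq {V Y : Scheme.{u}} [IsLocallyNoetherian Y]
    (j : V ⟶ Y) [IsOpenImmersion j] (S : Y.IdealSheafData) {H H' : Scheme.{u}} (e : H ⟶ Y)
    (e' : H' ⟶ Y) [IsClosedImmersion e] [IsClosedImmersion e']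
    (he : Disjoint (Set.range j) (Set.range e)) (he' : Disjoint (Set.range j) (Set.range e'))
    (v : V) : ∃ (C : Type u) (_ : CommRing C) (j' : Spec (.of C) ⟶ Y) (_ : IsOpenImmersion j')
      (q : Spec (.of C)), j' q = j v ∧ chartIdeal j' S =
        chartIdeal j' (e.ker ⊓ colonIdealSheaf S e.ker) ∧
      chartIdeal j' e'.ker = chartIdeal j' (e.ker ⊔ colonIdealSheaf S e.ker) := by
  obtain ⟨U, hU, hv, -⟩ := exists_isAffineOpen_mem_and_subset (x := v) (U := ⊤) trivial
  obtain ⟨q, rfl⟩ : v ∈ Set.range hU.fromSpec := hU.range_fromSpec ▸ hv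
  let l : Spec (.of Γ(V, U)) ⟶ V := hU.fromSpec
  have : IsOpenImmersion l := hU.isOpenImmersion_fromSpec
  have hrange : Set.range (l ≫ j) ⊆ Set.range j := by
    rintro _ ⟨c, rfl⟩
    exact ⟨_, rfl⟩
  have h1 : chartIdeal (l ≫ j) e.ker = ⊤ :=
    chartIdeal_ker_eq_top _ _ (he.mono_left hrange)
  have h2 : chartIdeal (l ≫ j) e'.ker = ⊤ :=
    chartIdeal_ker_eq_top _ _ (he'.mono_left hrange)
  refine ⟨Γ(V, U), _, l ≫ j, inferInstance, q, rfl, ?_, ?_⟩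
  · rw [chartIdeal_inf, h1, top_inf_eq]
    ext c
    rw [mem_chartIdeal_colon, h1]
    exact ⟨fun hc d _ => Ideal.mul_mem_right _ _ hc, fun h => by simpa using h 1 trivial⟩
  · rw [chartIdeal_sup, h1, h2, top_sup_eq]

/-- Every point of `Y` comes from `V`, where the properties are given, or lies over the centre,
where an exceptional chart provides parameters. The second component is obtained as the residual of
the exceptional divisor in the special fibre, so no strict transform has to be constructed; both
identities of ideal sheaves are then checked point by point. -/
theorem exists_semistable_of_glued {X V P H H' : Scheme.{u}} {A B : Type u} [CommRing A]
    [CommRing B] [IsNoetherianRing B] {b : B} (hmax : (Ideal.span {b}).IsMaximal)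
    (hb : IsSMulRegular B b) (f : X ⟶ Spec (.of B)) [LocallyOfFiniteType f] [QuasiCompact f]
    (i : Spec (.of A) ⟶ X) (j : V ⟶ X) [IsOpenImmersion i] [IsOpenImmersion j] {θ : B →+* A}
    (hθ : i ≫ f = Spec.map (CommRingCat.ofHom θ)) (hcover : i.opensRange ⊔ j.opensRange = ⊤)
    {I : Ideal A} (hI : ∀ a : Spec (.of A), i a ∈ j.opensRange ↔ ¬ I ≤ a.asIdeal)
    (hflat : Flat (j ≫ f)) (hreg : IsRegularScheme V)
    (hsnc : ∀ v : V, pullbackGerm (j ≫ f) v b ∈ IsLocalRing.maximalIdeal (V.presheaf.stalk v) →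
      ∃ (d : ℕ) (x : Fin d → V.presheaf.stalk v) (J : Finset (Fin d)), IsRegularParameters x ∧
        Ideal.span {pullbackGerm (j ≫ f) v b} = Ideal.span {∏ l ∈ J, x l})
    (p : P ⟶ Spec (.of A)) [IsProper p] (hp : IsIso (p ∣_ (i ⁻¹ᵁ j.opensRange)))
    (iD : H ⟶ P) (iC : H' ⟶ P) [IsClosedImmersion iD] [IsClosedImmersion iC]
    (hD : ∀ z, I ≤ (p (iD z)).asIdeal) (hC : ∀ z, I ≤ (p (iC z)).asIdeal)
    (hexc : ∀ y, I ≤ (p y).asIdeal → HasExceptionalChart iD iC p I (θ b) y) :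
    ∃ (Y : Scheme.{u}) (π : Y ⟶ X), IsProper π ∧ (∀ O ≤ j.opensRange, IsIso (π ∣_ O)) ∧
      IsSemistable (π ≫ f) b ∧ ∃ D D' : Y.IdealSheafData,
        (specialFiberι (π ≫ f) b).ker = D ⊓ D' ∧
        (∃ e : D.subscheme ≅ H, e.hom ≫ iD ≫ p ≫ i = D.subschemeι ≫ π) ∧
        (∃ e : (D ⊔ D').subscheme ≅ H', e.hom ≫ iC ≫ p ≫ i = (D ⊔ D').subschemeι ≫ π) := by
  obtain ⟨Y, π, jP, jV, _, _, hP, hV⟩ := exists_glued i j p hp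
  have hjP : jP ≫ π = p ≫ i := hP.w.symm
  have hjV : jV ≫ π = j := by rw [← hV.w, Category.id_comp]
  have hproper : IsProper π := isZariskiLocalAtTarget_of_isPullback @IsProper hcover hP hV
    inferInstance inferInstance
  have hmem : ∀ y, π y ∈ j.opensRange → ∃ v, jV v = y := by
    rintro y ⟨v, hv⟩
    obtain ⟨w, -, hw⟩ := Scheme.Pullback.exists_preimage_pullback v y hv
    exact ⟨hV.isoPullback.inv w, by rw [← Scheme.Hom.comp_apply, hV.isoPullback_inv_snd, hw]⟩
  have hmem' : ∀ y, (∃ v, jV v = y) ∨ ∃ w, jP w = y ∧ I ≤ (p w).asIdeal := by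
    intro y
    by_cases hy : π y ∈ j.opensRange
    · exact Or.inl (hmem y hy)
    · have h1 : π y ∈ i.opensRange ⊔ j.opensRange := hcover ▸ trivial
      obtain ⟨a, ha⟩ := h1.resolve_right hy
      obtain ⟨w, hw1, hw⟩ := Scheme.Pullback.exists_preimage_pullback a y ha
      refine Or.inr ⟨hP.isoPullback.inv w, ?_, ?_⟩
      · rw [← Scheme.Hom.comp_apply, hP.isoPullback_inv_snd, hw]
      · rw [← Scheme.Hom.comp_apply, hP.isoPullback_inv_fst, hw1]
        by_contra h
        exact hy (ha ▸ (hI a).mpr h)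
  have hdisj : ∀ {Z : Scheme.{u}} (k : Z ⟶ P), (∀ z, I ≤ (p (k z)).asIdeal) →
      Disjoint (Set.range jV) (Set.range (k ≫ jP)) := by
    intro Z k hk
    rw [Set.disjoint_left]
    rintro _ ⟨v, rfl⟩ ⟨z, hz⟩
    refine (hI (p (k z))).mp ⟨v, ?_⟩ (hk z)
    have h1 : π ((k ≫ jP) z) = π (jV v) := by rw [hz]
    rw [← Scheme.Hom.comp_apply, ← Scheme.Hom.comp_apply, hjV, Category.assoc, hjP] at h1
    exact h1.symm
  have hcov : jP.opensRange ⊔ jV.opensRange = ⊤ := by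
    rw [eq_top_iff]
    intro y _
    obtain ⟨v, hv⟩ | ⟨w, hw, -⟩ := hmem' y
    · exact Or.inr ⟨v, hv⟩
    · exact Or.inl ⟨w, hw⟩
  have hDc := isClosedImmersion_comp_of_disjoint iD jP jV hcov (hdisj iD hD)
  have hCc := isClosedImmersion_comp_of_disjoint iC jP jV hcov (hdisj iC hC)
  have hlft : LocallyOfFiniteType (π ≫ f) := inferInstance
  have hnoeth : IsLocallyNoetherian Y := LocallyOfFiniteType.isLocallyNoetherian (π ≫ f)
  have hg : jP ≫ π ≫ f = p ≫ Spec.map (CommRingCat.ofHom θ) := by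
    rw [← Category.assoc, hjP, Category.assoc, hθ]
  have hchart : ∀ w, I ≤ (p w).asIdeal →
      HasDivisorChart (π ≫ f) b (iD ≫ jP).ker (iC ≫ jP).ker (jP w) :=
    fun w hw => (hexc w hw).hasDivisorChart hw hg
  have hgV : jV ≫ π ≫ f = j ≫ f := by rw [← Category.assoc, hjV]
  have hsncY : ∀ y, pullbackGerm (π ≫ f) y b ∈ IsLocalRing.maximalIdeal (Y.presheaf.stalk y) →
      ∃ (d : ℕ) (x : Fin d → Y.presheaf.stalk y) (J : Finset (Fin d)), IsRegularParameters x ∧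
        Ideal.span {pullbackGerm (π ≫ f) y b} = Ideal.span {∏ l ∈ J, x l} := by
    intro y hy
    obtain ⟨v, rfl⟩ | ⟨w, rfl, hw⟩ := hmem' y
    · have h1 := stalkMap_pullbackGerm jV (π ≫ f) v b
      rw [hgV] at h1
      refine exists_isRegularParameters_of_ringEquiv
        (asIso (jV.stalkMap v)).commRingCatIsoToRingEquiv ?_
      change ∃ d x J, _ ∧ Ideal.span {jV.stalkMap v (pullbackGerm (π ≫ f) (jV v) b)} = _
      rw [h1]
      refine hsnc v ?_
      rw [← h1]
      exact fun hu => hy (isUnit_of_map_unit (jV.stalkMap v).hom _ hu)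
    · exact (hchart w hw).exists_isRegularParameters
  have hregY : IsRegularScheme Y := by
    intro y
    obtain ⟨v, rfl⟩ | ⟨w, rfl, hw⟩ := hmem' y
    · have := hreg v
      exact IsRegularLocalRing.of_ringEquiv (asIso (jV.stalkMap v)).commRingCatIsoToRingEquiv.symm
    · obtain ⟨d, x, J, hx, -⟩ := (hchart w hw).exists_isRegularParameters
      exact hx.isRegularLocalRing
  have hflatY : Flat (π ≫ f) := by
    refine Flat.of_stalkMap _ fun y => ?_
    obtain ⟨v, rfl⟩ | ⟨w, rfl, hw⟩ := hmem' y
    · have h1 : Flat (jV ≫ π ≫ f) := hgV ▸ hflat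
      have h2 := Flat.stalkMap (jV ≫ π ≫ f) v
      rw [Scheme.Hom.stalkMap_comp] at h2
      have h3 : (π ≫ f).stalkMap (jV v) = ((π ≫ f).stalkMap (jV v) ≫ jV.stalkMap v) ≫
          inv (jV.stalkMap v) :=
        (IsIso.eq_comp_inv (jV.stalkMap v)).mpr rfl
      rw [h3, CommRingCat.hom_comp]
      exact h2.comp (RingHom.Flat.of_bijective (ConcreteCategory.bijective_of_isIso _))
    -- Over the centre the point lies on `b = 0`, and flatness over the base follows from regularity
    -- of the pullback of `b`.
    · obtain ⟨h1, h2⟩ := (hchart w hw).isSMulRegular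
      exact flat_stalkMap_of_isSMulRegular hmax hb _ h1 h2
  have hS : (specialFiberι (π ≫ f) b).ker = (iD ≫ jP).ker ⊓
      colonIdealSheaf (specialFiberι (π ≫ f) b).ker (iD ≫ jP).ker := by
    refine ext_of_chartIdeal fun y => ?_
    obtain ⟨v, rfl⟩ | ⟨w, rfl, hw⟩ := hmem' y
    · obtain ⟨C, _, j, hj, q, hq, h1, h2⟩ := exists_chartIdeal_colon_eq jV
        (specialFiberι (π ≫ f) b).ker _ _ (hdisj iD hD) (hdisj iC hC) v
      exact ⟨C, _, j, hj, q, hq, h1⟩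
    · obtain ⟨C, _, j, hj, q, hq, h1, h2⟩ := (hchart w hw).exists_chartIdeal_eq
      exact ⟨C, _, j, hj, q, hq, h1⟩
  have hE : (iC ≫ jP).ker = (iD ≫ jP).ker ⊔
      colonIdealSheaf (specialFiberι (π ≫ f) b).ker (iD ≫ jP).ker := by
    refine ext_of_chartIdeal fun y => ?_
    obtain ⟨v, rfl⟩ | ⟨w, rfl, hw⟩ := hmem' y
    · obtain ⟨C, _, j, hj, q, hq, h1, h2⟩ := exists_chartIdeal_colon_eq jV
        (specialFiberι (π ≫ f) b).ker _ _ (hdisj iD hD) (hdisj iC hC) v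
      exact ⟨C, _, j, hj, q, hq, h2⟩
    · obtain ⟨C, _, j, hj, q, hq, h1, h2⟩ := (hchart w hw).exists_chartIdeal_eq
      exact ⟨C, _, j, hj, q, hq, h2⟩
  obtain ⟨e, he⟩ := exists_subscheme_iso (iD ≫ jP) rfl
  obtain ⟨e', he'⟩ := exists_subscheme_iso (iC ≫ jP) hE
  refine ⟨Y, π, hproper, fun O hO => isIso_morphismRestrict_of_isPullback hV hO,
    ⟨⟨hregY, hflatY, hlft, inferInstance⟩, hsncY⟩, _, _, hS, ⟨e, ?_⟩, ⟨e', ?_⟩⟩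
  · rw [← he, Category.assoc, Category.assoc, hjP]
  · rw [← he', Category.assoc, Category.assoc, hjP]

end GluedFamily

/-! ### The extension by an `r`-th root of `t` -/

section RootRings

open Polynomial

variable {R E : Type u} [CommRing R] [CommRing E] (t : R) {r : ℕ}

theorem rootParam_pow : rootParam t r ^ r = AdjoinRoot.of _ t := by
  have h := AdjoinRoot.eval₂_root (X ^ r - C t : R[X])
  rwa [eval₂_sub, eval₂_X_pow, eval₂_C, sub_eq_zero] at h

theorem flat_rootRing (hr : 0 < r) : Module.Flat R (RootRing t r) := by
  have := (monic_X_pow_sub_C t hr.ne').free_adjoinRoot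
  infer_instance

variable {t}

/-- Its `r`-th power is the image of `t`, which stays regular because the extension is flat. -/
theorem isSMulRegular_rootParam (hr : 0 < r) (ht : IsSMulRegular R t) :
    IsSMulRegular (RootRing t r) (rootParam t r) := by
  have := flat_rootRing t hr
  have h : IsSMulRegular (RootRing t r) (rootParam t r ^ r) := by
    rw [rootParam_pow]
    exact ht.of_flat
  exact (IsSMulRegular.pow_iff hr).mp h

/-- The homomorphism from `R[t^{1/r}]` given by an `r`-th root of `t`. -/
def rootRingHom (χ : R →+* E) (y : E) (h : y ^ r = χ t) : RootRing t r →+* E :=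
  AdjoinRoot.lift χ y (by rw [eval₂_sub, eval₂_X_pow, eval₂_C, h, sub_self])

theorem rootRingHom_of {χ : R →+* E} {y : E} (h : y ^ r = χ t) (c : R) :
    rootRingHom χ y h (AdjoinRoot.of _ c) = χ c := AdjoinRoot.lift_of _

theorem rootRingHom_root {χ : R →+* E} {y : E} (h : y ^ r = χ t) :
    rootRingHom χ y h (rootParam t r) = y := AdjoinRoot.lift_root _

theorem rootRing_hom_ext {g₁ g₂ : RootRing t r →+* E}
    (h : ∀ c, g₁ (AdjoinRoot.of _ c) = g₂ (AdjoinRoot.of _ c))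
    (h' : g₁ (rootParam t r) = g₂ (rootParam t r)) : g₁ = g₂ :=
  AdjoinRoot.ringHom_ext (RingHom.ext h) h'

/-- The homomorphism from `R[t^{1/r}]` that sends `t^{1/r}` to `0`. -/
def rootRingLift (hr : 0 < r) (φ : R →+* E) (hφ : φ t = 0) : RootRing t r →+* E :=
  rootRingHom φ 0 (by rw [hφ, zero_pow hr.ne'])

section

variable (hr : 0 < r) {φ : R →+* E} (hφ : φ t = 0)

theorem rootRingLift_of (c : R) : rootRingLift hr φ hφ (AdjoinRoot.of _ c) = φ c :=
  rootRingHom_of _ c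

theorem rootRingLift_root : rootRingLift hr φ hφ (rootParam t r) = 0 :=
  rootRingHom_root _

theorem rootRingLift_surjective (h : Function.Surjective φ) :
    Function.Surjective (rootRingLift hr φ hφ) := fun e => by
  obtain ⟨c, rfl⟩ := h e
  exact ⟨_, rootRingLift_of hr hφ c⟩

theorem exists_rootRing_eq (c : RootRing t r) : ∃ (c₀ : R) (c₁ : RootRing t r),
    c = AdjoinRoot.of _ c₀ + rootParam t r * c₁ := by
  obtain ⟨p, rfl⟩ := AdjoinRoot.mk_surjective c
  refine ⟨p.coeff 0, AdjoinRoot.mk _ p.divX, ?_⟩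
  conv_lhs => rw [← divX_mul_X_add p]
  rw [map_add, map_mul, AdjoinRoot.mk_X, AdjoinRoot.mk_C, add_comm, mul_comm]

theorem ker_rootRingLift : RingHom.ker (rootRingLift hr φ hφ) =
    (RingHom.ker φ).map (AdjoinRoot.of _) ⊔ Ideal.span {rootParam t r} := by
  apply le_antisymm
  · intro c hc
    obtain ⟨c₀, c₁, rfl⟩ := exists_rootRing_eq c
    rw [RingHom.mem_ker, map_add, map_mul, rootRingLift_root, rootRingLift_of, zero_mul,
      add_zero] at hc
    exact Ideal.add_mem _ (Ideal.mem_sup_left (Ideal.mem_map_of_mem _ hc))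
      (Ideal.mem_sup_right (Ideal.mul_mem_right _ _ (Ideal.mem_span_singleton_self _)))
  · refine sup_le ?_ ?_
    · rw [Ideal.map_le_iff_le_comap]
      intro c hc
      rw [Ideal.mem_comap, RingHom.mem_ker, rootRingLift_of]
      exact hc
    · rw [Ideal.span_singleton_le_iff_mem]
      exact rootRingLift_root hr hφ

theorem ker_rootRingLift_of_ker_eq (hker : RingHom.ker φ = Ideal.span {t}) :
    RingHom.ker (rootRingLift hr φ hφ) = Ideal.span {rootParam t r} := by
  rw [ker_rootRingLift, hker, Ideal.map_span, Set.image_singleton, sup_eq_right,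
    Ideal.span_singleton_le_iff_mem, ← rootParam_pow]
  exact Ideal.pow_mem_of_mem _ (Ideal.mem_span_singleton_self _) _ hr

end

theorem isMaximal_span_rootParam (hr : 0 < r) (h : (Ideal.span {t}).IsMaximal) :
    (Ideal.span {rootParam t r}).IsMaximal := by
  let _ := Ideal.Quotient.field (Ideal.span {t})
  have h0 : Ideal.Quotient.mk (Ideal.span {t}) t = 0 :=
    Ideal.Quotient.eq_zero_iff_mem.mpr (Ideal.mem_span_singleton_self t)
  rw [← ker_rootRingLift_of_ker_eq hr h0 Ideal.mk_ker]
  exact RingHom.ker_isMaximal_of_surjective _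
    (rootRingLift_surjective hr h0 Ideal.Quotient.mk_surjective)

/-- Differentiating `y ^ r = t` gives `r y ^ (r - 1) dy = 0`, and `r` and `y` are invertible. As `L`
is a localization of the algebra generated by `y`, all differentials vanish. -/
theorem formallyUnramified_of_rootRing {L : Type u} [CommRing L] [Algebra (RootRing t r) L]
    [Algebra R L] [IsScalarTower R (RootRing t r) L] (M : Submonoid (RootRing t r))
    [IsLocalization M L] (hr : IsUnit (r : R))
    (hM : IsUnit (algebraMap (RootRing t r) L (rootParam t r))) :
    Algebra.FormallyUnramified R L := by
  let D := KaehlerDifferential.D R L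
  let y := algebraMap (RootRing t r) L (rootParam t r)
  have hy : y ^ r = algebraMap R L t := by
    rw [← map_pow, rootParam_pow, IsScalarTower.algebraMap_apply R (RootRing t r) L]
    rfl
  have hDy : D y = 0 := by
    have h1 : D (y ^ r) = 0 := by rw [hy, Derivation.map_algebraMap]
    rw [Derivation.leibniz_pow, ← Nat.cast_smul_eq_nsmul R, hr.smul_eq_zero,
      (hM.pow (r - 1)).smul_eq_zero] at h1
    exact h1
  have hD (b : RootRing t r) : D (algebraMap _ L b) = 0 := by
    obtain ⟨p, rfl⟩ := AdjoinRoot.mk_surjective b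
    have h1 : algebraMap (RootRing t r) L (AdjoinRoot.mk _ p) = aeval y p := by
      rw [← AdjoinRoot.aeval_eq, aeval_algebraMap_apply]
    rw [h1, Derivation.map_aeval, hDy, smul_zero]
  constructor
  refine subsingleton_of_forall_eq 0 fun ω => ?_
  have hω : ω ∈ Submodule.span L (Set.range D) := by
    rw [KaehlerDifferential.span_range_derivation]
    trivial
  refine Submodule.span_le (p := (⊥ : Submodule L _)).mpr ?_ hω
  rintro _ ⟨l, rfl⟩
  obtain ⟨⟨b, s⟩, hs⟩ := IsLocalization.surj M l
  have h1 := congrArg D hs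
  rw [Derivation.leibniz, hD, hD, smul_zero, zero_add,
    (IsLocalization.map_units L s).smul_eq_zero] at h1
  exact h1

/-- Where `t^{1/r}` is invertible the extension is unramified and flat, so the maximal ideal is
extended from below and regularity ascends. -/
theorem isRegularLocalRing_rootRing [IsNoetherianRing R] (hr : 0 < r) (hr' : IsUnit (r : R))
    (P : Ideal (RootRing t r)) [P.IsPrime] (hP : rootParam t r ∉ P)
    [IsRegularLocalRing (Localization.AtPrime (P.comap (AdjoinRoot.of (X ^ r - C t))))] :
    IsRegularLocalRing (Localization.AtPrime P) := by
  have : Algebra.IsUnramifiedAt R P := formallyUnramified_of_rootRing P.primeCompl hr'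
    (IsLocalization.map_units (Localization.AtPrime P) (⟨_, hP⟩ : P.primeCompl))
  let p := P.comap (AdjoinRoot.of (X ^ r - C t))
  have : P.LiesOver p := ⟨rfl⟩
  let _ : Algebra (Localization.AtPrime p) (Localization.AtPrime P) :=
    Localization.AtPrime.algebraOfLiesOver p P
  have h := ((Algebra.isUnramifiedAt_iff_map_eq R p P).mp inferInstance).2
  have := flat_rootRing t hr
  have : Module.Flat (Localization.AtPrime p) (Localization.AtPrime P) := inferInstance
  refine isRegularLocalRing_of_flat_of_map_maximalIdeal (A := Localization.AtPrime p) ?_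
  rw [← h, ← Localization.AtPrime.map_eq_maximalIdeal, Ideal.map_map,
    ← IsScalarTower.algebraMap_eq]

/-- The homomorphism `R[t^{1/r}] → E[φ(t)^{1/r}]`. -/
def rootRingMap (φ : R →+* E) (t : R) (r : ℕ) : RootRing t r →+* RootRing (φ t) r :=
  rootRingHom ((AdjoinRoot.of _).comp φ) (rootParam (φ t) r) (rootParam_pow _)

theorem rootRingMap_of (φ : R →+* E) (t : R) (r : ℕ) (c : R) :
    rootRingMap φ t r (AdjoinRoot.of _ c) = AdjoinRoot.of _ (φ c) := rootRingHom_of _ c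

theorem rootRingMap_root (φ : R →+* E) (t : R) (r : ℕ) :
    rootRingMap φ t r (rootParam t r) = rootParam (φ t) r := rootRingHom_root _

theorem isPushout_rootRing (φ : R →+* E) (t : R) (r : ℕ) :
    IsPushout (CommRingCat.ofHom φ) (CommRingCat.ofHom (AdjoinRoot.of (X ^ r - C t)))
      (CommRingCat.ofHom (AdjoinRoot.of (X ^ r - C (φ t))))
      (CommRingCat.ofHom (rootRingMap φ t r)) := by
  have hw : ∀ s : PushoutCocone (CommRingCat.ofHom φ)
      (CommRingCat.ofHom (AdjoinRoot.of (X ^ r - C t))), ∀ c : R,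
      s.inl.hom (φ c) = s.inr.hom (AdjoinRoot.of _ c) :=
    fun s c => congrArg (fun f => f.hom c) s.condition
  have hr : ∀ s : PushoutCocone (CommRingCat.ofHom φ)
      (CommRingCat.ofHom (AdjoinRoot.of (X ^ r - C t))),
      s.inr.hom (rootParam t r) ^ r = s.inl.hom (φ t) := fun s => by
    rw [hw, ← rootParam_pow, map_pow]
  refine ⟨⟨?_⟩, ⟨PushoutCocone.IsColimit.mk _
    (fun s => CommRingCat.ofHom (rootRingHom s.inl.hom (s.inr.hom (rootParam t r)) (hr s)))
    ?_ ?_ ?_⟩⟩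
  · ext c
    exact (rootRingMap_of φ t r c).symm
  · intro s
    ext c
    exact rootRingHom_of (hr s) c
  · intro s
    apply CommRingCat.hom_ext
    refine rootRing_hom_ext (fun c => ?_) ?_
    · refine (congrArg (rootRingHom s.inl.hom (s.inr.hom (rootParam t r)) (hr s))
        (rootRingMap_of φ t r c)).trans ?_
      exact (rootRingHom_of (hr s) (φ c)).trans (hw s c)
    · refine (congrArg (rootRingHom s.inl.hom (s.inr.hom (rootParam t r)) (hr s))
        (rootRingMap_root φ t r)).trans ?_
      exact rootRingHom_root (hr s)
  · intro s m hm hm'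
    apply CommRingCat.hom_ext
    refine rootRing_hom_ext (fun c => ?_) ?_
    · exact (congrArg (fun f => f.hom c) hm).trans (rootRingHom_of (hr s) c).symm
    · have h1 : m.hom (rootRingMap φ t r (rootParam t r)) = s.inr.hom (rootParam t r) :=
        congrArg (fun f => f.hom (rootParam t r)) hm'
      refine Eq.trans ?_ (h1.trans (rootRingHom_root (hr s)).symm)
      exact congrArg m.hom (rootRingMap_root φ t r).symm

end RootRings

/-! ### Regularity of `X_r` away from the singular point -/

section RootFamily

variable {R : Type u} [CommRing R] {X : Scheme.{u}} (f : X ⟶ Spec (.of R)) (t : R)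

section Chart

variable {A : Type u} [CommRing A] {j : Spec (.of A) ⟶ X} {ψ : R →+* A}
  (hj : j ≫ f = Spec.map (CommRingCat.ofHom ψ))

include hj in
/-- The base change `X_r` on an affine chart of `X`. -/
theorem exists_isPullback_rootFamily (r : ℕ) :
    ∃ l : Spec (.of (RootRing (ψ t) r)) ⟶ rootFamily f t r,
      IsPullback (Spec.map (CommRingCat.ofHom (AdjoinRoot.of _))) l j (rootFamilyToSource f t r) ∧
      l ≫ rootFamilyMap f t r = Spec.map (CommRingCat.ofHom (rootRingMap ψ t r)) := by
  have h1 := isPullback_SpecMap_of_isPushout _ _ _ _ (isPushout_rootRing ψ t r)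
  rw [← hj] at h1
  refine ⟨pullback.lift _ _ ((Category.assoc _ _ _).trans h1.w), (IsPullback.of_right
    (h₁₂ := pullback.snd f (rootCover t r)) (v₁₃ := rootCover t r) (h₂₂ := f) ?_ ?_
    (IsPullback.of_hasPullback f (rootCover t r)).flip).flip, pullback.lift_snd _ _ _⟩
  · rw [pullback.lift_snd]
    exact h1.flip
  · exact pullback.lift_fst _ _ _

variable {f t}

include hj in
theorem isRegularLocalRing_localization_specialFiber [IsOpenImmersion j]
    (h : ∀ z : specialFiber f t, specialFiberι f t z ∈ Set.range j → ¬ IsSingularPoint z)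
    (q : Ideal (A ⧸ Ideal.span {ψ t})) [q.IsPrime] :
    IsRegularLocalRing (Localization.AtPrime q) := by
  obtain ⟨l, hl⟩ := exists_isPullback_specialFiberι f t hj
  have : IsOpenImmersion l := MorphismProperty.of_isPullback hl inferInstance
  let q' : PrimeSpectrum (A ⧸ Ideal.span {ψ t}) := ⟨q, inferInstance⟩
  obtain ⟨e, -⟩ := exists_stalkChartEquiv l q'
  have hq (z) : specialFiberι f t (l z) ∈ Set.range j :=
    ⟨Spec.map _ z, by rw [← Scheme.Hom.comp_apply, ← Scheme.Hom.comp_apply, hl.w]⟩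
  have h1 := not_not.mp (h (l q') (hq q'))
  exact IsRegularLocalRing.of_ringEquiv e

include hj in
theorem isSMulRegular_of_flat_chart [IsOpenImmersion j] [Flat f] (ht : IsSMulRegular R t) :
    IsSMulRegular A (ψ t) := by
  have h1 : Flat (j ≫ f) := inferInstance
  rw [hj, Flat.SpecMap_iff] at h1
  let _ := ψ.toAlgebra
  have : Module.Flat R A := h1
  exact ht.of_flat

-- Modulo `t^{1/r}` the root ring becomes `A / (ψ t)`, a chart of the special fibre, which is
-- regular here; this treats the primes containing `t^{1/r}`. At the other primes regularity comes
-- from `X`, over which the extension is unramified and flat.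
include hj in
theorem hasCrossingParameters_rootRing [IsOpenImmersion j] [Flat f] [IsNoetherianRing A]
    (hX : IsRegularScheme X) (ht : IsSMulRegular R t) {r : ℕ} (hr : 0 < r)
    (hr' : IsUnit (r : A))
    (h : ∀ z : specialFiber f t, specialFiberι f t z ∈ Set.range j → ¬ IsSingularPoint z)
    (P : PrimeSpectrum (RootRing (ψ t) r)) :
    IsRegularLocalRing (Localization.AtPrime P.asIdeal) ∧
      (rootParam (ψ t) r ∈ P.asIdeal → HasCrossingParameters P (rootParam (ψ t) r)) := by
  have h1 : rootParam (ψ t) r ∈ P.asIdeal → HasCrossingParameters P (rootParam (ψ t) r) := by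
    intro hP
    have h0 : Ideal.Quotient.mk (Ideal.span {ψ t}) (ψ t) = 0 :=
      Ideal.Quotient.eq_zero_iff_mem.mpr (Ideal.mem_span_singleton_self _)
    have h2 := isSMulRegular_rootParam hr (isSMulRegular_of_flat_chart hj ht)
    have h3 := hasCrossingParameters_of_ker_span (t := 1)
      (rootRingLift_surjective hr h0 Ideal.Quotient.mk_surjective)
      (ker_rootRingLift_of_ker_eq hr h0 Ideal.mk_ker)
      (fun c hc => h2 (hc.trans (smul_zero _).symm))
      (isRegularLocalRing_localization_specialFiber hj h) P hP rfl
    rwa [mul_one] at h3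
  refine ⟨?_, h1⟩
  by_cases hP : rootParam (ψ t) r ∈ P.asIdeal
  · obtain ⟨d, x, J, hx, -⟩ := h1 hP
    exact hx.isRegularLocalRing
  · let p : PrimeSpectrum A := P.comap (AdjoinRoot.of _)
    obtain ⟨e, -⟩ := exists_stalkChartEquiv j p
    have := hX (j p)
    have h2 : IsRegularLocalRing (Localization.AtPrime p.asIdeal) :=
      IsRegularLocalRing.of_ringEquiv e
    exact @isRegularLocalRing_rootRing A _ (ψ t) r _ hr hr' P.asIdeal _ hP h2

end Chart

variable {f t}

theorem exists_isRegularParameters_rootFamily [IsNoetherianRing R] (hf : IsRegularFamily f)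
    (ht : IsSMulRegular R t) {r : ℕ} (hr : 0 < r) (hr' : IsUnit (r : R)) {U : X.Opens}
    (h : ∀ z : specialFiber f t, specialFiberι f t z ∈ U → ¬ IsSingularPoint z)
    (v : rootFamily f t r) (hv : rootFamilyToSource f t r v ∈ U) :
    IsRegularLocalRing ((rootFamily f t r).presheaf.stalk v) ∧
    (pullbackGerm (rootFamilyMap f t r) v (rootParam t r) ∈
        IsLocalRing.maximalIdeal ((rootFamily f t r).presheaf.stalk v) →
      ∃ (d : ℕ) (x : Fin d → (rootFamily f t r).presheaf.stalk v) (J : Finset (Fin d)),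
        IsRegularParameters x ∧
        Ideal.span {pullbackGerm (rootFamilyMap f t r) v (rootParam t r)} =
          Ideal.span {∏ l ∈ J, x l}) := by
  have := hf.flat
  have := hf.locallyOfFiniteType
  have : IsLocallyNoetherian X := LocallyOfFiniteType.isLocallyNoetherian f
  obtain ⟨W, hW, hvW, hWU⟩ := exists_isAffineOpen_mem_and_subset hv
  let A : Type u := Γ(X, W)
  let j : Spec (.of A) ⟶ X := hW.fromSpec
  have : IsOpenImmersion j := hW.isOpenImmersion_fromSpec
  have : IsNoetherianRing A := IsLocallyNoetherian.component_noetherian ⟨W, hW⟩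
  have hrange : Set.range j = W := hW.range_fromSpec
  obtain ⟨ψ', hψ'⟩ := Spec.map_surjective (j ≫ f)
  have hj : j ≫ f = Spec.map (CommRingCat.ofHom ψ'.hom) := hψ'.symm
  obtain ⟨l, hl, hlf⟩ := exists_isPullback_rootFamily f t hj r
  have : IsOpenImmersion l := MorphismProperty.of_isPullback hl inferInstance
  obtain ⟨P, rfl⟩ : ∃ P : PrimeSpectrum (RootRing (ψ'.hom t) r), l P = v := by
    obtain ⟨a, ha⟩ : rootFamilyToSource f t r v ∈ Set.range j := hrange ▸ hvW
    obtain ⟨w, -, hw⟩ := Scheme.Pullback.exists_preimage_pullback a v ha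
    exact ⟨hl.isoPullback.inv w, by rw [← Scheme.Hom.comp_apply, hl.isoPullback_inv_snd, hw]⟩
  have hrA : IsUnit (r : A) := by
    have := hr'.map ψ'.hom
    rwa [map_natCast] at this
  obtain ⟨h1, h2⟩ := hasCrossingParameters_rootRing hj hf.regular ht hr hrA
    (fun z hz => h z (hWU (hrange.le hz))) P
  obtain ⟨e, he⟩ := exists_stalkChartEquiv l P
  have he' := he _ (rootFamilyMap f t r) _ hlf (rootParam t r)
  rw [rootRingMap_root] at he'
  refine ⟨IsRegularLocalRing.of_ringEquiv e.symm, fun h3 => ?_⟩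
  refine exists_isRegularParameters_of_ringEquiv e ?_
  rw [he']
  refine h2 ?_
  rw [IsLocalRing.mem_maximalIdeal, mem_nonunits_iff, ← MulEquiv.isUnit_map e, he',
      IsLocalization.AtPrime.isUnit_to_map_iff _ P.asIdeal] at h3
  exact not_not.mp h3

end RootFamily

/-! ### Affine neighbourhoods of a point and their shrinking -/

section LocalCharts

/-- `γ` exhibits `S` as a localization of `A`. -/
def IsLocalizationMap {A S : Type*} [CommRing A] [CommRing S] (γ : A →+* S) : Prop :=
  @IsLocalization A _ ((IsUnit.submonoid S).comap γ) S _ γ.toAlgebra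

namespace IsLocalizationMap

variable {A S : Type*} [CommRing A] [CommRing S] {γ : A →+* S}

theorem of_forall (h1 : ∀ s, ∃ a c, IsUnit (γ c) ∧ s * γ c = γ a)
    (h2 : ∀ a, γ a = 0 → ∃ c, IsUnit (γ c) ∧ c * a = 0) : IsLocalizationMap γ := by
  let _ := γ.toAlgebra
  refine (isLocalization_iff _ _).mpr ⟨fun c => c.2, fun s => ?_, fun {a b} hab => ?_⟩
  · obtain ⟨a, c, hc, h⟩ := h1 s
    exact ⟨⟨a, c, hc⟩, h⟩
  · have hab' : γ a = γ b := hab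
    obtain ⟨c, hc, h⟩ := h2 (a - b) (by rw [map_sub, hab', sub_self])
    exact ⟨⟨c, hc⟩, by linear_combination h⟩

variable (h : IsLocalizationMap γ)

include h

theorem exists_mul_eq (s : S) : ∃ a c, IsUnit (γ c) ∧ s * γ c = γ a := by
  let _ := γ.toAlgebra
  have : IsLocalization ((IsUnit.submonoid S).comap γ) S := h
  obtain ⟨⟨a, c⟩, hs⟩ := IsLocalization.surj ((IsUnit.submonoid S).comap γ) s
  exact ⟨a, c, c.2, hs⟩

theorem exists_mul_mem {J : Ideal A} {y : A} (hy : γ y ∈ J.map γ) :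
    ∃ c, IsUnit (γ c) ∧ c * y ∈ J := by
  let _ := γ.toAlgebra
  have : IsLocalization ((IsUnit.submonoid S).comap γ) S := h
  obtain ⟨c, hc, hcy⟩ := (IsLocalization.algebraMap_mem_map_algebraMap_iff
    ((IsUnit.submonoid S).comap γ) S J y).mp hy
  exact ⟨c, hc, hcy⟩

theorem exists_mul_eq_zero {y : A} (hy : γ y = 0) : ∃ c, IsUnit (γ c) ∧ c * y = 0 := by
  obtain ⟨c, hc, h0⟩ := h.exists_mul_mem (J := ⊥) (y := y) (by rw [hy]; exact Ideal.zero_mem _)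
  exact ⟨c, hc, h0⟩

theorem map_comap (J : Ideal S) : (J.comap γ).map γ = J := by
  refine le_antisymm Ideal.map_comap_le fun s hs => ?_
  obtain ⟨a, c, hc, ha⟩ := h.exists_mul_eq s
  rw [← Ideal.mul_unit_mem_iff_mem _ hc, ha]
  exact Ideal.mem_map_of_mem _ (by rw [Ideal.mem_comap, ← ha]; exact Ideal.mul_mem_right _ _ hs)

theorem away {g : A} (hg : IsUnit (γ g)) :
    IsLocalizationMap (IsLocalization.Away.lift g hg : Localization.Away g →+* S) := by
  have hγ (a : A) : (IsLocalization.Away.lift g hg : Localization.Away g →+* S)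
    (algebraMap A _ a) = γ a := IsLocalization.Away.lift_eq g hg a
  refine .of_forall (fun s => ?_) fun y hy => ?_
  · obtain ⟨a, c, hc, ha⟩ := h.exists_mul_eq s
    exact ⟨algebraMap _ _ a, algebraMap _ _ c, by rwa [hγ], by rw [hγ, hγ, ha]⟩
  · obtain ⟨⟨a, v⟩, ha⟩ := IsLocalization.surj (Submonoid.powers g) y
    have h1 : γ a = 0 := by rw [← hγ, ← ha, map_mul, hy, zero_mul]
    obtain ⟨c, hc, hc0⟩ := h.exists_mul_eq_zero h1
    refine ⟨algebraMap _ _ c, by rwa [hγ], ?_⟩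
    rw [← (IsLocalization.map_units (Localization.Away g) v).mul_left_eq_zero, mul_assoc, ha,
      ← map_mul, hc0, map_zero]

theorem exists_forall_mul_eq {ι : Type*} [Finite ι] (s : ι → S) :
    ∃ g, IsUnit (γ g) ∧ ∃ a : ι → A, ∀ i, s i * γ g = γ (a i) := by
  classical
  have := Fintype.ofFinite ι
  choose a c hc ha using fun i => h.exists_mul_eq (s i)
  refine ⟨∏ i, c i, ?_, fun i => a i * ∏ k ∈ Finset.univ.erase i, c k, fun i => ?_⟩
  · rw [map_prod]
    exact IsUnit.prod_univ_iff.mpr hc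
  · rw [← Finset.mul_prod_erase Finset.univ c (Finset.mem_univ i), map_mul, map_mul, ← ha]
    ring

theorem exists_forall_mul_mem [IsNoetherianRing A] {J K : Ideal A} (hJ : J.map γ ≤ K.map γ) :
    ∃ g, IsUnit (γ g) ∧ ∀ y ∈ J, g * y ∈ K := by
  classical
  obtain ⟨G, rfl⟩ := IsNoetherian.noetherian J
  choose! c hc hcy using fun y (hy : y ∈ G) =>
    h.exists_mul_mem (hJ (Ideal.mem_map_of_mem γ (Ideal.subset_span hy)))
  refine ⟨∏ y ∈ G, c y, ?_, fun y hy => ?_⟩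
  · rw [map_prod]
    exact IsUnit.prod_iff.mpr hc
  · have h1 : Ideal.span (G : Set A) ≤ Submodule.colon K {∏ y ∈ G, c y} := by
      rw [Ideal.span_le]
      intro z hz
      rw [SetLike.mem_coe, Submodule.mem_colon_singleton, smul_eq_mul,
        ← Finset.mul_prod_erase G c hz, ← mul_assoc, mul_comm z]
      exact Ideal.mul_mem_right _ _ (hcy z hz)
    have := Submodule.mem_colon_singleton.mp (h1 hy)
    rwa [smul_eq_mul, mul_comm] at this

end IsLocalizationMap

variable {X : Scheme.{u}}

/-- `j` is an affine open neighbourhood of `x`, with the canonical map `γ` to the local ring. -/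
structure IsLocalChart (x : X) {A : Type u} [CommRing A] (j : Spec (.of A) ⟶ X)
    (γ : A →+* X.presheaf.stalk x) : Prop where
  isOpenImmersion : IsOpenImmersion j
  isLocalization : IsLocalizationMap γ
  comp : Spec.map (CommRingCat.ofHom γ) ≫ j = X.fromSpecStalk x

theorem exists_isLocalChart (x : X) : ∃ (U : X.affineOpens) (j : Spec (.of Γ(X, U)) ⟶ X)
    (γ : Γ(X, U) →+* X.presheaf.stalk x), IsLocalChart x j γ := by
  obtain ⟨U, hU, hx, -⟩ := exists_isAffineOpen_mem_and_subset (x := x) (U := ⊤) trivial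
  refine ⟨⟨U, hU⟩, hU.fromSpec, (X.presheaf.germ U x hx).hom, hU.isOpenImmersion_fromSpec, ?_, ?_⟩
  · let _ := X.presheaf.algebra_section_stalk (⟨x, hx⟩ : U)
    have : IsLocalization.AtPrime (X.presheaf.stalk x) (hU.primeIdealOf ⟨x, hx⟩).asIdeal :=
      hU.isLocalization_stalk ⟨x, hx⟩
    refine .of_forall (fun s => ?_) fun a ha => ?_
    · obtain ⟨⟨a, c⟩, hs⟩ := IsLocalization.surj (hU.primeIdealOf ⟨x, hx⟩).asIdeal.primeCompl s
      exact ⟨a, c, IsLocalization.map_units _ c, hs⟩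
    · obtain ⟨c, hc⟩ := (IsLocalization.map_eq_zero_iff
        (hU.primeIdealOf ⟨x, hx⟩).asIdeal.primeCompl (X.presheaf.stalk x) a).mp ha
      exact ⟨c, IsLocalization.map_units _ c, hc⟩
  · rw [← hU.fromSpecStalk_eq_fromSpecStalk hx]
    rfl

theorem fromSpecStalk_comp_eq {R : Type u} [CommRing R] (f : X ⟶ Spec (.of R)) (x : X) :
    X.fromSpecStalk x ≫ f = Spec.map (CommRingCat.ofHom (pullbackGerm f x)) := by
  obtain ⟨φ, hφ⟩ := Spec.map_surjective (X.fromSpecStalk x ≫ f)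
  rw [← hφ]
  congr 1
  ext b
  have h1 := congrArg (fun χ => χ.hom b) (Scheme.ΓSpecIso_inv_naturality φ)
  have h2 : (Scheme.ΓSpecIso (X.presheaf.stalk x)).inv.hom (φ.hom b) =
    (Spec.map φ).appTop.hom ((Scheme.ΓSpecIso (.of R)).inv.hom b) := h1
  rw [hφ, Scheme.Hom.comp_appTop, Scheme.fromSpecStalk_appTop] at h2
  have h3 : (Spec (X.presheaf.stalk x)).presheaf.map (homOfLE (le_top : (⊤ : (Spec
      (X.presheaf.stalk x)).Opens) ≤ ⊤)).op = 𝟙 _ := CategoryTheory.Functor.map_id _ _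
  exact (Scheme.ΓSpecIso (X.presheaf.stalk x)).symm.commRingCatIsoToRingEquiv.injective
    (h2.trans (congrArg (fun χ => χ.hom ((Scheme.ΓSpecIso (X.presheaf.stalk x)).inv.hom
      (pullbackGerm f x b))) h3))

namespace IsLocalChart

variable {x : X} {A : Type u} [CommRing A] {j : Spec (.of A) ⟶ X} {γ : A →+* X.presheaf.stalk x}
  (h : IsLocalChart x j γ)

include h

theorem away {g : A} (hg : IsUnit (γ g)) :
    IsLocalChart x (Spec.map (CommRingCat.ofHom (algebraMap A (Localization.Away g))) ≫ j)
      (IsLocalization.Away.lift g hg) := by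
  have := h.isOpenImmersion
  have : IsOpenImmersion (Spec.map (CommRingCat.ofHom (algebraMap A (Localization.Away g)))) :=
    IsOpenImmersion.of_isLocalization g
  refine ⟨inferInstance, h.isLocalization.away hg, ?_⟩
  rw [← h.comp, ← Category.assoc, ← Spec.map_comp, ← CommRingCat.ofHom_comp]
  congr 4
  exact RingHom.ext fun a => IsLocalization.Away.lift_eq g hg a

theorem pullbackGerm_eq {R : Type u} [CommRing R] {f : X ⟶ Spec (.of R)} {ψ : R →+* A}
    (hψ : j ≫ f = Spec.map (CommRingCat.ofHom ψ)) (b : R) : pullbackGerm f x b = γ (ψ b) := by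
  have h1 := fromSpecStalk_comp_eq f x
  rw [← h.comp, Category.assoc, hψ, ← Spec.map_comp, Spec.map_inj] at h1
  exact congrArg (fun φ => φ.hom b) h1.symm

theorem apply_comap : j (PrimeSpectrum.comap γ (IsLocalRing.closedPoint _)) = x := by
  have h1 := X.fromSpecStalk_closedPoint (x := x)
  rwa [← h.comp] at h1

end IsLocalChart

end LocalCharts

/-! ### Local rings of the special fibre -/

section SpecialFiberPoints

variable {R : Type u} [CommRing R] {X : Scheme.{u}} {f : X ⟶ Spec (.of R)} {t : R}

theorem nonempty_quotient_localization_ringEquiv {A : Type u} [CommRing A] (c : A)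
    (q : PrimeSpectrum (A ⧸ Ideal.span {c})) {S : Type u} [CommRing S]
    (e : S ≃+* Localization.AtPrime (q.comap (Ideal.Quotient.mk (Ideal.span {c}))).asIdeal) {s : S}
    (hs : e s = algebraMap A _ c) :
    Nonempty ((S ⧸ Ideal.span {s}) ≃+* Localization.AtPrime q.asIdeal) := by
  let p : PrimeSpectrum A := q.comap (Ideal.Quotient.mk (Ideal.span {c}))
  have he₂ : Nonempty ((Localization.AtPrime p.asIdeal ⧸ (Ideal.span {c}).map (algebraMap A
      (Localization.AtPrime p.asIdeal))) ≃+* Localization.AtPrime q.asIdeal) :=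
    nonempty_localization_quotient_ringEquiv (Ideal.Quotient.mk (Ideal.span {c}))
    (Ideal.span {c}) q.asIdeal (fun e => by
      obtain ⟨a, rfl⟩ := Ideal.Quotient.mk_surjective e
      exact ⟨a, 1, by rw [map_one]; exact q.asIdeal.primeCompl.one_mem, by rw [map_one, mul_one]⟩)
    (fun a ha => ⟨1, by rw [map_one]; exact q.asIdeal.primeCompl.one_mem, by
      rw [one_mul]; exact Ideal.Quotient.eq_zero_iff_mem.mp ha⟩) Ideal.mk_ker.ge
  obtain ⟨e₂⟩ := he₂
  refine ⟨(Ideal.quotientEquiv _ _ e ?_).trans e₂⟩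
  rw [Ideal.map_span, Ideal.map_span, Set.image_singleton, Set.image_singleton]
  exact congrArg (fun c => Ideal.span {c}) hs.symm

theorem nonempty_stalk_specialFiber_ringEquiv_of_chart {A : Type u} [CommRing A]
    {j : Spec (.of A) ⟶ X} [IsOpenImmersion j] {ψ : R →+* A}
    (hj : j ≫ f = Spec.map (CommRingCat.ofHom ψ)) (z : specialFiber f t)
    (hz : specialFiberι f t z ∈ Set.range j) :
    Nonempty ((X.presheaf.stalk (specialFiberι f t z) ⧸
      Ideal.span {pullbackGerm f (specialFiberι f t z) t}) ≃+*
        (specialFiber f t).presheaf.stalk z) := by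
  obtain ⟨l, hl⟩ := exists_isPullback_specialFiberι f t hj
  have : IsOpenImmersion l := MorphismProperty.of_isPullback hl inferInstance
  obtain ⟨q, rfl⟩ : ∃ q : PrimeSpectrum (A ⧸ Ideal.span {ψ t}), l q = z := by
    obtain ⟨a, ha⟩ := hz
    obtain ⟨w, -, hw⟩ := Scheme.Pullback.exists_preimage_pullback a z ha
    exact ⟨hl.isoPullback.inv w, by rw [← Scheme.Hom.comp_apply, hl.isoPullback_inv_snd, hw]⟩
  obtain ⟨e, -⟩ := exists_stalkChartEquiv l q
  let p : PrimeSpectrum A := q.comap (Ideal.Quotient.mk _)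
  have hp : specialFiberι f t (l q) = j p := by
    have h1 (w) : specialFiberι f t (l w) = j (Spec.map (CommRingCat.ofHom
      (Ideal.Quotient.mk (Ideal.span {ψ t}))) w) := by
      rw [← Scheme.Hom.comp_apply, ← Scheme.Hom.comp_apply, hl.w]
    exact h1 q
  obtain ⟨e₁, he₁⟩ := exists_stalkChartEquiv j p
  obtain ⟨e₂⟩ := nonempty_quotient_localization_ringEquiv (ψ t) q e₁ (he₁ R f ψ hj t)
  have key : ∀ x, x = j p → Nonempty ((X.presheaf.stalk x ⧸ Ideal.span {pullbackGerm f x t}) ≃+*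
      (specialFiber f t).presheaf.stalk (l q)) := by
    rintro _ rfl
    exact ⟨e₂.trans e.symm⟩
  exact key _ hp

/-- The local rings of the special fibre are the quotients by `t` of those of `X`. -/
theorem nonempty_stalk_specialFiber_ringEquiv (z : specialFiber f t) :
    Nonempty ((X.presheaf.stalk (specialFiberι f t z) ⧸
      Ideal.span {pullbackGerm f (specialFiberι f t z) t}) ≃+*
        (specialFiber f t).presheaf.stalk z) := by
  obtain ⟨U, j, γ, h⟩ := exists_isLocalChart (specialFiberι f t z)
  have := h.isOpenImmersion
  obtain ⟨ψ, hψ⟩ := Spec.map_surjective (j ≫ f)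
  exact nonempty_stalk_specialFiber_ringEquiv_of_chart (ψ := ψ.hom) hψ.symm z ⟨_, h.apply_comap⟩

variable (hf : IsRegularFamily f) (ht : IsSMulRegular R t)

include hf ht

theorem pullbackGerm_ne_zero (x : X) : pullbackGerm f x t ≠ 0 := by
  have := hf.flat
  obtain ⟨U, j, γ, h⟩ := exists_isLocalChart x
  have := h.isOpenImmersion
  obtain ⟨ψ', hψ'⟩ := Spec.map_surjective (j ≫ f)
  have hj : j ≫ f = Spec.map (CommRingCat.ofHom ψ'.hom) := hψ'.symm
  rw [h.pullbackGerm_eq hj]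
  intro h0
  obtain ⟨c, hc, hc0⟩ := h.isLocalization.exists_mul_eq_zero h0
  have h1 := isSMulRegular_of_flat_chart hj ht (a₁ := c) (a₂ := 0) (by
    simpa [mul_comm] using hc0)
  rw [h1, map_zero] at hc
  exact not_isUnit_zero hc

/-- The local ring of the special fibre is the quotient of a regular local ring by the nonzero
element `t`. Such a quotient, when nontrivial, is regular exactly when the element avoids the square
of the maximal ideal. -/
theorem isSingularPoint_iff (z : specialFiber f t) : IsSingularPoint z ↔
    pullbackGerm f (specialFiberι f t z) t ∈
      IsLocalRing.maximalIdeal (X.presheaf.stalk (specialFiberι f t z)) ^ 2 := by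
  obtain ⟨e⟩ := nonempty_stalk_specialFiber_ringEquiv z
  have := hf.regular (specialFiberι f t z)
  constructor
  · intro hz
    by_contra h2
    have h1 : pullbackGerm f (specialFiberι f t z) t ∈
        IsLocalRing.maximalIdeal (X.presheaf.stalk (specialFiberι f t z)) := by
      intro hu
      have := e.symm.injective.nontrivial
      exact (Ideal.Quotient.nontrivial_iff.mp this) (Ideal.span_singleton_eq_top.mpr hu)
    have := isRegularLocalRing_quotient h1 h2
    exact hz (IsRegularLocalRing.of_ringEquiv e)
  · intro h hz
    have : IsRegularLocalRing ((specialFiber f t).presheaf.stalk z) := hz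
    exact not_isRegularLocalRing_quotient h (pullbackGerm_ne_zero hf ht _)
      (IsRegularLocalRing.of_ringEquiv e.symm)

end SpecialFiberPoints

/-! ### The singular point is closed -/

section SingularPoint

variable {R : Type u} [CommRing R] {X : Scheme.{u}} {f : X ⟶ Spec (.of R)} {t : R}

theorem pullbackGerm_mem_sq_of_chart {A : Type u} [CommRing A]
    {j : Spec (.of A) ⟶ X} [IsOpenImmersion j] {ψ : R →+* A}
    (hj : j ≫ f = Spec.map (CommRingCat.ofHom ψ)) (q : PrimeSpectrum A)
    (h : ψ t ∈ q.asIdeal ^ 2) {x : X} (hx : x = j q) :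
    pullbackGerm f x t ∈ IsLocalRing.maximalIdeal (X.presheaf.stalk x) ^ 2 := by
  subst hx
  obtain ⟨e, he⟩ := exists_stalkChartEquiv j q
  have h1 : e (pullbackGerm f (j q) t) ∈
      IsLocalRing.maximalIdeal (Localization.AtPrime q.asIdeal) ^ 2 := by
    rw [he R f ψ hj, ← Localization.AtPrime.map_eq_maximalIdeal, ← Ideal.map_pow]
    exact Ideal.mem_map_of_mem _ h
  have h2 := Ideal.mem_map_of_mem e.symm h1
  rwa [Ideal.map_pow, e.symm_apply_apply, IsLocalRing.map_ringEquiv_maximalIdeal] at h2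

/-- An isolated singular point of the special fibre is closed. -/
theorem isClosed_singleton_of_isSingularPoint (hmax : (Ideal.span {t}).IsMaximal)
    (hf : IsRegularFamily f) (ht : IsSMulRegular R t) {o : specialFiber f t}
    (hsingle : ∀ z : specialFiber f t, IsSingularPoint z → z = o) {A : Type u} [CommRing A]
    {j : Spec (.of A) ⟶ X} {γ : A →+* X.presheaf.stalk (specialFiberι f t o)}
    (h : IsLocalChart (specialFiberι f t o) j γ) {ψ : R →+* A}
    (hj : j ≫ f = Spec.map (CommRingCat.ofHom ψ))
    (hψ : ψ t ∈ (IsLocalRing.maximalIdeal _).comap γ ^ 2) : IsClosed {specialFiberι f t o} := by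
  have := h.isOpenImmersion
  have := hf.locallyOfFiniteType
  let _ := Ideal.Quotient.field (Ideal.span {t})
  have : LocallyOfFiniteType (pullback.snd f (closedPointι t)) :=
    MorphismProperty.of_isPullback (IsPullback.of_hasPullback f (closedPointι t))
      hf.locallyOfFiniteType
  have : JacobsonSpace (specialFiber f t) :=
    @LocallyOfFiniteType.jacobsonSpace _ _ (pullback.snd f (closedPointι t)) this inferInstance
  -- Since `t` lies in the square of the prime of `o` on the chart, it lies in the square of every
  -- larger prime: all specializations of `o` in the chart are singular, hence equal to `o`. So `o`
  -- is locally closed, and in a Jacobson space a locally closed point is closed.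
  have h1 : ({o} : Set (specialFiber f t)) =
      closure {o} ∩ specialFiberι f t ⁻¹' (Set.range j) := by
    refine Set.Subset.antisymm ?_ ?_
    · rintro _ rfl
      exact ⟨subset_closure rfl, _, h.apply_comap⟩
    · rintro z ⟨hz, q, hq⟩
      refine hsingle z ((isSingularPoint_iff hf ht z).mpr
        (pullbackGerm_mem_sq_of_chart hj q (Ideal.pow_right_mono ?_ 2 hψ) hq.symm))
      have h2 : specialFiberι f t o ⤳ specialFiberι f t z :=
        (specializes_iff_mem_closure.mpr hz).map (specialFiberι f t).continuous
      rw [← hq, ← h.apply_comap] at h2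
      exact (PrimeSpectrum.le_iff_specializes _ _).mpr
        (j.isOpenEmbedding.isInducing.specializes_iff.mp h2)
  have h2 : IsClosed ({o} : Set (specialFiber f t)) := by
    refine isClosed_singleton_of_isLocallyClosed_singleton ?_
    rw [h1]
    exact isClosed_closure.isLocallyClosed.inter (j.isOpenEmbedding.isOpen_range.preimage
      (specialFiberι f t).continuous).isLocallyClosed
  have h3 := (specialFiberι f t).isClosedEmbedding.isClosedMap _ h2
  rwa [Set.image_singleton] at h3

end SingularPoint

/-! ### Lifting the equation of the singularity to a neighbourhood -/

section LocalEquation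

open MvPolynomial

theorem eval_map_comp {A B σ : Type*} [CommRing A] [CommRing B] (φ : A →+* B) (y : σ → A)
    (p : MvPolynomial σ A) : eval (fun i => φ (y i)) (map φ p) = φ (eval y p) := by
  rw [MvPolynomial.eval_map]
  exact (eval₂_comp_left φ (RingHom.id A) y p).symm

/-- Lets the error term be absorbed: it is the value of a weighted homogeneous polynomial of degree
`r` whose coefficients vanish in the residue field when `I` is the maximal ideal. -/
theorem exists_isWeightedHomogeneous_eval_eq {S : Type u} [CommRing S] {m r : ℕ}
    {a : Fin (m + 1) → ℕ} {s : Fin (m + 1) → S} {I : Ideal S} {c : S}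
    (hc : c ∈ I * weightedIdeal a r s) : ∃ Ψ : MvPolynomial (Fin (m + 1)) S,
      IsWeightedHomogeneous a Ψ r ∧ (∀ b, Ψ.coeff b ∈ I) ∧ eval s Ψ = c := by
  have key : ∀ y ∈ weightedIdeal a r s, ∃ Ψ : MvPolynomial (Fin (m + 1)) S,
      IsWeightedHomogeneous a Ψ r ∧ eval s Ψ = y := by
    intro y hy
    induction hy using Submodule.span_induction with
    | mem y hy =>
      obtain ⟨b, hb, rfl⟩ := hy
      refine ⟨monomial (Finsupp.equivFunOnFinite.symm b) 1, isWeightedHomogeneous_monomial _ _ _ ?_,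
        ?_⟩
      · rw [← hb, Finsupp.weight_apply, Finsupp.sum_fintype _ _ (by simp)]
        exact Finset.sum_congr rfl fun i _ => by simp [mul_comm]
      · rw [eval_monomial, one_mul, Finsupp.prod_fintype _ _ (by simp)]
        rfl
    | zero => exact ⟨0, isWeightedHomogeneous_zero _ _ _, map_zero _⟩
    | add y y' _ _ hy hy' =>
      obtain ⟨Ψ, h1, rfl⟩ := hy
      obtain ⟨Ψ', h1', rfl⟩ := hy'
      exact ⟨Ψ + Ψ', h1.add h1', map_add _ _ _⟩
    | smul e y _ hy =>
      obtain ⟨Ψ, h1, rfl⟩ := hy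
      exact ⟨C e * Ψ, h1.C_mul e, by rw [map_mul, eval_C, smul_eq_mul]⟩
  induction hc using Submodule.mul_induction_on' with
  | mem_mul_mem e he y hy =>
    obtain ⟨Ψ, h1, rfl⟩ := key y hy
    exact ⟨C e * Ψ, h1.C_mul e, fun b => by rw [coeff_C_mul]; exact Ideal.mul_mem_right _ _ he,
      by rw [map_mul, eval_C]⟩
  | add y _ y' _ hy hy' =>
    obtain ⟨Ψ, h1, h2, rfl⟩ := hy
    obtain ⟨Ψ', h1', h2', rfl⟩ := hy'
    exact ⟨Ψ + Ψ', h1.add h1', fun b => by rw [coeff_add]; exact add_mem (h2 b) (h2' b),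
      map_add _ _ _⟩

variable {X : Scheme.{u}}

theorem IsLocalChart.exists_lift {x : X} {A : Type u} [CommRing A] [IsNoetherianRing A]
    {j : Spec (.of A) ⟶ X} {γ : A →+* X.presheaf.stalk x} (h : IsLocalChart x j γ) {ι : Type*}
    [Finite ι] (s : ι → X.presheaf.stalk x) :
    ∃ (A' : Type u) (_ : CommRing A') (_ : IsNoetherianRing A') (j' : Spec (.of A') ⟶ X)
      (γ' : A' →+* X.presheaf.stalk x), IsLocalChart x j' γ' ∧ ∃ y : ι → A', ∀ i, γ' (y i) = s i := by
  obtain ⟨g, hg, y, hy⟩ := h.isLocalization.exists_forall_mul_eq s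
  refine ⟨Localization.Away g, inferInstance,
    IsLocalization.isNoetherianRing (Submonoid.powers g) _ inferInstance, _, _, h.away hg,
    fun i => algebraMap _ _ (y i) * IsLocalization.Away.invSelf g, fun i => ?_⟩
  have h1 := congrArg (IsLocalization.Away.lift g hg : Localization.Away g →+* _)
    (IsLocalization.Away.mul_invSelf (S := Localization.Away g) g)
  rw [map_mul, map_one, IsLocalization.Away.lift_eq] at h1
  rw [map_mul, IsLocalization.Away.lift_eq, ← hy, mul_assoc, h1, mul_one]

theorem exists_map_eq_of_isWeightedHomogeneous {A S : Type*} [CommRing A] [CommRing S] {σ : Type*}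
    {w : σ → ℕ} {r : ℕ} {Ψ : MvPolynomial σ S} (hΨ : IsWeightedHomogeneous w Ψ r) {γ : A →+* S}
    (y : Ψ.support → A) (hy : ∀ b, γ (y b) = Ψ.coeff b.1) :
    ∃ Φ : MvPolynomial σ A, IsWeightedHomogeneous w Φ r ∧ map γ Φ = Ψ := by
  refine ⟨∑ b, monomial b.1 (y b), IsWeightedHomogeneous.sum _ _ _ fun b _ =>
    isWeightedHomogeneous_monomial _ _ _ (hΨ (mem_support_iff.mp b.2)), ?_⟩
  rw [map_sum]
  conv_rhs => rw [as_sum Ψ, ← Finset.sum_coe_sort]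
  exact Finset.sum_congr rfl fun b _ => by rw [map_monomial, hy]

/-- On a smaller chart, a system of parameters generates the prime of `x`, and an equation between
germs holds for functions. -/
theorem IsLocalChart.exists_equation {R : Type u} [CommRing R] {f : X ⟶ Spec (.of R)} {t : R}
    {x : X} {A : Type u} [CommRing A] [IsNoetherianRing A] {j : Spec (.of A) ⟶ X}
    {γ : A →+* X.presheaf.stalk x} (h : IsLocalChart x j γ) {m r : ℕ} {a : Fin m → ℕ}
    {y : Fin m → A} {Φ : MvPolynomial (Fin m) A} (hΦ : IsWeightedHomogeneous a Φ r)
    (hy : Ideal.span (Set.range fun i => γ (y i)) = IsLocalRing.maximalIdeal _)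
    (ht : eval (fun i => γ (y i)) (map γ Φ) = pullbackGerm f x t)
    (ht2 : pullbackGerm f x t ∈ IsLocalRing.maximalIdeal (X.presheaf.stalk x) ^ 2) :
    ∃ (A' : Type u) (_ : CommRing A') (_ : IsNoetherianRing A') (j' : Spec (.of A') ⟶ X)
      (γ' : A' →+* X.presheaf.stalk x) (ψ : R →+* A') (y' : Fin m → A')
      (Φ' : MvPolynomial (Fin m) A'), IsLocalChart x j' γ' ∧
      j' ≫ f = Spec.map (CommRingCat.ofHom ψ) ∧ IsWeightedHomogeneous a Φ' r ∧
      (∀ i, γ' (y' i) = γ (y i)) ∧ map γ' Φ' = map γ Φ ∧ eval y' Φ' = ψ t ∧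
      (IsLocalRing.maximalIdeal _).comap γ' = Ideal.span (Set.range y') ∧
      ψ t ∈ (IsLocalRing.maximalIdeal _).comap γ' ^ 2 := by
  obtain ⟨ψ, hψ⟩ := Spec.map_surjective (j ≫ f)
  have hj : j ≫ f = Spec.map (CommRingCat.ofHom ψ.hom) := hψ.symm
  have hγψ := h.pullbackGerm_eq hj t
  have hmap : (Ideal.span (Set.range y)).map γ = IsLocalRing.maximalIdeal _ := by
    rw [Ideal.map_span, ← Set.range_comp', hy]
  -- Three denominators are inverted: `g₁` so that `y` generates the prime of `x`, `g₂` so that the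
  -- equation holds between functions, and `g₃` so that `t` lies in the square of that prime.
  obtain ⟨g₁, hg₁, h₁⟩ := h.isLocalization.exists_forall_mul_mem
    (J := (IsLocalRing.maximalIdeal _).comap γ) (K := Ideal.span (Set.range y)) (by
      rw [h.isLocalization.map_comap, hmap])
  obtain ⟨g₂, hg₂, h₂⟩ := h.isLocalization.exists_mul_eq_zero (y := eval y Φ - ψ.hom t) (by
    rw [map_sub, ← hγψ, ← ht, eval_map_comp, sub_self])
  obtain ⟨g₃, hg₃, h₃⟩ := h.isLocalization.exists_mul_mem (y := ψ.hom t)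
    (J := (IsLocalRing.maximalIdeal _).comap γ ^ 2) (by
      rwa [Ideal.map_pow, h.isLocalization.map_comap, ← hγψ])
  let g := g₁ * g₂ * g₃
  have hg : IsUnit (γ g) := by
    rw [map_mul, map_mul]
    exact (hg₁.mul hg₂).mul hg₃
  let α : A →+* Localization.Away g := algebraMap _ _
  let γ' : Localization.Away g →+* X.presheaf.stalk x := IsLocalization.Away.lift g hg
  have hγ' (b : A) : γ' (α b) = γ b := IsLocalization.Away.lift_eq g hg b
  have hgu : IsUnit (α g) := IsLocalization.Away.algebraMap_isUnit g
  have hu₁ : IsUnit (α g₁) := by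
    rw [map_mul, map_mul] at hgu
    exact isUnit_of_mul_isUnit_left (isUnit_of_mul_isUnit_left hgu)
  have hu₂ : IsUnit (α g₂) := by
    rw [map_mul, map_mul] at hgu
    exact isUnit_of_mul_isUnit_right (isUnit_of_mul_isUnit_left hgu)
  have hu₃ : IsUnit (α g₃) := by
    rw [map_mul] at hgu
    exact isUnit_of_mul_isUnit_right hgu
  have hle : ((IsLocalRing.maximalIdeal _).comap γ).map α ≤
      (IsLocalRing.maximalIdeal _).comap γ' := by
    rw [Ideal.map_le_iff_le_comap]
    intro b hb
    rw [Ideal.mem_comap, Ideal.mem_comap, hγ']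
    exact hb
  refine ⟨Localization.Away g, inferInstance,
    IsLocalization.isNoetherianRing (Submonoid.powers g) _ inferInstance, _, γ', α.comp ψ.hom,
    fun i => α (y i), map α Φ, h.away hg, ?_, isWeightedHomogeneous_map α hΦ, fun i => hγ' _, ?_, ?_,
    ?_, ?_⟩
  · rw [Category.assoc, hj, ← Spec.map_comp]
    rfl
  · rw [map_map]
    have h7 : γ'.comp α = γ := RingHom.ext hγ'
    rw [h7]
  · have h4 := congrArg α h₂
    rw [map_mul, map_zero, hu₂.mul_right_eq_zero, map_sub, sub_eq_zero] at h4
    rw [RingHom.comp_apply, ← h4, eval_map_comp]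
  · apply le_antisymm
    · intro b hb
      obtain ⟨⟨c, v⟩, hc⟩ := IsLocalization.surj (Submonoid.powers g) b
      have hcm : c ∈ (IsLocalRing.maximalIdeal _).comap γ := by
        rw [Ideal.mem_comap, ← hγ']
        change γ' (algebraMap A _ c) ∈ _
        rw [← hc, map_mul]
        exact Ideal.mul_mem_right _ _ hb
      have h5 := Ideal.mem_map_of_mem α (h₁ c hcm)
      rw [map_mul, Ideal.unit_mul_mem_iff_mem _ hu₁, Ideal.map_span, ← Set.range_comp'] at h5
      refine (Ideal.mul_unit_mem_iff_mem _ (IsLocalization.map_units _ v)).mp ?_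
      rw [hc]
      exact h5
    · rw [Ideal.span_le]
      rintro _ ⟨i, rfl⟩
      rw [SetLike.mem_coe, Ideal.mem_comap, hγ', ← hy]
      exact Ideal.subset_span ⟨i, rfl⟩
  · refine Ideal.pow_right_mono hle 2 ?_
    rw [← Ideal.map_pow]
    have h6 := Ideal.mem_map_of_mem α h₃
    rwa [map_mul, Ideal.unit_mul_mem_iff_mem _ hu₃] at h6

end LocalEquation

/-! ### The equation of the singularity on an affine chart -/

section SingularityChart

open MvPolynomial

/-- The two kinds of base enter the argument only through these common properties. -/
theorem IsParameterRing.isPrincipalIdealRing {k R : Type u} [Field k] [CommRing R] [Algebra k R]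
    {t : R} (h : IsParameterRing k R t) :
    ∃ _ : IsDomain R, IsPrincipalIdealRing R ∧ Irreducible t := by
  rcases h with ⟨e, he⟩ | ⟨_, h1, -, h3⟩
  · have : IsDomain R := e.toMulEquiv.isDomain _
    refine ⟨this, IsPrincipalIdealRing.of_surjective e.symm.toRingEquiv.toRingHom e.symm.surjective,
      ?_⟩
    rw [← MulEquiv.irreducible_iff e, he]
    exact Polynomial.irreducible_X
  · exact ⟨‹_›, inferInstance, h3⟩

theorem natCast_ne_zero_of_coprime_ringExpChar {k : Type*} [Field k] {r : ℕ} (hr : 0 < r)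
    (h : Nat.Coprime r (ringExpChar k)) : (r : k) ≠ 0 := by
  intro h0
  replace h0 := (ringChar.spec k r).mp h0
  have h1 := Nat.dvd_gcd h0 (dvd_refl _)
  rcases (CharP.char_is_prime_or_zero k (ringChar k)) with hp | hp
  · rw [ringExpChar, max_eq_left hp.one_lt.le] at h
    rw [h.gcd_eq_one] at h1
    exact hp.one_lt.ne' (Nat.dvd_one.mp h1)
  · rw [hp, zero_dvd_iff] at h0
    exact hr.ne' h0

/-- Quasi-regularity concerns membership of coefficients in `(y)`. As `(y)` is the preimage of the
maximal ideal, it can be tested in the local ring, although `y` is not assumed to be a regular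
sequence on the chart. -/
theorem isQuasiRegular_of_isRegularParameters {A S : Type*} [CommRing A] [CommRing S]
    [IsLocalRing S] [IsNoetherianRing S] {γ : A →+* S} {m : ℕ} {a : Fin m → ℕ}
    (ha : ∀ i, 0 < a i) {y : Fin m → A}
    (hy : (IsLocalRing.maximalIdeal S).comap γ = Ideal.span (Set.range y))
    (h : RingTheory.Sequence.IsRegular S (List.ofFn fun i => γ (y i))) : IsQuasiRegular a y := by
  have hmem (i) : γ (y i) ∈ IsLocalRing.maximalIdeal S := by
    have : y i ∈ (IsLocalRing.maximalIdeal S).comap γ := hy ▸ Ideal.subset_span ⟨i, rfl⟩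
    exact this
  have hS := isQuasiRegular_of_isWeaklyRegular ha hmem h.toIsWeaklyRegular
  intro j p hp hpy b hb
  rw [← hy, Ideal.mem_comap, ← coeff_map]
  refine (Ideal.span_le.mpr ?_) (hS j (map γ p) (hp.map _) ?_ b hb)
  · rintro _ ⟨i, rfl⟩
    exact hmem i
  · rw [eval_map_comp, hpy, map_zero]

variable {k : Type u} [Field k] {R : Type u} [CommRing R] [Algebra k R] {t : R}
  {X : Scheme.{u}} {f : X ⟶ Spec (.of R)} {n r : ℕ} {a : Fin (n + 1) → ℕ}
  {F : MvPolynomial (Fin (n + 1)) k} {o : specialFiber f t}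

/-- The quasi-homogeneous equation of a singularity on an affine chart. -/
theorem IsQuasiHomogeneousSingularity.exists_chart [IsNoetherianRing R] (hf : IsRegularFamily f)
    (ht : IsSMulRegular R t) (ho : IsQuasiHomogeneousSingularity f t a r F o) :
    ∃ (A : Type u) (_ : CommRing A) (_ : IsNoetherianRing A) (j : Spec (.of A) ⟶ X)
      (γ : A →+* X.presheaf.stalk (specialFiberι f t o)) (ψ : R →+* A) (y : Fin (n + 1) → A)
      (Φ : MvPolynomial (Fin (n + 1)) A), IsLocalChart (specialFiberι f t o) j γ ∧
      j ≫ f = Spec.map (CommRingCat.ofHom ψ) ∧ IsWeightedHomogeneous a Φ r ∧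
      map ((X.residue (specialFiberι f t o)).hom.comp γ) Φ =
        map (residueStructure f k (specialFiberι f t o)) F ∧ eval y Φ = ψ t ∧
      RingHom.ker ((X.residue (specialFiberι f t o)).hom.comp γ) = Ideal.span (Set.range y) ∧
      ψ t ∈ (IsLocalRing.maximalIdeal _).comap γ ^ 2 ∧ IsQuasiRegular a y := by
  have := hf.locallyOfFiniteType
  have : IsLocallyNoetherian X := LocallyOfFiniteType.isLocallyNoetherian f
  let x := specialFiberι f t o
  obtain ⟨s, c, hs, hc, hst⟩ := ho.equation
  obtain ⟨Ψ, hΨ, hΨm, rfl⟩ := exists_isWeightedHomogeneous_eval_eq hc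
  -- `Ψ` represents the error term with coefficients in the maximal ideal, so `Φ₀` still reduces to
  -- `F` over the residue field.
  let Φ₀ : MvPolynomial (Fin (n + 1)) (X.presheaf.stalk x) := map (stalkStructure f k x) F + Ψ
  have hΦ₀ : IsWeightedHomogeneous a Φ₀ r :=
    (isWeightedHomogeneous_map _ ho.admissible.homogeneous).add hΨ
  have hΦ₀s : eval s Φ₀ = pullbackGerm f x t := by
    rw [map_add, MvPolynomial.eval_map]
    exact hst.symm
  have hΦ₀F : map (X.residue x).hom Φ₀ = map (residueStructure f k x) F := by
    rw [map_add, map_map, residueStructure, add_eq_left]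
    ext b
    rw [coeff_map, coeff_zero]
    exact (IsLocalRing.residue_eq_zero_iff _).mpr (hΨm b)
  obtain ⟨U, j₀, γ₀, h₀⟩ := exists_isLocalChart x
  have : IsNoetherianRing Γ(X, U) := IsLocallyNoetherian.component_noetherian U
  -- The chart is shrunk so that the parameters and the finitely many coefficients of `Φ₀` lift
  -- simultaneously.
  obtain ⟨A₁, _, _, j₁, γ₁, h₁, v, hv⟩ := h₀.exists_lift
    (Sum.elim s fun b : Φ₀.support => Φ₀.coeff b.1)
  obtain ⟨Φ₁, hΦ₁, hΦ₁'⟩ := exists_map_eq_of_isWeightedHomogeneous hΦ₀ (γ := γ₁)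
    (fun b => v (Sum.inr b)) fun b => hv (Sum.inr b)
  have hv' : (fun i => γ₁ (v (Sum.inl i))) = s := funext fun i => hv (Sum.inl i)
  obtain ⟨A, _, hA, j, γ, ψ, y, Φ, h, hj, hΦ, hy, hΦΦ, hev, hker, hsq⟩ :=
    h₁.exists_equation (f := f) (t := t) (y := fun i => v (Sum.inl i)) hΦ₁ (by rw [hv', hs.1])
    (by rw [hv', hΦ₁', hΦ₀s]) ((isSingularPoint_iff hf ht o).mp ho.singular)
  have hys : (fun i => γ (y i)) = s := by
    rw [← hv']
    exact funext hy
  refine ⟨A, _, hA, j, γ, ψ, y, Φ, h, hj, hΦ, ?_, hev, ?_, hsq, ?_⟩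
  · rw [← map_map, hΦΦ, hΦ₁', hΦ₀F]
  · rw [← hker, ← RingHom.comap_ker]
    congr 1
    exact IsLocalRing.ker_residue
  · exact isQuasiRegular_of_isRegularParameters ho.admissible.weight_pos hker (hys ▸ hs.2)

/-- A closed point has the residue field of the affine chart. -/
theorem IsLocalChart.residue_surjective {x : X} (hx : IsClosed {x}) {A : Type u} [CommRing A]
    {j : Spec (.of A) ⟶ X} {γ : A →+* X.presheaf.stalk x} (h : IsLocalChart x j γ) :
    Function.Surjective ((X.residue x).hom.comp γ) := by
  have := h.isOpenImmersion
  let p : PrimeSpectrum A := PrimeSpectrum.comap γ (IsLocalRing.closedPoint _)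
  have hp : p.asIdeal.IsMaximal := by
    rw [← PrimeSpectrum.isClosed_singleton_iff_isMaximal]
    have h1 : ({p} : Set (PrimeSpectrum A)) = j ⁻¹' {x} := by
      refine Set.Subset.antisymm ?_ fun q hq =>
        j.isOpenEmbedding.injective (Eq.trans hq h.apply_comap.symm)
      rintro _ rfl
      exact h.apply_comap
    rw [h1]
    exact hx.preimage j.continuous
  intro e
  obtain ⟨s, rfl⟩ := IsLocalRing.residue_surjective e
  obtain ⟨b, c, hc, hb⟩ := h.isLocalization.exists_mul_eq s
  have hcp : c ∉ p.asIdeal := fun hcp => hcp hc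
  obtain ⟨d, i, hi, hd⟩ := hp.exists_inv hcp
  have h2 : IsLocalRing.residue _ (γ i) = 0 := (IsLocalRing.residue_eq_zero_iff _).mpr hi
  have h3 := congrArg (fun a => IsLocalRing.residue _ (γ a)) hd
  simp only [map_add, map_mul, map_one, h2, add_zero] at h3
  refine ⟨b * d, ?_⟩
  change IsLocalRing.residue _ (γ (b * d)) = _
  rw [map_mul, ← hb, map_mul, map_mul, mul_assoc, mul_comm (IsLocalRing.residue _ (γ c)), h3,
    mul_one]

end SingularityChart

/-! ### The centre of the blowup and its complement in `X_r` -/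

section Main

open MvPolynomial

theorem mem_nonvanishing_iff {A : Type u} [CommRing A] {N : ℕ} {z : Fin N → A}
    (p : Spec (.of A)) : p ∈ nonvanishing z ↔ ¬ Ideal.span (Set.range z) ≤ p.asIdeal := by
  rw [Ideal.span_le, Set.range_subset_iff, not_forall]
  exact TopologicalSpace.Opens.mem_iSup

theorem IsInitialSystem.le_asIdeal_exceptionalι {A κ : Type u} [CommRing A] [Field κ] {m r : ℕ}
    {a : Fin m → ℕ} {x : Fin m → A} {τ : A} {ρ : A →+* κ} {F : MvPolynomial (Fin m) κ}
    (h : IsInitialSystem (Fin.snoc a 1 : Fin (m + 1) → ℕ) (Fin.snoc x τ : Fin (m + 1) → A) ρ r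
      (suspend r F)) (hF : IsWeightedHomogeneous a F r) (z) :
    RingHom.ker ρ ≤ (projToSpec A (reesGrading _ _) (h.exceptionalι hF z)).asIdeal := by
  rw [← Scheme.Hom.comp_apply, h.exceptionalι_comp, Scheme.Hom.comp_apply]
  exact Ideal.comap_mono (f := ρ) bot_le

theorem IsInitialSystem.le_asIdeal_exceptionalSectionι {A κ : Type u} [CommRing A] [Field κ]
    {m r : ℕ} {a : Fin m → ℕ} {x : Fin m → A} {τ : A} {ρ : A →+* κ} {F : MvPolynomial (Fin m) κ}
    (h : IsInitialSystem (Fin.snoc a 1 : Fin (m + 1) → ℕ) (Fin.snoc x τ : Fin (m + 1) → A) ρ r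
      (suspend r F)) (hF : IsWeightedHomogeneous a F r) (hr : 0 < r) (z) :
    RingHom.ker ρ ≤ (projToSpec A (reesGrading _ _) (h.exceptionalSectionι hF hr z)).asIdeal := by
  rw [← Scheme.Hom.comp_apply, h.exceptionalSectionι_comp, Scheme.Hom.comp_apply]
  exact Ideal.comap_mono (f := ρ) bot_le

variable {R : Type u} [CommRing R] {t : R} {X : Scheme.{u}} {f : X ⟶ Spec (.of R)} {r : ℕ}

/-- The family `X_r` away from the points over a closed point `x`. -/
theorem snc_rootFamily_compl [IsNoetherianRing R] (hf : IsRegularFamily f)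
    (ht : IsSMulRegular R t) (hr : 0 < r) (hr' : IsUnit (r : R)) {V : (rootFamily f t r).Opens}
    {U : X.Opens} (hV : ∀ v ∈ V, rootFamilyToSource f t r v ∈ U)
    (h : ∀ z : specialFiber f t, specialFiberι f t z ∈ U → ¬ IsSingularPoint z) :
    IsRegularScheme V.toScheme ∧ ∀ v : V.toScheme,
      pullbackGerm (V.ι ≫ rootFamilyMap f t r) v (rootParam t r) ∈
        IsLocalRing.maximalIdeal (V.toScheme.presheaf.stalk v) →
      ∃ (d : ℕ) (x : Fin d → V.toScheme.presheaf.stalk v) (J : Finset (Fin d)),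
        IsRegularParameters x ∧
        Ideal.span {pullbackGerm (V.ι ≫ rootFamilyMap f t r) v (rootParam t r)} =
          Ideal.span {∏ l ∈ J, x l} := by
  have key (v : V.toScheme) := exists_isRegularParameters_rootFamily hf ht hr hr' h (V.ι v)
    (hV _ v.2)
  refine ⟨fun v => ?_, fun v hv => ?_⟩
  · have := (key v).1
    exact IsRegularLocalRing.of_ringEquiv (asIso (V.ι.stalkMap v)).commRingCatIsoToRingEquiv
  · let e := (asIso (V.ι.stalkMap v)).commRingCatIsoToRingEquiv
    have he : e (pullbackGerm (rootFamilyMap f t r) (V.ι v) (rootParam t r)) =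
        pullbackGerm (V.ι ≫ rootFamilyMap f t r) v (rootParam t r) := stalkMap_pullbackGerm _ _ _ _
    rw [← he] at hv ⊢
    refine exists_isRegularParameters_of_ringEquiv e.symm ?_
    rw [e.symm_apply_apply]
    exact (key v).2 fun hu => hv (hu.map e)

section Chart

variable {x : X} {κ A : Type u} [Field κ] [CommRing A] {j : Spec (.of A) ⟶ X} {ψ : R →+* A}
  {ρ₀ : A →+* κ} (hρ₀ : Function.Surjective ρ₀)
  (hx : ∀ q : PrimeSpectrum A, j q = x ↔ q.asIdeal = RingHom.ker ρ₀) (hr : 0 < r)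
  (ht : ρ₀ (ψ t) = 0) {l : Spec (.of (RootRing (ψ t) r)) ⟶ rootFamily f t r}
  (hl : IsPullback (Spec.map (CommRingCat.ofHom (AdjoinRoot.of _))) l j (rootFamilyToSource f t r))

include hρ₀ hx hl in
theorem rootFamilyToSource_eq_iff (q : PrimeSpectrum (RootRing (ψ t) r)) :
    rootFamilyToSource f t r (l q) = x ↔ RingHom.ker (rootRingLift hr ρ₀ ht) ≤ q.asIdeal := by
  have h1 (w) : rootFamilyToSource f t r (l w) = j (Spec.map (CommRingCat.ofHom
      (AdjoinRoot.of _)) w) := by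
    rw [← Scheme.Hom.comp_apply, ← Scheme.Hom.comp_apply, hl.w]
  have h2 : rootFamilyToSource f t r (l q) = x ↔
      (q.comap (AdjoinRoot.of _)).asIdeal = RingHom.ker ρ₀ := by
    rw [← hx]
    exact (h1 q).congr_left
  have hmax : (RingHom.ker ρ₀).IsMaximal := RingHom.ker_isMaximal_of_surjective ρ₀ hρ₀
  rw [h2, ker_rootRingLift, sup_le_iff, Ideal.map_le_iff_le_comap,
    Ideal.span_singleton_le_iff_mem]
  constructor
  · intro h
    refine ⟨h.ge, q.isPrime.mem_of_pow_mem r ?_⟩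
    rw [rootParam_pow]
    exact h.ge ht
  · rintro ⟨h, -⟩
    exact (hmax.eq_of_le (q.comap (AdjoinRoot.of _)).isPrime.ne_top h).symm

end Chart

end Main

end QuasiHom

end

/-! ### Semistable reduction -/

theorem mainTheorem8 {k : Type u} [Field k] (hk : ringChar k ≠ 2)
    {R : Type u} [CommRing R] [Algebra k R] (t : R) (hR : QuasiHom.IsParameterRing k R t)
    {X : Scheme.{u}} (f : X ⟶ Spec (.of R)) (hf : QuasiHom.IsRegularFamily f)
    (hqp : QuasiHom.IsQuasiProjective f)
    {n r : ℕ} (a : Fin (n + 1) → ℕ) (F : MvPolynomial (Fin (n + 1)) k)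
    (o : QuasiHom.specialFiber f t)
    (ho : QuasiHom.IsQuasiHomogeneousSingularity f t a r F o)
    (hsingle : ∀ q : QuasiHom.specialFiber f t, QuasiHom.IsSingularPoint q → q = o) :
    ∃ (Y : Scheme.{u}) (π : Y ⟶ QuasiHom.rootFamily f t r),
      QuasiHom.IsSemistableReduction f t r π ∧
      ∃ D D' : Y.IdealSheafData,
        (QuasiHom.specialFiberι (π ≫ QuasiHom.rootFamilyMap f t r)
          (QuasiHom.rootParam t r)).ker = D ⊓ D' ∧
        (∃ e : D.subscheme ≅ QuasiHom.Hypersurface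
            (QuasiHom.isWeightedHomogeneous_suspend (QuasiHom.isWeightedHomogeneous_map
              (QuasiHom.residueStructure f k (QuasiHom.specialFiberι f t o))
              ho.admissible.homogeneous)),
          e.hom ≫ QuasiHom.Hypersurface.toSpec _ ≫
              X.fromSpecResidueField (QuasiHom.specialFiberι f t o) =
            D.subschemeι ≫ π ≫ QuasiHom.rootFamilyToSource f t r) ∧
        (∃ e : (D ⊔ D').subscheme ≅ QuasiHom.Hypersurface
            (QuasiHom.isWeightedHomogeneous_map
              (QuasiHom.residueStructure f k (QuasiHom.specialFiberι f t o))
              ho.admissible.homogeneous),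
          e.hom ≫ QuasiHom.Hypersurface.toSpec _ ≫
              X.fromSpecResidueField (QuasiHom.specialFiberι f t o) =
            (D ⊔ D').subschemeι ≫ π ≫ QuasiHom.rootFamilyToSource f t r) := by
  obtain ⟨_, _, hirr⟩ := hR.isPrincipalIdealRing
  have hmax : (Ideal.span {t}).IsMaximal := PrincipalIdealRing.isMaximal_of_irreducible hirr
  have ht : IsSMulRegular R t := QuasiHom.isSMulRegular_of_ne_zero hirr.ne_zero
  have hr := ho.admissible.degree_pos
  have hrk := QuasiHom.natCast_ne_zero_of_coprime_ringExpChar hr ho.admissible.coprime_char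
  have hrR : IsUnit (r : R) := by
    have := (isUnit_iff_ne_zero.mpr hrk).map (algebraMap k R)
    rwa [map_natCast] at this
  have := hf.flat
  have := hf.locallyOfFiniteType
  have := hf.quasiCompact
  let x := QuasiHom.specialFiberι f t o
  obtain ⟨A, _, _, j, γ, ψ, y, Φ, hγ, hj, hΦ, hΦF, hev, hker, hsq, hy⟩ := ho.exists_chart hf ht
  have hjo := hγ.isOpenImmersion
  have hx : IsClosed {x} := QuasiHom.isClosed_singleton_of_isSingularPoint hmax hf ht
    hsingle hγ hj hsq
  let ρ₀ : A →+* X.residueField x := (X.residue x).hom.comp γ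
  have hρ₀ : Function.Surjective ρ₀ := hγ.residue_surjective hx
  have hxq : ∀ q : PrimeSpectrum A, j q = x ↔ q.asIdeal = RingHom.ker ρ₀ := by
    intro q
    have h1 : j (PrimeSpectrum.comap γ (IsLocalRing.closedPoint _)) = x := hγ.apply_comap
    have h2 : (PrimeSpectrum.comap γ (IsLocalRing.closedPoint _)).asIdeal = RingHom.ker ρ₀ := by
      rw [← RingHom.comap_ker]
      exact congrArg (Ideal.comap γ) IsLocalRing.ker_residue.symm
    refine ⟨fun h => ?_, fun h => (congrArg j (PrimeSpectrum.ext (h.trans h2.symm))).trans h1⟩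
    have h3 : q = PrimeSpectrum.comap γ (IsLocalRing.closedPoint _) :=
      j.isOpenEmbedding.injective (h.trans h1.symm)
    rw [← h2, h3]
  have ht0 : ρ₀ (ψ t) = 0 :=
    (IsLocalRing.residue_eq_zero_iff _).mpr
      (Ideal.mem_comap.mp (Ideal.pow_le_self two_ne_zero hsq))
  obtain ⟨l, hl, hlf⟩ := QuasiHom.exists_isPullback_rootFamily f t hj r
  have hlo : IsOpenImmersion l := MorphismProperty.of_isPullback hl inferInstance
  let ρ := QuasiHom.rootRingLift hr ρ₀ ht0
  have hlq := QuasiHom.rootFamilyToSource_eq_iff hρ₀ hxq hr ht0 hl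
  -- `V` is `X_r` without the fibre over `o`. On the chart `l` this fibre is the zero locus of the
  -- maximal ideal `ker ρ`, generated by `z` and `τ`, so there `V` is where the blowup is an
  -- isomorphism.
  let V : (QuasiHom.rootFamily f t r).Opens :=
    QuasiHom.rootFamilyToSource f t r ⁻¹ᵁ ⟨{x}ᶜ, hx.isOpen_compl⟩
  obtain ⟨hVreg, hVsnc⟩ := QuasiHom.snc_rootFamily_compl hf ht hr hrR (V := V)
    (U := ⟨{x}ᶜ, hx.isOpen_compl⟩) (fun v hv => hv) fun z hz hz' => hz (by rw [hsingle z hz']; rfl)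
  let _ : Algebra k (X.residueField x) := (QuasiHom.residueStructure f k x).toAlgebra
  let τ := QuasiHom.rootParam (ψ t) r
  let z : Fin (n + 1) → QuasiHom.RootRing (ψ t) r := fun i => AdjoinRoot.mk _ (Polynomial.C (y i))
  -- The root ring of the chart is the quotient of `A[X]` by `X ^ r - Φ(y)`, since `Φ(y) = ψ t`, and
  -- `Φ` reduces to `F` over the residue field.
  have hsys : QuasiHom.IsInitialSystem (Fin.snoc a 1 : Fin (n + 1 + 1) → ℕ)
      (Fin.snoc z τ : Fin (n + 1 + 1) → QuasiHom.RootRing (ψ t) r) ρ r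
      (QuasiHom.suspend r (MvPolynomial.map (algebraMap k (X.residueField x)) F)) := by
    have h1 := QuasiHom.isInitialSystem_suspend ho.admissible.weight_pos hr hy hΦ hρ₀ hker
      (π := AdjoinRoot.mk (Polynomial.X ^ r - Polynomial.C (ψ t))) AdjoinRoot.mk_surjective
      (by rw [hev]; exact Ideal.mk_ker) (ρ := ρ) (fun b => QuasiHom.rootRingLift_of hr ht0 b)
      (QuasiHom.rootRingLift_root hr ht0)
    rw [hΦF] at h1
    exact h1
  have hFκ := QuasiHom.isWeightedHomogeneous_map (algebraMap k (X.residueField x))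
    ho.admissible.homogeneous
  let p := QuasiHom.projToSpec (QuasiHom.RootRing (ψ t) r) (QuasiHom.reesGrading
    (Fin.snoc a 1 : Fin (n + 1 + 1) → ℕ) (Fin.snoc z τ : Fin (n + 1 + 1) → QuasiHom.RootRing (ψ t) r))
  have hpp : IsProper p := QuasiHom.isProper_projToSpec_rees _ _
  have hVl : l ⁻¹ᵁ V.ι.opensRange = QuasiHom.nonvanishing
      (Fin.snoc z τ : Fin (n + 1 + 1) → QuasiHom.RootRing (ψ t) r) := by
    ext q
    rw [Scheme.Opens.opensRange_ι]
    refine Iff.trans ?_ (QuasiHom.mem_nonvanishing_iff q).symm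
    rw [← hsys.ker_eq]
    exact not_congr (hlq q)
  have hlV (v : QuasiHom.rootFamily f t r) (hv : v ∉ V) :
      ∃ q : PrimeSpectrum (QuasiHom.RootRing (ψ t) r), RingHom.ker ρ ≤ q.asIdeal ∧ l q = v := by
    have hvx : QuasiHom.rootFamilyToSource f t r v = x := not_not.mp hv
    obtain ⟨w, -, hw⟩ := Scheme.Pullback.exists_preimage_pullback (f := j)
      (g := QuasiHom.rootFamilyToSource f t r) (PrimeSpectrum.comap γ (IsLocalRing.closedPoint _)) v
      (hγ.apply_comap.trans hvx.symm)
    have h1 : l (hl.isoPullback.inv w) = v := by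
      rw [← Scheme.Hom.comp_apply, hl.isoPullback_inv_snd, hw]
    exact ⟨hl.isoPullback.inv w, (hlq _).mp (by rw [h1, hvx]), h1⟩
  have hpV : IsIso (p ∣_ (l ⁻¹ᵁ V.ι.opensRange)) := by
    rw [hVl]
    exact QuasiHom.isIso_projToSpec_rees hsys.weight_pos
  have := hsys.isClosedImmersion_exceptionalι hFκ
  have := hsys.isClosedImmersion_exceptionalSectionι hFκ hr
  have hlft : LocallyOfFiniteType (QuasiHom.rootFamilyMap f t r) :=
    MorphismProperty.of_isPullback (IsPullback.of_hasPullback f (QuasiHom.rootCover t r))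
      hf.locallyOfFiniteType
  have hqc : QuasiCompact (QuasiHom.rootFamilyMap f t r) :=
    MorphismProperty.of_isPullback (IsPullback.of_hasPullback f (QuasiHom.rootCover t r))
      hf.quasiCompact
  have hfl : Flat (QuasiHom.rootFamilyMap f t r) :=
    MorphismProperty.of_isPullback (IsPullback.of_hasPullback f (QuasiHom.rootCover t r))
      hf.flat
  have hB : IsNoetherianRing (QuasiHom.RootRing t r) := inferInstance
  have hcover : l.opensRange ⊔ V.ι.opensRange = ⊤ := by
    refine eq_top_iff.mpr fun v _ => ?_
    by_cases hv : v ∈ V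
    · exact Or.inr ((Scheme.Opens.opensRange_ι V).ge hv)
    · obtain ⟨q, -, hq⟩ := hlV v hv
      exact Or.inl ⟨q, hq⟩
  have hI (q : PrimeSpectrum (QuasiHom.RootRing (ψ t) r)) :
      l q ∈ V.ι.opensRange ↔ ¬ RingHom.ker ρ ≤ q.asIdeal := by
    rw [Scheme.Opens.opensRange_ι]
    exact not_congr (hlq q)
  have hrκ : (r : X.residueField x) ≠ 0 := by
    rw [← map_natCast (algebraMap k (X.residueField x)) r]
    exact (map_ne_zero _).mpr hrk
  obtain ⟨Y, π, hπ, hπV, hss, D, D', hDD', ⟨e, he⟩, ⟨e', he'⟩⟩ :=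
    QuasiHom.exists_semistable_of_glued (QuasiHom.isMaximal_span_rootParam hr hmax)
    (QuasiHom.isSMulRegular_rootParam hr ht) (QuasiHom.rootFamilyMap f t r) l V.ι hlf hcover
    (I := RingHom.ker ρ) hI inferInstance hVreg hVsnc p hpV (hsys.exceptionalι hFκ)
    (hsys.exceptionalSectionι hFκ hr) (hsys.le_asIdeal_exceptionalι hFκ)
    (hsys.le_asIdeal_exceptionalSectionι hFκ hr) (fun w hw => by
      rw [QuasiHom.rootRingMap_root]
      exact hsys.hasExceptionalChart ho.admissible.homogeneous ho.admissible.smooth hr hrκ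
        ho.admissible.ne_zero ho.admissible.weight_pos ho.admissible.coprime ho.admissible.vertex
        w hw)
  -- The centre maps to `X` by the canonical morphism from the spectrum of the residue field of `o`,
  -- which gives the two compatibilities over `X`.
  have hcomp : Spec.map (CommRingCat.ofHom ρ) ≫ l ≫ QuasiHom.rootFamilyToSource f t r =
      X.fromSpecResidueField x := by
    have h1 : (RingHom.comp ρ (AdjoinRoot.of _)) = ρ₀ :=
      RingHom.ext fun b => QuasiHom.rootRingLift_of hr ht0 b
    rw [← hl.w, ← Spec.map_comp_assoc, ← CommRingCat.ofHom_comp, h1, Scheme.fromSpecResidueField,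
      ← hγ.comp, ← Spec.map_comp_assoc]
    rfl
  refine ⟨Y, π, ⟨hπ, hπV _ ?_, hss⟩, D, D', hDD', ⟨e, ?_⟩, ⟨e', ?_⟩⟩
  -- The parameter `t^{1/r}` maps to zero under `ρ`, hence vanishes at every point over `o`; the
  -- locus where it does not vanish therefore lies in `V`.
  · intro v hv
    rw [Scheme.Opens.opensRange_ι]
    by_contra hvV
    obtain ⟨q, hq, rfl⟩ := hlV v hvV
    have h1 (w) : QuasiHom.rootFamilyMap f t r (l w) =
        Spec.map (CommRingCat.ofHom (QuasiHom.rootRingMap ψ t r)) w := by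
      rw [← Scheme.Hom.comp_apply, hlf]
    refine hv ((congrArg PrimeSpectrum.asIdeal (h1 q)).ge (hq ?_))
    rw [RingHom.mem_ker]
    exact (congrArg ρ (QuasiHom.rootRingMap_root ψ t r)).trans
      (QuasiHom.rootRingLift_root hr ht0)
  · rw [← Category.assoc D.subschemeι, ← he, ← hcomp]
    simp only [Category.assoc]
    rw [← Category.assoc (hsys.exceptionalι hFκ), hsys.exceptionalι_comp, Category.assoc]
  · rw [← Category.assoc (D ⊔ D').subschemeι, ← he', ← hcomp]
    simp only [Category.assoc]
    rw [← Category.assoc (hsys.exceptionalSectionι hFκ hr), hsys.exceptionalSectionι_comp,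
      Category.assoc]
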